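/- **Setting.** Let $F(x,y;t)$ be a real analytic germ at $0\in\mathbb R^3$ with $F(0,0;t)\equiv 0$; put $f_t(x,y):=F(x,y;t)$, $f:=f_0$, and assume that $f$ is mini-regular in $x$, i.e. the order of $f(x,0)$ at $x=0$ equals the multiplicity of $f$ at $0$. *Arcs.* $\mathbb R_*$ is the set of arcs at $0\in\mathbb R^2$ lying in $y>0$ or in $y<0$ and not tangent to the $x$-axis, i.e. given by a convergent series $x=\lambda(y)=\sum_{j\ge d}a_j|y|^{j/d}$, $a_j\in\mathbb R$. The contact order $\mathcal O(\lambda,\zeta)$ of two distinct arcs (at $0$ in $\mathbb R^2$ or $\mathbb C^2$) is the $h$ in $\mathrm{dist}(P,\zeta)=a\,|P|^h+\cdots$, $a>0$, $P\in\lambda$; $\mathcal O(\lambda,\lambda)=\infty$. For $g=f_t$, the height $h_g(\lambda)$ is the largest contact order of $\lambda$ with a (real-analytically parametrized) arc at $0\in\mathbb C^2$ on which the complexification of $g$ vanishes. *$g$-arcs and bars.* $\lambda\sim_g\mu$ iff $\lambda=\mu$ or $h_g(\lambda)=h_g(\mu)<\mathcal O(\lambda,\mu)$; the class $\lambda_g$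 is a $g$-arc. Two $g$-arcs $\lambda_g,\mu_g$ in the same half plane are bar equivalent iff they are equal or $h_g(\lambda)=h_g(\mu)=\mathcal O(\lambda,\mu)$; the class of $\lambda_g$ is the bar $B(\lambda_g)$, of height $h(B)=h_g(\lambda)$. Its canonical representation $\lambda_B(y)$ is $\lambda(y)$ with all terms $|y|^e$, $e\ge h(B)$, deleted. If $h(B)<\infty$, every member of $B$ has the form $\lambda_B(y)+u|y|^{h(B)}+\cdots$, and there are a polynomial $I^B_g$ and an exponent $e$ with $g(\lambda_B(y)+u|y|^{h(B)}+\cdots,y)=I_g^B(u)|y|^{e}+\cdots$, $I_g^B(u)\ne0$, for all members of $B$. The multiplicity $m(B)$ is $\deg I^B_g$ if $h(B)<\infty$, and is the multiplicity of $\lambda$ as a root of $g$ if $h(B)=\infty$ (then $B=\{\lambda\}$). $B$ is polar if $h(B)<\infty$ and $I^B_g$ has at least two distinct complex roots, or $h(B)=\infty$ and $m(B)\ge2$. For bars, $\mathcal O(B,B)=\infty$ and $\mathcal O(B,B')=\mathcal O(\lambda,\lambda')$ for any $\lambda\in B$, $\lambda'\in B'$ if $B\ne B'$. *Relative Newton polygon.*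 $\mathbb P(g,\lambda)$ is the Newton polygon of $g(X+\lambda(Y),Y)=\sum a_{ij}X^i|Y|^{j/d}$, i.e. of the dots $(i,j/d)$ with $a_{ij}\neq0$. *Deformations.* A continuous (resp. analytic) deformation of an $f$-arc $\lambda_f$ over an interval around $0$ is the family of $f_t$-arcs of $x=\lambda_t(y)=\sum_{j\ge d}a_j(t)|y|^{j/d}$, with $d$ and the half plane independent of $t$, the series convergent for each $t$, all $a_j(t)$ continuous (resp. real analytic) in $t$, and $\lambda_0\in\lambda_f$; it is denoted $\lambda_{f_t}$. A continuous deformation of a bar $B$ of $f$ is $B_t=B(\lambda_{f_t})$ for a continuous deformation of some $\lambda_f\in B$. **Fundamental Lemma.** Suppose that each polar bar $B$ of $f$ admits a continuous deformation $B_t$ (over some interval around $0$) such that $h(B_t)$ and $m(B_t)$ are independent of $t$. Then there is $\delta>0$ such that the following hold. 1. Each $f$-arc $\lambda_f$ with $\lambda\in\mathbb R_*$ admits an analytic deformation $\lambda_{f_t}$, $|t|<\delta$, with $\mathbb P(f_t,\lambda_{f_t})=\mathbb P(f,\lambda_f)$ for all $t$. 2. For every such deformation, put $B_t=B(\lambda_{f_t})$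 and $B_0=B(\lambda_f)$. Then $x=\lambda_{B_t}(y)$ is an analytic deformation of the canonical representation $x=\lambda_{B_0}(y)$ (fixed denominator of the exponents, coefficients analytic in $t$), and $B_t$ and $\lambda_{B_t}$ are unique: if $\eta_f\in B(\lambda_f)$, $0<\delta'\le\delta$, and $\eta_{f_t}$, $|t|<\delta'$, is a continuous deformation of $\eta_f$ with $\mathbb P(f_t,\eta_{f_t})=\mathbb P(f,\lambda_f)$ for all $t$, then $B(\eta_{f_t})=B(\lambda_{f_t})$, with the same canonical representation, for all $|t|<\delta'$. 3. If $B_t$ and $B'_t$ are the deformations, as in 2, of two bars $B$ and $B'$ of $f$, then $\mathcal O(B_t,B'_t)=\mathcal O(B,B')$ for all $|t|<\delta$. -/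

import Mathlib

open Filter Topology Set
open scoped NNReal ENNReal Polynomial

noncomputable section

/-- An arc at `0` in the real plane, in the open half plane `y > 0` (`sgn = 1`) or `y < 0`
(`sgn = -1`) and not tangent to the `x`-axis, given by its convergent fractional power series
`x = ∑ coeff j * |y| ^ (j / d)`, all exponents being at least `1`.
The same arc has several presentations (replace `d` by a multiple). -/
structure RArc where
  sgn : ℤˣ
  d : ℕ
  d_pos : 0 < d
  coeff : ℕ → ℝ
  coeff_eq_zero : ∀ j, j < d → coeff j = 0
  convergent : ∃ r : ℝ, 0 < r ∧ Summable fun j => |coeff j| * r ^ j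

namespace RArc

/-- The parametrization `s ↦ (x s, y s)`, `0 ≤ s`, with `|y| = s ^ d`. -/
def x (γ : RArc) (s : ℝ) : ℝ := ∑' j, γ.coeff j * s ^ j

def y (γ : RArc) (s : ℝ) : ℝ := ((γ.sgn : ℤ) : ℝ) * s ^ γ.d

/-- The parametrized arc, seen in `ℂ × ℂ`. -/
def toComplex (γ : RArc) (s : ℝ) : ℂ × ℂ := ((γ.x s : ℂ), (γ.y s : ℂ))

/-- The coefficient of `|y| ^ e` in the fractional power series of the arc. -/
def coeffAt (γ : RArc) (e : ℝ) : ℝ :=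
  if ((⌊e * γ.d⌋₊ : ℕ) : ℝ) = e * γ.d then γ.coeff ⌊e * γ.d⌋₊ else 0

/-- Two presentations of the same fractional power series in the same half plane. -/
def SameSeries (γ μ : RArc) : Prop := γ.sgn = μ.sgn ∧ ∀ e : ℝ, γ.coeffAt e = μ.coeffAt e

/-- The arc whose series is that of `γ` with all terms `|y| ^ e`, `e ≥ h`, deleted. -/
def truncate (γ : RArc) (h : ℝ≥0∞) : RArc where
  sgn := γ.sgn
  d := γ.d
  d_pos := γ.d_pos
  coeff := fun j => if ENNReal.ofReal ((j : ℝ) / γ.d) < h then γ.coeff j else 0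
  coeff_eq_zero := by
    intro j hj
    simp [γ.coeff_eq_zero j hj]
  convergent := by
    obtain ⟨r, hr, hs⟩ := γ.convergent
    refine ⟨r, hr, Summable.of_nonneg_of_le (fun j => by positivity) (fun j => ?_) hs⟩
    split_ifs
    · exact le_rfl
    · simp only [abs_zero, zero_mul]
      positivity

end RArc

/-- A parametrized arc at `0` in `ℂ × ℂ`: (the restriction to `s ≥ 0` of) a real analytic germ,
vanishing at `0` but not identically. -/
def IsParamArc (ζ : ℝ → ℂ × ℂ) : Prop :=
  AnalyticAt ℝ ζ 0 ∧ ζ 0 = 0 ∧ ¬ ∀ᶠ s in 𝓝[>] (0 : ℝ), ζ s = 0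

/-- The contact order of two parametrized arcs: the exponent `h` in
`dist (P, w) = a * |P| ^ h + ⋯`, `a > 0`, for `P` on `v` (and `∞` if the loci agree), written as
the supremum of all `h` with `dist (P, w) = O (|P| ^ h)`. -/
def contactOrder (v w : ℝ → ℂ × ℂ) : ℝ≥0∞ :=
  ⨆ (h : ℝ≥0) (_ : ∀ ε > (0 : ℝ), (fun s => Metric.infDist (v s) (w '' Ico 0 ε))
    =O[𝓝[>] (0 : ℝ)] fun s => ‖v s‖ ^ (h : ℝ)), (h : ℝ≥0∞)

/-- Contact order of two real arcs. -/
def RArc.contact (γ μ : RArc) : ℝ≥0∞ := contactOrder γ.toComplex μ.toComplex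

/-- `g` is (a representative of) the complexification of the germ of `f` at `0`. -/
def IsComplexification (f : ℝ × ℝ → ℝ) (g : ℂ × ℂ → ℂ) : Prop :=
  AnalyticAt ℂ g 0 ∧ ∀ᶠ p : ℝ × ℝ in 𝓝 0, g ((p.1 : ℂ), (p.2 : ℂ)) = ((f p : ℝ) : ℂ)

/-- The complex arcs at `0` along which the complexification of `f` vanishes. -/
def complexZeroArcs (f : ℝ × ℝ → ℝ) : Set (ℝ → ℂ × ℂ) :=
  {ζ | IsParamArc ζ ∧ ∃ g, IsComplexification f g ∧ ∀ᶠ s in 𝓝[>] (0 : ℝ), g (ζ s) = 0}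

/-- The `f`-height of an arc: its largest contact order with a complex zero arc of `f`. -/
def fHeight (f : ℝ × ℝ → ℝ) (γ : RArc) : ℝ≥0∞ :=
  ⨆ ζ ∈ complexZeroArcs f, contactOrder γ.toComplex ζ

/-- The `f`-arc of `γ`: all arcs of the same `f`-height `h` whose contact order with `γ` exceeds
`h`; if `h = ∞` the class consists of `γ` alone (contact order `∞` means equal loci). -/
def fArc (f : ℝ × ℝ → ℝ) (γ : RArc) : Set RArc :=
  {μ | fHeight f γ = fHeight f μ ∧ (fHeight f γ < γ.contact μ ∨ γ.contact μ = ⊤)}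

/-- The `f`-bar containing the `f`-arc of `γ` (as the union of its `f`-arcs). -/
def bar (f : ℝ × ℝ → ℝ) (γ : RArc) : Set RArc :=
  {μ | γ.sgn = μ.sgn ∧
    (μ ∈ fArc f γ ∨ (fHeight f γ = fHeight f μ ∧ fHeight f γ = γ.contact μ))}

/-- The canonical representation of the bar of `γ`. -/
def canonicalRep (f : ℝ × ℝ → ℝ) (γ : RArc) : RArc := γ.truncate (fHeight f γ)

/-- The canonical coordinate of (the `f`-arc of) `γ` in its bar, when the height is finite. -/
def canonicalCoord (f : ℝ × ℝ → ℝ) (γ : RArc) : ℝ := γ.coeffAt (fHeight f γ).toReal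

/-- `P` is the polynomial `I` and `e` the Lojasiewicz exponent of `f` on the bar of `γ`:
for every `μ` in the bar, with canonical coordinate `u`,
`f (μ (y), y) = P (u) * |y| ^ e + ⋯` and `P (u) ≠ 0`. -/
def HasInitialForm (f : ℝ × ℝ → ℝ) (γ : RArc) (P : ℝ[X]) (e : ℝ) : Prop :=
  ∀ μ ∈ bar f γ, P.eval (canonicalCoord f μ) ≠ 0 ∧
    Tendsto (fun s => f (μ.x s, μ.y s) / |μ.y s| ^ e) (𝓝[>] (0 : ℝ))
      (𝓝 (P.eval (canonicalCoord f μ)))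

/-- The `i`-th partial derivative of `f` in `x` vanishes along `γ`. -/
def XDerivVanishes (f : ℝ × ℝ → ℝ) (γ : RArc) (i : ℕ) : Prop :=
  ∀ᶠ s in 𝓝[>] (0 : ℝ), iteratedDeriv i (fun x => f (x, γ.y s)) (γ.x s) = 0

/-- The bar of `γ` has multiplicity `n`: the degree of its polynomial if the height is finite, and
the multiplicity of `γ` as a root of `f` if the bar is the singleton of `γ` (height `∞`). -/
def HasBarMult (f : ℝ × ℝ → ℝ) (γ : RArc) (n : ℕ) : Prop :=
  (fHeight f γ < ⊤ ∧ ∃ P e, HasInitialForm f γ P e ∧ P.natDegree = n) ∨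
  (fHeight f γ = ⊤ ∧ (∀ i < n, XDerivVanishes f γ i) ∧ ¬ XDerivVanishes f γ n)

/-- The bar of `γ` is polar. -/
def IsPolar (f : ℝ × ℝ → ℝ) (γ : RArc) : Prop :=
  (fHeight f γ < ⊤ ∧ ∃ P e, HasInitialForm f γ P e ∧
    ∃ z w : ℂ, z ≠ w ∧ Polynomial.aeval z P = 0 ∧ Polynomial.aeval w P = 0) ∨
  (fHeight f γ = ⊤ ∧ ∃ n, 2 ≤ n ∧ HasBarMult f γ n)

open Classical in
/-- The contact order of two bars: `∞` if they are equal, otherwise the contact order of an arc in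
the one with an arc in the other (which does not depend on the choice of the two arcs). -/
def barContact (B B' : Set RArc) : ℝ≥0∞ :=
  if B = B' then ⊤ else ⨆ γ ∈ B, ⨆ μ ∈ B', γ.contact μ

/-- The coefficient of `X ^ i * Y ^ (j / d)` in `f (X + γ (Y), Y)`, where `Y ^ (1 / d) = s`
(with `|Y|` in place of `Y` in the lower half plane). -/
def relCoeff (f : ℝ × ℝ → ℝ) (γ : RArc) (i j : ℕ) : ℝ :=
  iteratedDeriv j (fun s => iteratedDeriv i (fun X => f (X + γ.x s, γ.y s)) 0) 0 /
    ((i.factorial : ℝ) * (j.factorial : ℝ))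

/-- The Newton polygon of `f` relative to `γ`: the convex region spanned by the quadrants at the
dots `(i, j / d)` with nonzero coefficient (its boundary consists of the Newton edges). -/
def relNewtonPolygon (f : ℝ × ℝ → ℝ) (γ : RArc) : Set (ℝ × ℝ) :=
  convexHull ℝ {p | ∃ i j : ℕ, relCoeff f γ i j ≠ 0 ∧ (i : ℝ) ≤ p.1 ∧ (j : ℝ) / γ.d ≤ p.2}

/-- `f` is mini-regular in `x`: for some `m`, the multiplicity of `f` at `0` and the order of
`f (x, 0)` at `x = 0` are both `m`. -/
def MiniRegular (f : ℝ × ℝ → ℝ) : Prop :=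
  ∃ m : ℕ, (∀ k < m, iteratedFDeriv ℝ k f 0 = 0) ∧ iteratedDeriv m (fun x => f (x, 0)) 0 ≠ 0

/-- `f_t (x, y) = F (x, y; t)`. -/
def slice (F : ℝ × ℝ × ℝ → ℝ) (t : ℝ) : ℝ × ℝ → ℝ := fun p => F (p.1, p.2, t)

/-- A family of arcs `x = ∑ a_j (t) * |y| ^ (j / d)`, `|t| < δ`, with `d` and the half plane fixed
and all coefficients continuous in `t`. -/
def IsContFamily (δ : ℝ) (Γ : ℝ → RArc) : Prop :=
  (∀ t ∈ Ioo (-δ) δ, (Γ t).sgn = (Γ 0).sgn ∧ (Γ t).d = (Γ 0).d) ∧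
    ∀ j, ContinuousOn (fun t => (Γ t).coeff j) (Ioo (-δ) δ)

/-- The same with all coefficients real analytic in `t`. -/
def IsAnalyticFamily (δ : ℝ) (Γ : ℝ → RArc) : Prop :=
  (∀ t ∈ Ioo (-δ) δ, (Γ t).sgn = (Γ 0).sgn ∧ (Γ t).d = (Γ 0).d) ∧
    ∀ j, AnalyticOnNhd ℝ (fun t => (Γ t).coeff j) (Ioo (-δ) δ)

/-- `Γ` defines a continuous deformation (for `|t| < δ`) of the `f_0`-arc of `γ` into
`f_t`-arcs. -/
def IsContDeformation (F : ℝ × ℝ × ℝ → ℝ) (δ : ℝ) (γ : RArc) (Γ : ℝ → RArc) : Prop :=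
  IsContFamily δ Γ ∧ Γ 0 ∈ fArc (slice F 0) γ

/-- `Γ` defines an analytic deformation (for `|t| < δ`) of the `f_0`-arc of `γ` into
`f_t`-arcs. -/
def IsAnalyticDeformation (F : ℝ × ℝ × ℝ → ℝ) (δ : ℝ) (γ : RArc) (Γ : ℝ → RArc) : Prop :=
  IsAnalyticFamily δ Γ ∧ Γ 0 ∈ fArc (slice F 0) γ

/-- The Newton polygon of `f_t` relative to `Γ t` is that of `f_0` relative to `γ`,
for all `|t| < δ`. -/
def KeepsPolygon (F : ℝ × ℝ × ℝ → ℝ) (δ : ℝ) (γ : RArc) (Γ : ℝ → RArc) : Prop :=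
  ∀ t ∈ Ioo (-δ) δ, relNewtonPolygon (slice F t) (Γ t) = relNewtonPolygon (slice F 0) γ

/-- The bar of `γ` admits a continuous deformation (over some interval around `0`) along which
height and multiplicity are constant. -/
def HasStableBarDeformation (F : ℝ × ℝ × ℝ → ℝ) (γ : RArc) : Prop :=
  ∃ δ > (0 : ℝ), ∃ μ ∈ bar (slice F 0) γ, ∃ Γ : ℝ → RArc, IsContDeformation F δ μ Γ ∧
    (∀ t ∈ Ioo (-δ) δ, fHeight (slice F t) (Γ t) = fHeight (slice F 0) γ) ∧
    ∃ n : ℕ, ∀ t ∈ Ioo (-δ) δ, HasBarMult (slice F t) (Γ t) n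

end

/-!
The proof works with orders of vanishing on horns. For an arc `x = γ (y)` the germ `f` is
`O (|y| ^ e)` on all horns `|x - γ (y)| ≤ K * |y| ^ h` for certain pairs `(h, e)` (`RelBound`), and
these pairs determine both invariants of the statement. The optimal `e` is, as a function of `h`,
the support function of the relative Newton polygon (`relNewtonPolygon_eq_iff`). The exponents `h`
beyond which it stops growing are called stable, and the height is their infimum
(`RegularX.le_fHeight_iff`): a complex zero closer to the arc than a stable exponent contradicts the
expansion of the complexification along the arc (`heightGE_of_near`), and at an exponent which is
not stable a Newton step and a Puiseux parametrization produce a zero (`exists_zeroArc`). Contact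
orders of arcs in one half plane are orders of differences of fractional power series. So the
theorem becomes one about bounds of real analytic functions and needs no complex arcs any more.

The deformation is resolved by charts `x = Λ (σ, t) + v * σ ^ A`, `|y| = σ ^ D` (`Chart`), in which
`F` is `σ ^ C * G (v, σ, t)` with `G` of order `p` in `v`. The centre `Λ` is a root of the derivative
of order `p - 1`, so that the Taylor expansion of `G` in `v` has no term of degree `p - 1`. The first
chart is given by mini-regularity (`exists_chart`). At `t = 0` there are two cases
(`Chart.dichotomy`).

* The Taylor coefficients below degree `p` vanish along the centre. If `p ≥ 2`, the centre is a
  polar bar of infinite height, and the stability of its multiplicity keeps the root multiple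
  (`Chart.eventually_zero_of_root`). Every arc is deformed by moving it along with the centre.
* The coefficients have a first Newton edge, seen from the dot `(p, 0)`. Since the term of degree
  `p - 1` is missing, the edge polynomial has two distinct roots (`exists_two_roots`), so an arc on
  the edge that avoids the real roots is polar. The stable deformation of its bar has an initial form
  of the same degree `p` at the same exponent, and the normalization forces it to stay at the centre;
  hence the edge persists for small `t` (`Chart.isBigO_of_edge`). At every real root of the edge
  polynomial at `t = 0` there is a new chart, whose multiplicity is smaller than `p`
  (`Chart.exists_child`).

By induction on `p`, the deformation is equisingular in every chart (`Chart.equisingularOn`): every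
arc of the chart is in an analytic family with constant orders on horns, and the contact order of
two deformed arcs is constant as far as it is below their heights. In the second case, an arc that
does not run into a root of the edge is moved with the centre, or with a root near its limit; an arc
that does is deformed in the chart at the root (`EdgeTracking.exists_family`). For the contact
orders, the weighted limit of the coordinate of a deformed arc of large height is a continuous
function of `t` whose values are roots of the edge polynomials. These roots stay in disjoint
intervals, so by connectedness the arc follows one root (`EdgeTracking.exists_tendsto_root`). Arcs at
different roots have the contact order of the edge, and arcs at the same root are compared in the
chart there.

A constant relative Newton polygon makes the height constant. Therefore the contact order of two
deformed arcs, cut off at their heights, is constant (`ofReal_le_contact_iff`). This gives the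
uniqueness of the deformed bars and of their canonical representations
(`mem_bar_deformation_iff`), as well as the constancy of the contact orders of bars.
-/

noncomputable section

open Asymptotics
open Real (norm_of_nonneg rpow_natCast rpow_pos_of_pos rpow_mul rpow_nonneg norm_eq_abs rpow_sub
  rpow_le_rpow_of_exponent_ge rpow_add rpow_zero rpow_one rpow_le_rpow mul_rpow)
open Finset (sum_congr sum_eq_zero mem_filter sum_range_succ)
open Polynomial (taylor taylor_eval mem_roots aeval finsetSum_coeff taylor_eq_zero monomial
  coeff_add natDegree_taylor eval_finsetSum coeff_monomial rootMultiplicity_pos coeff_C_mul_X_pow)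
open Complex (norm_real ofReal_zero)
open Metric (infDist_nonneg infDist ball)

attribute [fun_prop] analyticAt_fst analyticAt_snd

/-! ### Filters within a set -/

section Within

variable {X Y : Type*} [TopologicalSpace X] {a : X} {s : Set X}

theorem Filter.Eventually.within {p : X → Prop} (h : ∀ᶠ x in 𝓝 a, p x) : ∀ᶠ x in 𝓝[s] a, p x :=
  h.filter_mono nhdsWithin_le_nhds

theorem Filter.Tendsto.within {f : X → Y} {l : Filter Y} (h : Tendsto f (𝓝 a) l) :
    Tendsto f (𝓝[s] a) l := h.mono_left nhdsWithin_le_nhds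

theorem Filter.Tendsto.of_within {f : Y → X} {l : Filter Y} (h : Tendsto f l (𝓝[s] a)) :
    Tendsto f l (𝓝 a) := h.mono_right nhdsWithin_le_nhds

theorem eventually_lt_one_right : ∀ᶠ y : ℝ in 𝓝[>] 0, y < 1 :=
  nhdsWithin_le_nhds (gt_mem_nhds one_pos)

end Within

/-! ### Division and Taylor expansion of analytic functions with parameters -/

section Analytic

variable {𝕜 : Type*} [RCLike 𝕜] {E : Type*} [NormedAddCommGroup E] [NormedSpace 𝕜 E]

theorem MultilinearMap.map_const_sub_map_const {V W : Type*} [AddCommGroup V] [Module 𝕜 V]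
    [AddCommGroup W] [Module 𝕜 W] {n : ℕ} (m : MultilinearMap 𝕜 (fun _ : Fin (n + 1) => V) W)
    (v w : V) :
    m (fun _ => v) - m (fun _ => w) = ∑ k : Fin (n + 1), m (Fin.insertNth k (v - w)
        (fun j : Fin n => if j.castSucc < k then v else w)) := by
  have key : ∀ k : Fin (n + 1), m (Fin.insertNth k (v - w)
        (fun j : Fin n => if j.castSucc < k then v else w)) =
      m (fun i => if i.1 < k.1 + 1 then v else w) - m (fun i => if i.1 < k.1 then v else w) := by
    intro k
    have h1 : ∀ x : V, (Fin.insertNth k x (fun j : Fin n => if j.castSucc < k then v else w) :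
        Fin (n + 1) → V) = Function.update (fun i => if i.1 < k.1 then v else w) k x := by
      intro x
      ext i
      refine Fin.succAboveCases k ?_ (fun j => ?_) i
      · simp
      · have hne : k.succAbove j ≠ k := Fin.succAbove_ne k j
        simp only [Fin.insertNth_apply_succAbove, Function.update_of_ne hne]
        by_cases h : j.castSucc < k
        · rw [Fin.succAbove_of_castSucc_lt _ _ h]
          have h' : j.1 < k.1 := h
          simp [h, h']
        · rw [Fin.succAbove_of_le_castSucc _ _ (not_lt.1 h)]
          have h' : k.1 ≤ j.1 := not_lt.1 h
          have : ¬ (j.succ.1 < k.1) := by simp; omega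
          simp only [h, if_false, this]
    rw [h1, MultilinearMap.map_update_sub]
    congr 2
    · ext i
      by_cases hi : i = k
      · subst hi; simp
      · rw [Function.update_of_ne hi]
        have : i.1 ≠ k.1 := fun h => hi (Fin.ext h)
        by_cases h : i.1 < k.1
        · have : i.1 < k.1 + 1 := by omega
          simp [h, this]
        · have : ¬ i.1 < k.1 + 1 := by omega
          simp [h, this]
    · ext i
      by_cases hi : i = k
      · subst hi; simp
      · rw [Function.update_of_ne hi]
  rw [sum_congr rfl (fun k _ => key k)]
  rw [Fin.sum_univ_eq_sum_range (fun k => m (fun i => if i.1 < k + 1 then v else w) -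
    m (fun i => if i.1 < k then v else w)), Finset.sum_range_sub
    (fun k => m (fun i => if i.1 < k then v else w))]
  have h1 : (fun i : Fin (n + 1) => if i.1 < n + 1 then v else w) = fun _ => v := by
    ext i; simp [i.2]
  simp only [h1, Nat.not_lt_zero, if_false]

/-- The projection of `𝕜 × E` to `{0} × E`. -/
def zeroSnd (𝕜 E : Type*) [RCLike 𝕜] [NormedAddCommGroup E] [NormedSpace 𝕜 E] : 𝕜 × E →L[𝕜] 𝕜 × E :=
  (ContinuousLinearMap.inr 𝕜 𝕜 E).comp (ContinuousLinearMap.snd 𝕜 𝕜 E)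

theorem norm_zeroSnd_le : ‖zeroSnd 𝕜 E‖ ≤ 1 := by
  refine ContinuousLinearMap.opNorm_le_bound _ zero_le_one (fun x => ?_)
  simp [zeroSnd, Prod.norm_def]

/-- The power series of the quotient of `f - f ∘ (zero first coordinate)` by the first
coordinate, in terms of that of `f`. -/
def divSeries (p : FormalMultilinearSeries 𝕜 (𝕜 × E) 𝕜) :
    FormalMultilinearSeries 𝕜 (𝕜 × E) 𝕜 := fun n =>
  ∑ k : Fin (n + 1), ((p (n + 1)).curryMid k (1, 0)).compContinuousLinearMap
    (fun j : Fin n => if j.castSucc < k then ContinuousLinearMap.id 𝕜 (𝕜 × E) else zeroSnd 𝕜 E)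

theorem divSeries_apply (p : FormalMultilinearSeries 𝕜 (𝕜 × E) 𝕜) (n : ℕ) (v : 𝕜 × E) :
    v.1 * divSeries p n (fun _ => v) =
      p (n + 1) (fun _ => v) - p (n + 1) (fun _ => zeroSnd 𝕜 E v) := by
  have h := MultilinearMap.map_const_sub_map_const (p (n + 1)).toMultilinearMap v (zeroSnd 𝕜 E v)
  simp only [ContinuousMultilinearMap.coe_coe] at h
  rw [h, divSeries, sum_apply, Finset.mul_sum]
  refine sum_congr rfl (fun k _ => ?_)
  have hv : v - zeroSnd 𝕜 E v = v.1 • ((1, 0) : 𝕜 × E) := by ext <;> simp [zeroSnd]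
  rw [ContinuousMultilinearMap.compContinuousLinearMap_apply,
    ContinuousMultilinearMap.curryMid_apply, hv, ← smul_eq_mul]
  rw [← ContinuousMultilinearMap.curryMid_apply, ← ContinuousMultilinearMap.curryMid_apply,
    map_smul, smul_apply]
  congr 3
  ext j : 1
  split_ifs <;> rfl

theorem norm_divSeries_le (p : FormalMultilinearSeries 𝕜 (𝕜 × E) 𝕜) (n : ℕ) :
    ‖divSeries p n‖ ≤ (n + 1) * ‖p (n + 1)‖ := by
  refine (norm_sum_le _ _).trans ?_
  have : ∀ k ∈ (Finset.univ : Finset (Fin (n + 1))),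
      ‖((p (n + 1)).curryMid k (1, 0)).compContinuousLinearMap
    (fun j : Fin n => if j.castSucc < k then ContinuousLinearMap.id 𝕜 (𝕜 × E)
      else zeroSnd 𝕜 E)‖ ≤ ‖p (n + 1)‖ := by
    intro k _
    refine (ContinuousMultilinearMap.norm_compContinuousLinearMap_le _ _).trans ?_
    have h1 : ‖(p (n + 1)).curryMid k (1, 0)‖ ≤ ‖p (n + 1)‖ := by
      refine (ContinuousLinearMap.le_opNorm _ _).trans ?_
      rw [ContinuousMultilinearMap.norm_curryMid]
      simp [Prod.norm_def]
    have h2 : ∏ j : Fin n, ‖(if j.castSucc < k then ContinuousLinearMap.id 𝕜 (𝕜 × E)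
      else zeroSnd 𝕜 E)‖ ≤ 1 := by
      refine Finset.prod_le_one (fun _ _ => norm_nonneg _) (fun j _ => ?_)
      split_ifs
      · exact ContinuousLinearMap.norm_id_le
      · exact norm_zeroSnd_le
    calc _ ≤ ‖p (n + 1)‖ * 1 := by gcongr
      _ = _ := mul_one _
  refine (Finset.sum_le_sum this).trans ?_
  simp

theorem divSeries_radius_pos (p : FormalMultilinearSeries 𝕜 (𝕜 × E) 𝕜) (hp : 0 < p.radius) :
    0 < (divSeries p).radius := by
  obtain ⟨C, r, hC, hr, h⟩ := p.le_mul_pow_of_radius_pos hp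
  have h2 : (0 : ℝ) < 1 / (2 * r) := by positivity
  refine lt_of_lt_of_le ?_ ((divSeries p).le_radius_of_bound (C * r)
    (r := (1 / (2 * r)).toNNReal) (fun n => ?_))
  · rw [ENNReal.coe_pos]; exact Real.toNNReal_pos.2 h2
  · rw [Real.coe_toNNReal _ h2.le]
    have h1 := norm_divSeries_le p n
    have h3 := h (n + 1)
    have h4 : ((n : ℝ) + 1) ≤ 2 ^ n := mod_cast Nat.lt_two_pow_self (n := n)
    calc ‖divSeries p n‖ * (1 / (2 * r)) ^ n
        ≤ ((n + 1) * (C * r ^ (n + 1))) * (1 / (2 * r)) ^ n := by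
          gcongr
          exact h1.trans (by gcongr)
      _ ≤ (2 ^ n * (C * r ^ (n + 1))) * (1 / (2 * r)) ^ n := by gcongr
      _ = C * r := by
          rw [div_pow, mul_pow, one_pow, pow_succ]
          field_simp

/-- An analytic function vanishing with the first coordinate is divisible by it. -/
theorem AnalyticAt.exists_eq_fst_mul {f : 𝕜 × E → 𝕜} {x₀ : E} (hf : AnalyticAt 𝕜 f (0, x₀))
    (h0 : ∀ᶠ x in 𝓝 x₀, f (0, x) = 0) :
    ∃ g : 𝕜 × E → 𝕜, AnalyticAt 𝕜 g (0, x₀) ∧ ∀ᶠ z in 𝓝 ((0 : 𝕜), x₀), f z = z.1 * g z := by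
  obtain ⟨p, hp⟩ := hf
  have hrad := divSeries_radius_pos p hp.radius_pos
  have hq := (divSeries p).hasFPowerSeriesOnBall hrad
  refine ⟨fun z => (divSeries p).sum (z - (0, x₀)), ?_, ?_⟩
  · have : AnalyticAt 𝕜 (divSeries p).sum ((0, x₀) - (0, x₀)) := by
      rw [sub_self]; exact hq.analyticAt
    exact this.comp (f := fun z : 𝕜 × E => z - (0, x₀)) (by fun_prop)
  · have e1 : ∀ᶠ v in 𝓝 (0 : 𝕜 × E), HasSum (fun n => p n fun _ => v) (f ((0, x₀) + v)) :=
      hp.eventually_hasSum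
    have hz : Tendsto (fun v : 𝕜 × E => zeroSnd 𝕜 E v) (𝓝 0) (𝓝 0) := by
      have := (zeroSnd 𝕜 E).continuous.tendsto 0
      rwa [map_zero] at this
    have e2 := hz.eventually e1
    have e3 : ∀ᶠ v in 𝓝 (0 : 𝕜 × E), HasSum (fun n => divSeries p n fun _ => v)
        ((divSeries p).sum v) := by
      have := hq.hasFPowerSeriesAt.eventually_hasSum
      simpa using this
    have e4 : ∀ᶠ v in 𝓝 (0 : 𝕜 × E), f ((0, x₀) + zeroSnd 𝕜 E v) = 0 := by
      have : Tendsto (fun v : 𝕜 × E => x₀ + v.2) (𝓝 0) (𝓝 x₀) := by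
        have : Continuous (fun v : 𝕜 × E => x₀ + v.2) := by fun_prop
        simpa using this.tendsto 0
      filter_upwards [this.eventually h0] with v hv
      simpa [zeroSnd] using hv
    have main : ∀ᶠ v in 𝓝 (0 : 𝕜 × E), f ((0, x₀) + v) = v.1 * (divSeries p).sum v := by
      filter_upwards [e1, e2, e3, e4] with v h1 h2 h3 h4
      rw [h4] at h2
      have h5 := h1.sub h2
      rw [sub_zero] at h5
      have h6 : HasSum (fun n => v.1 * divSeries p n fun _ => v) (v.1 * (divSeries p).sum v) :=
        h3.mul_left _
      simp only [divSeries_apply] at h6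
      rw [hasSum_nat_add_iff' 1 |>.symm] at h5
      simp only [Finset.range_one, Finset.sum_singleton] at h5
      have h7 : p 0 (fun _ => v) = p 0 (fun _ => zeroSnd 𝕜 E v) := by
        congr 1; exact funext fun i => i.elim0
      rw [h7, sub_self, sub_zero] at h5
      exact h5.unique h6
    have hs : Tendsto (fun z : 𝕜 × E => z - (0, x₀)) (𝓝 (0, x₀)) (𝓝 0) := by
      have : Continuous (fun z : 𝕜 × E => z - (0, x₀)) := by fun_prop
      simpa using this.tendsto (0, x₀)
    filter_upwards [hs.eventually main] with z hz
    simpa using hz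

end Analytic

section Analytic

variable {𝕜 : Type*} [RCLike 𝕜] {E : Type*} [NormedAddCommGroup E] [NormedSpace 𝕜 E]

/-- `R` is a sequence of Taylor remainders of `G` in the first variable, at `(0, x₀)`: the Taylor
coefficients are `R n (0, x)`, and `G (v, x) = ∑ i < n, v ^ i * R i (0, x) + v ^ n * R n (v, x)`. -/
structure IsTaylorSeq (G : 𝕜 × E → 𝕜) (x₀ : E) (R : ℕ → 𝕜 × E → 𝕜) : Prop where
  zero : R 0 = G
  analyticAt : ∀ n, AnalyticAt 𝕜 (R n) (0, x₀)
  succ : ∀ n, ∀ᶠ z in 𝓝 ((0 : 𝕜), x₀), R n z = R n (0, z.2) + z.1 * R (n + 1) z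

theorem AnalyticAt.exists_eq_add_fst_mul {f : 𝕜 × E → 𝕜} {x₀ : E}
    (hf : AnalyticAt 𝕜 f (0, x₀)) : ∃ g : 𝕜 × E → 𝕜, AnalyticAt 𝕜 g (0, x₀) ∧
      ∀ᶠ z in 𝓝 ((0 : 𝕜), x₀), f z = f (0, z.2) + z.1 * g z := by
  have h1 : AnalyticAt 𝕜 (fun z : 𝕜 × E => f (0, z.2)) (0, x₀) :=
    AnalyticAt.comp (g := f) (f := fun z : 𝕜 × E => ((0 : 𝕜), z.2)) hf (by fun_prop)
  obtain ⟨g, hg, h⟩ := AnalyticAt.exists_eq_fst_mul (hf.sub h1) (by simp)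
  refine ⟨g, hg, h.mono fun z hz => ?_⟩
  rw [← hz]; simp

theorem AnalyticAt.exists_isTaylorSeq {G : 𝕜 × E → 𝕜} {x₀ : E} (hG : AnalyticAt 𝕜 G (0, x₀)) :
    ∃ R, IsTaylorSeq G x₀ R := by
  classical
  have step : ∀ f : {f : 𝕜 × E → 𝕜 // AnalyticAt 𝕜 f (0, x₀)},
      ∃ g : {f : 𝕜 × E → 𝕜 // AnalyticAt 𝕜 f (0, x₀)},
        ∀ᶠ z in 𝓝 ((0 : 𝕜), x₀), f.1 z = f.1 (0, z.2) + z.1 * g.1 z := by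
    rintro ⟨f, hf⟩
    obtain ⟨g, hg, h⟩ := hf.exists_eq_add_fst_mul
    exact ⟨⟨g, hg⟩, h⟩
  choose nxt hnxt using step
  let S : ℕ → {f : 𝕜 × E → 𝕜 // AnalyticAt 𝕜 f (0, x₀)} := fun n => nxt^[n] ⟨G, hG⟩
  refine ⟨fun n => (S n).1, rfl, fun n => (S n).2, fun n => ?_⟩
  have : S (n + 1) = nxt (S n) := Function.iterate_succ_apply' _ _ _
  rw [this]
  exact hnxt _

theorem eventually_nhds_slice {X Y : Type*} [TopologicalSpace X] [TopologicalSpace Y]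
    {p : X × Y → Prop} {a : X} {x₀ : Y} (h : ∀ᶠ z in 𝓝 (a, x₀), p z) :
    ∀ᶠ x in 𝓝 x₀, ∀ᶠ z in 𝓝 (a, x), p z := by
  have h2 := eventually_eventually_nhds.2 h
  have : Tendsto (fun x : Y => (a, x)) (𝓝 x₀) (𝓝 (a, x₀)) := by
    have : Continuous (fun x : Y => (a, x)) := by fun_prop
    exact this.tendsto _
  exact this.eventually h2

theorem eventually_nhds_slice' {X Y : Type*} [TopologicalSpace X] [TopologicalSpace Y]
    {p : X × Y → Prop} {a : X} {x₀ : Y} (h : ∀ᶠ z in 𝓝 (a, x₀), p z) :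
    ∀ᶠ x in 𝓝 x₀, ∀ᶠ v in 𝓝 a, p (v, x) := by
  filter_upwards [eventually_nhds_slice h] with x hx
  have : Tendsto (fun v : X => (v, x)) (𝓝 a) (𝓝 (a, x)) := by
    have : Continuous (fun v : X => (v, x)) := by fun_prop
    exact this.tendsto _
  exact this.eventually hx

namespace IsTaylorSeq

variable {G : 𝕜 × E → 𝕜} {x₀ : E} {R : ℕ → 𝕜 × E → 𝕜}

theorem analyticAt_coeff (h : IsTaylorSeq G x₀ R) (n : ℕ) : AnalyticAt 𝕜 (fun x => R n (0, x)) x₀ :=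
  AnalyticAt.comp (g := R n) (f := fun x : E => ((0 : 𝕜), x)) (h.analyticAt n) (by fun_prop)

theorem expand (h : IsTaylorSeq G x₀ R) (n : ℕ) : ∀ᶠ z in 𝓝 ((0 : 𝕜), x₀),
    G z = ∑ i ∈ Finset.range n, z.1 ^ i * R i (0, z.2) + z.1 ^ n * R n z := by
  induction n with
  | zero => simp [h.zero]
  | succ n ih =>
    filter_upwards [ih, h.succ n] with z h1 h2
    rw [h1, sum_range_succ, pow_succ]
    nth_rewrite 1 [h2]
    ring

/-- The Taylor sequence at nearby parameters, up to a fixed order. -/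
theorem eventually_expand (h : IsTaylorSeq G x₀ R) (n : ℕ) : ∀ᶠ x in 𝓝 x₀, ∀ᶠ v in 𝓝 (0 : 𝕜),
    G (v, x) = ∑ i ∈ Finset.range n, v ^ i * R i (0, x) + v ^ n * R n (v, x) :=
  eventually_nhds_slice' (h.expand n)

end IsTaylorSeq

theorem iteratedDeriv_of_expand {H S : 𝕜 → 𝕜} {b : ℕ → 𝕜} {n : ℕ} (hS : AnalyticAt 𝕜 S 0)
    (h : ∀ᶠ X in 𝓝 (0 : 𝕜), H X = ∑ i ∈ Finset.range n, X ^ i * b i + X ^ n * S X)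
    {i : ℕ} (hi : i < n) : iteratedDeriv i H 0 = i.factorial * b i := by
  have hP : AnalyticAt 𝕜 (fun X : 𝕜 => ∑ i ∈ Finset.range n, X ^ i * b i) 0 := by
    refine Finset.analyticAt_fun_sum _ fun i _ => by fun_prop
  have hQ : AnalyticAt 𝕜 (fun X : 𝕜 => X ^ n * S X) 0 := by fun_prop
  have h1 : iteratedDeriv i (fun X : 𝕜 => X ^ n * S X) 0 = 0 := by
    refine (natCast_le_analyticOrderAt_iff_iteratedDeriv_eq_zero hQ).1 ?_ i hi
    rw [natCast_le_analyticOrderAt hQ]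
    exact ⟨S, hS, by simp⟩
  have h2 : H =ᶠ[𝓝 0] (fun X : 𝕜 => ∑ i ∈ Finset.range n, X ^ i * b i) +
      fun X : 𝕜 => X ^ n * S X := h
  rw [h2.iteratedDeriv_eq, iteratedDeriv_add hP.contDiffAt hQ.contDiffAt, h1, add_zero]
  rw [iteratedDeriv_fun_sum (fun j _ => by fun_prop)]
  simp_rw [mul_comm _ (b _)]
  rw [sum_congr rfl (fun j _ => iteratedDeriv_const_mul_field (b j) (fun X : 𝕜 => X ^ j))]
  simp only [iteratedDeriv_fun_pow_zero]
  rw [Finset.sum_eq_single_of_mem i (Finset.mem_range.2 hi)]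
  · simp
  · intro j _ hj
    simp [hj.symm]

theorem IsTaylorSeq.iteratedDeriv_eq {G : 𝕜 × E → 𝕜} {x₀ : E} {R : ℕ → 𝕜 × E → 𝕜}
    (h : IsTaylorSeq G x₀ R) (n : ℕ) :
    ∀ᶠ x in 𝓝 x₀, iteratedDeriv n (fun v => G (v, x)) 0 = n.factorial * R n (0, x) := by
  have h2 : ∀ᶠ x in 𝓝 x₀, AnalyticAt 𝕜 (R (n + 1)) (0, x) := by
    have := (h.analyticAt (n + 1)).eventually_analyticAt
    exact (eventually_nhds_slice this).mono fun x hx => hx.self_of_nhds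
  filter_upwards [h.eventually_expand (n + 1), h2] with x h1 h2
  refine iteratedDeriv_of_expand (b := fun i => R i (0, x)) (S := fun v => R (n + 1) (v, x))
    ?_ h1 (Nat.lt_succ_self n)
  exact AnalyticAt.comp (g := R (n + 1)) (f := fun v : 𝕜 => (v, x)) h2 (by fun_prop)

/-- Taylor coefficients of an analytic function along the first variable, the base point of the
expansion being a parameter too. The coefficient of order `n` at `v` varies with `v` with
derivative `n + 1` times the next coefficient. -/
theorem IsTaylorSeq.exists_moving {G : 𝕜 × E → 𝕜} {x₀ : E} {R : ℕ → 𝕜 × E → 𝕜}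
    (h : IsTaylorSeq G x₀ R) :
    ∃ B : ℕ → 𝕜 × (𝕜 × E) → 𝕜,
      IsTaylorSeq (fun z : 𝕜 × (𝕜 × E) => G (z.2.1 + z.1, z.2.2)) (0, x₀) B ∧
      (∀ n, ∀ᶠ x in 𝓝 x₀, B n (0, (0, x)) = R n (0, x)) ∧
      ∀ n, ∃ Q : 𝕜 × E → 𝕜, AnalyticAt 𝕜 Q (0, x₀) ∧ Q (0, x₀) = (n + 1) * R (n + 1) (0, x₀) ∧
        ∀ᶠ z in 𝓝 ((0 : 𝕜), x₀), B n (0, z) = B n (0, (0, z.2)) + z.1 * Q z := by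
  have hG : AnalyticAt 𝕜 G (0, x₀) := h.zero ▸ h.analyticAt 0
  have hĜ : AnalyticAt 𝕜 (fun z : 𝕜 × (𝕜 × E) => G (z.2.1 + z.1, z.2.2)) (0, (0, x₀)) := by
    refine AnalyticAt.fun_comp (g := G) (f := fun z : 𝕜 × (𝕜 × E) => (z.2.1 + z.1, z.2.2)) ?_
      (by fun_prop)
    simpa using hG
  obtain ⟨B, hB⟩ := hĜ.exists_isTaylorSeq
  have hcoef : ∀ n, ∀ᶠ x in 𝓝 x₀, B n (0, (0, x)) = R n (0, x) := by
    intro n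
    have h1 := hB.iteratedDeriv_eq n
    have : Tendsto (fun x : E => ((0 : 𝕜), x)) (𝓝 x₀) (𝓝 (0, x₀)) := by
      have : Continuous (fun x : E => ((0 : 𝕜), x)) := by fun_prop
      exact this.tendsto _
    filter_upwards [this.eventually h1, h.iteratedDeriv_eq n] with x h2 h3
    simp only [zero_add] at h2
    rw [h2] at h3
    exact mul_left_cancel₀ (by exact_mod_cast n.factorial_ne_zero) h3
  refine ⟨B, hB, hcoef, fun n => ?_⟩
  obtain ⟨Q, hQ, hQ2⟩ := (hB.analyticAt_coeff n).exists_eq_add_fst_mul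
  refine ⟨Q, hQ, ?_, hQ2⟩
  have e1 : ∀ᶠ v in 𝓝 (0 : 𝕜), B n (0, (v, x₀)) = B n (0, (0, x₀)) + v * Q (v, x₀) :=
    (eventually_nhds_slice' hQ2).self_of_nhds
  have e2 : ∀ᶠ v in 𝓝 (0 : 𝕜),
      iteratedDeriv n (fun v => G (v, x₀)) v = n.factorial * B n (0, (v, x₀)) := by
    have h1 := (eventually_nhds_slice' (hB.iteratedDeriv_eq n)).self_of_nhds
    filter_upwards [h1] with v hv
    rw [← hv]
    have := iteratedDeriv_comp_const_add n (fun v => G (v, x₀)) v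
    simpa using (congrFun this 0).symm
  have e3 : (fun v => iteratedDeriv n (fun v => G (v, x₀)) v) =ᶠ[𝓝 0]
      fun v => n.factorial * (B n (0, (0, x₀)) + v * Q (v, x₀)) := by
    filter_upwards [e1, e2] with v h1 h2
    rw [h2, h1]
  have e4 := e3.deriv_eq
  have hQ' : DifferentiableAt 𝕜 (fun v => Q (v, x₀)) 0 :=
    (AnalyticAt.comp (g := Q) (f := fun v : 𝕜 => (v, x₀)) hQ (by fun_prop)).differentiableAt
  have e5 : HasDerivAt (fun v => (n.factorial : 𝕜) * (B n (0, (0, x₀)) + v * Q (v, x₀)))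
      (n.factorial * (1 * Q (0, x₀) + 0 * deriv (fun v => Q (v, x₀)) 0)) 0 :=
    (((hasDerivAt_id (0 : 𝕜)).mul hQ'.hasDerivAt).const_add _).const_mul _
  rw [e5.deriv] at e4
  have e6 := (h.iteratedDeriv_eq (n + 1)).self_of_nhds
  rw [iteratedDeriv_succ, e4, Nat.factorial_succ] at e6
  push_cast at e6
  have : (n.factorial : 𝕜) ≠ 0 := mod_cast n.factorial_ne_zero
  refine mul_left_cancel₀ this ?_
  rw [zero_mul, add_zero, one_mul] at e6
  rw [e6]; ring

/-- The analytic implicit function theorem for one scalar equation in one scalar unknown. -/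
theorem AnalyticAt.exists_implicit [CompleteSpace E] {g Q : 𝕜 × E → 𝕜} {x₀ : E}
    (hg : AnalyticAt 𝕜 g (0, x₀)) (h0 : g (0, x₀) = 0) (hQ : AnalyticAt 𝕜 Q (0, x₀))
    (hgQ : ∀ᶠ z in 𝓝 ((0 : 𝕜), x₀), g z = g (0, z.2) + z.1 * Q z) (hne : Q (0, x₀) ≠ 0) :
    ∃ ψ : E → 𝕜, AnalyticAt 𝕜 ψ x₀ ∧ ψ x₀ = 0 ∧ ∀ᶠ x in 𝓝 x₀, g (ψ x, x) = 0 := by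
  let f : E × 𝕜 → 𝕜 := fun u => g (u.2, u.1)
  have hf : AnalyticAt 𝕜 f (x₀, 0) :=
    AnalyticAt.comp (g := g) (f := fun u : E × 𝕜 => (u.2, u.1)) hg (by fun_prop)
  have cdf : ContDiffAt 𝕜 (⊤ : WithTop ℕ∞) f (x₀, 0) := hf.contDiffAt
  have hder : (fderiv 𝕜 f (x₀, 0) ∘L ContinuousLinearMap.inr 𝕜 E 𝕜) 1 = Q (0, x₀) := by
    have h1 : HasDerivAt (fun v : 𝕜 => f (x₀, v))
        ((fderiv 𝕜 f (x₀, 0) ∘L ContinuousLinearMap.inr 𝕜 E 𝕜) 1) 0 := by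
      have h2 : HasFDerivAt (fun v : 𝕜 => (x₀, v)) (ContinuousLinearMap.inr 𝕜 E 𝕜) 0 :=
        hasFDerivAt_prodMk_right x₀ (0 : 𝕜)
      exact (HasFDerivAt.comp (0 : 𝕜) hf.differentiableAt.hasFDerivAt h2).hasDerivAt
    have hQ' : DifferentiableAt 𝕜 (fun v => Q (v, x₀)) 0 :=
      (AnalyticAt.comp (g := Q) (f := fun v : 𝕜 => (v, x₀)) hQ (by fun_prop)).differentiableAt
    have e5 : HasDerivAt (fun v => (g (0, x₀) + v * Q (v, x₀)))
      ((1 * Q (0, x₀) + 0 * deriv (fun v => Q (v, x₀)) 0)) 0 :=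
      (((hasDerivAt_id (0 : 𝕜)).mul hQ'.hasDerivAt).const_add _)
    have e6 : (fun v : 𝕜 => f (x₀, v)) =ᶠ[𝓝 0] fun v => (g (0, x₀) + v * Q (v, x₀)) :=
      (eventually_nhds_slice' hgQ).self_of_nhds
    have := h1.unique (e5.congr_of_eventuallyEq e6)
    rw [this]; ring
  have hinv : (fderiv 𝕜 f (x₀, 0) ∘L ContinuousLinearMap.inr 𝕜 E 𝕜).IsInvertible := by
    refine ⟨ContinuousLinearEquiv.unitsEquivAut 𝕜 (Units.mk0 _ hne), ?_⟩
    ext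
    rw [hder]
    simp
  refine ⟨cdf.implicitFunction (by simp) hinv, ?_,
    cdf.implicitFunction_apply_self (by simp) hinv, ?_⟩
  · exact (cdf.contDiffAt_implicitFunction (by simp) hinv).analyticAt
  · have := cdf.eventually_apply_implicitFunction (by simp) hinv
    filter_upwards [this] with x hx
    simpa [f, h0] using hx

/-- The coefficients of a polynomial of degree `< p` are fixed linear combinations of its values
at `0, …, p - 1`. -/
theorem exists_coeff_eq_sum_values (p : ℕ) : ∃ M : ℕ → ℕ → 𝕜, ∀ c : ℕ → 𝕜, ∀ i < p,
    c i = ∑ k ∈ Finset.range p, M i k * ∑ j ∈ Finset.range p, c j * (k : 𝕜) ^ j := by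
  classical
  let V : Matrix (Fin p) (Fin p) 𝕜 := Matrix.vandermonde (fun k : Fin p => ((k : ℕ) : 𝕜))
  have hV : IsUnit V.det := by
    rw [isUnit_iff_ne_zero, Matrix.det_vandermonde_ne_zero_iff]
    intro a b hab
    have hab' : ((a : ℕ) : 𝕜) = ((b : ℕ) : 𝕜) := hab
    exact Fin.ext (by exact_mod_cast hab')
  refine ⟨fun i k => if h : i < p ∧ k < p then V⁻¹ ⟨i, h.1⟩ ⟨k, h.2⟩ else 0, fun c i hi => ?_⟩
  have h1 : (V⁻¹ * V).mulVec (fun j : Fin p => c j) = fun j : Fin p => c j := by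
    rw [Matrix.nonsing_inv_mul _ hV, Matrix.one_mulVec]
  rw [← Matrix.mulVec_mulVec] at h1
  have h2 := congrFun h1 ⟨i, hi⟩
  simp only [Matrix.mulVec, dotProduct] at h2
  rw [← h2, Finset.sum_range]
  refine sum_congr rfl (fun k _ => ?_)
  simp only [hi, k.2, and_self, dif_pos, Fin.eta]
  rw [Finset.sum_range]
  congr 1
  refine sum_congr rfl (fun j _ => ?_)
  simp [V, Matrix.vandermonde_apply, mul_comm]

end Analytic

/-! ### The Newton substitution and Puiseux parametrizations of complex zeros -/

section Newton

variable {𝕜 : Type*} [RCLike 𝕜] {E : Type*} [NormedAddCommGroup E] [NormedSpace 𝕜 E]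

/-- A family of functions regular of order `p` in the first variable can be translated, along an
analytic root of the derivative of order `p - 1`, so that the coefficient of order `p - 1`
vanishes. -/
theorem IsTaylorSeq.exists_normalize [CompleteSpace E] {G : 𝕜 × E → 𝕜} {x₀ : E}
    {R : ℕ → 𝕜 × E → 𝕜} (h : IsTaylorSeq G x₀ R) {p : ℕ} (hp : 0 < p)
    (low : ∀ i < p, R i (0, x₀) = 0) (top : R p (0, x₀) ≠ 0) :
    ∃ φ : E → 𝕜, AnalyticAt 𝕜 φ x₀ ∧ φ x₀ = 0 ∧ ∃ R' : ℕ → 𝕜 × E → 𝕜,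
      IsTaylorSeq (fun z => G (z.1 + φ z.2, z.2)) x₀ R' ∧
      (∀ i < p, R' i (0, x₀) = 0) ∧ R' p (0, x₀) ≠ 0 ∧ ∀ᶠ x in 𝓝 x₀, R' (p - 1) (0, x) = 0 := by
  obtain ⟨B, hB, hB0, hBQ⟩ := h.exists_moving
  obtain ⟨Q, hQ, hQ0, hQe⟩ := hBQ (p - 1)
  have hp1 : p - 1 + 1 = p := Nat.sub_add_cancel hp
  have hB00 : ∀ n, B n (0, (0, x₀)) = R n (0, x₀) := fun n => (hB0 n).self_of_nhds
  have hQne : Q (0, x₀) ≠ 0 := by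
    rw [hQ0, hp1]
    exact mul_ne_zero (by exact_mod_cast Nat.succ_ne_zero (p - 1)) top
  obtain ⟨φ, hφ, hφ0, hφe⟩ := AnalyticAt.exists_implicit (g := fun z => B (p - 1) (0, z))
    (hB.analyticAt_coeff (p - 1)) (by rw [hB00]; exact low _ (by omega)) hQ hQe hQne
  have hG : AnalyticAt 𝕜 G (0, x₀) := h.zero ▸ h.analyticAt 0
  have hG' : AnalyticAt 𝕜 (fun z : 𝕜 × E => G (z.1 + φ z.2, z.2)) (0, x₀) := by
    refine AnalyticAt.fun_comp (g := G) (f := fun z : 𝕜 × E => (z.1 + φ z.2, z.2)) ?_ (by fun_prop)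
    simpa [hφ0] using hG
  obtain ⟨R', hR'⟩ := hG'.exists_isTaylorSeq
  have hcoef : ∀ n, ∀ᶠ x in 𝓝 x₀, R' n (0, x) = B n (0, (φ x, x)) := by
    intro n
    have ht : Tendsto (fun x => (φ x, x)) (𝓝 x₀) (𝓝 (0, x₀)) := by
      have := hφ.continuousAt.tendsto.prodMk_nhds (tendsto_id (x := 𝓝 x₀))
      rwa [hφ0] at this
    filter_upwards [hR'.iteratedDeriv_eq n, ht.eventually (hB.iteratedDeriv_eq n)] with x h1 h2
    simp only [add_comm (φ x)] at h2
    rw [h1] at h2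
    exact mul_left_cancel₀ (by exact_mod_cast n.factorial_ne_zero) h2
  have hc0 : ∀ n, R' n (0, x₀) = R n (0, x₀) := fun n => by rw [(hcoef n).self_of_nhds, hφ0, hB00]
  refine ⟨φ, hφ, hφ0, R', hR', fun i hi => by rw [hc0, low i hi], by rwa [hc0], ?_⟩
  filter_upwards [hcoef (p - 1), hφe] with x h1 h2
  rw [h1, h2]

/-- The quotient by `τ ^ c` of `G (w * τ ^ a, (τ ^ b, t))`, where
`G = ∑ i < m, v ^ i * (σ ^ k i * A i (σ, t)) + v ^ m * S`, in the variables `(w, (τ, t))`. -/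
def newtonQuotient (m a b c : ℕ) (k : ℕ → ℕ) (A : ℕ → 𝕜 × E → 𝕜) (S : 𝕜 × (𝕜 × E) → 𝕜)
    (z : 𝕜 × (𝕜 × E)) : 𝕜 :=
  ∑ i ∈ Finset.range m, z.1 ^ i * (z.2.1 ^ (b * k i + a * i - c) * A i (z.2.1 ^ b, z.2.2)) +
    z.1 ^ m * (z.2.1 ^ (a * m - c) * S (z.1 * z.2.1 ^ a, (z.2.1 ^ b, z.2.2)))

variable {m a b c : ℕ} {k : ℕ → ℕ} {A : ℕ → 𝕜 × E → 𝕜} {S : 𝕜 × (𝕜 × E) → 𝕜}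

theorem analyticAt_newtonQuotient_of {w₀ : 𝕜} {t₀ : E} (hA : ∀ i < m, AnalyticAt 𝕜 (A i) (0, t₀))
    (hS : AnalyticAt 𝕜 S (0, (0, t₀))) (ha : 0 < a) (hb : 0 < b) :
    AnalyticAt 𝕜 (newtonQuotient m a b c k A S) (w₀, (0, t₀)) := by
  unfold newtonQuotient
  refine AnalyticAt.add (Finset.analyticAt_fun_sum _ fun i hi => ?_) ?_
  · have h1 : AnalyticAt 𝕜 (fun z : 𝕜 × (𝕜 × E) => A i (z.2.1 ^ b, z.2.2)) (w₀, (0, t₀)) := by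
      refine AnalyticAt.fun_comp (g := A i) (f := fun z : 𝕜 × (𝕜 × E) => (z.2.1 ^ b, z.2.2)) ?_
        (by fun_prop)
      simpa [hb.ne'] using hA i (Finset.mem_range.1 hi)
    exact AnalyticAt.fun_mul (by fun_prop) (AnalyticAt.fun_mul (by fun_prop) h1)
  · have h1 : AnalyticAt 𝕜 (fun z : 𝕜 × (𝕜 × E) => S (z.1 * z.2.1 ^ a, (z.2.1 ^ b, z.2.2)))
        (w₀, (0, t₀)) := by
      refine AnalyticAt.fun_comp (g := S)
        (f := fun z : 𝕜 × (𝕜 × E) => (z.1 * z.2.1 ^ a, (z.2.1 ^ b, z.2.2))) ?_ (by fun_prop)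
      simpa [hb.ne', ha.ne'] using hS
    exact AnalyticAt.fun_mul (by fun_prop) (AnalyticAt.fun_mul (by fun_prop) h1)

theorem IsTaylorSeq.newton_eq {G : 𝕜 × (𝕜 × E) → 𝕜} {R : ℕ → 𝕜 × (𝕜 × E) → 𝕜}
    (h : IsTaylorSeq G 0 R) (hk : ∀ i < m, ∀ᶠ x in 𝓝 (0 : 𝕜 × E), R i (0, x) = x.1 ^ k i * A i x)
    (ha : 0 < a) (hb : 0 < b) (hc : ∀ i < m, c ≤ b * k i + a * i) (hcm : c ≤ a * m) (w₀ : 𝕜) :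
    ∀ᶠ z in 𝓝 (w₀, (0 : 𝕜 × E)), G (z.1 * z.2.1 ^ a, (z.2.1 ^ b, z.2.2)) =
      z.2.1 ^ c * newtonQuotient m a b c k A (R m) z := by
  have ht : Tendsto (fun z : 𝕜 × (𝕜 × E) => (z.1 * z.2.1 ^ a, (z.2.1 ^ b, z.2.2)))
      (𝓝 (w₀, 0)) (𝓝 (0, 0)) := by
    have : Continuous (fun z : 𝕜 × (𝕜 × E) => (z.1 * z.2.1 ^ a, (z.2.1 ^ b, z.2.2))) := by fun_prop
    have h2 := this.tendsto (w₀, 0)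
    have h3 : (w₀ * (0 : 𝕜 × E).1 ^ a, ((0 : 𝕜 × E).1 ^ b, (0 : 𝕜 × E).2)) = (0, 0) := by
      simp [ha.ne', hb.ne']
    rwa [h3] at h2
  have ht2 : Tendsto (fun z : 𝕜 × (𝕜 × E) => (z.2.1 ^ b, z.2.2))
      (𝓝 (w₀, 0)) (𝓝 0) := (continuous_snd.tendsto _).comp ht
  have hk' : ∀ᶠ x in 𝓝 (0 : 𝕜 × E), ∀ i ∈ Finset.range m, R i (0, x) = x.1 ^ k i * A i x := by
    rw [eventually_all_finset]
    exact fun i hi => hk i (Finset.mem_range.1 hi)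
  filter_upwards [ht.eventually (h.expand m), ht2.eventually hk'] with z h1 h2
  rw [h1, newtonQuotient, mul_add, Finset.mul_sum]
  congr 1
  · refine sum_congr rfl fun i hi => ?_
    rw [h2 i hi]
    have h3 : z.2.1 ^ (b * k i) * z.2.1 ^ (a * i) = z.2.1 ^ c * z.2.1 ^ (b * k i + a * i - c) := by
      rw [← pow_add, ← pow_add, Nat.add_sub_of_le (hc i (Finset.mem_range.1 hi))]
    rw [mul_pow, ← pow_mul, ← pow_mul]
    linear_combination z.1 ^ i * A i (z.2.1 ^ b, z.2.2) * h3
  · have h3 : z.2.1 ^ (a * m) = z.2.1 ^ c * z.2.1 ^ (a * m - c) := by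
      rw [← pow_add, Nat.add_sub_of_le hcm]
    rw [mul_pow, ← pow_mul, h3]
    ring

theorem newtonQuotient_zero {E : Type*} {A : ℕ → 𝕜 × E → 𝕜} {S : 𝕜 × (𝕜 × E) → 𝕜} (hb : 0 < b)
    (ha : 0 < a) (hc : ∀ i < m, c ≤ b * k i + a * i)
    (hcm : c ≤ a * m) (w : 𝕜) (t : E) :
    newtonQuotient m a b c k A S (w, (0, t)) =
      ∑ i ∈ Finset.range m, w ^ i * (if b * k i + a * i = c then A i (0, t) else 0) +
        w ^ m * (if a * m = c then S (0, (0, t)) else 0) := by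
  unfold newtonQuotient
  congr 1
  · refine sum_congr rfl fun i hi => ?_
    have := hc i (Finset.mem_range.1 hi)
    simp only [zero_pow hb.ne']
    split_ifs with h
    · rw [h, Nat.sub_self, pow_zero, one_mul]
    · rw [zero_pow (by omega), zero_mul]
  · simp only [zero_pow hb.ne', zero_pow ha.ne', mul_zero]
    split_ifs with h
    · rw [h, Nat.sub_self, pow_zero, one_mul]
    · rw [zero_pow (by omega), zero_mul]

/-- The first edge of a Newton polygon, seen from the dot `(p, 0)`: its slope is `a / b`. -/
theorem exists_newton_edge {p : ℕ} {α : ℕ → 𝕜 → 𝕜} (hα : ∀ i < p, AnalyticAt 𝕜 (α i) 0)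
    (hne : ∃ i < p, ¬ ∀ᶠ s in 𝓝 (0 : 𝕜), α i s = 0) :
    ∃ (a b : ℕ) (k : ℕ → ℕ) (β : ℕ → 𝕜 → 𝕜), 0 < b ∧
      (∀ i < p, AnalyticAt 𝕜 (β i) 0 ∧ (∀ᶠ s in 𝓝 (0 : 𝕜), α i s = s ^ k i * β i s) ∧
        a * p ≤ b * k i + a * i) ∧
      ∃ i < p, b * k i + a * i = a * p ∧ β i 0 ≠ 0 ∧ a = k i := by
  classical
  let Z : Finset ℕ := (Finset.range p).filter fun i => ¬ ∀ᶠ s in 𝓝 (0 : 𝕜), α i s = 0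
  have hZ : Z.Nonempty := by
    obtain ⟨i, hi, h⟩ := hne
    exact ⟨i, by simp only [Z, mem_filter, Finset.mem_range]; exact ⟨hi, h⟩⟩
  have hfac : ∀ i ∈ Z, ∃ (n : ℕ) (g : 𝕜 → 𝕜), AnalyticAt 𝕜 g 0 ∧ g 0 ≠ 0 ∧
      ∀ᶠ s in 𝓝 (0 : 𝕜), α i s = s ^ n * g s := by
    intro i hi
    simp only [Z, mem_filter, Finset.mem_range] at hi
    obtain ⟨n, g, hg, hg0, h⟩ := ((hα i hi.1).exists_eventuallyEq_pow_smul_nonzero_iff).2 hi.2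
    exact ⟨n, g, hg, hg0, by simpa using h⟩
  choose! n g hg hg0 hfg using hfac
  obtain ⟨i₀, hi₀, hmin⟩ := Finset.exists_min_image Z (fun i => (n i : ℚ) / ((p : ℚ) - i)) hZ
  have hlt : ∀ i ∈ Z, i < p := fun i hi => by
    simp only [Z, mem_filter, Finset.mem_range] at hi; exact hi.1
  have hmin' : ∀ i ∈ Z, n i₀ * (p - i) ≤ (p - i₀) * n i := by
    intro i hi
    have h1 := hmin i hi
    have hp1 : (0 : ℚ) < (p : ℚ) - i := by have := hlt i hi; rw [sub_pos]; exact_mod_cast this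
    have hp2 : (0 : ℚ) < (p : ℚ) - i₀ := by have := hlt i₀ hi₀; rw [sub_pos]; exact_mod_cast this
    rw [div_le_div_iff₀ hp2 hp1] at h1
    have h2 : ((n i₀ * (p - i) : ℕ) : ℚ) ≤ (((p - i₀) * n i : ℕ) : ℚ) := by
      push_cast [Nat.cast_sub (hlt i hi).le, Nat.cast_sub (hlt i₀ hi₀).le]
      linarith
    exact_mod_cast h2
  have hb : 0 < p - i₀ := Nat.sub_pos_of_lt (hlt i₀ hi₀)
  refine ⟨n i₀, p - i₀, fun i => if i ∈ Z then n i else n i₀ * p,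
    fun i => if i ∈ Z then g i else 0, hb, fun i hi => ?_, i₀, hlt i₀ hi₀, ?_, ?_, ?_⟩
  · by_cases hiZ : i ∈ Z
    · simp only [hiZ, if_true]
      refine ⟨hg i hiZ, hfg i hiZ, ?_⟩
      have := hmin' i hiZ
      calc n i₀ * p = n i₀ * (p - i) + n i₀ * i := by rw [← mul_add, Nat.sub_add_cancel hi.le]
        _ ≤ _ := by omega
    · simp only [hiZ, if_false]
      refine ⟨analyticAt_const, ?_, ?_⟩
      · simp only [Z, mem_filter, Finset.mem_range, not_and, not_not] at hiZ
        filter_upwards [hiZ hi] with s hs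
        simp [hs]
      · calc n i₀ * p ≤ (p - i₀) * (n i₀ * p) := Nat.le_mul_of_pos_left _ hb
          _ ≤ _ := Nat.le_add_right _ _
  · simp only [hi₀, if_true]
    rw [mul_comm (p - i₀), ← mul_add, Nat.sub_add_cancel (hlt i₀ hi₀).le]
  · simpa [hi₀] using hg0 i₀ hi₀
  · simp [hi₀]

end Newton

section PolyRoot

variable {K : Type*} [Field K] [CharZero K]

/-- A polynomial of degree `p` without term of degree `p - 1`, not a monomial, has no root of
multiplicity `p`. -/
theorem Polynomial.rootMultiplicity_lt_of_coeff_eq_zero {J : K[X]} {p i₀ : ℕ}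
    (hdeg : J.natDegree = p) (h1 : J.coeff (p - 1) = 0) (hi₀ : i₀ < p) (h2 : J.coeff i₀ ≠ 0)
    (z : K) : J.rootMultiplicity z < p := by
  have hJ : J ≠ 0 := by rintro rfl; simp at h2
  by_contra hcon
  push Not at hcon
  have hdvd : (Polynomial.X - Polynomial.C z) ^ p ∣ J :=
    (pow_dvd_pow _ hcon).trans (J.pow_rootMultiplicity_dvd z)
  obtain ⟨q, hq⟩ := hdvd
  have hq0 : q ≠ 0 := by rintro rfl; simp at hq; exact hJ hq
  have hmon : ((Polynomial.X - Polynomial.C z) ^ p).Monic := (Polynomial.monic_X_sub_C z).pow p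
  have hqd : q.natDegree = 0 := by
    have h3 := congrArg Polynomial.natDegree hq
    rw [hmon.natDegree_mul' hq0, Polynomial.natDegree_pow, Polynomial.natDegree_X_sub_C, hdeg] at h3
    omega
  obtain ⟨r, rfl⟩ := Polynomial.natDegree_eq_zero.1 hqd
  have hr : r ≠ 0 := by rintro rfl; simp at hq0
  have hco : ∀ i, J.coeff i = ((-z) ^ (p - i) * (p.choose i)) * r := by
    intro i
    rw [hq, Polynomial.coeff_mul_C, sub_eq_add_neg, ← Polynomial.C_neg,
      Polynomial.coeff_X_add_C_pow]
  have hz : z = 0 := by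
    have h3 := hco (p - 1)
    rw [h1] at h3
    have h4 : p - (p - 1) = 1 := by omega
    have h5 : (p.choose (p - 1) : K) ≠ 0 := by exact_mod_cast (Nat.choose_pos (Nat.sub_le p 1)).ne'
    rw [h4, pow_one] at h3
    by_contra hz
    exact mul_ne_zero (mul_ne_zero (neg_ne_zero.2 hz) h5) hr h3.symm
  apply h2
  rw [hco, hz, neg_zero, zero_pow (by omega), zero_mul, zero_mul]

end PolyRoot

section Puiseux

theorem IsTaylorSeq.coeff_of_polynomial {𝕜 : Type*} [RCLike 𝕜]
    {E : Type*} [NormedAddCommGroup E] [NormedSpace 𝕜 E] {G : 𝕜 × E → 𝕜} {x₀ : E}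
    {R : ℕ → 𝕜 × E → 𝕜} (h : IsTaylorSeq G x₀ R) {J : 𝕜[X]} {w₀ : 𝕜}
    (hJ : ∀ w, G (w, x₀) = J.eval (w₀ + w)) (i : ℕ) :
    R i (0, x₀) = (taylor w₀ J).coeff i := by
  have h1 := (h.iteratedDeriv_eq i).self_of_nhds
  have h2 : iteratedDeriv i (fun v => G (v, x₀)) 0 = i.factorial * (taylor w₀ J).coeff i := by
    refine iteratedDeriv_of_expand (n := J.natDegree + 1 + i) (S := fun _ => 0)
      (b := fun i => (taylor w₀ J).coeff i) analyticAt_const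
      (Eventually.of_forall fun w => ?_) (by omega)
    rw [hJ, add_comm w₀ w, ← taylor_eval, mul_zero, add_zero,
      Polynomial.eval_eq_sum_range' (n := J.natDegree + 1 + i) (by rw [natDegree_taylor]; omega)]
    exact sum_congr rfl fun j _ => mul_comm _ _
  rw [h1] at h2
  exact mul_left_cancel₀ (by exact_mod_cast i.factorial_ne_zero) h2

theorem Polynomial.taylor_coeff_of_lt_rootMultiplicity {K : Type*} [Field K] {J : K[X]} {w₀ : K}
    {i : ℕ} (hi : i < J.rootMultiplicity w₀) : (taylor w₀ J).coeff i = 0 := by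
  rw [Polynomial.rootMultiplicity_eq_natTrailingDegree] at hi
  exact Polynomial.coeff_eq_zero_of_lt_natTrailingDegree hi

theorem Polynomial.taylor_coeff_rootMultiplicity_ne_zero {K : Type*} [Field K] {J : K[X]}
    (hJ : J ≠ 0) (w₀ : K) : (taylor w₀ J).coeff (J.rootMultiplicity w₀) ≠ 0 := by
  rw [Polynomial.rootMultiplicity_eq_natTrailingDegree]
  have : taylor w₀ J ≠ 0 := by rw [Ne, taylor_eq_zero]; exact hJ
  exact Polynomial.trailingCoeff_nonzero_iff_nonzero.2 this

/-- A convergent Puiseux parametrization of a branch of the zero set of a complex analytic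
function of two variables, regular of order `p > 0` in the first one. -/
theorem IsTaylorSeq.exists_puiseux_root {p : ℕ} (hp : 0 < p) {G : ℂ × (ℂ × PUnit.{1}) → ℂ}
    {R : ℕ → ℂ × (ℂ × PUnit.{1}) → ℂ} (h : IsTaylorSeq G 0 R) (low : ∀ i < p, R i (0, 0) = 0)
    (top : R p (0, 0) ≠ 0) :
    ∃ N : ℕ, 0 < N ∧ ∃ w : ℂ → ℂ, AnalyticAt ℂ w 0 ∧ w 0 = 0 ∧
      ∀ᶠ τ in 𝓝 (0 : ℂ), G (w τ, (τ ^ N, PUnit.unit)) = 0 := by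
  induction p using Nat.strong_induction_on generalizing G R with
  | _ p ih =>
  obtain ⟨φ, hφ, hφ0, R', hR', low', top', hnorm⟩ := h.exists_normalize hp low top
  have hline : AnalyticAt ℂ (fun σ : ℂ => (σ, PUnit.unit)) 0 := by fun_prop
  have hcoef : ∀ i, AnalyticAt ℂ (fun σ : ℂ => R' i (0, (σ, PUnit.unit))) 0 := fun i =>
    AnalyticAt.fun_comp (g := fun x => R' i (0, x)) (f := fun σ : ℂ => (σ, PUnit.unit))
      (hR'.analyticAt_coeff i) hline
  have htl : Tendsto (fun σ : ℂ => (σ, PUnit.unit)) (𝓝 0) (𝓝 0) := hline.continuousAt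
  by_cases hall : ∀ i < p, ∀ᶠ σ in 𝓝 (0 : ℂ), R' i (0, (σ, PUnit.unit)) = 0
  · refine ⟨1, one_pos, fun σ => φ (σ, PUnit.unit), ?_, hφ0, ?_⟩
    · exact AnalyticAt.fun_comp (g := φ) hφ hline
    · filter_upwards [hall 0 hp] with σ hσ
      rw [hR'.zero] at hσ
      simpa using hσ
  · obtain ⟨a, b, k, β, hb, hβ, i₀, hi₀, hedge, hβ0, hak⟩ := exists_newton_edge
      (fun i _ => hcoef i) (by
        by_contra hcon
        exact hall fun i hi => by_contra fun h => hcon ⟨i, hi, h⟩)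
    have ha : 0 < a := by
      rw [hak]
      rcases Nat.eq_zero_or_pos (k i₀) with h0 | h0
      · exfalso
        have h1 := (hβ i₀ hi₀).2.1.self_of_nhds
        rw [h0, pow_zero, one_mul] at h1
        exact hβ0 (h1 ▸ low' i₀ hi₀)
      · exact h0
    let A : ℕ → ℂ × PUnit.{1} → ℂ := fun i x => β i x.1
    have hA : ∀ i < p, AnalyticAt ℂ (A i) 0 := fun i hi =>
      AnalyticAt.fun_comp (g := β i) (f := fun x : ℂ × PUnit => x.1) (hβ i hi).1 (by fun_prop)
    have hk : ∀ i < p, ∀ᶠ x in 𝓝 (0 : ℂ × PUnit.{1}), R' i (0, x) = x.1 ^ k i * A i x := by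
      intro i hi
      have : Tendsto (fun x : ℂ × PUnit => x.1) (𝓝 0) (𝓝 0) := continuous_fst.tendsto _
      exact this.eventually (hβ i hi).2.1
    have hc : ∀ i < p, a * p ≤ b * k i + a * i := fun i hi => (hβ i hi).2.2
    have hN := fun w₀ => hR'.newton_eq hk ha hb hc le_rfl w₀
    let H : ℂ × (ℂ × PUnit.{1}) → ℂ := newtonQuotient p a b (a * p) k A (R' p)
    have hH : ∀ w₀, AnalyticAt ℂ H (w₀, 0) := fun w₀ =>
      analyticAt_newtonQuotient_of hA (hR'.analyticAt p) ha hb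
    -- the polynomial of the edge
    let co : ℕ → ℂ := fun i => if b * k i + a * i = a * p then A i 0 else 0
    let J : ℂ[X] := ∑ i ∈ Finset.range p, Polynomial.C (co i) * Polynomial.X ^ i +
      Polynomial.C (R' p (0, 0)) * Polynomial.X ^ p
    have hJH : ∀ w, H (w, 0) = J.eval w := by
      intro w
      have := newtonQuotient_zero (S := R' p) (A := A) hb ha hc le_rfl w (PUnit.unit)
      simp only [H]
      refine this.trans ?_
      simp only [J, Polynomial.eval_add, eval_finsetSum, Polynomial.eval_mul,
        Polynomial.eval_C, Polynomial.eval_pow, Polynomial.eval_X, co, if_true]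
      congr 1
      · exact sum_congr rfl fun i _ => mul_comm _ _
      · exact mul_comm _ _
    have hJc : ∀ i < p, J.coeff i = co i := by
      intro i hi
      simp only [J, coeff_add, finsetSum_coeff, coeff_C_mul_X_pow]
      rw [Finset.sum_eq_single_of_mem i (Finset.mem_range.2 hi) (fun j _ hj => if_neg hj.symm)]
      simp [hi.ne]
    have hJp : J.coeff p = R' p (0, 0) := by
      simp only [J, coeff_add, finsetSum_coeff, coeff_C_mul_X_pow]
      rw [sum_eq_zero fun j hj => if_neg (Finset.mem_range.1 hj).ne']
      simp
    have hJd : J.natDegree = p := by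
      refine le_antisymm (Polynomial.natDegree_le_iff_coeff_eq_zero.2 fun N hN => ?_)
        (Polynomial.le_natDegree_of_ne_zero (hJp ▸ top'))
      simp only [J, coeff_add, finsetSum_coeff, coeff_C_mul_X_pow]
      rw [sum_eq_zero fun j hj => if_neg ?_]
      · simp [hN.ne']
      · have := Finset.mem_range.1 hj; omega
    have hJ1 : J.coeff (p - 1) = 0 := by
      rw [hJc _ (by omega)]
      simp only [co]
      split_ifs with hcase
      · have hz : ∀ᶠ σ in 𝓝 (0 : ℂ), σ ^ k (p - 1) * β (p - 1) σ = 0 := by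
          filter_upwards [htl.eventually hnorm, (hβ (p - 1) (by omega)).2.1] with σ h1 h2
          rw [← h2, h1]
        have hz2 : ∀ᶠ σ in 𝓝[≠] (0 : ℂ), β (p - 1) σ = 0 := by
          filter_upwards [hz.within, self_mem_nhdsWithin] with σ h1 h2
          exact (mul_eq_zero.1 h1).resolve_left (pow_ne_zero _ h2)
        have hcont := (hβ (p - 1) (by omega)).1.continuousAt.tendsto.mono_left
          (nhdsWithin_le_nhds (s := {0}ᶜ))
        exact tendsto_nhds_unique_of_eventuallyEq hcont tendsto_const_nhds hz2
      · rfl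
    have hJi : J.coeff i₀ ≠ 0 := by
      rw [hJc i₀ hi₀]
      simp only [co, hedge, if_true]
      exact hβ0
    have hJ0 : J ≠ 0 := by rintro h0; rw [h0] at hJi; simp at hJi
    obtain ⟨w₀, hw₀⟩ := Complex.exists_root (f := J)
      (Polynomial.natDegree_pos_iff_degree_pos.1 (by rw [hJd]; exact hp))
    have hmul := Polynomial.rootMultiplicity_lt_of_coeff_eq_zero hJd hJ1 hi₀ hJi w₀
    have hmul0 : 0 < J.rootMultiplicity w₀ := (rootMultiplicity_pos hJ0).2 hw₀
    let G₁ : ℂ × (ℂ × PUnit.{1}) → ℂ := fun z => H (w₀ + z.1, z.2)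
    have hG₁ : AnalyticAt ℂ G₁ (0, 0) := by
      refine AnalyticAt.fun_comp (g := H) (f := fun z : ℂ × (ℂ × PUnit.{1}) => (w₀ + z.1, z.2)) ?_
        (by fun_prop)
      simpa using hH w₀
    obtain ⟨R₁, hR₁⟩ := hG₁.exists_isTaylorSeq
    have hR₁c := hR₁.coeff_of_polynomial (J := J) (w₀ := w₀) (fun w => hJH (w₀ + w))
    obtain ⟨N, hN0, w₁, hw₁, hw₁0, hw₁e⟩ := ih _ hmul hmul0 hR₁
      (fun i hi => by rw [hR₁c]; exact Polynomial.taylor_coeff_of_lt_rootMultiplicity hi)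
      (by rw [hR₁c]; exact Polynomial.taylor_coeff_rootMultiplicity_ne_zero hJ0 w₀)
    refine ⟨N * b, Nat.mul_pos hN0 hb,
      fun τ => (w₀ + w₁ τ) * (τ ^ N) ^ a + φ (τ ^ (N * b), PUnit.unit), ?_, ?_, ?_⟩
    · have h1 : AnalyticAt ℂ (fun τ : ℂ => φ (τ ^ (N * b), PUnit.unit)) 0 := by
        refine AnalyticAt.fun_comp (g := φ) (f := fun τ : ℂ => (τ ^ (N * b), PUnit.unit)) ?_
          (by fun_prop)
        have : (N * b) ≠ 0 := (Nat.mul_pos hN0 hb).ne'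
        rw [zero_pow this]
        exact hφ
      exact AnalyticAt.fun_add (by fun_prop) h1
    · have : (N * b) ≠ 0 := (Nat.mul_pos hN0 hb).ne'
      simp only [zero_pow this, zero_pow hN0.ne', zero_pow ha.ne', mul_zero, zero_add]
      exact hφ0
    · have ht : Tendsto (fun τ : ℂ => (w₀ + w₁ τ, (τ ^ N, PUnit.unit))) (𝓝 0) (𝓝 (w₀, 0)) := by
        have : ContinuousAt (fun τ : ℂ => (w₀ + w₁ τ, (τ ^ N, PUnit.unit))) 0 := by
          have := hw₁.continuousAt
          fun_prop
        have h2 := this.tendsto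
        rw [hw₁0, add_zero, zero_pow hN0.ne'] at h2
        exact h2
      filter_upwards [hw₁e, ht.eventually (hN w₀)] with τ h1 h2
      simp only [G₁] at h1
      rw [pow_mul τ N b]
      refine h2.trans ?_
      simp only [H] at h1
      rw [h1, mul_zero]

end Puiseux

/-! ### Convergent fractional power series of one positive variable -/

section Series

variable {𝕜 : Type*} [RCLike 𝕜]

/-- A coefficient sequence with positive radius of convergence. -/
def ConvSeq (c : ℕ → 𝕜) : Prop := ∃ r : ℝ, 0 < r ∧ Summable fun j => ‖c j‖ * r ^ j

/-- The sum of a power series. -/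
def ser (c : ℕ → 𝕜) (s : 𝕜) : 𝕜 := ∑' j, c j * s ^ j

/-- The Taylor coefficients of a function at `0`. -/
def taylorSeq (f : 𝕜 → 𝕜) (j : ℕ) : 𝕜 := iteratedDeriv j f 0 / (j.factorial : 𝕜)

theorem ConvSeq.hasFPowerSeriesAt {c : ℕ → 𝕜} (hc : ConvSeq c) :
    HasFPowerSeriesAt (ser c) (FormalMultilinearSeries.ofScalars 𝕜 c) 0 := by
  obtain ⟨r, hr, hs⟩ := hc
  have h1 : 0 < (FormalMultilinearSeries.ofScalars 𝕜 c).radius := by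
    refine lt_of_lt_of_le ?_ (FormalMultilinearSeries.le_radius_of_summable _ (r := r.toNNReal) ?_)
    · rw [ENNReal.coe_pos]; exact Real.toNNReal_pos.2 hr
    · rw [Real.coe_toNNReal _ hr.le]
      simpa using hs
  have h2 := (FormalMultilinearSeries.ofScalars 𝕜 c).hasFPowerSeriesOnBall h1
  have h3 : (FormalMultilinearSeries.ofScalars 𝕜 c).sum = ser c := by
    ext s
    simp [FormalMultilinearSeries.sum, ser, mul_comm]
  rw [h3] at h2
  exact h2.hasFPowerSeriesAt

theorem ConvSeq.analyticAt {c : ℕ → 𝕜} (hc : ConvSeq c) : AnalyticAt 𝕜 (ser c) 0 :=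
  hc.hasFPowerSeriesAt.analyticAt

theorem AnalyticAt.convSeq {f : 𝕜 → 𝕜} (hf : AnalyticAt 𝕜 f 0) : ConvSeq (taylorSeq f) := by
  have h := hf.hasFPowerSeriesAt
  obtain ⟨r, hr0, hr⟩ := ENNReal.lt_iff_exists_nnreal_btwn.1 h.radius_pos
  refine ⟨r, by exact_mod_cast hr0, ?_⟩
  have := (FormalMultilinearSeries.ofScalars 𝕜
    fun n => iteratedDeriv n f 0 / n.factorial).summable_norm_mul_pow hr
  simpa [taylorSeq] using this

theorem AnalyticAt.eventuallyEq_ser {f : 𝕜 → 𝕜} (hf : AnalyticAt 𝕜 f 0) :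
    f =ᶠ[𝓝 0] ser (taylorSeq f) := by
  have h := hf.hasFPowerSeriesAt.eventually_hasSum
  filter_upwards [h] with s hs
  rw [zero_add] at hs
  rw [← hs.tsum_eq, ser]
  refine tsum_congr fun n => ?_
  simp [taylorSeq, mul_comm]

theorem ConvSeq.taylorSeq_ser {c : ℕ → 𝕜} (hc : ConvSeq c) : taylorSeq (ser c) = c := by
  have h1 := hc.hasFPowerSeriesAt
  have h2 := hc.analyticAt.hasFPowerSeriesAt
  have h3 := h2.eq_formalMultilinearSeries h1
  rw [FormalMultilinearSeries.ofScalars_series_eq_iff] at h3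
  exact h3

theorem taylorSeq_congr {f g : 𝕜 → 𝕜} (h : f =ᶠ[𝓝 0] g) : taylorSeq f = taylorSeq g := by
  ext j
  rw [taylorSeq, taylorSeq, h.iteratedDeriv_eq]

theorem ConvSeq.summable {c : ℕ → 𝕜} (hc : ConvSeq c) :
    ∀ᶠ s in 𝓝 (0 : 𝕜), Summable fun j => c j * s ^ j := by
  obtain ⟨r, hr, hs⟩ := hc
  filter_upwards [Metric.ball_mem_nhds (0 : 𝕜) hr] with s h
  rw [mem_ball_zero_iff] at h
  refine Summable.of_norm_bounded hs fun j => ?_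
  rw [norm_mul, norm_pow]
  gcongr

theorem ConvSeq.mono {c c' : ℕ → 𝕜} (hc : ConvSeq c) (h : ∀ j, ‖c' j‖ ≤ ‖c j‖) : ConvSeq c' := by
  obtain ⟨r, hr, hs⟩ := hc
  exact ⟨r, hr, hs.of_nonneg_of_le (fun j => by positivity) fun j => by gcongr; exact h j⟩

theorem ConvSeq.shrink {c : ℕ → 𝕜} (hc : ConvSeq c) : ∃ r : ℝ, 0 < r ∧ ∀ r', 0 < r' → r' ≤ r →
    Summable fun j => ‖c j‖ * r' ^ j := by
  obtain ⟨r, hr, hs⟩ := hc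
  exact ⟨r, hr, fun r' h1 h2 => hs.of_nonneg_of_le (fun j => by positivity) fun j => by gcongr⟩

theorem ConvSeq.sub {c c' : ℕ → 𝕜} (hc : ConvSeq c) (hc' : ConvSeq c') :
    ConvSeq fun j => c j - c' j := by
  obtain ⟨r, hr, h⟩ := hc.shrink
  obtain ⟨r', hr', h'⟩ := hc'.shrink
  have h3 : 0 < min r r' := lt_min hr hr'
  refine ⟨min r r', h3, ((h _ h3 (min_le_left _ _)).add
    (h' _ h3 (min_le_right _ _))).of_nonneg_of_le (fun j => by positivity) fun j => ?_⟩
  rw [← add_mul]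
  gcongr
  exact norm_sub_le _ _

theorem ConvSeq.neg {c : ℕ → 𝕜} (hc : ConvSeq c) : ConvSeq fun j => - c j :=
  hc.mono fun j => by simp

theorem ConvSeq.add {c c' : ℕ → 𝕜} (hc : ConvSeq c) (hc' : ConvSeq c') :
    ConvSeq fun j => c j + c' j := by
  simpa using hc.sub hc'.neg

theorem ConvSeq.ser_sub {c c' : ℕ → 𝕜} (hc : ConvSeq c) (hc' : ConvSeq c') :
    ∀ᶠ s in 𝓝 (0 : 𝕜), ser (fun j => c j - c' j) s = ser c s - ser c' s := by
  filter_upwards [hc.summable, hc'.summable] with s h h'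
  simp only [ser, sub_mul]
  exact h.tsum_sub h'

theorem ConvSeq.ser_add {c c' : ℕ → 𝕜} (hc : ConvSeq c) (hc' : ConvSeq c') :
    ∀ᶠ s in 𝓝 (0 : 𝕜), ser (fun j => c j + c' j) s = ser c s + ser c' s := by
  filter_upwards [hc.summable, hc'.summable] with s h h'
  simp only [ser, add_mul]
  exact h.tsum_add h'

/-- The coefficients of the series in `s ^ M`. -/
def ramify (c : ℕ → 𝕜) (M k : ℕ) : 𝕜 := if M ∣ k then c (k / M) else 0

theorem ramify_mul (c : ℕ → 𝕜) {M : ℕ} (hM : 0 < M) (j : ℕ) : ramify c M (M * j) = c j := by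
  simp [ramify, Nat.mul_div_cancel_left _ hM]

theorem ramify_of_not_dvd (c : ℕ → 𝕜) {M k : ℕ} (h : ¬ M ∣ k) : ramify c M k = 0 := if_neg h

theorem ser_ramify (c : ℕ → 𝕜) {M : ℕ} (hM : 0 < M) (s : 𝕜) :
    ser (ramify c M) s = ser c (s ^ M) := by
  have hinj : Function.Injective fun j : ℕ => M * j := fun a b h => Nat.eq_of_mul_eq_mul_left hM h
  rw [ser, ser, ← hinj.tsum_eq]
  · refine tsum_congr fun j => ?_
    rw [ramify_mul c hM, ← pow_mul]
  · intro k hk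
    by_contra hcon
    apply hk
    have : ¬ M ∣ k := fun ⟨j, hj⟩ => hcon ⟨j, hj.symm⟩
    simp [ramify_of_not_dvd c this]

theorem ConvSeq.ramified {c : ℕ → 𝕜} (hc : ConvSeq c) {M : ℕ} (hM : 0 < M) :
    ConvSeq (ramify c M) := by
  obtain ⟨r, hr, h⟩ := hc.shrink
  have h1 : 0 < min r 1 := lt_min hr one_pos
  refine ⟨min r 1, h1, ?_⟩
  have hinj : Function.Injective fun j : ℕ => M * j := fun a b h => Nat.eq_of_mul_eq_mul_left hM h
  rw [← hinj.summable_iff]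
  · refine (h _ h1 (min_le_left _ _)).of_nonneg_of_le (fun j => ?_) fun j => ?_
    · simp only [Function.comp]; positivity
    · simp only [Function.comp, ramify_mul c hM]
      gcongr ?_ * ?_
      exact pow_le_pow_of_le_one h1.le (min_le_right _ _) (Nat.le_mul_of_pos_left _ hM)
  · intro k hk
    have : ¬ M ∣ k := fun ⟨j, hj⟩ => hk ⟨j, hj.symm⟩
    simp [ramify_of_not_dvd c this]

/-- The coefficient of `y ^ e` in the fractional power series `∑ c j * y ^ (j / N)`. -/
def fracCoeff (N : ℕ) (c : ℕ → 𝕜) (e : ℝ) : 𝕜 :=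
  if ((⌊e * N⌋₊ : ℕ) : ℝ) = e * N then c ⌊e * N⌋₊ else 0

theorem fracCoeff_of_eq {N : ℕ} {c : ℕ → 𝕜} {e : ℝ} {j : ℕ} (h : e * N = j) :
    fracCoeff N c e = c j := by
  simp [fracCoeff, h]

theorem fracCoeff_of_ne {N : ℕ} {c : ℕ → 𝕜} {e : ℝ} (h : ∀ j : ℕ, e * N ≠ j) :
    fracCoeff N c e = 0 := if_neg fun h' => h _ h'.symm

theorem fracCoeff_ramify {N M : ℕ} (hM : 0 < M) (c : ℕ → 𝕜) (e : ℝ) :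
    fracCoeff (N * M) (ramify c M) e = fracCoeff N c e := by
  have hM' : (M : ℝ) ≠ 0 := mod_cast hM.ne'
  by_cases h : ∃ j : ℕ, e * N = j
  · obtain ⟨j, hj⟩ := h
    rw [fracCoeff_of_eq hj, fracCoeff_of_eq (j := M * j), ramify_mul c hM]
    push_cast
    rw [← mul_assoc, hj, mul_comm]
  · push Not at h
    rw [fracCoeff_of_ne h]
    by_cases h' : ∃ k : ℕ, e * ((N * M : ℕ) : ℝ) = k
    · obtain ⟨k, hk⟩ := h'
      rw [fracCoeff_of_eq hk]
      refine ramify_of_not_dvd c fun ⟨j, hj⟩ => h j ?_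
      rw [hj] at hk
      push_cast at hk
      have : (M : ℝ) * (e * N) = M * j := by rw [← hk]; ring
      exact mul_left_cancel₀ hM' this
    · push Not at h'
      exact fracCoeff_of_ne h'

theorem fracCoeff_sub (N : ℕ) (c c' : ℕ → 𝕜) (e : ℝ) :
    fracCoeff N (fun j => c j - c' j) e = fracCoeff N c e - fracCoeff N c' e := by
  unfold fracCoeff; split_ifs <;> simp

end Series

section RealSeries

theorem tendsto_rpow_nhds_zero {a : ℝ} (ha : 0 < a) :
    Tendsto (fun y : ℝ => y ^ a) (𝓝[>] 0) (𝓝 0) := by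
  simpa [Real.zero_rpow ha.ne'] using
    (Real.continuousAt_rpow_const 0 a (Or.inr ha.le)).tendsto.within

theorem tendsto_rpow_zero_right {a : ℝ} (ha : 0 < a) :
    Tendsto (fun y : ℝ => y ^ a) (𝓝[>] 0) (𝓝[>] 0) :=
  tendsto_nhdsWithin_of_tendsto_nhds_of_eventually_within _ (tendsto_rpow_nhds_zero ha)
    (by filter_upwards [self_mem_nhdsWithin] with y hy using rpow_pos_of_pos hy a)

theorem tendsto_pow_zero_right {n : ℕ} (hn : 0 < n) :
    Tendsto (fun y : ℝ => y ^ n) (𝓝[>] 0) (𝓝[>] 0) := by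
  have := tendsto_rpow_zero_right (a := (n : ℝ)) (by exact_mod_cast hn)
  simpa using this

theorem tendsto_root_zero_right {N : ℕ} (hN : 0 < N) :
    Tendsto (fun y : ℝ => y ^ (1 / (N : ℝ))) (𝓝[>] 0) (𝓝[>] 0) :=
  tendsto_rpow_zero_right (by positivity)

theorem root_pow {N : ℕ} (hN : 0 < N) {y : ℝ} (hy : 0 ≤ y) : (y ^ (1 / (N : ℝ))) ^ N = y := by
  rw [one_div]; exact Real.rpow_inv_natCast_pow hy hN.ne'

theorem pow_root {N : ℕ} (hN : 0 < N) {y : ℝ} (hy : 0 ≤ y) : (y ^ N) ^ (1 / (N : ℝ)) = y := by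
  rw [one_div]; exact Real.pow_rpow_inv_natCast hy hN.ne'

theorem ConvSeq.tendsto_ser_div {c : ℕ → ℝ} (hc : ConvSeq c) {κ : ℝ}
    (h : ∀ j : ℕ, (j : ℝ) < κ → c j = 0) :
    Tendsto (fun s => ser c s / s ^ κ) (𝓝[>] 0) (𝓝 (fracCoeff 1 c κ)) := by
  set n := ⌈κ⌉₊ with hn
  have han := hc.analyticAt
  have hcoef : ∀ i, iteratedDeriv i (ser c) 0 = i.factorial * c i := by
    intro i
    have := congrFun hc.taylorSeq_ser i
    rw [taylorSeq, div_eq_iff (by exact_mod_cast i.factorial_ne_zero)] at this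
    rw [this, mul_comm]
  obtain ⟨F, hF, hFe⟩ := han.exists_eventuallyEq_sum_add_pow_mul (n + 1)
  have hsum : ∀ᶠ s in 𝓝 (0 : ℝ), ser c s = s ^ n * (c n + s * F s) := by
    filter_upwards [hFe] with s hs
    rw [hs, sum_range_succ, sum_eq_zero]
    · simp only [hcoef, smul_eq_mul]
      have : (n.factorial : ℝ) ≠ 0 := mod_cast n.factorial_ne_zero
      field_simp
      ring
    · intro i hi
      rw [hcoef, h i (Nat.lt_ceil.1 (Finset.mem_range.1 hi))]
      simp
  have hlim : Tendsto (fun s => c n + s * F s) (𝓝[>] 0) (𝓝 (c n)) := by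
    have : ContinuousAt (fun s => c n + s * F s) 0 := by
      have := hF.continuousAt
      fun_prop
    have h2 := this.tendsto.within (s := Ioi 0)
    simpa using h2
  have heq : ∀ᶠ s in 𝓝[>] (0 : ℝ), ser c s / s ^ κ = s ^ ((n : ℝ) - κ) * (c n + s * F s) := by
    filter_upwards [hsum.within, self_mem_nhdsWithin] with s h1 h2
    rw [h1, rpow_sub h2, rpow_natCast]
    ring
  have hle : κ ≤ n := Nat.le_ceil κ
  rcases hle.eq_or_lt with heqn | hlt
  · have : fracCoeff 1 c κ = c n := fracCoeff_of_eq (by simpa using heqn)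
    rw [this]
    refine hlim.congr' ?_
    filter_upwards [heq] with s hs
    rw [hs, ← heqn, sub_self, rpow_zero, one_mul]
  · have : fracCoeff 1 c κ = 0 := by
      refine fracCoeff_of_ne fun j hj => ?_
      simp only [Nat.cast_one, mul_one] at hj
      rw [hn, hj, Nat.ceil_natCast] at hlt
      exact lt_irrefl _ hlt
    rw [this]
    have h1 : Tendsto (fun s : ℝ => s ^ ((n : ℝ) - κ)) (𝓝[>] 0) (𝓝 0) :=
      tendsto_rpow_nhds_zero (sub_pos.2 hlt)
    have h2 := h1.mul hlim
    rw [zero_mul] at h2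
    exact h2.congr' (heq.mono fun s hs => hs.symm)

theorem isBigO_rpow_of_tendsto_div {g : ℝ → ℝ} {κ a : ℝ}
    (h : Tendsto (fun s => g s / s ^ κ) (𝓝[>] 0) (𝓝 a)) :
    g =O[𝓝[>] 0] fun s => s ^ κ := by
  have h1 := h.isBigO_one ℝ
  have h2 := h1.mul (isBigO_refl (fun s : ℝ => s ^ κ) (𝓝[>] 0))
  refine (h2.congr' ?_ ?_)
  · filter_upwards [self_mem_nhdsWithin] with s hs
    have : s ^ κ ≠ 0 := (rpow_pos_of_pos hs κ).ne'
    field_simp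
  · simp

theorem tendsto_div_rpow_of_isBigO {g : ℝ → ℝ} {κ κ' : ℝ}
    (h : g =O[𝓝[>] 0] fun s => s ^ κ) (hlt : κ' < κ) :
    Tendsto (fun s => g s / s ^ κ') (𝓝[>] 0) (𝓝 0) := by
  have h1 : (fun s => g s / s ^ κ') =O[𝓝[>] 0] fun s => s ^ (κ - κ') := by
    have h2 := h.mul (isBigO_refl (fun s : ℝ => (s ^ κ')⁻¹) (𝓝[>] 0))
    refine h2.congr' ?_ ?_
    · exact Eventually.of_forall fun s => (div_eq_mul_inv _ _).symm
    · filter_upwards [self_mem_nhdsWithin] with s hs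
      rw [rpow_sub hs, div_eq_mul_inv]
  exact h1.trans_tendsto (tendsto_rpow_nhds_zero (sub_pos.2 hlt))

theorem isBigO_rpow_rpow {κ κ' : ℝ} (h : κ' ≤ κ) :
    (fun s : ℝ => s ^ κ) =O[𝓝[>] 0] fun s => s ^ κ' := by
  refine IsBigO.of_bound 1 ?_
  filter_upwards [self_mem_nhdsWithin, eventually_lt_one_right] with s (hs' : (0 : ℝ) < s) hs1
  rw [one_mul, norm_of_nonneg (by positivity), norm_of_nonneg (by positivity)]
  exact rpow_le_rpow_of_exponent_ge hs' hs1.le h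

theorem ConvSeq.coeff_eq_zero_of_isBigO {c : ℕ → ℝ} (hc : ConvSeq c) {κ : ℝ}
    (h : ser c =O[𝓝[>] 0] fun s => s ^ κ) (j : ℕ) (hj : (j : ℝ) < κ) : c j = 0 := by
  induction j using Nat.strong_induction_on with
  | _ j ih =>
  have h1 := hc.tendsto_ser_div (κ := j) fun i hi => ih i (by exact_mod_cast hi) (hi.trans hj)
  have h2 := tendsto_div_rpow_of_isBigO h hj
  have h3 := tendsto_nhds_unique h1 h2
  rwa [fracCoeff_of_eq (j := j) (by simp)] at h3

/-- The fractional power series `∑ c j * y ^ (j / N)`, as a function of `y`. -/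
def fracSer (N : ℕ) (c : ℕ → ℝ) (y : ℝ) : ℝ := ser c (y ^ (1 / (N : ℝ)))

theorem fracSer_pow {N : ℕ} (hN : 0 < N) (c : ℕ → ℝ) {s : ℝ} (hs : 0 ≤ s) :
    fracSer N c (s ^ N) = ser c s := by
  rw [fracSer, pow_root hN hs]

theorem fracSer_ramify {N M : ℕ} (hM : 0 < M) (c : ℕ → ℝ) {y : ℝ} (hy : 0 ≤ y) :
    fracSer (N * M) (ramify c M) y = fracSer N c y := by
  rw [fracSer, fracSer, ser_ramify c hM, ← rpow_natCast, ← rpow_mul hy]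
  congr 2
  have : (M : ℝ) ≠ 0 := mod_cast hM.ne'
  push_cast
  by_cases hN : (N : ℝ) = 0
  · simp [hN]
  · field_simp

theorem ConvSeq.tendsto_fracSer_div {c : ℕ → ℝ} (hc : ConvSeq c) {N : ℕ} (hN : 0 < N) {h : ℝ}
    (h0 : ∀ e < h, fracCoeff N c e = 0) :
    Tendsto (fun y => fracSer N c y / y ^ h) (𝓝[>] 0) (𝓝 (fracCoeff N c h)) := by
  have hN' : (0 : ℝ) < N := mod_cast hN
  have h1 := hc.tendsto_ser_div (κ := h * N) fun j hj => by
    have := h0 (j / N) (by rwa [div_lt_iff₀ hN'])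
    rwa [fracCoeff_of_eq (j := j) (by field_simp)] at this
  have h2 : fracCoeff 1 c (h * N) = fracCoeff N c h := by simp [fracCoeff]
  rw [h2] at h1
  refine (h1.comp (tendsto_root_zero_right hN)).congr' ?_
  filter_upwards [self_mem_nhdsWithin] with y hy
  have hy' : (0 : ℝ) ≤ y := (le_of_lt hy)
  simp only [Function.comp, fracSer]
  congr 1
  rw [← rpow_mul hy']
  congr 1
  field_simp

theorem ConvSeq.fracCoeff_eq_zero_of_isBigO {c : ℕ → ℝ} (hc : ConvSeq c) {N : ℕ} (hN : 0 < N)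
    {h : ℝ} (hO : fracSer N c =O[𝓝[>] 0] fun y => y ^ h) {e : ℝ} (he : e < h) :
    fracCoeff N c e = 0 := by
  have hN' : (0 : ℝ) < N := mod_cast hN
  by_cases hj : ∃ j : ℕ, e * N = j
  · obtain ⟨j, hj⟩ := hj
    rw [fracCoeff_of_eq hj]
    refine hc.coeff_eq_zero_of_isBigO (κ := h * N) ?_ j (by rw [← hj]; gcongr)
    have := hO.comp_tendsto (tendsto_pow_zero_right hN)
    refine this.congr' ?_ ?_
    · filter_upwards [self_mem_nhdsWithin] with s hs
      exact fracSer_pow hN c (le_of_lt hs)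
    · filter_upwards [self_mem_nhdsWithin] with s hs
      simp only [Function.comp]
      rw [← rpow_natCast, ← rpow_mul (le_of_lt hs), mul_comm]
  · push Not at hj
    exact fracCoeff_of_ne hj

/-- A fractional power series is zero or has an order. -/
theorem ConvSeq.fracSer_order {c : ℕ → ℝ} (hc : ConvSeq c) {N : ℕ} (hN : 0 < N) :
    (∀ᶠ y in 𝓝[>] (0 : ℝ), fracSer N c y = 0) ∨ ∃ q : ℝ, 0 ≤ q ∧ ∃ a : ℝ, a ≠ 0 ∧
        Tendsto (fun y => fracSer N c y / y ^ q) (𝓝[>] 0) (𝓝 a) := by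
  classical
  have hN' : (0 : ℝ) < N := mod_cast hN
  by_cases h : ∃ j, c j ≠ 0
  · right
    refine ⟨Nat.find h / N, by positivity, c (Nat.find h), Nat.find_spec h, ?_⟩
    have := hc.tendsto_fracSer_div hN (h := Nat.find h / N) fun e he => ?_
    · rwa [fracCoeff_of_eq (j := Nat.find h) (by field_simp)] at this
    · by_cases hj : ∃ j : ℕ, e * N = j
      · obtain ⟨j, hj⟩ := hj
        rw [fracCoeff_of_eq hj]
        rw [lt_div_iff₀ hN', hj] at he
        by_contra hcon
        exact Nat.find_min h (by exact_mod_cast he) hcon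
      · push Not at hj
        exact fracCoeff_of_ne hj
  · left
    push Not at h
    exact Eventually.of_forall fun y => by simp [fracSer, ser, h]

/-- The difference of two fractional power series, on a common denominator. -/
theorem ConvSeq.fracSer_sub {c c' : ℕ → ℝ} (hc : ConvSeq c) (hc' : ConvSeq c') {N N' : ℕ}
    (hN : 0 < N) (hN' : 0 < N') :
    ∀ᶠ y in 𝓝[>] (0 : ℝ), fracSer N c y - fracSer N' c' y =
      fracSer (N * N') (fun j => ramify c N' j - ramify c' N j) y := by
  have h1 := (hc.ramified hN').ser_sub (hc'.ramified hN)
  have h2 := (tendsto_root_zero_right (Nat.mul_pos hN hN')).of_within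
  filter_upwards [h2.eventually h1, self_mem_nhdsWithin] with y hy hy0
  have hy0' : (0 : ℝ) ≤ y := le_of_lt hy0
  rw [← fracSer_ramify hN' c hy0', ← fracSer_ramify hN c' hy0', mul_comm N' N]
  exact hy.symm

theorem fracCoeff_ramify_sub {c c' : ℕ → ℝ} {N N' : ℕ} (hN : 0 < N) (hN' : 0 < N') (e : ℝ) :
    fracCoeff (N * N') (fun j => ramify c N' j - ramify c' N j) e =
      fracCoeff N c e - fracCoeff N' c' e := by
  rw [fracCoeff_sub, fracCoeff_ramify hN', mul_comm N N', fracCoeff_ramify hN]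

theorem fracCoeff_eq_of_isBigO {c c' : ℕ → ℝ} (hc : ConvSeq c) (hc' : ConvSeq c') {N N' : ℕ}
    (hN : 0 < N) (hN' : 0 < N') {h : ℝ}
    (hO : (fun y => fracSer N c y - fracSer N' c' y) =O[𝓝[>] 0] fun y => y ^ h) {e : ℝ}
    (he : e < h) : fracCoeff N c e = fracCoeff N' c' e := by
  rw [← sub_eq_zero, ← fracCoeff_ramify_sub hN hN']
  refine ((hc.ramified hN').sub (hc'.ramified hN)).fracCoeff_eq_zero_of_isBigO
    (Nat.mul_pos hN hN') (hO.congr' ?_ EventuallyEq.rfl) he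
  exact hc.fracSer_sub hc' hN hN'

theorem tendsto_fracSer_sub_div {c c' : ℕ → ℝ} (hc : ConvSeq c) (hc' : ConvSeq c') {N N' : ℕ}
    (hN : 0 < N) (hN' : 0 < N') {h : ℝ} (he : ∀ e < h, fracCoeff N c e = fracCoeff N' c' e) :
    Tendsto (fun y => (fracSer N c y - fracSer N' c' y) / y ^ h) (𝓝[>] 0)
      (𝓝 (fracCoeff N c h - fracCoeff N' c' h)) := by
  rw [← fracCoeff_ramify_sub hN hN']
  refine (((hc.ramified hN').sub (hc'.ramified hN)).tendsto_fracSer_div (Nat.mul_pos hN hN')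
    fun e heh => ?_).congr' ?_
  · rw [fracCoeff_ramify_sub hN hN', he e heh, sub_self]
  · filter_upwards [hc.fracSer_sub hc' hN hN'] with y hy
    rw [hy]

theorem fracSer_sub_order {c c' : ℕ → ℝ} (hc : ConvSeq c) (hc' : ConvSeq c') {N N' : ℕ}
    (hN : 0 < N) (hN' : 0 < N') :
    (∀ᶠ y in 𝓝[>] (0 : ℝ), fracSer N c y = fracSer N' c' y) ∨ ∃ q : ℝ, 0 ≤ q ∧ ∃ a : ℝ, a ≠ 0 ∧
        Tendsto (fun y => (fracSer N c y - fracSer N' c' y) / y ^ q) (𝓝[>] 0) (𝓝 a) := by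
  rcases ((hc.ramified hN').sub (hc'.ramified hN)).fracSer_order (Nat.mul_pos hN hN') with h | h
  · left
    filter_upwards [h, hc.fracSer_sub hc' hN hN'] with y h1 h2
    rw [h1] at h2
    linarith
  · obtain ⟨q, hq, a, ha, h⟩ := h
    refine Or.inr ⟨q, hq, a, ha, h.congr' ?_⟩
    filter_upwards [hc.fracSer_sub hc' hN hN'] with y hy
    rw [hy]

end RealSeries

/-! ### Arcs as fractional power series, and their contact orders -/

section Arcs

namespace RArc

/-- The arc as a function of `|y|`. -/
def X (γ : RArc) (y : ℝ) : ℝ := fracSer γ.d γ.coeff y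

/-- The sign of `y` on the arc, as a real number. -/
def ε (γ : RArc) : ℝ := ((γ.sgn : ℤ) : ℝ)

theorem ε_cases (γ : RArc) : γ.ε = 1 ∨ γ.ε = -1 := by
  rcases Int.units_eq_one_or γ.sgn with h | h <;> simp [ε, h]

theorem abs_ε (γ : RArc) : |γ.ε| = 1 := by rcases γ.ε_cases with h | h <;> simp [h]

theorem ε_ne_zero (γ : RArc) : γ.ε ≠ 0 := by rcases γ.ε_cases with h | h <;> simp [h]

theorem sgn_eq_iff {γ μ : RArc} : γ.sgn = μ.sgn ↔ γ.ε = μ.ε := by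
  rcases Int.units_eq_one_or γ.sgn with h | h <;> rcases Int.units_eq_one_or μ.sgn with h' | h' <;>
    simp [ε, h, h'] <;> norm_num

theorem ε_eq_neg {γ μ : RArc} (h : γ.sgn ≠ μ.sgn) : μ.ε = - γ.ε := by
  rw [Ne, sgn_eq_iff] at h
  rcases γ.ε_cases with h1 | h1 <;> rcases μ.ε_cases with h2 | h2 <;> simp_all

theorem convSeq (γ : RArc) : ConvSeq γ.coeff := γ.convergent

theorem x_eq (γ : RArc) : γ.x = ser γ.coeff := rfl

theorem coeffAt_eq (γ : RArc) (e : ℝ) : γ.coeffAt e = fracCoeff γ.d γ.coeff e := rfl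

theorem y_eq (γ : RArc) (s : ℝ) : γ.y s = γ.ε * s ^ γ.d := rfl

theorem analyticAt_x (γ : RArc) : AnalyticAt ℝ γ.x 0 := γ.convSeq.analyticAt

theorem X_pow (γ : RArc) {s : ℝ} (hs : 0 ≤ s) : γ.X (s ^ γ.d) = γ.x s := fracSer_pow γ.d_pos _ hs

theorem X_eq (γ : RArc) (y : ℝ) : γ.X y = γ.x (y ^ (1 / (γ.d : ℝ))) := rfl

/-- The series of an arc starts with a term `s ^ d` or later. -/
theorem exists_x_eq (γ : RArc) : ∃ k : ℝ → ℝ, AnalyticAt ℝ k 0 ∧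
    ∀ᶠ s in 𝓝 (0 : ℝ), γ.x s = s ^ γ.d * k s := by
  obtain ⟨k, hk, h⟩ := γ.analyticAt_x.exists_eventuallyEq_sum_add_pow_mul γ.d
  refine ⟨k, hk, ?_⟩
  filter_upwards [h] with s hs
  rw [hs, sum_eq_zero]
  · simp
  · intro i hi
    have := congrFun γ.convSeq.taylorSeq_ser i
    rw [taylorSeq, div_eq_iff (by exact_mod_cast i.factorial_ne_zero),
      γ.coeff_eq_zero i (Finset.mem_range.1 hi), zero_mul] at this
    rw [x_eq, this]
    simp

theorem x_zero (γ : RArc) : γ.x 0 = 0 := by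
  obtain ⟨k, -, h⟩ := γ.exists_x_eq
  rw [h.self_of_nhds, zero_pow γ.d_pos.ne', zero_mul]

theorem toComplex_zero (γ : RArc) : γ.toComplex 0 = 0 := by simp [toComplex, x_zero, y, γ.d_pos.ne']

/-- The function `X` is Lipschitz near `0`, in terms of the parameter of the arc. -/
theorem exists_lipschitz_x (γ : RArc) : ∃ L > (0 : ℝ), ∃ r > (0 : ℝ), ∀ s ∈ Icc 0 r, ∀ s' ∈ Icc 0 r,
    |γ.x s - γ.x s'| ≤ L * |s ^ γ.d - s' ^ γ.d| := by
  obtain ⟨k, hk, hx⟩ := γ.exists_x_eq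
  obtain ⟨K, U, hU, hlip⟩ := (hk.contDiffAt (n := 1)).exists_lipschitzOnWith
  have hb : ∀ᶠ s in 𝓝 (0 : ℝ), |k s| < |k 0| + 1 :=
    hk.continuousAt.abs.tendsto.eventually (gt_mem_nhds (lt_add_one _))
  obtain ⟨r₀, hr₀, hball⟩ := Metric.mem_nhds_iff.1 (inter_mem (inter_mem hU hb) hx)
  set r := min (r₀ / 2) 1
  have hr1 : r ≤ 1 := min_le_right _ _
  have hmem : ∀ s ∈ Icc 0 r, s ∈ U ∧ |k s| < |k 0| + 1 ∧ γ.x s = s ^ γ.d * k s := by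
    intro s hs
    have : s ∈ ball (0 : ℝ) r₀ := by
      rw [mem_ball_zero_iff, norm_of_nonneg hs.1]
      have := min_le_left (r₀ / 2) 1
      linarith [hs.2]
    exact ⟨(hball this).1.1, (hball this).1.2, (hball this).2⟩
  have key : ∀ s ∈ Icc 0 r, ∀ s' ∈ Icc 0 r, s' ≤ s →
      |γ.x s - γ.x s'| ≤ (|k 0| + 1 + K) * |s ^ γ.d - s' ^ γ.d| := by
    intro s hs s' hs' hle
    obtain ⟨h1, h2, h3⟩ := hmem s hs
    obtain ⟨h1', h2', h3'⟩ := hmem s' hs'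
    have hpow : s' ^ γ.d ≤ s ^ γ.d := pow_le_pow_left₀ hs'.1 hle _
    have hk1 : |k s - k s'| ≤ K * (s - s') := by
      have := hlip.dist_le_mul s h1 s' h1'
      rwa [Real.dist_eq, Real.dist_eq, abs_of_nonneg (sub_nonneg.2 hle)] at this
    have hk2 : s' ^ γ.d * (s - s') ≤ s ^ γ.d - s' ^ γ.d := by
      obtain ⟨n, hn⟩ := Nat.exists_eq_succ_of_ne_zero γ.d_pos.ne'
      rw [hn, pow_succ, pow_succ]
      have e1 : s' ^ n ≤ s ^ n := pow_le_pow_left₀ hs'.1 hle _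
      have e2 : 0 ≤ s' ^ n := pow_nonneg hs'.1 _
      have e3 : s' ≤ 1 := hs'.2.trans hr1
      calc s' ^ n * s' * (s - s') ≤ s' ^ n * 1 * (s - s') := by
            gcongr
        _ = s' ^ n * s - s' ^ n * s' := by ring
        _ ≤ s ^ n * s - s' ^ n * s' := by
            have := hs.1
            gcongr
    have : γ.x s - γ.x s' = (s ^ γ.d - s' ^ γ.d) * k s + s' ^ γ.d * (k s - k s') := by
      rw [h3, h3']; ring
    rw [this, abs_of_nonneg (sub_nonneg.2 hpow)]
    have e0 : 0 ≤ s' ^ γ.d := pow_nonneg hs'.1 _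
    calc _ ≤ |(s ^ γ.d - s' ^ γ.d) * k s| + |s' ^ γ.d * (k s - k s')| := abs_add_le _ _
      _ = (s ^ γ.d - s' ^ γ.d) * |k s| + s' ^ γ.d * |k s - k s'| := by
        rw [abs_mul, abs_mul, abs_of_nonneg (sub_nonneg.2 hpow), abs_of_nonneg e0]
      _ ≤ (s ^ γ.d - s' ^ γ.d) * (|k 0| + 1) + s' ^ γ.d * (K * (s - s')) := by gcongr
      _ = (s ^ γ.d - s' ^ γ.d) * (|k 0| + 1) + K * (s' ^ γ.d * (s - s')) := by ring
      _ ≤ (s ^ γ.d - s' ^ γ.d) * (|k 0| + 1) + K * (s ^ γ.d - s' ^ γ.d) := by gcongr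
      _ = _ := by ring
  refine ⟨|k 0| + 1 + K, by positivity, r, by positivity, fun s hs s' hs' => ?_⟩
  rcases le_total s' s with h | h
  · exact key s hs s' hs' h
  · rw [abs_sub_comm, abs_sub_comm (s ^ γ.d)]
    exact key s' hs' s hs h

theorem exists_lipschitz_X (γ : RArc) : ∃ L > (0 : ℝ), ∃ r > (0 : ℝ), ∀ y ∈ Icc 0 r, ∀ y' ∈ Icc 0 r,
    |γ.X y - γ.X y'| ≤ L * |y - y'| := by
  obtain ⟨L, hL, r, hr, h⟩ := γ.exists_lipschitz_x
  have aux : ∀ y ∈ Icc 0 (r ^ γ.d), y ^ (1 / (γ.d : ℝ)) ∈ Icc 0 r := by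
    intro y hy
    refine ⟨rpow_nonneg hy.1 _, ?_⟩
    calc y ^ (1 / (γ.d : ℝ)) ≤ (r ^ γ.d) ^ (1 / (γ.d : ℝ)) :=
          rpow_le_rpow hy.1 hy.2 (by positivity)
      _ = r := pow_root γ.d_pos hr.le
  refine ⟨L, hL, r ^ γ.d, by positivity, fun y hy y' hy' => ?_⟩
  have := h _ (aux y hy) _ (aux y' hy')
  rwa [root_pow γ.d_pos hy.1, root_pow γ.d_pos hy'.1] at this

theorem X_isBigO (γ : RArc) : γ.X =O[𝓝[>] 0] fun y => y ^ (1 : ℝ) := by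
  obtain ⟨L, hL, r, hr, h⟩ := γ.exists_lipschitz_X
  refine IsBigO.of_bound L ?_
  filter_upwards [Ioc_mem_nhdsGT hr] with y hy
  have := h y ⟨hy.1.le, hy.2⟩ 0 ⟨le_rfl, hr.le⟩
  have h0 : γ.X 0 = 0 := by
    rw [X_eq, Real.zero_rpow, x_zero]
    have := γ.d_pos
    positivity
  rw [h0, sub_zero, sub_zero] at this
  rw [rpow_one]
  exact this

theorem X_tendsto (γ : RArc) : Tendsto γ.X (𝓝[>] 0) (𝓝 0) := by
  refine γ.X_isBigO.trans_tendsto ?_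
  simpa using tendsto_rpow_nhds_zero one_pos

theorem norm_toComplex_bounds (γ : RArc) : ∃ K : ℝ, 1 ≤ K ∧
    ∀ᶠ s in 𝓝[>] (0 : ℝ), s ^ γ.d ≤ ‖γ.toComplex s‖ ∧ ‖γ.toComplex s‖ ≤ K * s ^ γ.d := by
  obtain ⟨L, hL, r, hr, h⟩ := γ.exists_lipschitz_x
  refine ⟨max L 1, le_max_right _ _, ?_⟩
  filter_upwards [Ioc_mem_nhdsGT hr] with s hs
  have h1 := h s ⟨hs.1.le, hs.2⟩ 0 ⟨le_rfl, hr.le⟩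
  have hpos : 0 < s ^ γ.d := pow_pos hs.1 _
  rw [x_zero, zero_pow γ.d_pos.ne', sub_zero, sub_zero, abs_of_pos hpos] at h1
  have hy : |γ.y s| = s ^ γ.d := by rw [y_eq, abs_mul, abs_ε, one_mul, abs_of_pos hpos]
  have hn : ‖γ.toComplex s‖ = max |γ.x s| (s ^ γ.d) := by
    rw [toComplex, Prod.norm_mk, norm_real, norm_real, norm_eq_abs, norm_eq_abs, hy]
  rw [hn]
  refine ⟨le_max_right _ _, max_le (h1.trans ?_) ?_⟩
  · gcongr; exact le_max_left _ _
  · nlinarith [le_max_right L 1]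

theorem norm_toComplex_rpow (γ : RArc) {h : ℝ} (hh : 0 ≤ h) :
    (fun s => ‖γ.toComplex s‖ ^ h) =Θ[𝓝[>] 0] fun s => (s ^ γ.d) ^ h := by
  obtain ⟨K, hK, hs⟩ := γ.norm_toComplex_bounds
  constructor
  · refine IsBigO.of_bound (K ^ h) ?_
    filter_upwards [hs, self_mem_nhdsWithin] with s h1 h2
    have hpos : 0 < s ^ γ.d := pow_pos h2 _
    rw [norm_of_nonneg (by positivity), norm_of_nonneg (by positivity),
      ← mul_rpow (by positivity) hpos.le]
    exact rpow_le_rpow (norm_nonneg _) h1.2 hh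
  · refine IsBigO.of_bound 1 ?_
    filter_upwards [hs, self_mem_nhdsWithin] with s h1 h2
    have hpos : 0 < s ^ γ.d := pow_pos h2 _
    rw [norm_of_nonneg (by positivity), norm_of_nonneg (by positivity), one_mul]
    exact rpow_le_rpow hpos.le h1.1 hh

/-- The distance of the points of `γ` from the locus of `w` is `O (|y| ^ h)`. -/
def Near (γ : RArc) (w : ℝ → ℂ × ℂ) (h : ℝ) : Prop :=
  ∀ ε > (0 : ℝ), (fun s => infDist (γ.toComplex s) (w '' Ico 0 ε))
    =O[𝓝[>] (0 : ℝ)] fun s => (s ^ γ.d) ^ h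

theorem Near.mono {γ : RArc} {w : ℝ → ℂ × ℂ} {h h' : ℝ} (H : γ.Near w h) (hle : h' ≤ h) :
    γ.Near w h' := fun ε hε =>
  (H ε hε).trans ((isBigO_rpow_rpow hle).comp_tendsto (tendsto_pow_zero_right γ.d_pos))

theorem Near.le {γ : RArc} {w : ℝ → ℂ × ℂ} {h : ℝ} (H : γ.Near w h) :
    ENNReal.ofReal h ≤ contactOrder γ.toComplex w := by
  rcases le_or_gt h 0 with hh | hh
  · rw [ENNReal.ofReal_of_nonpos hh]; exact zero_le
  · refine le_iSup₂_of_le h.toNNReal ?_ le_rfl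
    intro ε hε
    rw [Real.coe_toNNReal _ hh.le]
    exact (H ε hε).trans (γ.norm_toComplex_rpow hh.le).2

theorem near_of_lt {γ : RArc} {w : ℝ → ℂ × ℂ} {h : ℝ}
    (H : ENNReal.ofReal h < contactOrder γ.toComplex w) : γ.Near w h := by
  rw [contactOrder, lt_iSup_iff] at H
  obtain ⟨k, hk⟩ := H
  rw [lt_iSup_iff] at hk
  obtain ⟨hk1, hk2⟩ := hk
  have hle : h ≤ k := by
    by_contra hcon
    push Not at hcon
    exact absurd hk2 (not_lt.2 (by
      rw [← ENNReal.ofReal_coe_nnreal]; exact ENNReal.ofReal_le_ofReal hcon.le))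
  refine Near.mono (h := k) (fun ε hε => ?_) hle
  exact (hk1 ε hε).trans (γ.norm_toComplex_rpow k.2).1

theorem one_le_contactOrder (γ : RArc) {w : ℝ → ℂ × ℂ} (hw : w 0 = 0) :
    1 ≤ contactOrder γ.toComplex w := by
  have : γ.Near w 1 := by
    intro ε hε
    refine IsBigO.trans (g := fun s => ‖γ.toComplex s‖ ^ (1 : ℝ)) ?_
      (γ.norm_toComplex_rpow zero_le_one).1
    refine IsBigO.of_bound 1 (Eventually.of_forall fun s => ?_)
    rw [norm_of_nonneg infDist_nonneg, rpow_one, norm_norm, one_mul]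
    have := Metric.infDist_le_dist_of_mem (x := γ.toComplex s)
      (mem_image_of_mem w (show (0 : ℝ) ∈ Ico 0 ε from ⟨le_rfl, hε⟩))
    rwa [hw, dist_zero_right] at this
  simpa using this.le

theorem one_le_contact (γ μ : RArc) : 1 ≤ γ.contact μ := γ.one_le_contactOrder μ.toComplex_zero

theorem dist_toComplex (γ μ : RArc) (s s' : ℝ) :
    dist (γ.toComplex s) (μ.toComplex s') = max |γ.x s - μ.x s'| |γ.y s - μ.y s'| := by
  rw [Prod.dist_eq, toComplex, toComplex]
  simp only [dist_eq_norm, ← Complex.ofReal_sub, norm_real, norm_eq_abs]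

theorem contact_of_sgn_ne {γ μ : RArc} (h : γ.sgn ≠ μ.sgn) : γ.contact μ = 1 := by
  refine le_antisymm ?_ (γ.one_le_contact μ)
  by_contra hcon
  push Not at hcon
  obtain ⟨q, hq1, hq2⟩ := ENNReal.lt_iff_exists_nnreal_btwn.1 hcon
  have hq : (1 : ℝ) < q := mod_cast hq1
  have hnear : γ.Near μ.toComplex q := near_of_lt (by rw [ENNReal.ofReal_coe_nnreal]; exact hq2)
  have h1 := hnear 1 one_pos
  have h2 : (fun s : ℝ => (s ^ γ.d) ^ (1 : ℝ)) =O[𝓝[>] 0] fun s => (s ^ γ.d) ^ (q : ℝ) := by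
    refine IsBigO.trans ?_ h1
    refine IsBigO.of_bound 1 ?_
    filter_upwards [self_mem_nhdsWithin] with s hs
    have hpos : 0 < s ^ γ.d := pow_pos hs _
    rw [norm_of_nonneg infDist_nonneg, rpow_one, one_mul,
      norm_of_nonneg hpos.le, Metric.le_infDist ⟨_, mem_image_of_mem _
        (show (0 : ℝ) ∈ Ico 0 1 from ⟨le_rfl, one_pos⟩)⟩]
    rintro _ ⟨s', hs', rfl⟩
    rw [dist_toComplex]
    refine le_trans ?_ (le_max_right _ _)
    rw [y_eq, y_eq, ε_eq_neg h, show γ.ε * s ^ γ.d - -γ.ε * s' ^ μ.d =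
      γ.ε * (s ^ γ.d + s' ^ μ.d) by ring, abs_mul, abs_ε, one_mul]
    have : 0 ≤ s' ^ μ.d := pow_nonneg hs'.1 _
    rw [abs_of_nonneg (by positivity)]
    linarith
  have h3 : (fun y : ℝ => y ^ (1 : ℝ)) =O[𝓝[>] 0] fun y => y ^ (q : ℝ) := by
    refine (h2.comp_tendsto (tendsto_root_zero_right γ.d_pos)).congr' ?_ ?_ <;>
    · filter_upwards [self_mem_nhdsWithin] with y hy
      simp only [Function.comp]
      rw [root_pow γ.d_pos (le_of_lt hy)]
  have h4 := tendsto_div_rpow_of_isBigO h3 hq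
  refine zero_ne_one (tendsto_nhds_unique h4 (tendsto_const_nhds.congr' ?_))
  filter_upwards [self_mem_nhdsWithin] with y hy
  have : y ≠ 0 := ne_of_gt hy
  rw [rpow_one, div_self this]

theorem near_iff {γ μ : RArc} (hs : γ.sgn = μ.sgn) {h : ℝ} :
    γ.Near μ.toComplex h ↔ (fun y => γ.X y - μ.X y) =O[𝓝[>] 0] fun y => y ^ h := by
  have hε : γ.ε = μ.ε := sgn_eq_iff.1 hs
  constructor
  · intro H
    obtain ⟨L, hL, r, hr, hlip⟩ := μ.exists_lipschitz_x
    have h1 := (H r hr).comp_tendsto (tendsto_root_zero_right γ.d_pos)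
    have h2 : (fun y => γ.X y - μ.X y) =O[𝓝[>] 0]
        ((fun s => infDist (γ.toComplex s) (μ.toComplex '' Ico 0 r)) ∘
          fun y : ℝ => y ^ (1 / (γ.d : ℝ))) := by
      refine IsBigO.of_bound (1 + L) ?_
      have hev : ∀ᶠ y : ℝ in 𝓝[>] 0, y ^ (1 / (μ.d : ℝ)) < r :=
        ((tendsto_root_zero_right μ.d_pos).of_within).eventually (gt_mem_nhds hr)
      filter_upwards [self_mem_nhdsWithin, hev] with y hy hyr
      have hy0 : (0 : ℝ) ≤ y := le_of_lt hy
      simp only [Function.comp]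
      rw [norm_of_nonneg infDist_nonneg, norm_eq_abs, ← div_le_iff₀' (by positivity),
        Metric.le_infDist ⟨_, mem_image_of_mem _ (show (0 : ℝ) ∈ Ico 0 r from ⟨le_rfl, hr⟩)⟩]
      rintro _ ⟨s', hs', rfl⟩
      rw [dist_toComplex, div_le_iff₀' (by positivity)]
      set M := max |γ.x (y ^ (1 / (γ.d : ℝ))) - μ.x s'| |γ.y (y ^ (1 / (γ.d : ℝ))) - μ.y s'|
      have e1 : |γ.X y - μ.x s'| ≤ M := le_max_left _ _
      have e2 : |y - s' ^ μ.d| ≤ M := by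
        refine le_trans (le_of_eq ?_) (le_max_right _ _)
        rw [y_eq, y_eq, hε, ← mul_sub, abs_mul, abs_ε, one_mul, root_pow γ.d_pos hy0]
      have e3 := hlip _ ⟨rpow_nonneg hy0 _, hyr.le⟩ s' ⟨hs'.1, hs'.2.le⟩
      rw [root_pow μ.d_pos hy0] at e3
      calc |γ.X y - μ.X y| ≤ |γ.X y - μ.x s'| + |μ.X y - μ.x s'| := by
            rw [show γ.X y - μ.X y = (γ.X y - μ.x s') - (μ.X y - μ.x s') by ring]
            exact abs_sub _ _
        _ ≤ M + L * |y - s' ^ μ.d| := add_le_add e1 e3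
        _ ≤ M + L * M := by gcongr
        _ = _ := by ring
    refine (h2.trans h1).congr' EventuallyEq.rfl ?_
    filter_upwards [self_mem_nhdsWithin] with y hy
    simp only [Function.comp]
    rw [root_pow γ.d_pos (le_of_lt hy)]
  · intro H ε hε0
    have h1 := H.comp_tendsto (tendsto_pow_zero_right γ.d_pos)
    refine IsBigO.trans ?_ h1
    refine IsBigO.of_bound 1 ?_
    have hev : ∀ᶠ s : ℝ in 𝓝[>] 0, (s ^ γ.d) ^ (1 / (μ.d : ℝ)) < ε :=
      (((tendsto_root_zero_right μ.d_pos).comp (tendsto_pow_zero_right γ.d_pos)).of_within).eventually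
        (gt_mem_nhds hε0)
    filter_upwards [self_mem_nhdsWithin, hev] with s hs0 hse
    have hs1 : (0 : ℝ) ≤ s := le_of_lt hs0
    have hp : 0 ≤ s ^ γ.d := pow_nonneg hs1 _
    rw [norm_of_nonneg infDist_nonneg, one_mul]
    refine (Metric.infDist_le_dist_of_mem
      (mem_image_of_mem μ.toComplex (show _ ∈ Ico 0 ε from ⟨rpow_nonneg hp _, hse⟩))).trans
        (le_of_eq ?_)
    rw [dist_toComplex, y_eq, y_eq, root_pow μ.d_pos hp, hε, sub_self, abs_zero,
      max_eq_left (abs_nonneg _)]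
    simp only [Function.comp]
    rw [X_pow _ hs1, norm_eq_abs]
    rfl

theorem isBigO_of_forall_lt {γ μ : RArc} {h : ℝ}
    (H : ∀ h' < h, 0 < h' → (fun y => γ.X y - μ.X y) =O[𝓝[>] 0] fun y => y ^ h') :
    (fun y => γ.X y - μ.X y) =O[𝓝[>] 0] fun y => y ^ h := by
  rcases fracSer_sub_order γ.convSeq μ.convSeq γ.d_pos μ.d_pos with h1 | ⟨q, hq, a, ha, hlim⟩
  · refine IsBigO.of_bound 1 ?_
    filter_upwards [h1, self_mem_nhdsWithin] with y hy hy0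
    have : γ.X y - μ.X y = 0 := sub_eq_zero.2 hy
    rw [this, norm_zero]
    positivity
  · have hO := isBigO_rpow_of_tendsto_div hlim
    rcases le_or_gt h q with hhq | hhq
    · exact hO.trans (isBigO_rpow_rpow hhq)
    · exfalso
      obtain ⟨h', h1, h2⟩ := exists_between hhq
      exact ha (tendsto_nhds_unique hlim (tendsto_div_rpow_of_isBigO (H h' h2 (hq.trans_lt h1)) h1))

/-- The contact order of two arcs in one half plane is the order of the difference of their
series. -/
theorem le_contact_iff {γ μ : RArc} (hs : γ.sgn = μ.sgn) {h : ℝ} :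
    ENNReal.ofReal h ≤ γ.contact μ ↔ (fun y => γ.X y - μ.X y) =O[𝓝[>] 0] fun y => y ^ h := by
  rw [← near_iff hs]
  refine ⟨fun H => ?_, fun H => H.le⟩
  rw [near_iff hs]
  refine isBigO_of_forall_lt fun h' h1 h0 => (near_iff hs).1 (near_of_lt (lt_of_lt_of_le ?_ H))
  exact (ENNReal.ofReal_lt_ofReal_iff (h0.trans h1)).2 h1

end RArc

theorem ENNReal.le_of_forall_one_lt {a b : ℝ≥0∞} (hb : 1 ≤ b)
    (h : ∀ x : ℝ, 1 < x → ENNReal.ofReal x ≤ a → ENNReal.ofReal x ≤ b) : a ≤ b := by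
  by_contra hcon
  push Not at hcon
  obtain ⟨q, h1, h2⟩ := ENNReal.lt_iff_exists_nnreal_btwn.1 hcon
  have := h q (by exact_mod_cast hb.trans_lt h1) (by simpa using h2.le)
  rw [ENNReal.ofReal_coe_nnreal] at this
  exact absurd h1 (not_lt.2 this)

theorem ENNReal.eq_of_forall_one_lt {a b : ℝ≥0∞} (ha : 1 ≤ a) (hb : 1 ≤ b)
    (h : ∀ x : ℝ, 1 < x → (ENNReal.ofReal x ≤ a ↔ ENNReal.ofReal x ≤ b)) : a = b :=
  le_antisymm (ENNReal.le_of_forall_one_lt hb fun x hx => (h x hx).1)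
    (ENNReal.le_of_forall_one_lt ha fun x hx => (h x hx).2)

namespace RArc

theorem contact_comm (γ μ : RArc) : γ.contact μ = μ.contact γ := by
  by_cases hs : γ.sgn = μ.sgn
  · refine ENNReal.eq_of_forall_one_lt (γ.one_le_contact μ) (μ.one_le_contact γ) fun x _ => ?_
    rw [le_contact_iff hs, le_contact_iff hs.symm, ← isBigO_neg_left]
    simp only [neg_sub]
  · rw [contact_of_sgn_ne hs, contact_of_sgn_ne fun h => hs h.symm]

theorem sgn_eq_of_lt_contact {γ μ : RArc} (h : 1 < γ.contact μ) : γ.sgn = μ.sgn := by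
  by_contra hs
  rw [contact_of_sgn_ne hs] at h
  exact lt_irrefl _ h

/-- The contact order is ultrametric. -/
theorem contact_ultra (γ μ ν : RArc) : min (γ.contact μ) (μ.contact ν) ≤ γ.contact ν := by
  refine ENNReal.le_of_forall_one_lt (γ.one_le_contact ν) fun x hx h => ?_
  have hx' : 1 < ENNReal.ofReal x := by
    rw [← ENNReal.ofReal_one]; exact (ENNReal.ofReal_lt_ofReal_iff (by linarith)).2 hx
  have h1 := h.trans (min_le_left _ _)
  have h2 := h.trans (min_le_right _ _)
  have s1 := sgn_eq_of_lt_contact (hx'.trans_le h1)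
  have s2 := sgn_eq_of_lt_contact (hx'.trans_le h2)
  rw [le_contact_iff s1] at h1
  rw [le_contact_iff s2] at h2
  rw [le_contact_iff (s1.trans s2)]
  simpa using h1.add h2

theorem coeffAt_eq_of_lt_contact {γ μ : RArc} (hs : γ.sgn = μ.sgn) {e : ℝ}
    (he : ENNReal.ofReal e < γ.contact μ) : γ.coeffAt e = μ.coeffAt e := by
  have he' : ∃ h : ℝ, e < h ∧ ENNReal.ofReal h ≤ γ.contact μ := by
    obtain ⟨q, h1, h2⟩ := ENNReal.lt_iff_exists_nnreal_btwn.1 he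
    refine ⟨q, ?_, by simpa using h2.le⟩
    rw [← ENNReal.ofReal_coe_nnreal] at h1
    exact (ENNReal.ofReal_lt_ofReal_iff').1 h1 |>.1
  obtain ⟨h, h1, h2⟩ := he'
  exact fracCoeff_eq_of_isBigO γ.convSeq μ.convSeq γ.d_pos μ.d_pos ((le_contact_iff hs).1 h2) h1

theorem tendsto_sub_div {γ μ : RArc} {h : ℝ}
    (hO : (fun y => γ.X y - μ.X y) =O[𝓝[>] 0] fun y => y ^ h) :
    Tendsto (fun y => (γ.X y - μ.X y) / y ^ h) (𝓝[>] 0) (𝓝 (γ.coeffAt h - μ.coeffAt h)) :=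
  tendsto_fracSer_sub_div γ.convSeq μ.convSeq γ.d_pos μ.d_pos fun _ he =>
    fracCoeff_eq_of_isBigO γ.convSeq μ.convSeq γ.d_pos μ.d_pos hO he

theorem coeffAt_truncate (γ : RArc) (h : ℝ≥0∞) (e : ℝ) :
    (γ.truncate h).coeffAt e = if ENNReal.ofReal e < h then γ.coeffAt e else 0 := by
  have hd : (0 : ℝ) < γ.d := mod_cast γ.d_pos
  by_cases hj : ∃ j : ℕ, e * γ.d = j
  · obtain ⟨j, hj⟩ := hj
    rw [coeffAt_eq, coeffAt_eq, fracCoeff_of_eq (N := (γ.truncate h).d) hj, fracCoeff_of_eq hj]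
    have : (j : ℝ) / γ.d = e := by rw [← hj]; field_simp
    simp only [truncate, this]
  · push Not at hj
    rw [coeffAt_eq, coeffAt_eq, fracCoeff_of_ne (N := (γ.truncate h).d) hj, fracCoeff_of_ne hj]
    simp

end RArc

end Arcs

/-! ### Bars in terms of heights and contact orders -/

section Bars

namespace RArc

theorem Near.transfer {γ μ : RArc} (hs : γ.sgn = μ.sgn) {w : ℝ → ℂ × ℂ} {h : ℝ}
    (H : γ.Near w h) (hO : (fun y => γ.X y - μ.X y) =O[𝓝[>] 0] fun y => y ^ h) : μ.Near w h := by
  intro ε hε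
  have hsgn : γ.ε = μ.ε := sgn_eq_iff.1 hs
  have ht : Tendsto (fun s : ℝ => (s ^ μ.d) ^ (1 / (γ.d : ℝ))) (𝓝[>] 0) (𝓝[>] 0) :=
    (tendsto_root_zero_right γ.d_pos).comp (tendsto_pow_zero_right μ.d_pos)
  have h1 := (H ε hε).comp_tendsto ht
  have h2 := hO.comp_tendsto (tendsto_pow_zero_right μ.d_pos)
  have h1' : ((fun s => infDist (γ.toComplex s) (w '' Ico 0 ε)) ∘
      fun s : ℝ => (s ^ μ.d) ^ (1 / (γ.d : ℝ))) =O[𝓝[>] 0] fun s => (s ^ μ.d) ^ h := by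
    refine h1.congr' EventuallyEq.rfl ?_
    filter_upwards [self_mem_nhdsWithin] with s hs0
    simp only [Function.comp]
    rw [root_pow γ.d_pos (pow_nonneg (le_of_lt hs0) _)]
  refine IsBigO.trans ?_ (h1'.norm_left.add h2.norm_left)
  refine IsBigO.of_bound 1 ?_
  filter_upwards [self_mem_nhdsWithin] with s hs0
  have hs1 : (0 : ℝ) ≤ s := le_of_lt hs0
  have hp : 0 ≤ s ^ μ.d := pow_nonneg hs1 _
  simp only [Function.comp]
  rw [norm_of_nonneg infDist_nonneg, one_mul,
    norm_of_nonneg (add_nonneg (norm_nonneg _) (norm_nonneg _)),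
    norm_of_nonneg infDist_nonneg]
  refine (Metric.infDist_le_infDist_add_dist (y := γ.toComplex ((s ^ μ.d) ^ (1 / (γ.d : ℝ))))).trans
    ?_
  gcongr
  rw [dist_toComplex, y_eq, y_eq, root_pow γ.d_pos hp, hsgn, sub_self, abs_zero,
    max_eq_left (abs_nonneg _), X_pow _ hs1, norm_eq_abs, abs_sub_comm]
  rfl

end RArc

theorem fHeight_ultra {f : ℝ × ℝ → ℝ} (hf : ∀ γ, 1 ≤ fHeight f γ) (γ μ : RArc) :
    min (fHeight f γ) (γ.contact μ) ≤ fHeight f μ := by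
  by_contra hcon
  push Not at hcon
  obtain ⟨q, h1, h2⟩ := ENNReal.lt_iff_exists_nnreal_btwn.1 hcon
  have hq : (1 : ℝ≥0∞) < q := (hf μ).trans_lt h1
  have h3 : (q : ℝ≥0∞) < γ.contact μ := h2.trans_le (min_le_right _ _)
  have hs := RArc.sgn_eq_of_lt_contact (hq.trans h3)
  have h4 : (q : ℝ≥0∞) < fHeight f γ := h2.trans_le (min_le_left _ _)
  rw [fHeight, lt_iSup_iff] at h4
  obtain ⟨ζ, h5⟩ := h4
  rw [lt_iSup_iff] at h5
  obtain ⟨hζ, h5⟩ := h5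
  rw [← ENNReal.ofReal_coe_nnreal] at h5 h3 h1
  have h6 := (RArc.near_of_lt h5).transfer hs ((RArc.le_contact_iff hs).1 h3.le)
  exact absurd h1 (not_lt.2 (h6.le.trans (le_iSup₂_of_le ζ hζ le_rfl)))

theorem mem_bar_iff {f : ℝ × ℝ → ℝ} {γ μ : RArc} : μ ∈ bar f γ ↔
    γ.sgn = μ.sgn ∧ fHeight f γ = fHeight f μ ∧ fHeight f γ ≤ γ.contact μ := by
  simp only [bar, fArc, mem_ofPred_eq]
  refine and_congr_right fun _ => ⟨?_, ?_⟩
  · rintro (⟨h1, h2 | h2⟩ | ⟨h1, h2⟩)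
    · exact ⟨h1, h2.le⟩
    · exact ⟨h1, h2 ▸ le_top⟩
    · exact ⟨h1, h2.le⟩
  · rintro ⟨h1, h2⟩
    rcases h2.lt_or_eq with h | h
    · exact Or.inl ⟨h1, Or.inl h⟩
    · exact Or.inr ⟨h1, h⟩

theorem RArc.contact_self (γ : RArc) : γ.contact γ = ⊤ := by
  rw [eq_top_iff]
  refine ENNReal.le_of_forall_one_lt (γ.one_le_contact γ) fun x _ _ => ?_
  rw [RArc.le_contact_iff rfl]
  simp only [sub_self]
  exact isBigO_zero _ _

theorem self_mem_bar (f : ℝ × ℝ → ℝ) (γ : RArc) : γ ∈ bar f γ :=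
  mem_bar_iff.2 ⟨rfl, rfl, γ.contact_self ▸ le_top⟩

theorem mem_bar_of_mem_fArc {f : ℝ × ℝ → ℝ} (hf : ∀ γ, 1 ≤ fHeight f γ) {γ μ : RArc}
    (h : μ ∈ fArc f γ) : μ ∈ bar f γ := by
  refine ⟨?_, Or.inl h⟩
  refine RArc.sgn_eq_of_lt_contact ?_
  rcases h.2 with h1 | h1
  · exact (hf γ).trans_lt h1
  · rw [h1]; exact ENNReal.one_lt_top

theorem bar_symm {f : ℝ × ℝ → ℝ} {γ μ : RArc} (h : μ ∈ bar f γ) : γ ∈ bar f μ := by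
  rw [mem_bar_iff] at h ⊢
  refine ⟨h.1.symm, h.2.1.symm, ?_⟩
  rw [RArc.contact_comm, ← h.2.1]
  exact h.2.2

theorem bar_trans {f : ℝ × ℝ → ℝ} {γ μ ν : RArc} (h : μ ∈ bar f γ) (h' : ν ∈ bar f μ) :
    ν ∈ bar f γ := by
  rw [mem_bar_iff] at h h' ⊢
  refine ⟨h.1.trans h'.1, h.2.1.trans h'.2.1, ?_⟩
  refine (le_min h.2.2 ?_).trans (RArc.contact_ultra γ μ ν)
  rw [h.2.1]; exact h'.2.2

theorem bar_eq_of_mem {f : ℝ × ℝ → ℝ} {γ μ : RArc} (h : μ ∈ bar f γ) : bar f μ = bar f γ :=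
  Subset.antisymm (fun _ h' => bar_trans h h') fun _ h' => bar_trans (bar_symm h) h'

theorem bar_eq_iff {f : ℝ × ℝ → ℝ} {γ μ : RArc} : bar f γ = bar f μ ↔ μ ∈ bar f γ :=
  ⟨fun h => h ▸ self_mem_bar f μ, fun h => (bar_eq_of_mem h).symm⟩

/-- The contact order of two arcs in different bars does not exceed their heights. -/
theorem contact_le_of_notMem_bar {f : ℝ × ℝ → ℝ} (hf : ∀ γ, 1 ≤ fHeight f γ) {γ μ : RArc}
    (h : μ ∉ bar f γ) : γ.contact μ ≤ min (fHeight f γ) (fHeight f μ) := by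
  by_cases hs : γ.sgn = μ.sgn
  swap
  · rw [RArc.contact_of_sgn_ne hs]; exact le_min (hf γ) (hf μ)
  have h1 := fHeight_ultra hf γ μ
  have h2 := fHeight_ultra hf μ γ
  rw [RArc.contact_comm μ γ] at h2
  rw [mem_bar_iff] at h
  by_contra hcon
  push Not at hcon
  apply h
  refine ⟨hs, ?_⟩
  rcases le_total (fHeight f γ) (fHeight f μ) with hle | hle
  · rw [min_eq_left hle] at hcon
    rcases min_le_iff.1 h2 with h3 | h3
    · exact ⟨le_antisymm hle h3, hcon.le⟩
    · exact absurd hcon (not_lt.2 h3)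
  · rw [min_eq_right hle] at hcon
    rcases min_le_iff.1 h1 with h3 | h3
    · exact ⟨le_antisymm h3 hle, h3.trans hcon.le⟩
    · exact absurd hcon (not_lt.2 h3)

theorem barContact_of_notMem {f : ℝ × ℝ → ℝ} (hf : ∀ γ, 1 ≤ fHeight f γ) {γ μ : RArc}
    (h : μ ∉ bar f γ) : barContact (bar f γ) (bar f μ) = γ.contact μ := by
  have hne : bar f γ ≠ bar f μ := fun h' => h (bar_eq_iff.1 h')
  have key : ∀ γ' ∈ bar f γ, ∀ μ' ∈ bar f μ, γ'.contact μ' ≤ γ.contact μ := by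
    intro γ' hγ' μ' hμ'
    have hn' : μ' ∉ bar f γ' := by
      intro hcon
      exact h (bar_trans (bar_trans hγ' hcon) (bar_symm hμ'))
    have h2 := contact_le_of_notMem_bar hf hn'
    have e1 := (mem_bar_iff.1 hγ').2
    have e2 := (mem_bar_iff.1 (bar_symm hμ')).2
    refine le_trans (le_min ?_ ?_) (RArc.contact_ultra γ γ' μ)
    · exact h2.trans ((min_le_left _ _).trans (e1.1 ▸ e1.2))
    · exact le_trans (le_min le_rfl (h2.trans ((min_le_right _ _).trans e2.2)))
        (RArc.contact_ultra γ' μ' μ)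
  rw [barContact, if_neg hne]
  refine le_antisymm (iSup₂_le fun γ' hγ' => iSup₂_le fun μ' hμ' => key γ' hγ' μ' hμ') ?_
  exact le_iSup₂_of_le γ (self_mem_bar f γ) (le_iSup₂_of_le μ (self_mem_bar f μ) le_rfl)

theorem sameSeries_canonicalRep {f : ℝ × ℝ → ℝ} {γ μ : RArc} (h : μ ∈ bar f γ) :
    (canonicalRep f μ).SameSeries (canonicalRep f γ) := by
  rw [mem_bar_iff] at h
  refine ⟨h.1.symm, fun e => ?_⟩
  rw [canonicalRep, canonicalRep, RArc.coeffAt_truncate, RArc.coeffAt_truncate, ← h.2.1]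
  split_ifs with he
  · exact (RArc.coeffAt_eq_of_lt_contact h.1 (he.trans_le h.2.2)).symm
  · rfl

end Bars

/-! ### Analytic families of arcs -/

section Families

/-- The arc with the series of `γ` plus `∑ c j * |y| ^ (j / D)`. -/
def RArc.addSeries (γ : RArc) {D : ℕ} (hD : 0 < D) {c : ℕ → ℝ} (hc : ConvSeq c)
    (h0 : ∀ j < D, c j = 0) : RArc where
  sgn := γ.sgn
  d := γ.d * D
  d_pos := Nat.mul_pos γ.d_pos hD
  coeff := fun j => ramify γ.coeff D j + ramify c γ.d j
  coeff_eq_zero := by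
    intro j hj
    have h1 : ramify γ.coeff D j = 0 := by
      rw [ramify]
      split_ifs
      · exact γ.coeff_eq_zero _ ((Nat.div_lt_iff_lt_mul hD).2 hj)
      · rfl
    have h2 : ramify c γ.d j = 0 := by
      rw [ramify]
      split_ifs
      · exact h0 _ ((Nat.div_lt_iff_lt_mul γ.d_pos).2 (by rwa [mul_comm]))
      · rfl
    rw [h1, h2, add_zero]
  convergent := (γ.convSeq.ramified hD).add (hc.ramified γ.d_pos)

theorem RArc.X_addSeries (γ : RArc) {D : ℕ} (hD : 0 < D) {c : ℕ → ℝ} (hc : ConvSeq c)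
    (h0 : ∀ j < D, c j = 0) :
    ∀ᶠ y in 𝓝[>] (0 : ℝ), (γ.addSeries hD hc h0).X y = γ.X y + fracSer D c y := by
  have h1 := (γ.convSeq.ramified hD).ser_add (hc.ramified γ.d_pos)
  have h2 := (tendsto_root_zero_right (Nat.mul_pos γ.d_pos hD)).of_within
  filter_upwards [h2.eventually h1, self_mem_nhdsWithin] with y hy hy0
  have hy0' : (0 : ℝ) ≤ y := le_of_lt hy0
  rw [X, X, ← fracSer_ramify hD γ.coeff hy0', ← fracSer_ramify γ.d_pos c hy0', mul_comm D γ.d]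
  exact hy

theorem analyticAt_taylorSeq_slice {M : ℝ × ℝ → ℝ} {t₀ : ℝ} (hM : AnalyticAt ℝ M (0, t₀)) (j : ℕ) :
    AnalyticAt ℝ (fun t => taylorSeq (fun σ => M (σ, t)) j) t₀ := by
  obtain ⟨R, hR⟩ := hM.exists_isTaylorSeq
  refine (hR.analyticAt_coeff j).congr ?_
  filter_upwards [hR.iteratedDeriv_eq j] with t ht
  rw [taylorSeq, ht]
  have : (j.factorial : ℝ) ≠ 0 := mod_cast j.factorial_ne_zero
  field_simp

theorem analyticAt_slice {M : ℝ × ℝ → ℝ} {t₀ : ℝ} (hM : AnalyticAt ℝ M (0, t₀)) :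
    AnalyticAt ℝ (fun σ => M (σ, t₀)) 0 :=
  AnalyticAt.fun_comp (g := M) (f := fun σ : ℝ => (σ, t₀)) hM (by fun_prop)

/-- Adding to a fixed arc the deviation of an analytic family of power series from its member at
`t = 0` gives an analytic family of arcs. -/
theorem exists_isAnalyticFamily (γ : RArc) {D : ℕ} (hD : 0 < D) {M : ℝ × ℝ → ℝ} {δ : ℝ} (hδ : 0 < δ)
    (hM : ∀ t ∈ Ioo (-δ) δ, AnalyticAt ℝ M (0, t))
    (hO : ∀ t ∈ Ioo (-δ) δ, (fun σ => M (σ, t) - M (σ, 0)) =O[𝓝[>] 0] fun σ : ℝ => σ ^ (D : ℝ)) :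
    ∃ Γ : ℝ → RArc, IsAnalyticFamily δ Γ ∧ ∀ t ∈ Ioo (-δ) δ, (Γ t).sgn = γ.sgn ∧
      ∀ᶠ y in 𝓝[>] (0 : ℝ), (Γ t).X y =
        γ.X y + (M (y ^ (1 / (D : ℝ)), t) - M (y ^ (1 / (D : ℝ)), 0)) := by
  classical
  have h0 : (0 : ℝ) ∈ Ioo (-δ) δ := ⟨by linarith, hδ⟩
  let c : ℝ → ℕ → ℝ := fun t j => if t ∈ Ioo (-δ) δ then
    taylorSeq (fun σ => M (σ, t)) j - taylorSeq (fun σ => M (σ, 0)) j else 0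
  have hcin : ∀ t ∈ Ioo (-δ) δ, c t = fun j =>
      taylorSeq (fun σ => M (σ, t)) j - taylorSeq (fun σ => M (σ, 0)) j := fun t ht => by
    ext j; simp only [c, if_pos ht]
  have hser : ∀ t ∈ Ioo (-δ) δ, ∀ᶠ σ in 𝓝 (0 : ℝ), ser (c t) σ = M (σ, t) - M (σ, 0) := by
    intro t ht
    rw [hcin t ht]
    filter_upwards [(analyticAt_slice (hM t ht)).convSeq.ser_sub
      (analyticAt_slice (hM 0 h0)).convSeq, (analyticAt_slice (hM t ht)).eventuallyEq_ser,
      (analyticAt_slice (hM 0 h0)).eventuallyEq_ser] with σ e1 e2 e3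
    rw [e1, ← e2, ← e3]
  have hconv : ∀ t, ConvSeq (c t) := by
    intro t
    by_cases ht : t ∈ Ioo (-δ) δ
    · rw [hcin t ht]
      exact (analyticAt_slice (hM t ht)).convSeq.sub (analyticAt_slice (hM 0 h0)).convSeq
    · have : c t = fun _ => 0 := by ext j; simp only [c, if_neg ht]
      rw [this]
      exact ⟨1, one_pos, by simp⟩
  have hzero : ∀ t, ∀ j < D, c t j = 0 := by
    intro t j hj
    by_cases ht : t ∈ Ioo (-δ) δ
    · refine (hconv t).coeff_eq_zero_of_isBigO (κ := D) ((hO t ht).congr' ?_ EventuallyEq.rfl) j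
        (by exact_mod_cast hj)
      filter_upwards [(hser t ht).within] with σ hσ
      exact hσ.symm
    · simp only [c, if_neg ht]
  refine ⟨fun t => γ.addSeries hD (hconv t) (hzero t), ⟨fun t _ => ⟨rfl, rfl⟩, fun j t ht => ?_⟩,
    fun t ht => ⟨rfl, ?_⟩⟩
  · have e : (fun t => (γ.addSeries hD (hconv t) (hzero t)).coeff j) =ᶠ[𝓝 t] fun t =>
        ramify γ.coeff D j + if γ.d ∣ j then taylorSeq (fun σ => M (σ, t)) (j / γ.d) -
          taylorSeq (fun σ => M (σ, 0)) (j / γ.d) else 0 := by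
      filter_upwards [isOpen_Ioo.mem_nhds ht] with t ht
      simp only [RArc.addSeries, ramify, hcin t ht]
    refine AnalyticAt.congr ?_ e.symm
    split_ifs
    · have := analyticAt_taylorSeq_slice (hM t ht) (j / γ.d)
      fun_prop
    · fun_prop
  · filter_upwards [γ.X_addSeries hD (hconv t) (hzero t),
      ((tendsto_root_zero_right hD).of_within).eventually (hser t ht)]
      with y h1 h2
    rw [h1, fracSer, h2]

end Families

/-! ### The Newton dots of a function relative to an arc -/

section Dots

/-- A germ vanishing at `0` and of finite order along the `x`-axis. -/
def RegularX (f : ℝ × ℝ → ℝ) : Prop :=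
  AnalyticAt ℝ f 0 ∧ f 0 = 0 ∧ ∃ m, iteratedDeriv m (fun x => f (x, 0)) 0 ≠ 0

/-- The germ `f` is `O (|y| ^ e)` on every horn `|x - γ (y)| ≤ K * |y| ^ h`. -/
def RelBound (f : ℝ × ℝ → ℝ) (γ : RArc) (h e : ℝ) : Prop :=
  ∀ K : ℝ, ∃ C : ℝ, ∀ᶠ y in 𝓝[>] (0 : ℝ), ∀ X : ℝ, |X| ≤ K * y ^ h →
    |f (γ.X y + X, γ.ε * y)| ≤ C * y ^ e

/-- Shrinking the horns beyond the exponent `h` does not improve the vanishing order of `f`. -/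
def IsStableAt (f : ℝ × ℝ → ℝ) (γ : RArc) (h : ℝ) : Prop :=
  ∀ h' ≥ h, ∀ e, RelBound f γ h' e → RelBound f γ h e

/-- No exponent between `0` and `h` is stable. This says that the height is at least `h`, see
`le_fHeight_iff`. -/
def HeightGE (f : ℝ × ℝ → ℝ) (γ : RArc) (h : ℝ) : Prop :=
  ∀ h', 0 < h' → h' < h → ¬ IsStableAt f γ h'

theorem eventually_forall_of_isCompact {X Y : Type*} [TopologicalSpace X] {K : Set X}
    (hK : IsCompact K) {l : Filter Y} {p : X × Y → Prop}
    (h : ∀ x ∈ K, ∀ᶠ z in 𝓝 x ×ˢ l, p z) : ∀ᶠ y in l, ∀ x ∈ K, p (x, y) := by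
  have h1 : ∀ᶠ z in 𝓝ˢ K ×ˢ l, p z := by
    rw [hK.nhdsSet_prod_eq_biSup]
    simpa only [eventually_iSup] using h
  have h2 : ∀ᶠ z in 𝓟 K ×ˢ l, p z := h1.filter_mono (prod_mono_left _ principal_le_nhdsSet)
  rw [prod_comm, eventually_map, eventually_prod_principal_iff] at h2
  exact h2

/-- The dots `(i, ν i)`, `i ∈ S`, span the Newton polygon of `f` relative to `γ`; `l i` is the
leading coefficient of the coefficient of `X ^ i`, and `m` is the order of `f` along the
`x`-axis. -/
structure IsDots (f : ℝ × ℝ → ℝ) (γ : RArc) (S : Finset ℕ) (ν l : ℕ → ℝ) (m : ℕ) : Prop where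
  mem : m ∈ S
  pos : 0 < m
  zero : ν m = 0
  ne : ∀ i ∈ S, l i ≠ 0
  lim : ∀ h > 0, ∀ E : ℝ, (∀ i ∈ S, E ≤ ν i + h * i) → ∀ u : ℝ,
    Tendsto (fun z : ℝ × ℝ => f (γ.X z.2 + z.1 * z.2 ^ h, γ.ε * z.2) / z.2 ^ E)
      (𝓝 u ×ˢ 𝓝[>] 0) (𝓝 (∑ i ∈ S, if ν i + h * i = E then l i * u ^ i else 0))
  exists_relCoeff : ∀ i ∈ S, ∃ j : ℕ, relCoeff f γ i j ≠ 0 ∧ (j : ℝ) / γ.d = ν i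
  of_relCoeff : ∀ i j, relCoeff f γ i j ≠ 0 → ∃ i' ∈ S, i' ≤ i ∧ ν i' ≤ (j : ℝ) / γ.d

theorem AnalyticAt.taylorSeq_dichotomy {α : ℝ → ℝ} (h : AnalyticAt ℝ α 0) :
    ((∀ᶠ s in 𝓝 (0 : ℝ), α s = 0) ∧ ∀ j, taylorSeq α j = 0) ∨
    ∃ (n : ℕ) (u : ℝ → ℝ), AnalyticAt ℝ u 0 ∧ u 0 ≠ 0 ∧ (∀ᶠ s in 𝓝 (0 : ℝ), α s = s ^ n * u s) ∧
      taylorSeq α n ≠ 0 ∧ ∀ j, taylorSeq α j ≠ 0 → n ≤ j := by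
  by_cases h0 : ∀ᶠ s in 𝓝 (0 : ℝ), α s = 0
  · left
    refine ⟨h0, fun j => ?_⟩
    rw [taylorSeq_congr (g := fun _ => 0) h0]
    simp [taylorSeq, iteratedDeriv_fun_const_zero]
  · right
    obtain ⟨n, u, hu, hu0, hα⟩ := h.exists_eventuallyEq_pow_smul_nonzero_iff.2 h0
    have hord : analyticOrderAt α 0 = n := h.analyticOrderAt_eq_natCast.2 ⟨u, hu, hu0, hα⟩
    have hiff := fun k : ℕ => natCast_le_analyticOrderAt_iff_iteratedDeriv_eq_zero (n := k) h
    have hlow : ∀ j < n, taylorSeq α j = 0 := fun j hj => by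
      rw [taylorSeq, (hiff n).1 hord.ge j hj, zero_div]
    refine ⟨n, u, hu, hu0, by simpa using hα, fun hcon => ?_, fun j hj => ?_⟩
    · have : ((n + 1 : ℕ) : ℕ∞) ≤ analyticOrderAt α 0 := by
        refine (hiff (n + 1)).2 fun i hi => ?_
        rcases Nat.lt_succ_iff_lt_or_eq.1 hi with h1 | h1
        · exact (hiff n).1 hord.ge i h1
        · rw [h1]
          rw [taylorSeq, div_eq_zero_iff] at hcon
          exact hcon.resolve_right (by exact_mod_cast n.factorial_ne_zero)
      rw [hord] at this
      exact absurd (Nat.cast_le.1 this) (by omega)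
    · by_contra hcon
      push Not at hcon
      exact hj (hlow j hcon)

theorem RegularX.exists_isDots {f : ℝ × ℝ → ℝ} (hf : RegularX f) (γ : RArc) :
    ∃ S ν l m, IsDots f γ S ν l m := by
  classical
  obtain ⟨hf1, hf2, m₀, hm₀⟩ := hf
  have hG : AnalyticAt ℝ (fun z : ℝ × ℝ => f (γ.x z.2 + z.1, γ.y z.2)) (0, 0) := by
    have hx : AnalyticAt ℝ (fun z : ℝ × ℝ => γ.x z.2) (0, 0) :=
      AnalyticAt.fun_comp (g := γ.x) (f := fun z : ℝ × ℝ => z.2) γ.analyticAt_x (by fun_prop)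
    refine AnalyticAt.fun_comp (g := f) (f := fun z : ℝ × ℝ => (γ.x z.2 + z.1, γ.y z.2)) ?_ ?_
    · simp only [RArc.x_zero, RArc.y_eq, zero_pow γ.d_pos.ne', mul_zero, add_zero]
      exact hf1
    · simp only [RArc.y_eq]
      fun_prop
  obtain ⟨R, hR⟩ := hG.exists_isTaylorSeq
  have hder := fun i => hR.iteratedDeriv_eq i
  have hex : ∃ i, R i (0, 0) ≠ 0 := by
    refine ⟨m₀, fun hcon => hm₀ ?_⟩
    have := (hder m₀).self_of_nhds
    simp only [RArc.x_zero, zero_add, RArc.y_eq, zero_pow γ.d_pos.ne', mul_zero, hcon] at this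
    exact this
  set m := Nat.find hex
  have hmne : R m (0, 0) ≠ 0 := Nat.find_spec hex
  have hm0 : 0 < m := by
    rw [Nat.pos_iff_ne_zero]
    intro h0
    rw [h0, hR.zero] at hmne
    simp only [RArc.x_zero, zero_add, RArc.y_eq, zero_pow γ.d_pos.ne', mul_zero] at hmne
    exact hmne hf2
  have hα : ∀ i, AnalyticAt ℝ (fun s => R i (0, s)) 0 := fun i => hR.analyticAt_coeff i
  have hrel : ∀ i j, relCoeff f γ i j = taylorSeq (fun s => R i (0, s)) j := by
    intro i j
    have h1 : (fun s => iteratedDeriv i (fun X => f (X + γ.x s, γ.y s)) 0) =ᶠ[𝓝 0]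
        fun s => (i.factorial : ℝ) * R i (0, s) := by
      filter_upwards [hder i] with s hs
      rw [← hs]
      simp only [add_comm]
    rw [relCoeff, h1.iteratedDeriv_eq, iteratedDeriv_const_mul_field, taylorSeq]
    field_simp
  have hdich := fun i => (hα i).taylorSeq_dichotomy
  let P : ℕ → Prop := fun i => ∀ᶠ s in 𝓝 (0 : ℝ), R i (0, s) = 0
  have hchoice : ∀ i, ∃ (n : ℕ) (u : ℝ → ℝ), (i = m → n = 0) ∧ (¬ P i → ContinuousAt u 0 ∧ u 0 ≠ 0 ∧
      (∀ᶠ s in 𝓝 (0 : ℝ), R i (0, s) = s ^ n * u s) ∧ relCoeff f γ i n ≠ 0 ∧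
      ∀ j, relCoeff f γ i j ≠ 0 → n ≤ j) := by
    intro i
    rcases hdich i with h | ⟨n, u, h1, h2, h3, h4, h5⟩
    · exact ⟨0, 0, fun _ => rfl, fun h' => absurd h.1 h'⟩
    · refine ⟨n, u, fun him => ?_, fun _ => ⟨h1.continuousAt, h2, h3, by rwa [hrel],
        fun j hj => h5 j (by rwa [hrel] at hj)⟩⟩
      by_contra hn
      have := h3.self_of_nhds
      rw [zero_pow hn, zero_mul, him] at this
      exact hmne this
  choose n u hn hu using hchoice
  have hPm : ¬ P m := fun h => hmne h.self_of_nhds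
  have hrel0 : ∀ i, P i → ∀ j, relCoeff f γ i j = 0 := by
    intro i hi j
    rw [hrel, taylorSeq_congr (g := fun _ => 0) hi]
    simp [taylorSeq, iteratedDeriv_fun_const_zero]
  refine ⟨(Finset.range (m + 1)).filter fun i => ¬ P i, fun i => (n i : ℝ) / γ.d, fun i => u i 0, m,
    ⟨?_, hm0, ?_, ?_, ?_, ?_, ?_⟩⟩
  · simp [hPm]
  · rw [hn m rfl]; simp
  · intro i hi
    exact (hu i (mem_filter.1 hi).2).2.1
  · intro h hh E hE w
    have hy : Tendsto (fun z : ℝ × ℝ => z.2) (𝓝 w ×ˢ 𝓝[>] 0) (𝓝[>] 0) := tendsto_snd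
    have hw : Tendsto (fun z : ℝ × ℝ => z.1) (𝓝 w ×ˢ 𝓝[>] 0) (𝓝 w) := tendsto_fst
    have hs : Tendsto (fun z : ℝ × ℝ => z.2 ^ (1 / (γ.d : ℝ))) (𝓝 w ×ˢ 𝓝[>] 0) (𝓝 0) :=
      ((tendsto_root_zero_right γ.d_pos).comp hy).of_within
    have hX : Tendsto (fun z : ℝ × ℝ => z.1 * z.2 ^ h) (𝓝 w ×ˢ 𝓝[>] 0) (𝓝 0) := by
      have := hw.mul (((tendsto_rpow_zero_right hh).comp hy).of_within)
      simpa using this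
    have hXs : Tendsto (fun z : ℝ × ℝ => (z.1 * z.2 ^ h, z.2 ^ (1 / (γ.d : ℝ))))
        (𝓝 w ×ˢ 𝓝[>] 0) (𝓝 (0, 0)) := hX.prodMk_nhds hs
    have hexp := hXs.eventually (hR.expand m)
    have hpos : ∀ᶠ z : ℝ × ℝ in 𝓝 w ×ˢ 𝓝[>] 0, 0 < z.2 := hy.eventually self_mem_nhdsWithin
    -- each monomial of the expansion, after division by `y ^ E`
    have hpw : ∀ i ∈ (Finset.range (m + 1)).filter fun i => ¬ P i,
        Tendsto (fun z : ℝ × ℝ => z.2 ^ ((n i : ℝ) / γ.d + h * i - E)) (𝓝 w ×ˢ 𝓝[>] 0)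
          (𝓝 (if (n i : ℝ) / γ.d + h * i = E then 1 else 0)) := by
      intro i hi
      split_ifs with he
      · simp [he]
      · have : 0 < (n i : ℝ) / γ.d + h * i - E := sub_pos.2 (lt_of_le_of_ne (hE i hi) (Ne.symm he))
        exact ((tendsto_rpow_zero_right this).comp hy).of_within
    have hsplit : ∀ i, ∀ᶠ z : ℝ × ℝ in 𝓝 w ×ˢ 𝓝[>] 0, (z.1 * z.2 ^ h) ^ i *
        (z.2 ^ (1 / (γ.d : ℝ))) ^ n i / z.2 ^ E =
          z.1 ^ i * z.2 ^ ((n i : ℝ) / γ.d + h * i - E) := by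
      intro i
      filter_upwards [hpos] with z hz
      rw [mul_pow, ← rpow_natCast (z.2 ^ h), ← rpow_mul hz.le,
        ← rpow_natCast (z.2 ^ (1 / (γ.d : ℝ))), ← rpow_mul hz.le, rpow_sub hz,
        rpow_add hz]
      rw [show 1 / (γ.d : ℝ) * n i = n i / γ.d by ring]
      ring
    have hterm : ∀ i ∈ Finset.range m, Tendsto (fun z : ℝ × ℝ => (z.1 * z.2 ^ h) ^ i *
        R i (0, z.2 ^ (1 / (γ.d : ℝ))) / z.2 ^ E) (𝓝 w ×ˢ 𝓝[>] 0)
          (𝓝 (if ¬ P i then (if (n i : ℝ) / γ.d + h * i = E then u i 0 * w ^ i else 0)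
            else 0)) := by
      intro i hi
      by_cases hP : P i
      · rw [if_neg (not_not.2 hP)]
        refine tendsto_const_nhds.congr' ?_
        filter_upwards [hs.eventually hP] with z hz
        rw [hz]; simp
      · rw [if_pos hP]
        have hi' : i ∈ (Finset.range (m + 1)).filter fun i => ¬ P i := by
          rw [mem_filter, Finset.mem_range] at *
          exact ⟨by omega, hP⟩
        obtain ⟨h1, h2, h3, -, -⟩ := hu i hP
        have := ((hw.pow i).mul (hpw i hi')).mul (h1.tendsto.comp hs)
        have e : w ^ i * (if (n i : ℝ) / γ.d + h * i = E then 1 else 0) * u i 0 =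
            if (n i : ℝ) / γ.d + h * i = E then u i 0 * w ^ i else 0 := by
          split_ifs <;> ring
        rw [e] at this
        refine this.congr' ?_
        filter_upwards [hs.eventually h3, hsplit i] with z hz hz2
        rw [← hz2, hz, Function.comp]
        ring
    have htop : Tendsto (fun z : ℝ × ℝ => (z.1 * z.2 ^ h) ^ m *
        R m (z.1 * z.2 ^ h, z.2 ^ (1 / (γ.d : ℝ))) / z.2 ^ E) (𝓝 w ×ˢ 𝓝[>] 0)
          (𝓝 (if (n m : ℝ) / γ.d + h * m = E then u m 0 * w ^ m else 0)) := by
      have hm' : m ∈ (Finset.range (m + 1)).filter fun i => ¬ P i := by simp [hPm]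
      have hRm := ((hR.analyticAt m).continuousAt.tendsto).comp hXs
      have := ((hw.pow m).mul (hpw m hm')).mul hRm
      have hu0 : u m 0 = R m (0, 0) := by
        have := (hu m hPm).2.2.1.self_of_nhds
        rw [hn m rfl, pow_zero, one_mul] at this
        exact this.symm
      have e : w ^ m * (if (n m : ℝ) / γ.d + h * m = E then 1 else 0) * R m (0, 0) =
          if (n m : ℝ) / γ.d + h * m = E then u m 0 * w ^ m else 0 := by
        rw [hu0]; split_ifs <;> ring
      rw [e] at this
      refine this.congr' ?_
      filter_upwards [hsplit m] with z hz2
      rw [← hz2, hn m rfl, pow_zero, Function.comp]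
      ring
    have hall := (tendsto_finsetSum _ hterm).add htop
    have esum : (∑ i ∈ Finset.range m, if ¬ P i then
        (if (n i : ℝ) / γ.d + h * i = E then u i 0 * w ^ i else 0) else 0) +
        (if (n m : ℝ) / γ.d + h * m = E then u m 0 * w ^ m else 0) =
        ∑ i ∈ (Finset.range (m + 1)).filter fun i => ¬ P i,
          if (n i : ℝ) / γ.d + h * i = E then u i 0 * w ^ i else 0 := by
      rw [Finset.sum_filter, sum_range_succ, if_pos hPm]
    rw [esum] at hall
    refine hall.congr' ?_
    filter_upwards [hexp, hpos] with z hz hz0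
    have : f (γ.X z.2 + z.1 * z.2 ^ h, γ.ε * z.2) =
        f (γ.x (z.2 ^ (1 / (γ.d : ℝ))) + z.1 * z.2 ^ h, γ.y (z.2 ^ (1 / (γ.d : ℝ)))) := by
      rw [RArc.y_eq, root_pow γ.d_pos hz0.le]; rfl
    rw [this, hz, add_div, Finset.sum_div]
  · intro i hi
    exact ⟨n i, (hu i (mem_filter.1 hi).2).2.2.2.1, rfl⟩
  · intro i j hij
    have hPi : ¬ P i := fun h => hij (hrel0 i h j)
    rcases le_or_gt i m with him | him
    · refine ⟨i, ?_, le_rfl, ?_⟩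
      · rw [mem_filter, Finset.mem_range]; exact ⟨by omega, hPi⟩
      · have := (hu i hPi).2.2.2.2 j hij
        gcongr
    · refine ⟨m, by simp [hPm], him.le, ?_⟩
      rw [hn m rfl]
      simp only [Nat.cast_zero, zero_div]
      positivity

end Dots

section Initial

variable {f : ℝ × ℝ → ℝ} {γ μ : RArc} {S : Finset ℕ} {ν l : ℕ → ℝ} {m : ℕ} {h e : ℝ}

/-- The initial polynomial at the exponent `h` with order `E`. -/
def initialPoly (S : Finset ℕ) (ν l : ℕ → ℝ) (h E : ℝ) : ℝ[X] :=
  ∑ i ∈ S, if ν i + h * i = E then monomial i (l i) else 0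

theorem eval_initialPoly (S : Finset ℕ) (ν l : ℕ → ℝ) (h E u : ℝ) :
    (initialPoly S ν l h E).eval u = ∑ i ∈ S, if ν i + h * i = E then l i * u ^ i else 0 := by
  rw [initialPoly, eval_finsetSum]
  refine sum_congr rfl fun i _ => ?_
  split_ifs <;> simp

theorem coeff_initialPoly (S : Finset ℕ) (ν l : ℕ → ℝ) (h E : ℝ) (k : ℕ) :
    (initialPoly S ν l h E).coeff k = if k ∈ S ∧ ν k + h * k = E then l k else 0 := by
  rw [initialPoly, finsetSum_coeff]
  have : ∀ i ∈ S, (if ν i + h * i = E then monomial i (l i) else 0).coeff k =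
      if i = k then (if ν k + h * k = E then l k else 0) else 0 := by
    intro i _
    by_cases hik : i = k
    · subst hik
      rw [if_pos rfl]
      split_ifs
      · exact Polynomial.coeff_monomial_same _ _
      · simp
    · rw [if_neg hik]; split_ifs
      · rw [coeff_monomial, if_neg hik]
      · simp
  rw [sum_congr rfl this, Finset.sum_ite_eq' S k]
  by_cases hk : k ∈ S <;> simp [hk]

/-- The value at `h` of the support function of the dots. -/
theorem IsDots.exists_min (H : IsDots f γ S ν l m) (h : ℝ) :
    ∃ E, (∀ i ∈ S, E ≤ ν i + h * i) ∧ ∃ i ∈ S, ν i + h * i = E := by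
  obtain ⟨i, hi, h1⟩ := S.exists_min_image (fun i => ν i + h * i) ⟨m, H.mem⟩
  exact ⟨_, h1, i, hi, rfl⟩

theorem exists_eval_ne_zero {J : ℝ[X]} (hJ : J ≠ 0) : ∃ u, J.eval u ≠ 0 := by
  by_contra hcon
  push Not at hcon
  exact hJ (Polynomial.funext fun u => by simpa using hcon u)

/-- If `f` has a limit with weight `E` in the horns of exponent `h`, then it is bounded there. -/
theorem relBound_of_lim {E : ℝ} {J : ℝ → ℝ} (hlim : ∀ u : ℝ,
    Tendsto (fun z : ℝ × ℝ => f (γ.X z.2 + z.1 * z.2 ^ h, γ.ε * z.2) / z.2 ^ E)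
      (𝓝 u ×ˢ 𝓝[>] 0) (𝓝 (J u))) (hJ : Continuous J) (he : e ≤ E) : RelBound f γ h e := by
  intro K
  obtain ⟨C, hC⟩ := (isCompact_Icc (a := -K) (b := K)).exists_bound_of_continuousOn hJ.continuousOn
  refine ⟨C + 1, ?_⟩
  have h1 : ∀ u ∈ Icc (-K) K, ∀ᶠ z : ℝ × ℝ in 𝓝 u ×ˢ 𝓝[>] 0,
      |f (γ.X z.2 + z.1 * z.2 ^ h, γ.ε * z.2) / z.2 ^ E| < C + 1 := fun u hu =>
    (hlim u).abs.eventually (gt_mem_nhds (lt_of_le_of_lt (hC u hu) (lt_add_one C)))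
  filter_upwards [eventually_forall_of_isCompact isCompact_Icc h1, self_mem_nhdsWithin,
    eventually_lt_one_right]
    with y h2 (hy' : (0 : ℝ) < y) hy1 X hX
  have hyh : 0 < y ^ h := rpow_pos_of_pos hy' _
  have hyE : 0 < y ^ E := rpow_pos_of_pos hy' _
  have hu : X / y ^ h ∈ Icc (-K) K := by
    rw [mem_Icc, ← abs_le, abs_div, abs_of_pos hyh, div_le_iff₀ hyh]
    exact hX
  have h3 := h2 _ hu
  simp only [div_mul_cancel₀ _ hyh.ne'] at h3
  rw [abs_div, abs_of_pos hyE, div_lt_iff₀ hyE] at h3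
  refine h3.le.trans ?_
  have hC0 : 0 ≤ C + 1 := by
    by_contra hcon
    push Not at hcon
    have := (abs_nonneg _).trans_lt h3
    nlinarith
  exact mul_le_mul_of_nonneg_left (rpow_le_rpow_of_exponent_ge hy' hy1.le he) hC0

theorem le_of_relBound {E : ℝ} {a u : ℝ} (hlim :
    Tendsto (fun y : ℝ => f (γ.X y + u * y ^ h, γ.ε * y) / y ^ E) (𝓝[>] 0) (𝓝 a)) (ha : a ≠ 0)
    (hb : RelBound f γ h e) : e ≤ E := by
  by_contra hcon
  push Not at hcon
  obtain ⟨C, hC⟩ := hb |u|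
  have hO : (fun y : ℝ => f (γ.X y + u * y ^ h, γ.ε * y)) =O[𝓝[>] 0] fun y => y ^ e := by
    refine IsBigO.of_bound C ?_
    filter_upwards [hC, self_mem_nhdsWithin] with y h1 (hy' : (0 : ℝ) < y)
    have hyh : 0 < y ^ h := rpow_pos_of_pos hy' _
    rw [norm_of_nonneg (rpow_nonneg hy'.le e), norm_eq_abs]
    exact h1 _ (by rw [abs_mul, abs_of_pos hyh])
  exact ha (tendsto_nhds_unique hlim (tendsto_div_rpow_of_isBigO hO hcon))

theorem tendsto_const_prodMk (u : ℝ) : Tendsto (fun y : ℝ => (u, y)) (𝓝[>] 0) (𝓝 u ×ˢ 𝓝[>] 0) :=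
  tendsto_const_nhds.prodMk tendsto_id

theorem IsDots.relBound_iff (H : IsDots f γ S ν l m) (hh : 0 < h) :
    RelBound f γ h e ↔ ∀ i ∈ S, e ≤ ν i + h * i := by
  obtain ⟨E, hE, i, hi, hiE⟩ := H.exists_min h
  have hlim : ∀ u : ℝ, Tendsto (fun z : ℝ × ℝ => f (γ.X z.2 + z.1 * z.2 ^ h, γ.ε * z.2) / z.2 ^ E)
        (𝓝 u ×ˢ 𝓝[>] 0) (𝓝 ((initialPoly S ν l h E).eval u)) := fun u => by
    rw [eval_initialPoly]; exact H.lim h hh E hE u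
  constructor
  · intro hb
    have hJ : initialPoly S ν l h E ≠ 0 := by
      intro h0
      have := coeff_initialPoly S ν l h E i
      rw [h0, if_pos ⟨hi, hiE⟩] at this
      exact H.ne i hi (by simpa using this.symm)
    obtain ⟨u, hu⟩ := exists_eval_ne_zero hJ
    have h5 : Tendsto (fun y : ℝ => f (γ.X y + u * y ^ h, γ.ε * y) / y ^ E) (𝓝[>] 0)
        (𝓝 ((initialPoly S ν l h E).eval u)) :=
      Tendsto.comp (g := fun z : ℝ × ℝ => f (γ.X z.2 + z.1 * z.2 ^ h, γ.ε * z.2) / z.2 ^ E)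
        (f := fun y : ℝ => (u, y)) (hlim u) (tendsto_const_prodMk u)
    have := le_of_relBound h5 hu hb
    exact fun j hj => this.trans (hE j hj)
  · intro h1
    exact relBound_of_lim hlim (Polynomial.continuous _) (hiE ▸ h1 i hi)

theorem IsDots.isStableAt_iff (H : IsDots f γ S ν l m) (hh : 0 < h) :
    IsStableAt f γ h ↔ 0 ∈ S ∧ ∀ i ∈ S, ν 0 ≤ ν i + h * i := by
  constructor
  · intro hs
    by_contra hcon
    obtain ⟨E, hE, i₀, hi₀, hiE⟩ := H.exists_min h
    have h1 : 0 ∈ S → E < ν 0 := by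
      intro h0
      by_contra h2
      push Not at h2
      exact hcon ⟨h0, fun i hi => h2.trans (hE i hi)⟩
    have h2 : ∃ E' > E, ∀ i ∈ S, E' ≤ ν i + (h + 1) * i := by
      refine ⟨min (E + 1) (if 0 ∈ S then ν 0 else E + 1), ?_, fun i hi => ?_⟩
      · refine lt_min (lt_add_one E) ?_
        split_ifs with h0
        · exact h1 h0
        · exact lt_add_one E
      · rcases Nat.eq_zero_or_pos i with h0 | h0
        · subst h0
          refine (min_le_right _ _).trans ?_
          rw [if_pos hi]; simp
        · refine (min_le_left _ _).trans ?_
          have := hE i hi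
          have h3 : (1 : ℝ) ≤ i := mod_cast h0
          nlinarith
    obtain ⟨E', hE', h3⟩ := h2
    have h4 := hs (h + 1) (by simp) E' ((H.relBound_iff (by linarith)).2 h3)
    have := (H.relBound_iff hh).1 h4 i₀ hi₀
    linarith
  · rintro ⟨h0, h1⟩ h' hh' e he
    rw [H.relBound_iff hh]
    intro i hi
    have := (H.relBound_iff (hh.trans_le hh')).1 he 0 h0
    simp only [Nat.cast_zero, mul_zero, add_zero] at this
    exact this.trans (h1 i hi)

/-- The initial form of `f` on the horns of exponent `h` around `γ`. -/
theorem RegularX.exists_initial (hf : RegularX f) (γ : RArc) (hh : 0 < h) :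
    ∃ (E : ℝ) (J : ℝ[X]), J ≠ 0 ∧ (∀ e, RelBound f γ h e ↔ e ≤ E) ∧ (∀ u : ℝ,
      Tendsto (fun z : ℝ × ℝ => f (γ.X z.2 + z.1 * z.2 ^ h, γ.ε * z.2) / z.2 ^ E)
        (𝓝 u ×ˢ 𝓝[>] 0) (𝓝 (J.eval u))) ∧ (J.eval 0 ≠ 0 ↔ IsStableAt f γ h) := by
  obtain ⟨S, ν, l, m, H⟩ := hf.exists_isDots γ
  obtain ⟨E, hE, i, hi, hiE⟩ := H.exists_min h
  refine ⟨E, initialPoly S ν l h E, ?_, fun e => ?_, fun u => ?_, ?_⟩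
  · intro h0
    have := coeff_initialPoly S ν l h E i
    rw [h0, if_pos ⟨hi, hiE⟩] at this
    exact H.ne i hi (by simpa using this.symm)
  · rw [H.relBound_iff hh]
    exact ⟨fun h1 => hiE ▸ h1 i hi, fun h1 j hj => h1.trans (hE j hj)⟩
  · rw [eval_initialPoly]
    exact H.lim h hh E hE u
  · rw [H.isStableAt_iff hh, ← Polynomial.coeff_zero_eq_eval_zero, coeff_initialPoly]
    simp only [Nat.cast_zero, mul_zero, add_zero]
    constructor
    · intro h1
      by_cases h2 : 0 ∈ S ∧ ν 0 = E
      · exact ⟨h2.1, fun i hi => h2.2 ▸ hE i hi⟩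
      · exact absurd (if_neg h2) h1
    · rintro ⟨h1, h2⟩
      have h3 : ν 0 = E := le_antisymm (hiE ▸ h2 i hi) (by simpa using hE 0 h1)
      rw [if_pos ⟨h1, h3⟩]
      exact H.ne 0 h1

theorem RelBound.anti {h' : ℝ} (hb : RelBound f γ h e) (hle : h ≤ h') : RelBound f γ h' e := by
  intro K
  obtain ⟨C, hC⟩ := hb |K|
  refine ⟨C, ?_⟩
  filter_upwards [hC, self_mem_nhdsWithin,
    eventually_lt_one_right] with y h1 (hy' : (0 : ℝ) < y) hy1 X hX
  refine h1 X (hX.trans ?_)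
  gcongr ?_ * ?_
  · exact le_abs_self K
  · exact rpow_le_rpow_of_exponent_ge hy' hy1.le hle

theorem RelBound.congr_arc (hb : RelBound f γ h e) (hs : γ.sgn = μ.sgn)
    (hO : (fun y => γ.X y - μ.X y) =O[𝓝[>] 0] fun y => y ^ h) : RelBound f μ h e := by
  intro K
  obtain ⟨c, hc⟩ := hO.bound
  obtain ⟨C, hC⟩ := hb (K + c)
  refine ⟨C, ?_⟩
  filter_upwards [hC, hc, self_mem_nhdsWithin] with y h1 h2 (hy' : (0 : ℝ) < y) X hX
  rw [norm_of_nonneg (rpow_nonneg hy'.le _), norm_eq_abs] at h2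
  have h3 := h1 (X - (γ.X y - μ.X y)) (by
    rw [add_mul]
    exact (abs_sub _ _).trans (add_le_add hX h2))
  rwa [show γ.X y + (X - (γ.X y - μ.X y)) = μ.X y + X by ring, RArc.sgn_eq_iff.1 hs] at h3

theorem IsStableAt.mono {h' : ℝ} (hs : IsStableAt f γ h) (hle : h ≤ h') : IsStableAt f γ h' :=
  fun h'' hh'' e he => (hs h'' (hle.trans hh'') e he).anti hle

theorem HeightGE.mono {h' : ℝ} (hs : HeightGE f γ h) (hle : h' ≤ h) : HeightGE f γ h' :=
  fun k hk hk' => hs k hk (hk'.trans_le hle)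

/-- Stability is a closed condition on the exponent. -/
theorem RegularX.exists_heightGE (hf : RegularX f) (hh : 0 < h) (hs : ¬ IsStableAt f γ h) :
    ∃ h' > h, HeightGE f γ h' := by
  obtain ⟨S, ν, l, m, H⟩ := hf.exists_isDots γ
  have h1 : ∃ h' > h, ¬ IsStableAt f γ h' := by
    rw [H.isStableAt_iff hh] at hs
    by_cases h0 : 0 ∈ S
    · have : ∃ i ∈ S, ν i + h * i < ν 0 := by
        by_contra hcon
        push Not at hcon
        exact hs ⟨h0, hcon⟩
      obtain ⟨i, hi, hlt⟩ := this
      refine ⟨h + (ν 0 - (ν i + h * i)) / (i + 1) / 2, ?_, ?_⟩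
      · have : 0 < (ν 0 - (ν i + h * i)) / (i + 1) / 2 := by
          have := sub_pos.2 hlt
          positivity
        linarith
      · have hpos : 0 < (ν 0 - (ν i + h * i)) / (i + 1) / 2 := by
          have := sub_pos.2 hlt
          positivity
        rw [H.isStableAt_iff (by linarith)]
        rintro ⟨-, h2⟩
        have h3 := h2 i hi
        have h4 : (ν 0 - (ν i + h * i)) / (i + 1) * (i + 1) = ν 0 - (ν i + h * i) := by field_simp
        nlinarith
    · refine ⟨h + 1, by linarith, ?_⟩
      rw [H.isStableAt_iff (by linarith)]
      exact fun h2 => h0 h2.1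
  obtain ⟨h', hlt, hn⟩ := h1
  exact ⟨h', hlt, fun k _ hk' hst => hn (hst.mono hk'.le)⟩

theorem lim_shift_aux {E : ℝ} (hs : γ.sgn = μ.sgn) (v : ℝ) :
    (fun z : ℝ × ℝ => f (μ.X z.2 + z.1 * z.2 ^ h, μ.ε * z.2) / z.2 ^ E) =ᶠ[𝓝 v ×ˢ 𝓝[>] 0]
      (fun z : ℝ × ℝ => f (γ.X z.2 + z.1 * z.2 ^ h, γ.ε * z.2) / z.2 ^ E) ∘
        fun z : ℝ × ℝ => (z.1 + (μ.X z.2 - γ.X z.2) / z.2 ^ h, z.2) := by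
  have hpos : ∀ᶠ z : ℝ × ℝ in 𝓝 v ×ˢ 𝓝[>] 0, 0 < z.2 := tendsto_snd.eventually self_mem_nhdsWithin
  filter_upwards [hpos] with z hz
  have hyh : 0 < z.2 ^ h := rpow_pos_of_pos hz _
  simp only [Function.comp]
  rw [add_mul, div_mul_cancel₀ _ hyh.ne', RArc.sgn_eq_iff.1 hs]
  congr 3
  ring

/-- Passing to an arc `γ + (u + o(1)) * |y| ^ h` translates the initial form by `u`. -/
theorem lim_shift {E : ℝ} {J : ℝ → ℝ} {u : ℝ} (hlim : ∀ u : ℝ,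
    Tendsto (fun z : ℝ × ℝ => f (γ.X z.2 + z.1 * z.2 ^ h, γ.ε * z.2) / z.2 ^ E)
      (𝓝 u ×ˢ 𝓝[>] 0) (𝓝 (J u))) (hs : γ.sgn = μ.sgn)
    (hμ : Tendsto (fun y => (μ.X y - γ.X y) / y ^ h) (𝓝[>] 0) (𝓝 u)) (v : ℝ) :
    Tendsto (fun z : ℝ × ℝ => f (μ.X z.2 + z.1 * z.2 ^ h, μ.ε * z.2) / z.2 ^ E)
      (𝓝 v ×ˢ 𝓝[>] 0) (𝓝 (J (v + u))) := by
  refine Tendsto.congr' (lim_shift_aux hs v).symm ((hlim (v + u)).comp ?_)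
  exact (tendsto_fst.add (hμ.comp tendsto_snd)).prodMk tendsto_snd

end Initial

/-! ### Complexification -/

section Complexification

/-- The standard basis of the plane. -/
def planeBasis (j : Fin 2) : ℝ × ℝ := if j = 0 then (1, 0) else (0, 1)

/-- The coordinate functions of the complex plane. -/
def planeProj (j : Fin 2) : ℂ × ℂ →L[ℂ] ℂ :=
  if j = 0 then ContinuousLinearMap.fst ℂ ℂ ℂ else ContinuousLinearMap.snd ℂ ℂ ℂ

theorem norm_planeBasis (j : Fin 2) : ‖planeBasis j‖ = 1 := by
  fin_cases j <;> simp [planeBasis, Prod.norm_mk]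

theorem norm_planeProj_le (j : Fin 2) : ‖planeProj j‖ ≤ 1 := by
  fin_cases j
  · exact ContinuousLinearMap.norm_fst_le _ _ _
  · exact ContinuousLinearMap.norm_snd_le _ _ _

/-- The complex multilinear extension of a real multilinear form on the plane. -/
def complexifyForm {n : ℕ} (p : ContinuousMultilinearMap ℝ (fun _ : Fin n => ℝ × ℝ) ℝ) :
    ContinuousMultilinearMap ℂ (fun _ : Fin n => ℂ × ℂ) ℂ :=
  ∑ σ : Fin n → Fin 2, ((p fun i => planeBasis (σ i) : ℝ) : ℂ) •
    (ContinuousMultilinearMap.mkPiAlgebra ℂ (Fin n) ℂ).compContinuousLinearMap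
      fun i => planeProj (σ i)

theorem norm_complexifyForm_le {n : ℕ} (p : ContinuousMultilinearMap ℝ (fun _ : Fin n => ℝ × ℝ) ℝ) :
    ‖complexifyForm p‖ ≤ 2 ^ n * ‖p‖ := by
  have h1 : ∀ σ : Fin n → Fin 2, ‖((p fun i => planeBasis (σ i) : ℝ) : ℂ) •
      (ContinuousMultilinearMap.mkPiAlgebra ℂ (Fin n) ℂ).compContinuousLinearMap
        fun i => planeProj (σ i)‖ ≤ ‖p‖ := by
    intro σ
    rw [norm_smul, norm_real]
    have e1 : ‖p fun i => planeBasis (σ i)‖ ≤ ‖p‖ := by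
      have := p.le_opNorm fun i => planeBasis (σ i)
      simpa [norm_planeBasis] using this
    have e2 : ‖(ContinuousMultilinearMap.mkPiAlgebra ℂ (Fin n) ℂ).compContinuousLinearMap
        fun i => planeProj (σ i)‖ ≤ 1 := by
      refine (ContinuousMultilinearMap.norm_compContinuousLinearMap_le _ _).trans ?_
      refine mul_le_one₀ (ContinuousMultilinearMap.norm_mkPiAlgebra (𝕜 := ℂ) (A := ℂ) (ι := Fin n)).le
        (Finset.prod_nonneg fun _ _ => norm_nonneg _)
        (Finset.prod_le_one (fun _ _ => norm_nonneg _) fun i _ => norm_planeProj_le _)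
    calc _ ≤ ‖p‖ * 1 := mul_le_mul e1 e2 (norm_nonneg _) (norm_nonneg _)
      _ = ‖p‖ := mul_one _
  refine (norm_sum_le _ _).trans ((Finset.sum_le_sum fun σ _ => h1 σ).trans (le_of_eq ?_))
  simp

theorem complexifyForm_ofReal {n : ℕ}
    (p : ContinuousMultilinearMap ℝ (fun _ : Fin n => ℝ × ℝ) ℝ) (x : ℝ × ℝ) :
    complexifyForm p (fun _ => ((x.1 : ℂ), (x.2 : ℂ))) = ((p fun _ => x : ℝ) : ℂ) := by
  classical
  let c : Fin 2 → ℝ := fun j => if j = 0 then x.1 else x.2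
  have hx : x = ∑ j : Fin 2, c j • planeBasis j := by ext <;> simp [c, planeBasis, Fin.sum_univ_two]
  have h1 : p (fun _ => x) = ∑ σ : Fin n → Fin 2, (∏ i, c (σ i)) • p fun i => planeBasis (σ i) := by
    have e1 : (fun _ : Fin n => x) = fun _ => ∑ j : Fin 2, c j • planeBasis j := by
      funext i; exact hx
    rw [e1]
    have := p.toMultilinearMap.map_sum (fun (_ : Fin n) (j : Fin 2) => c j • planeBasis j)
    refine Eq.trans this (sum_congr rfl fun σ _ => ?_)
    exact p.toMultilinearMap.map_smul_univ (fun i => c (σ i)) fun i => planeBasis (σ i)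
  rw [h1, complexifyForm, sum_apply]
  push_cast
  refine sum_congr rfl fun σ _ => ?_
  rw [Pi.smul_apply, ContinuousMultilinearMap.compContinuousLinearMap_apply,
    ContinuousMultilinearMap.mkPiAlgebra_apply, smul_eq_mul, smul_eq_mul, mul_comm]
  push_cast
  congr 1
  refine Finset.prod_congr rfl fun i _ => ?_
  simp only [planeProj, c]
  split_ifs <;> simp

theorem exists_isComplexification {f : ℝ × ℝ → ℝ} (hf : AnalyticAt ℝ f 0) :
    ∃ g, IsComplexification f g := by
  obtain ⟨p, hp⟩ := hf
  obtain ⟨r, hr0, hr⟩ := ENNReal.lt_iff_exists_nnreal_btwn.1 hp.radius_pos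
  obtain ⟨C, hC0, hC⟩ := p.norm_mul_pow_le_of_lt_radius hr
  let Q : FormalMultilinearSeries ℂ (ℂ × ℂ) ℂ := fun n => complexifyForm (p n)
  have hr0' : 0 < r := mod_cast hr0
  have hQ : 0 < Q.radius := by
    refine lt_of_lt_of_le ?_ (Q.le_radius_of_bound (r := r / 2) C fun n => ?_)
    · rw [ENNReal.coe_pos]; positivity
    · have h1 : ‖Q n‖ ≤ 2 ^ n * ‖p n‖ := norm_complexifyForm_le (p n)
      calc ‖Q n‖ * ((r : ℝ) / 2) ^ n ≤ 2 ^ n * ‖p n‖ * ((r : ℝ) / 2) ^ n := by gcongr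
        _ = ‖p n‖ * (r : ℝ) ^ n := by rw [div_pow]; field_simp
        _ ≤ C := hC n
  have hg := Q.hasFPowerSeriesOnBall hQ
  refine ⟨Q.sum, hg.analyticAt, ?_⟩
  have h1 := hp.eventually_hasSum
  have h2 : ∀ᶠ x : ℝ × ℝ in 𝓝 0,
      HasSum (fun n => Q n fun _ => ((x.1 : ℂ), (x.2 : ℂ))) (Q.sum ((x.1 : ℂ), (x.2 : ℂ))) := by
    have hc : Tendsto (fun x : ℝ × ℝ => ((x.1 : ℂ), (x.2 : ℂ))) (𝓝 0) (𝓝 0) := by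
      have : Continuous fun x : ℝ × ℝ => ((x.1 : ℂ), (x.2 : ℂ)) := by fun_prop
      have := this.tendsto 0
      rwa [show (((0 : ℝ × ℝ).1 : ℂ), ((0 : ℝ × ℝ).2 : ℂ)) = 0 by simp] at this
    have := hc.eventually hg.hasFPowerSeriesAt.eventually_hasSum
    simpa using this
  filter_upwards [h1, h2] with x e1 e2
  rw [zero_add] at e1
  have e3 := Complex.hasSum_ofReal.2 e1
  refine HasSum.unique e2 (e3.congr_fun ?_) 
  intro n
  exact complexifyForm_ofReal (p n) x

end Complexification

/-! ### The complex germ near an arc -/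

section ComplexArc

/-- The series of an arc, as a function of a complex parameter. -/
def RArc.xc (γ : RArc) (s : ℂ) : ℂ := ser (fun j => (γ.coeff j : ℂ)) s

theorem RArc.convSeq_ofReal (γ : RArc) : ConvSeq fun j => (γ.coeff j : ℂ) := by
  obtain ⟨r, hr, h⟩ := γ.convSeq
  exact ⟨r, hr, by simpa using h⟩

theorem RArc.analyticAt_xc (γ : RArc) : AnalyticAt ℂ γ.xc 0 := γ.convSeq_ofReal.analyticAt

theorem RArc.xc_ofReal (γ : RArc) (s : ℝ) : γ.xc s = γ.x s := by
  rw [xc, ser, x, Complex.ofReal_tsum]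
  simp

theorem RArc.exists_xc_eq (γ : RArc) : ∃ k : ℂ → ℂ, AnalyticAt ℂ k 0 ∧
    ∀ᶠ s in 𝓝 (0 : ℂ), γ.xc s = s ^ γ.d * k s := by
  obtain ⟨k, hk, h⟩ := γ.analyticAt_xc.exists_eventuallyEq_sum_add_pow_mul γ.d
  refine ⟨k, hk, ?_⟩
  filter_upwards [h] with s hs
  rw [hs, sum_eq_zero]
  · simp
  · intro i hi
    have := congrFun γ.convSeq_ofReal.taylorSeq_ser i
    rw [taylorSeq, div_eq_iff (by exact_mod_cast i.factorial_ne_zero),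
      γ.coeff_eq_zero i (Finset.mem_range.1 hi)] at this
    have h2 : iteratedDeriv i γ.xc 0 = 0 := by
      refine Eq.trans this ?_
      simp
    rw [h2]
    simp

theorem RArc.xc_zero (γ : RArc) : γ.xc 0 = 0 := by
  have := γ.xc_ofReal 0
  rwa [x_zero, ofReal_zero] at this

theorem RArc.ε_pow_two (γ : RArc) : γ.ε * γ.ε = 1 := by rcases γ.ε_cases with h | h <;> simp [h]

/-- The complexification in coordinates centred on an arc. -/
def arcGerm (g : ℂ × ℂ → ℂ) (γ : RArc) (z : ℂ × (ℂ × PUnit.{1})) : ℂ :=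
  g (γ.xc z.2.1 + z.1, γ.ε * z.2.1 ^ γ.d)

theorem analyticAt_arcGerm {g : ℂ × ℂ → ℂ} (hg : AnalyticAt ℂ g 0) (γ : RArc) :
    AnalyticAt ℂ (arcGerm g γ) (0, (0 : ℂ × PUnit.{1})) := by
  have hx : AnalyticAt ℂ (fun z : ℂ × (ℂ × PUnit.{1}) => γ.xc z.2.1) (0, (0 : ℂ × PUnit.{1})) :=
    AnalyticAt.fun_comp (g := γ.xc) (f := fun z : ℂ × (ℂ × PUnit.{1}) => z.2.1) γ.analyticAt_xc
      (by fun_prop)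
  refine AnalyticAt.fun_comp (g := g)
    (f := fun z : ℂ × (ℂ × PUnit.{1}) => (γ.xc z.2.1 + z.1, (γ.ε : ℂ) * z.2.1 ^ γ.d)) ?_ ?_
  · have : ((γ.xc (0 : ℂ × PUnit.{1}).1 + 0, (γ.ε : ℂ) * (0 : ℂ × PUnit.{1}).1 ^ γ.d) : ℂ × ℂ) = 0 := by
      simp [γ.xc_zero, γ.d_pos.ne']
    show AnalyticAt ℂ g (γ.xc (0 : ℂ × PUnit.{1}).1 + 0, (γ.ε : ℂ) * (0 : ℂ × PUnit.{1}).1 ^ γ.d)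
    rw [this]
    exact hg
  · fun_prop

/-- At real points the germ takes the values of the real function. -/
theorem arcGerm_ofReal {f : ℝ × ℝ → ℝ} {g : ℂ × ℂ → ℂ} (hg : IsComplexification f g) (γ : RArc) :
    ∀ᶠ z : ℝ × ℝ in 𝓝 0, arcGerm g γ ((z.1 : ℂ), ((z.2 : ℂ), PUnit.unit)) =
      ((f (γ.x z.2 + z.1, γ.y z.2) : ℝ) : ℂ) := by
  have hc : Tendsto (fun z : ℝ × ℝ => (γ.x z.2 + z.1, γ.y z.2)) (𝓝 0) (𝓝 0) := by
    have h1 : ContinuousAt (fun z : ℝ × ℝ => γ.x z.2) 0 :=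
      ContinuousAt.comp (g := γ.x) (f := fun z : ℝ × ℝ => z.2) γ.analyticAt_x.continuousAt
        (by fun_prop)
    have h2 : ContinuousAt (fun z : ℝ × ℝ => (γ.x z.2 + z.1, γ.y z.2)) 0 := by
      simp only [RArc.y_eq]
      fun_prop
    have := h2.tendsto
    rwa [show (γ.x (0 : ℝ × ℝ).2 + (0 : ℝ × ℝ).1, γ.y (0 : ℝ × ℝ).2) = 0 by
      simp [RArc.x_zero, RArc.y_eq, γ.d_pos.ne']] at this
  filter_upwards [hc.eventually hg.2] with z hz
  rw [← hz, arcGerm, γ.xc_ofReal, RArc.y_eq]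
  push_cast
  rfl

end ComplexArc

/-! ### Heights in terms of stable exponents -/

section Orders

theorem pow_rpow_eq {s : ℝ} (hs : 0 ≤ s) (d : ℕ) (E : ℝ) : (s ^ d) ^ E = s ^ ((d : ℝ) * E) := by
  rw [← rpow_natCast, ← rpow_mul hs]

theorem not_isBigO_rpow {κ κ' : ℝ} (h : κ < κ') :
    ¬ (fun s : ℝ => s ^ κ) =O[𝓝[>] 0] fun s => s ^ κ' := by
  intro hO
  refine zero_ne_one (tendsto_nhds_unique (tendsto_div_rpow_of_isBigO hO h)
    (tendsto_const_nhds.congr' ?_))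
  filter_upwards [self_mem_nhdsWithin] with y hy
  exact (div_self (rpow_pos_of_pos hy κ).ne').symm

/-- Bounds on the values of polynomials at `0, …, n - 1` bound the coefficients. -/
theorem coeff_isBigO {𝕜 : Type*} [RCLike 𝕜] {ι : Type*} {l : Filter ι} {c : ℕ → ι → 𝕜} {g : ι → ℝ}
    {n : ℕ} (h : ∀ k < n, (fun s => ∑ j ∈ Finset.range n, c j s * (k : 𝕜) ^ j) =O[l] g) :
    ∀ i < n, c i =O[l] g := by
  obtain ⟨M, hM⟩ := exists_coeff_eq_sum_values (𝕜 := 𝕜) n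
  intro i hi
  have h1 : c i = fun s => ∑ k ∈ Finset.range n,
      M i k * ∑ j ∈ Finset.range n, c j s * (k : 𝕜) ^ j := by
    funext s
    exact hM (fun j => c j s) i hi
  rw [h1]
  refine IsBigO.fun_sum fun k hk => ?_
  exact (h k (Finset.mem_range.1 hk)).const_mul_left _

theorem tendsto_ofReal_right : Tendsto (fun s : ℝ => (s : ℂ)) (𝓝[>] 0) (𝓝[≠] 0) := by
  refine tendsto_nhdsWithin_of_tendsto_nhds_of_eventually_within _ ?_ ?_
  · simpa using (Complex.continuous_ofReal.tendsto 0).within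
  · filter_upwards [self_mem_nhdsWithin] with s (hs : (0 : ℝ) < s)
    simpa using hs.ne'

/-- A nonzero analytic germ has the order of a power. -/
theorem AnalyticAt.exists_isTheta {α : ℂ → ℂ} (hα : AnalyticAt ℂ α 0)
    (h0 : ¬ ∀ᶠ s in 𝓝 (0 : ℂ), α s = 0) : ∃ n : ℕ, α =Θ[𝓝[≠] 0] (fun s => ‖s‖ ^ (n : ℝ)) ∧
      (fun s : ℝ => α s) =Θ[𝓝[>] 0] (fun s => s ^ (n : ℝ)) := by
  obtain ⟨n, u, hu, hu0, hn⟩ := hα.exists_eventuallyEq_pow_smul_nonzero_iff.2 h0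
  simp only [sub_zero, smul_eq_mul] at hn
  have h1 : u =Θ[𝓝[≠] 0] fun _ => (1 : ℝ) :=
    ((isEquivalent_const_iff_tendsto hu0).2 hu.continuousAt.tendsto.within).isTheta.trans
      (isTheta_const_const hu0 one_ne_zero)
  have h2 : α =Θ[𝓝[≠] 0] (fun s => ‖s‖ ^ (n : ℝ)) := by
    have h3 : (fun s : ℂ => s ^ n) =Θ[𝓝[≠] 0] (fun s => ‖s‖ ^ (n : ℝ)) := by
      simpa using (isTheta_refl (fun s : ℂ => s ^ n) (𝓝[≠] 0)).norm_right
    simpa using (EventuallyEq.isTheta hn.within).trans (h3.mul h1)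
  have h4 : (fun s => ‖s‖ ^ (n : ℝ)) ∘ (fun s : ℝ => (s : ℂ)) =ᶠ[𝓝[>] 0] fun s => s ^ (n : ℝ) := by
    filter_upwards [self_mem_nhdsWithin] with s (hs : (0 : ℝ) < s)
    simp [abs_of_pos hs]
  exact ⟨n, h2, (h2.1.comp_tendsto tendsto_ofReal_right).trans_eventuallyEq h4,
    h4.symm.trans_isBigO (h2.2.comp_tendsto tendsto_ofReal_right)⟩

theorem isBigO_norm_rpow {κ κ' : ℝ} (h : κ' ≤ κ) :
    (fun s : ℂ => ‖s‖ ^ κ) =O[𝓝[≠] 0] fun s => ‖s‖ ^ κ' :=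
  (isBigO_rpow_rpow h).comp_tendsto tendsto_norm_nhdsNE_zero

theorem isBigO_of_real {α : ℂ → ℂ} (hα : AnalyticAt ℂ α 0) {κ : ℝ}
    (h : (fun s : ℝ => α s) =O[𝓝[>] 0] fun s => s ^ κ) : α =O[𝓝[≠] 0] fun s => ‖s‖ ^ κ := by
  by_cases h0 : ∀ᶠ s in 𝓝 (0 : ℂ), α s = 0
  · exact EventuallyEq.trans_isBigO (h0.within) (isBigO_zero _ _)
  obtain ⟨n, h1, h2⟩ := hα.exists_isTheta h0
  refine h1.1.trans (isBigO_norm_rpow ?_)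
  by_contra hcon
  exact not_isBigO_rpow (not_le.1 hcon) (h2.2.trans h)

theorem isBigO_rev_of_real {α : ℂ → ℂ} (hα : AnalyticAt ℂ α 0) {κ : ℝ}
    (h : (fun s : ℝ => s ^ κ) =O[𝓝[>] 0] fun s : ℝ => α s) :
    (fun s : ℂ => ‖s‖ ^ κ) =O[𝓝[≠] 0] α := by
  by_cases h0 : ∀ᶠ s in 𝓝 (0 : ℂ), α s = 0
  · exfalso
    refine not_isBigO_rpow (lt_add_one κ) (h.trans (IsBigO.of_bound 0 ?_))
    filter_upwards [tendsto_ofReal_right.eventually h0.within] with s hs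
    simp [hs]
  obtain ⟨n, h1, h2⟩ := hα.exists_isTheta h0
  refine (isBigO_norm_rpow ?_).trans h1.2
  by_contra hcon
  exact not_isBigO_rpow (not_le.1 hcon) (h.trans h2.1)

end Orders

section UpperBound

/-- The zeros of the complexification close to an arc, in coordinates centred on the arc: the
parameter `s` moves slightly into the complex plane. -/
theorem exists_zero_near {g : ℂ × ℂ → ℂ} (hg0 : g 0 = 0) {γ : RArc} {ζ : ℝ → ℂ × ℂ} (hζ0 : ζ 0 = 0)
    (hz : ∀ᶠ s in 𝓝[>] (0 : ℝ), g (ζ s) = 0) {h : ℝ} (hh : 1 < h) (hnear : γ.Near ζ h) :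
    ∃ C : ℝ, ∀ᶠ s : ℝ in 𝓝[>] (0 : ℝ), ∃ (sc X : ℂ), ‖sc - (s : ℂ)‖ ≤ s / 2 ∧
      ‖X‖ ≤ C * s ^ (γ.d * h) ∧ arcGerm g γ (X, (sc, PUnit.unit)) = 0 := by
  obtain ⟨k, hk, hx⟩ := γ.exists_xc_eq
  obtain ⟨K, U, hU, hlip⟩ := (hk.contDiffAt (n := 1)).exists_lipschitzOnWith
  have hd := γ.d_pos
  have hd' : (0 : ℝ) < γ.d := mod_cast hd
  -- a branch of the `d`-th root near `1`
  let ρ : ℂ → ℂ := fun z => Complex.exp (Complex.log (1 + z) / γ.d)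
  have hρan : AnalyticAt ℂ ρ 0 := by
    have h1 : AnalyticAt ℂ (fun z : ℂ => Complex.log (1 + z)) 0 := by
      refine AnalyticAt.clog (by fun_prop) ?_
      simp [Complex.slitPlane]
    exact (h1.div (by fun_prop) (by exact_mod_cast hd.ne')).cexp
  have hρ0 : ρ 0 = 1 := by simp [ρ]
  obtain ⟨L, V, hV, hlipρ⟩ := (hρan.contDiffAt (n := 1)).exists_lipschitzOnWith
  have hρd : ∀ᶠ z in 𝓝 (0 : ℂ), ρ z ^ γ.d = 1 + z := by
    have : ∀ᶠ z in 𝓝 (0 : ℂ), (1 : ℂ) + z ≠ 0 := by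
      have : ContinuousAt (fun z : ℂ => (1 : ℂ) + z) 0 := by fun_prop
      exact this.eventually_ne (by simp)
    filter_upwards [this] with z hz
    have hdc : (γ.d : ℂ) ≠ 0 := mod_cast hd.ne'
    rw [← Complex.exp_nat_mul, mul_div_cancel₀ _ hdc, Complex.exp_log hz]
  obtain ⟨ε₀, hε₀, hzero⟩ : ∃ ε₀ > (0 : ℝ), ∀ s ∈ Ico 0 ε₀, g (ζ s) = 0 := by
    obtain ⟨ε₀, hε₀, h1⟩ := mem_nhdsGT_iff_exists_Ioo_subset.1 hz
    refine ⟨ε₀, hε₀, fun s hs => ?_⟩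
    rcases hs.1.eq_or_lt with h0 | h0
    · rw [← h0, hζ0, hg0]
    · exact h1 ⟨h0, hs.2⟩
  obtain ⟨c, hc0, hc⟩ := (hnear ε₀ hε₀).exists_pos
  rw [isBigOWith_iff] at hc
  set c' := c + 1 with hc'
  set B : ℝ := ‖k 0‖ + 1
  refine ⟨c' + c' * B + 2 ^ γ.d * (K * (L * c')), ?_⟩
  -- smallness conditions
  have hex : 0 < (γ.d : ℝ) * (h - 1) := mul_pos hd' (by linarith)
  have hsmall : Tendsto (fun s : ℝ => c' * s ^ ((γ.d : ℝ) * (h - 1))) (𝓝[>] 0) (𝓝 0) := by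
    have := (tendsto_rpow_nhds_zero hex).const_mul c'
    simpa using this
  obtain ⟨r₁, hr₁, hball₁⟩ := Metric.mem_nhds_iff.1 (inter_mem hV hρd)
  have hkb : ∀ᶠ s in 𝓝 (0 : ℂ), ‖k s‖ < B :=
    hk.continuousAt.norm.tendsto.eventually (gt_mem_nhds (lt_add_one _))
  obtain ⟨r₂, hr₂, hball₂⟩ := Metric.mem_nhds_iff.1 (inter_mem (inter_mem hU hkb) hx)
  have hev1 : ∀ᶠ s : ℝ in 𝓝[>] 0, c' * s ^ ((γ.d : ℝ) * (h - 1)) < r₁ :=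
    hsmall.eventually (gt_mem_nhds hr₁)
  have hev2 : ∀ᶠ s : ℝ in 𝓝[>] 0, L * (c' * s ^ ((γ.d : ℝ) * (h - 1))) < 1 / 2 := by
    have := hsmall.const_mul (L : ℝ)
    rw [mul_zero] at this
    exact this.eventually (gt_mem_nhds (by norm_num))
  have hev3 : ∀ᶠ s : ℝ in 𝓝[>] 0, s < r₂ / 2 := nhdsWithin_le_nhds (gt_mem_nhds (by positivity))
  filter_upwards [hc, hev1, hev2, hev3, eventually_lt_one_right, self_mem_nhdsWithin]
    with s h1 h2 h3 h4 h5 (hs0 : (0 : ℝ) < s)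
  have hsd : 0 < s ^ γ.d := pow_pos hs0 _
  rw [norm_of_nonneg infDist_nonneg,
    norm_of_nonneg (rpow_nonneg hsd.le _), pow_rpow_eq hs0.le] at h1
  set T := s ^ ((γ.d : ℝ) * h) with hT
  have hTpos : 0 < T := rpow_pos_of_pos hs0 _
  have hTeq : T = s ^ γ.d * s ^ ((γ.d : ℝ) * (h - 1)) := by
    rw [hT, ← rpow_natCast, ← rpow_add hs0]; congr 1; ring
  have hlt : infDist (γ.toComplex s) (ζ '' Ico 0 ε₀) < c' * T := by rw [hc', add_mul]; linarith
  rw [Metric.infDist_lt_iff ⟨_, mem_image_of_mem _ (show (0 : ℝ) ∈ Ico 0 ε₀ from ⟨le_rfl, hε₀⟩)⟩]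
    at hlt
  obtain ⟨_, ⟨s', hs', rfl⟩, hdist⟩ := hlt
  set P := ζ s'
  have hgP : g P = 0 := hzero s' hs'
  rw [Prod.dist_eq, max_lt_iff, RArc.toComplex] at hdist
  obtain ⟨hd1, hd2⟩ := hdist
  rw [dist_comm, dist_eq_norm] at hd1 hd2
  simp only at hd1 hd2
  have hεc : (γ.ε : ℂ) * γ.ε = 1 := mod_cast γ.ε_pow_two
  have hεn : ‖(γ.ε : ℂ)‖ = 1 := by rw [norm_real, norm_eq_abs, γ.abs_ε]
  have hsdc : (s : ℂ) ^ γ.d ≠ 0 := mod_cast hsd.ne'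
  have hnsd : ‖(s : ℂ) ^ γ.d‖ = s ^ γ.d := by rw [norm_pow, norm_real, norm_of_nonneg hs0.le]
  set η : ℂ := P.2 - γ.y s with hη
  set z : ℂ := γ.ε * η / (s : ℂ) ^ γ.d with hzdef
  have hzn : ‖z‖ ≤ c' * s ^ ((γ.d : ℝ) * (h - 1)) := by
    rw [hzdef, norm_div, norm_mul, hεn, one_mul, hnsd, div_le_iff₀ hsd]
    calc ‖η‖ ≤ c' * T := hd2.le
      _ = _ := by rw [hTeq]; ring
  have hzmem : z ∈ ball (0 : ℂ) r₁ := by rw [mem_ball_zero_iff]; exact hzn.trans_lt h2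
  have hρz : ‖ρ z - 1‖ ≤ L * ‖z‖ := by
    have := hlipρ.dist_le_mul z (hball₁ hzmem).1 0 (hball₁ (Metric.mem_ball_self hr₁)).1
    rwa [dist_eq_norm, dist_eq_norm, sub_zero, hρ0] at this
  have hρz' : ‖ρ z - 1‖ ≤ 1 / 2 := hρz.trans ((mul_le_mul_of_nonneg_left hzn L.2).trans h3.le)
  set sc : ℂ := s * ρ z with hsc
  have hscs : ‖sc - s‖ = s * ‖ρ z - 1‖ := by
    rw [hsc, show (s : ℂ) * ρ z - s = s * (ρ z - 1) by ring, norm_mul, norm_real,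
      norm_of_nonneg hs0.le]
  have hscd : (γ.ε : ℂ) * sc ^ γ.d = P.2 := by
    rw [hsc, mul_pow, (hball₁ hzmem).2, hzdef, mul_add, mul_one, mul_div_cancel₀ _ hsdc, mul_add,
      ← mul_assoc, hεc, one_mul, hη, RArc.y_eq]
    push_cast
    ring
  have hscn : ‖sc‖ ≤ 2 * s := by
    have : ‖sc‖ ≤ ‖sc - s‖ + ‖(s : ℂ)‖ := by simpa using norm_add_le (sc - s) (s : ℂ)
    rw [norm_real, norm_of_nonneg hs0.le, hscs] at this
    nlinarith
  have hm1 : (s : ℂ) ∈ ball (0 : ℂ) r₂ := by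
    rw [mem_ball_zero_iff, norm_real, norm_of_nonneg hs0.le]; linarith
  have hm2 : sc ∈ ball (0 : ℂ) r₂ := by rw [mem_ball_zero_iff]; linarith
  refine ⟨sc, P.1 - γ.xc sc, ?_, ?_, ?_⟩
  · rw [hscs]; nlinarith
  · have e1 : P.1 - γ.xc sc = (P.1 - γ.x s) + (γ.xc s - γ.xc sc) := by rw [γ.xc_ofReal]; ring
    have e2 : γ.xc s - γ.xc sc = ((s : ℂ) ^ γ.d - sc ^ γ.d) * k s + sc ^ γ.d * (k s - k sc) := by
      rw [(hball₂ hm1).2, (hball₂ hm2).2]; ring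
    have e3 : (s : ℂ) ^ γ.d - sc ^ γ.d = - (γ.ε * η) := by
      have : sc ^ γ.d = γ.ε * P.2 := by rw [← hscd, ← mul_assoc, hεc, one_mul]
      rw [this, hη, RArc.y_eq]
      push_cast
      rw [mul_sub, ← mul_assoc (γ.ε : ℂ) γ.ε, hεc]
      ring
    have e4 : ‖(s : ℂ) ^ γ.d - sc ^ γ.d‖ ≤ c' * T := by
      rw [e3, norm_neg, norm_mul, hεn, one_mul]; exact hd2.le
    have e5 : ‖k s‖ ≤ B := (hball₂ hm1).1.2.le
    have e6 : ‖k s - k sc‖ ≤ K * (s * (L * (c' * s ^ ((γ.d : ℝ) * (h - 1))))) := by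
      have := hlip.dist_le_mul s (hball₂ hm1).1.1 sc (hball₂ hm2).1.1
      rw [dist_eq_norm, dist_eq_norm, norm_sub_rev (s : ℂ) sc, hscs] at this
      refine this.trans ?_
      gcongr
      exact hρz.trans (mul_le_mul_of_nonneg_left hzn L.2)
    have e7 : ‖sc ^ γ.d‖ ≤ 2 ^ γ.d * s ^ γ.d := by
      rw [norm_pow, ← mul_pow]
      exact pow_le_pow_left₀ (norm_nonneg _) hscn _
    have e8 : ‖((s : ℂ) ^ γ.d - sc ^ γ.d) * k s‖ ≤ c' * B * T := by
      rw [norm_mul]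
      calc _ ≤ c' * T * B := mul_le_mul e4 e5 (norm_nonneg _) (by positivity)
        _ = _ := by ring
    have e9 : ‖sc ^ γ.d * (k s - k sc)‖ ≤ 2 ^ γ.d * (K * (L * c')) * T := by
      rw [norm_mul]
      calc _ ≤ 2 ^ γ.d * s ^ γ.d * (K * (s * (L * (c' * s ^ ((γ.d : ℝ) * (h - 1)))))) :=
            mul_le_mul e7 e6 (norm_nonneg _) (by positivity)
        _ = 2 ^ γ.d * (K * (L * c')) * T * s := by rw [hTeq]; ring
        _ ≤ 2 ^ γ.d * (K * (L * c')) * T * 1 := by gcongr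
        _ = _ := mul_one _
    rw [e1, e2, add_mul, add_mul]
    refine (norm_add_le _ _).trans ?_
    rw [add_assoc]
    exact add_le_add hd1.le ((norm_add_le _ _).trans (add_le_add e8 e9))
  · rw [arcGerm]
    simp only [add_sub_cancel, hscd]
    exact hgP

end UpperBound

section HeightUpper

/-- The Taylor coefficients of the complex germ along an arc, on a horn where `f = O (|y| ^ E)`. -/
theorem arcGerm_coeff_isBigO {f : ℝ × ℝ → ℝ} {g : ℂ × ℂ → ℂ} (hg : IsComplexification f g)
    {γ : RArc} {R : ℕ → ℂ × (ℂ × PUnit.{1}) → ℂ} (hR : IsTaylorSeq (arcGerm g γ) 0 R) {h E : ℝ}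
    (hh : 0 < h) (hb : RelBound f γ h E) {n : ℕ} (hn : E ≤ h * n) {i : ℕ} (hi : i < n) :
    (fun s : ℝ => R i (0, ((s : ℂ), PUnit.unit))) =O[𝓝[>] 0]
      fun s => s ^ ((γ.d : ℝ) * E - γ.d * h * i) := by
  have hd' : (0 : ℝ) < γ.d := mod_cast γ.d_pos
  have hdh : 0 < (γ.d : ℝ) * h := mul_pos hd' hh
  set T : ℝ → ℝ := fun s => s ^ ((γ.d : ℝ) * h) with hT
  have hTt : Tendsto T (𝓝[>] 0) (𝓝 0) := tendsto_rpow_nhds_zero hdh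
  have hid : Tendsto (fun s : ℝ => s) (𝓝[>] 0) (𝓝 0) := tendsto_id.within
  have hvals : ∀ k < n, (fun s : ℝ => ∑ j ∈ Finset.range n,
      (R j (0, ((s : ℂ), PUnit.unit)) * (T s : ℂ) ^ j) * (k : ℂ) ^ j) =O[𝓝[>] 0]
        fun s => s ^ ((γ.d : ℝ) * E) := by
    intro k hk
    have hkT : Tendsto (fun s : ℝ => (k : ℝ) * T s) (𝓝[>] 0) (𝓝 0) := by
      simpa using hTt.const_mul (k : ℝ)
    have hpt : Tendsto (fun s : ℝ => ((((k : ℝ) * T s : ℝ) : ℂ), ((s : ℂ), PUnit.unit)))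
        (𝓝[>] 0) (𝓝 ((0 : ℂ), (0 : ℂ × PUnit.{1}))) := by
      have e1 : Tendsto (fun s : ℝ => (((k : ℝ) * T s : ℝ) : ℂ)) (𝓝[>] 0) (𝓝 0) := by
        have := (Complex.continuous_ofReal.tendsto 0).comp hkT
        rwa [ofReal_zero] at this
      have e2 : Tendsto (fun s : ℝ => (s : ℂ)) (𝓝[>] 0) (𝓝 0) := tendsto_ofReal_right.of_within
      exact e1.prodMk_nhds (e2.prodMk_nhds tendsto_const_nhds)
    have hexp := hpt.eventually (hR.expand n)
    have hreal := (hkT.prodMk_nhds hid).eventually (arcGerm_ofReal hg γ)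
    obtain ⟨C, hC⟩ := hb k
    have hC' := (tendsto_pow_zero_right γ.d_pos).eventually hC
    have h1 : (fun s : ℝ => arcGerm g γ ((((k : ℝ) * T s : ℝ) : ℂ), ((s : ℂ), PUnit.unit)))
        =O[𝓝[>] 0] fun s => s ^ ((γ.d : ℝ) * E) := by
      refine IsBigO.of_bound C ?_
      filter_upwards [hreal, hC', self_mem_nhdsWithin] with s e1 e2 (hs : (0 : ℝ) < s)
      rw [e1, norm_real, norm_of_nonneg (rpow_nonneg hs.le _), ← pow_rpow_eq hs.le,
        norm_eq_abs, RArc.y_eq, ← γ.X_pow hs.le]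
      refine e2 _ ?_
      rw [pow_rpow_eq hs.le, abs_of_nonneg (by positivity)]
    have h2 : (fun s : ℝ => (((k : ℝ) * T s : ℝ) : ℂ) ^ n *
        R n ((((k : ℝ) * T s : ℝ) : ℂ), ((s : ℂ), PUnit.unit))) =O[𝓝[>] 0]
          fun s => s ^ ((γ.d : ℝ) * E) := by
      have e1 : (fun s : ℝ => R n ((((k : ℝ) * T s : ℝ) : ℂ), ((s : ℂ), PUnit.unit)))
          =O[𝓝[>] 0] fun _ => (1 : ℝ) :=
        ((hR.analyticAt n).continuousAt.tendsto.comp hpt).isBigO_one ℝ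
      have e2 : (fun s : ℝ => (((k : ℝ) * T s : ℝ) : ℂ) ^ n) =O[𝓝[>] 0]
          fun s => s ^ ((γ.d : ℝ) * h * n) := by
        refine IsBigO.of_bound ((k : ℝ) ^ n) ?_
        filter_upwards [self_mem_nhdsWithin] with s (hs : (0 : ℝ) < s)
        rw [norm_pow, norm_real, norm_of_nonneg (by positivity), mul_pow,
          norm_of_nonneg (rpow_nonneg hs.le _), hT, ← rpow_natCast (s ^ _),
          ← rpow_mul hs.le]
      have := e2.mul e1
      simp only [mul_one] at this
      refine this.trans (isBigO_rpow_rpow ?_)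
      rw [mul_assoc]
      gcongr
    refine (h1.sub h2).congr' ?_ EventuallyEq.rfl
    filter_upwards [hexp] with s hs
    rw [hs, add_sub_cancel_right]
    refine sum_congr rfl fun j _ => ?_
    push_cast
    rw [mul_pow]
    ring
  have h3 := coeff_isBigO hvals i hi
  have h5 : (fun s : ℝ => R i (0, ((s : ℂ), PUnit.unit))) =O[𝓝[>] 0]
      fun s : ℝ => (R i (0, ((s : ℂ), PUnit.unit)) * (T s : ℂ) ^ i) *
        ((s ^ (-((γ.d : ℝ) * h * i)) : ℝ) : ℂ) := by
    refine IsBigO.of_bound 1 ?_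
    filter_upwards [self_mem_nhdsWithin] with s (hs : (0 : ℝ) < s)
    have : ((T s : ℂ) ^ i) * ((s ^ (-((γ.d : ℝ) * h * i)) : ℝ) : ℂ) = 1 := by
      rw [← Complex.ofReal_pow, ← Complex.ofReal_mul, hT]
      rw [← rpow_natCast (s ^ _), ← rpow_mul hs.le, ← rpow_add hs, add_neg_cancel,
        rpow_zero, Complex.ofReal_one]
    rw [mul_assoc, this, mul_one, one_mul]
  have h6 : (fun s : ℝ => (R i (0, ((s : ℂ), PUnit.unit)) * (T s : ℂ) ^ i) *
        ((s ^ (-((γ.d : ℝ) * h * i)) : ℝ) : ℂ)) =O[𝓝[>] 0]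
          fun s => s ^ ((γ.d : ℝ) * E) * s ^ (-((γ.d : ℝ) * h * i)) := by
    refine h3.mul (IsBigO.of_bound 1 (Eventually.of_forall fun s => ?_))
    rw [norm_real, one_mul]
  refine (h5.trans h6).congr' EventuallyEq.rfl ?_
  filter_upwards [self_mem_nhdsWithin] with s (hs : (0 : ℝ) < s)
  rw [← rpow_add hs]
  congr 1

/-- A stable exponent bounds the contact orders with the complex zeros. -/
theorem heightGE_of_near {f : ℝ × ℝ → ℝ} (hf : RegularX f) {g : ℂ × ℂ → ℂ}
    (hg : IsComplexification f g) {γ : RArc} {ζ : ℝ → ℂ × ℂ} (hζ0 : ζ 0 = 0)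
    (hz : ∀ᶠ s in 𝓝[>] (0 : ℝ), g (ζ s) = 0) {h h' : ℝ} (hh : 1 < h) (hnear : γ.Near ζ h)
    (hh' : 0 < h') (hlt : h' < h) : ¬ IsStableAt f γ h' := by
  intro hst
  have hd' : (0 : ℝ) < γ.d := mod_cast γ.d_pos
  have hg0 : g 0 = 0 := by
    have := hg.2.self_of_nhds
    simp only [Prod.fst_zero, Prod.snd_zero, ofReal_zero] at this
    rw [hf.2.1, ofReal_zero] at this
    exact this
  obtain ⟨E, J, -, hE, hlim, hJ⟩ := hf.exists_initial γ hh'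
  have hJ0 := hJ.2 hst
  obtain ⟨R, hR⟩ := (analyticAt_arcGerm hg.1 γ).exists_isTaylorSeq
  obtain ⟨n, hn⟩ : ∃ n : ℕ, E ≤ h' * n := by
    obtain ⟨n, hn⟩ := exists_nat_ge (E / h')
    exact ⟨n, by rwa [div_le_iff₀' hh'] at hn⟩
  set n' := n + 1 with hn'
  have hn1 : E ≤ h' * n' := hn.trans (by gcongr; omega)
  set α : ℕ → ℂ → ℂ := fun i s => R i (0, (s, PUnit.unit)) with hα
  have hαan : ∀ i, AnalyticAt ℂ (α i) 0 := fun i =>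
    AnalyticAt.fun_comp (g := R i) (f := fun s : ℂ => ((0 : ℂ), (s, PUnit.unit)))
      (hR.analyticAt i) (by fun_prop)
  have hαO : ∀ i < n', α i =O[𝓝[≠] 0] fun s => ‖s‖ ^ ((γ.d : ℝ) * E - γ.d * h' * i) :=
    fun i hi => isBigO_of_real (hαan i) (arcGerm_coeff_isBigO hg hR hh' ((hE E).2 le_rfl) hn1 hi)
  -- the coefficient of order zero has exact order `d * E`
  have hα0 : (fun s : ℂ => ‖s‖ ^ ((γ.d : ℝ) * E)) =O[𝓝[≠] 0] α 0 := by
    refine isBigO_rev_of_real (hαan 0) ?_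
    have h1 : Tendsto (fun y : ℝ => f (γ.X y + 0 * y ^ h', γ.ε * y) / y ^ E) (𝓝[>] 0)
        (𝓝 (J.eval 0)) :=
      Tendsto.comp (g := fun z : ℝ × ℝ => f (γ.X z.2 + z.1 * z.2 ^ h', γ.ε * z.2) / z.2 ^ E)
        (f := fun y : ℝ => ((0 : ℝ), y)) (hlim 0) (tendsto_const_prodMk 0)
    have h2 := (h1.comp (tendsto_pow_zero_right γ.d_pos)).inv₀ hJ0
    have h3 := (h2.isBigO_one ℝ).mul
      ((isBigO_refl (fun s : ℝ => α 0 s) (𝓝[>] 0)).norm_left.norm_right)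
    have hid : Tendsto (fun s : ℝ => s) (𝓝[>] 0) (𝓝 0) := tendsto_id.within
    have hreal := ((tendsto_const_nhds (x := (0 : ℝ))).prodMk_nhds hid).eventually
      (arcGerm_ofReal hg γ)
    have hne := (h1.comp (tendsto_pow_zero_right γ.d_pos)).eventually_ne hJ0
    simp only [one_mul] at h3
    refine (IsBigO.trans ?_ h3).of_norm_right
    refine IsBigO.of_bound 1 ?_
    filter_upwards [hreal, hne, self_mem_nhdsWithin] with s e1 e2 (hs : (0 : ℝ) < s)
    have e4 : α 0 s = ((f (γ.x s + 0, γ.y s) : ℝ) : ℂ) := by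
      rw [← e1, hα]; simp only [hR.zero, ofReal_zero]
    simp only [Function.comp, zero_mul] at e2 ⊢
    rw [e4, norm_real, RArc.y_eq, ← γ.X_pow hs.le]
    have e5 : f (γ.X (s ^ γ.d) + 0, γ.ε * s ^ γ.d) ≠ 0 := fun h0 => e2 (by rw [h0, zero_div])
    rw [← pow_rpow_eq hs.le, one_mul, norm_mul, norm_inv, norm_div, norm_norm, inv_div,
      div_mul_cancel₀ _ (norm_ne_zero_iff.2 e5)]
  obtain ⟨C, hC⟩ := exists_zero_near hg0 hζ0 hz hh hnear
  obtain ⟨w, hw⟩ := hC.choice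
  obtain ⟨X, hX⟩ := hw.choice
  have hid : Tendsto (fun s : ℝ => s) (𝓝[>] 0) (𝓝 0) := tendsto_id.within
  have hpos : ∀ᶠ s : ℝ in 𝓝[>] 0, 0 < s := self_mem_nhdsWithin
  have hwn : ∀ᶠ s : ℝ in 𝓝[>] 0, s / 2 ≤ ‖w s‖ ∧ ‖w s‖ ≤ 2 * s := by
    filter_upwards [hX, hpos] with s h1 hs
    have e1 : ‖(s : ℂ)‖ = s := by rw [norm_real, norm_of_nonneg hs.le]
    have e2 := norm_sub_norm_le (s : ℂ) (w s)
    have e3 := norm_sub_norm_le (w s) (s : ℂ)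
    rw [norm_sub_rev] at e2
    rw [e1] at e2 e3
    constructor <;> linarith [h1.1]
  have hwt : Tendsto w (𝓝[>] 0) (𝓝[≠] 0) := by
    refine tendsto_nhdsWithin_of_tendsto_nhds_of_eventually_within _ ?_ ?_
    · refine squeeze_zero_norm' (a := fun s : ℝ => 2 * s) (hwn.mono fun s h => h.2) ?_
      simpa using hid.const_mul 2
    · filter_upwards [hwn, hpos] with s h1 hs
      have : 0 < ‖w s‖ := by linarith [h1.1]
      simpa using this
  have hwΘ : (fun s : ℝ => ‖w s‖) =Θ[𝓝[>] 0] fun s => s := by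
    constructor <;> refine IsBigO.of_bound 2 ?_ <;> filter_upwards [hwn, hpos] with s h1 hs <;>
      rw [norm_norm, norm_of_nonneg hs.le] <;> linarith [h1.1, h1.2]
  have hwO : ∀ κ : ℝ, (fun s : ℝ => ‖w s‖ ^ κ) =Θ[𝓝[>] 0] fun s => s ^ κ := fun κ =>
    hwΘ.rpow (Eventually.of_forall fun s => norm_nonneg _) (hpos.mono fun s hs => hs.le)
  have hdh : 0 < (γ.d : ℝ) * h := mul_pos hd' (by linarith)
  have hXO : X =O[𝓝[>] 0] fun s => s ^ ((γ.d : ℝ) * h) := by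
    refine IsBigO.of_bound C ?_
    filter_upwards [hX, hpos] with s h1 hs
    rw [norm_of_nonneg (by positivity)]
    exact h1.2.1
  have hXpow : ∀ i : ℕ, (fun s => X s ^ i) =O[𝓝[>] 0] fun s => s ^ ((γ.d : ℝ) * h * i) := by
    intro i
    refine (hXO.pow i).congr' EventuallyEq.rfl ?_
    filter_upwards [hpos] with s hs
    rw [← rpow_natCast (s ^ _), ← rpow_mul hs.le]
  have hX0 : Tendsto X (𝓝[>] 0) (𝓝 0) := hXO.trans_tendsto (tendsto_rpow_nhds_zero hdh)
  have hpt : Tendsto (fun s : ℝ => (X s, (w s, PUnit.unit))) (𝓝[>] 0)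
      (𝓝 ((0 : ℂ), (0 : ℂ × PUnit.{1}))) :=
    hX0.prodMk_nhds ((hwt.of_within).prodMk_nhds tendsto_const_nhds)
  -- all other terms of the expansion at the zero are of higher order
  have hhi : (fun s : ℝ => α 0 (w s)) =O[𝓝[>] 0] fun s => s ^ ((γ.d : ℝ) * E + γ.d * (h - h')) := by
    have hsum : (fun s : ℝ => ∑ i ∈ Finset.range n, X s ^ (i + 1) * α (i + 1) (w s)) =O[𝓝[>] 0]
        fun s => s ^ ((γ.d : ℝ) * E + γ.d * (h - h')) := by
      refine IsBigO.fun_sum fun i hi => ?_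
      have e1 := ((hαO (i + 1) (by rw [Finset.mem_range] at hi; omega)).comp_tendsto hwt).trans
        (hwO _).1
      refine (((hXpow (i + 1)).mul e1).congr' EventuallyEq.rfl (g₂ := fun s : ℝ =>
        s ^ ((γ.d : ℝ) * h * (i + 1 : ℕ) + (γ.d * E - γ.d * h' * (i + 1 : ℕ)))) ?_).trans
        (isBigO_rpow_rpow ?_)
      · filter_upwards [hpos] with s hs
        rw [rpow_add hs]
      · push_cast
        have : 0 ≤ (γ.d : ℝ) * (h - h') * i := by
          have := sub_pos.2 hlt
          positivity
        nlinarith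
    have htop : (fun s : ℝ => X s ^ n' * R n' (X s, (w s, PUnit.unit))) =O[𝓝[>] 0]
        fun s => s ^ ((γ.d : ℝ) * E + γ.d * (h - h')) := by
      have e1 : (fun s : ℝ => R n' (X s, (w s, PUnit.unit))) =O[𝓝[>] 0] fun _ => (1 : ℝ) :=
        ((hR.analyticAt n').continuousAt.tendsto.comp hpt).isBigO_one ℝ
      have := (hXpow n').mul e1
      simp only [mul_one] at this
      refine this.trans (isBigO_rpow_rpow ?_)
      rw [hn']
      push_cast
      have e2 : 0 ≤ (γ.d : ℝ) * (h - h') * n := by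
        have := sub_pos.2 hlt
        positivity
      nlinarith
    refine ((hsum.add htop).neg_left).congr' ?_ EventuallyEq.rfl
    filter_upwards [hX, hpt.eventually (hR.expand n')] with s h1 h2
    rw [h1.2.2, hn', Finset.sum_range_succ'] at h2
    simp only [pow_zero, one_mul] at h2
    simp only [hα, hn']
    linear_combination h2
  have hlow : (fun s : ℝ => s ^ ((γ.d : ℝ) * E)) =O[𝓝[>] 0] fun s => α 0 (w s) :=
    (hwO _).2.trans (hα0.comp_tendsto hwt)
  refine not_isBigO_rpow ?_ (hlow.trans hhi)
  have := mul_pos hd' (sub_pos.2 hlt)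
  linarith

end HeightUpper

section HeightLower

theorem iteratedDeriv_complexification {f : ℝ × ℝ → ℝ} {g : ℂ × ℂ → ℂ}
    (hg : IsComplexification f g) (γ : RArc) {R : ℕ → ℂ × (ℂ × PUnit.{1}) → ℂ}
    (hR : IsTaylorSeq (arcGerm g γ) 0 R) {m : ℕ} (hlow : ∀ i ≤ m, R i (0, 0) = 0) :
    iteratedDeriv m (fun x => f (x, 0)) 0 = 0 := by
  have h1 := (hR.eventually_expand (m + 1)).self_of_nhds
  have hS : AnalyticAt ℝ (fun X : ℝ => (R (m + 1) ((X : ℂ), 0)).re) 0 := by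
    have e1 : AnalyticAt ℝ (R (m + 1)) (0, 0) := (hR.analyticAt (m + 1)).restrictScalars
    have e2 : AnalyticAt ℝ (fun X : ℝ => R (m + 1) ((X : ℂ), 0)) 0 := by
      refine AnalyticAt.fun_comp (g := R (m + 1))
        (f := fun X : ℝ => ((X : ℂ), (0 : ℂ × PUnit.{1}))) ?_ ?_
      · simpa using e1
      · exact (Complex.ofRealCLM.analyticAt 0).prod analyticAt_const
    exact (Complex.reCLM.analyticAt _).comp e2
  have hreal : ∀ᶠ X : ℝ in 𝓝 0, arcGerm g γ ((X : ℂ), 0) = ((f (X, 0) : ℝ) : ℂ) := by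
    have hc : Tendsto (fun X : ℝ => (X, (0 : ℝ))) (𝓝 0) (𝓝 0) := by
      have : Continuous fun X : ℝ => (X, (0 : ℝ)) := by fun_prop
      exact this.tendsto 0
    filter_upwards [hc.eventually (arcGerm_ofReal hg γ)] with X hX
    simp only [γ.x_zero, RArc.y_eq, zero_pow γ.d_pos.ne', mul_zero, zero_add, ofReal_zero] at hX
    exact hX
  have h2 : ∀ᶠ X : ℝ in 𝓝 0, f (X, 0) = ∑ i ∈ Finset.range (m + 1), X ^ i * (0 : ℝ) +
      X ^ (m + 1) * (R (m + 1) ((X : ℂ), 0)).re := by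
    have hc : Tendsto (fun X : ℝ => (X : ℂ)) (𝓝 0) (𝓝 0) := by
      have := Complex.continuous_ofReal.tendsto 0
      rwa [ofReal_zero] at this
    filter_upwards [hreal, hc.eventually h1] with X e1 e2
    rw [e1, sum_eq_zero fun i hi => by
      rw [hlow i (Nat.lt_succ_iff.1 (Finset.mem_range.1 hi)), mul_zero], zero_add,
      ← Complex.ofReal_pow] at e2
    have := congrArg Complex.re e2
    rw [Complex.ofReal_re, Complex.re_ofReal_mul] at this
    simp [this]
  simpa using iteratedDeriv_of_expand hS h2 (Nat.lt_succ_self m)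

/-- At a rational exponent which is not stable, a Newton step followed by a Puiseux root gives a
complex zero. -/
theorem exists_zeroArc {f : ℝ × ℝ → ℝ} (hf : RegularX f) (γ : RArc) {p b : ℕ} (hp : 0 < p)
    (hb0 : 0 < b) (hst : ¬ IsStableAt f γ ((p : ℝ) / b)) :
    ∃ ζ ∈ complexZeroArcs f, γ.Near ζ ((p : ℝ) / b) := by
  classical
  obtain ⟨g, hg⟩ := exists_isComplexification hf.1
  have hd := γ.d_pos
  have hd' : (0 : ℝ) < γ.d := mod_cast hd
  have hb' : (0 : ℝ) < b := mod_cast hb0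
  have hpr : (0 : ℝ) < (p : ℝ) / b := by positivity
  obtain ⟨E, J, hJne, hE, hlim, hJ⟩ := hf.exists_initial γ hpr
  have hJ0 : J.eval 0 = 0 := by
    by_contra hcon
    exact hst (hJ.1 hcon)
  obtain ⟨R, hR⟩ := (analyticAt_arcGerm hg.1 γ).exists_isTaylorSeq
  have hex : ∃ i, R i (0, 0) ≠ 0 := by
    by_contra hcon
    push Not at hcon
    obtain ⟨m₀, hm₀⟩ := hf.2.2
    exact hm₀ (iteratedDeriv_complexification hg γ hR fun i _ => hcon i)
  set m := Nat.find hex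
  have hmne : R m (0, 0) ≠ 0 := Nat.find_spec hex
  -- the Taylor coefficients as power series in the parameter
  have hα : ∀ i, AnalyticAt ℂ (fun s : ℂ => R i (0, (s, PUnit.unit))) 0 := fun i =>
    AnalyticAt.fun_comp (g := R i) (f := fun s : ℂ => ((0 : ℂ), (s, PUnit.unit)))
      (hR.analyticAt i) (by fun_prop)
  set a := p * γ.d with ha
  have ha0 : 0 < a := Nat.mul_pos hp hd
  have hk : ∀ i, ∃ (k : ℕ) (A : ℂ × PUnit.{1} → ℂ), AnalyticAt ℂ A 0 ∧
      (∀ᶠ x in 𝓝 (0 : ℂ × PUnit.{1}), R i (0, x) = x.1 ^ k * A x) ∧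
      (A 0 ≠ 0 ∨ k = a * m) := by
    intro i
    have hfst : Tendsto (fun x : ℂ × PUnit.{1} => x.1) (𝓝 0) (𝓝 0) := by
      have : Continuous fun x : ℂ × PUnit.{1} => x.1 := continuous_fst
      exact this.tendsto 0
    by_cases h0 : ∀ᶠ s in 𝓝 (0 : ℂ), R i (0, (s, PUnit.unit)) = 0
    · refine ⟨a * m, 0, analyticAt_const, ?_, Or.inr rfl⟩
      filter_upwards [hfst.eventually h0] with x hx
      have : x = (x.1, PUnit.unit) := rfl
      rw [this, hx]; simp
    · obtain ⟨n, u, hu, hu0, hn⟩ := (hα i).exists_eventuallyEq_pow_smul_nonzero_iff.2 h0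
      refine ⟨n, fun x => u x.1, ?_, ?_, Or.inl hu0⟩
      · exact AnalyticAt.fun_comp (g := u) (f := fun x : ℂ × PUnit.{1} => x.1) hu (by fun_prop)
      · filter_upwards [hfst.eventually hn] with x hx
        have : x = (x.1, PUnit.unit) := rfl
        rw [this, hx]; simp
  choose k A hA hRA hkA using hk
  obtain ⟨i₀, hi₀, hmin⟩ := (Finset.range (m + 1)).exists_min_image
    (fun i => if i = m then a * m else b * k i + a * i) ⟨m, by simp⟩
  set c := if i₀ = m then a * m else b * k i₀ + a * i₀ with hc
  have hc1 : ∀ i < m, c ≤ b * k i + a * i := fun i hi => by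
    have := hmin i (by rw [Finset.mem_range]; omega)
    rwa [if_neg hi.ne] at this
  have hc2 : c ≤ a * m := by
    have := hmin m (by simp)
    rwa [if_pos rfl] at this
  set G1 := newtonQuotient m a b c k A (R m)
  have hnewton := hR.newton_eq (fun i _ => hRA i) ha0 hb0 hc1 hc2
  have hG1an : ∀ w : ℂ, AnalyticAt ℂ G1 (w, (0 : ℂ × PUnit.{1})) := fun w =>
    analyticAt_newtonQuotient_of (t₀ := PUnit.unit) (fun i _ => hA i) (hR.analyticAt m) ha0 hb0
  -- the edge polynomial
  let Jc : ℂ[X] := ∑ i ∈ Finset.range m, monomial i (if b * k i + a * i = c then A i 0 else 0) +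
    monomial m (if a * m = c then R m (0, 0) else 0)
  have hJc : ∀ w : ℂ, G1 (w, (0 : ℂ × PUnit.{1})) = Jc.eval w := by
    intro w
    have h1 := newtonQuotient_zero (A := A) (S := R m) (E := PUnit.{1}) hb0 ha0 hc1 hc2 w PUnit.unit
    refine Eq.trans h1 ?_
    simp only [Jc, Polynomial.eval_add, eval_finsetSum, Polynomial.eval_monomial]
    congr 1
    · refine sum_congr rfl fun i _ => ?_
      rw [mul_comm]; rfl
    · rw [mul_comm]; rfl
  have hJcne : Jc ≠ 0 := by
    intro h0
    have hco : ∀ i, Jc.coeff i = 0 := fun i => by rw [h0]; simp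
    have hcm : Jc.coeff m = if a * m = c then R m (0, 0) else 0 := by
      simp only [Jc, coeff_add, finsetSum_coeff, coeff_monomial, if_true]
      rw [sum_eq_zero fun i hi => if_neg (Finset.mem_range.1 hi).ne, zero_add]
    have hne : a * m ≠ c := by
      intro h1
      rw [hco, if_pos h1] at hcm
      exact hmne hcm.symm
    have hi₀m : i₀ ≠ m := by
      intro h1
      rw [hc, if_pos h1] at hne
      exact hne rfl
    have hi₀lt : i₀ < m := by rw [Finset.mem_range] at hi₀; omega
    have hceq : b * k i₀ + a * i₀ = c := by rw [hc, if_neg hi₀m]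
    have hA0 : A i₀ 0 ≠ 0 := by
      rcases hkA i₀ with h1 | h1
      · exact h1
      · exfalso
        rw [h1] at hceq
        have : a * m ≤ b * (a * m) := Nat.le_mul_of_pos_left _ hb0
        omega
    have hci : Jc.coeff i₀ = A i₀ 0 := by
      simp only [Jc, coeff_add, finsetSum_coeff, coeff_monomial]
      rw [if_neg hi₀m.symm, add_zero, Finset.sum_ite_eq' (Finset.range m) i₀,
        if_pos (Finset.mem_range.2 hi₀lt), if_pos hceq]
    exact hA0 (by rw [← hci, hco])
  -- comparison with the initial form of `f`
  have hda : ((γ.d : ℝ)) * ((p : ℝ) / b) = (a : ℝ) / b := by rw [ha]; push_cast; ring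
  have hcomp : ∀ u : ℝ, Tendsto (fun τ : ℝ => ((f (γ.X (τ ^ (b * γ.d)) + u * τ ^ a,
      γ.ε * τ ^ (b * γ.d)) : ℝ) : ℂ) / (τ : ℂ) ^ c) (𝓝[>] 0) (𝓝 (Jc.eval (u : ℂ))) := by
    intro u
    have hpt : Tendsto (fun τ : ℝ => ((u : ℂ), ((τ : ℂ), PUnit.unit))) (𝓝[>] 0)
        (𝓝 ((u : ℂ), (0 : ℂ × PUnit.{1}))) :=
      tendsto_const_nhds.prodMk_nhds ((tendsto_ofReal_right.of_within).prodMk_nhds tendsto_const_nhds)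
    have h1 := (hG1an u).continuousAt.tendsto.comp hpt
    rw [hJc] at h1
    refine h1.congr' ?_
    have hz : Tendsto (fun τ : ℝ => (u * τ ^ a, τ ^ b)) (𝓝[>] 0) (𝓝 0) := by
      have : ContinuousAt (fun τ : ℝ => (u * τ ^ a, τ ^ b)) 0 := by fun_prop
      have := this.tendsto.within (s := Ioi 0)
      rwa [zero_pow ha0.ne', zero_pow hb0.ne', mul_zero] at this
    filter_upwards [hpt.eventually (hnewton u), hz.eventually (arcGerm_ofReal hg γ),
      self_mem_nhdsWithin] with τ e1 e2 (hτ : (0 : ℝ) < τ)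
    have hτc : (τ : ℂ) ^ c ≠ 0 := by
      have : (τ : ℂ) ≠ 0 := mod_cast hτ.ne'
      exact pow_ne_zero _ this
    push_cast at e2
    have e4 : γ.X (τ ^ (b * γ.d)) = γ.x (τ ^ b) := by rw [pow_mul, γ.X_pow (pow_nonneg hτ.le _)]
    rw [e4, pow_mul τ b γ.d]
    have e5 := e1.symm.trans e2
    rw [RArc.y_eq] at e5
    rw [← e5]
    exact (mul_div_cancel_left₀ _ hτc).symm
  have hJc0 : Jc.eval 0 = 0 := by
    -- the same limit, computed from the initial form
    have hlim2 : ∀ u : ℝ, Tendsto (fun τ : ℝ => f (γ.X (τ ^ (b * γ.d)) + u * τ ^ a,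
        γ.ε * τ ^ (b * γ.d)) / τ ^ (((b * γ.d : ℕ) : ℝ) * E)) (𝓝[>] 0) (𝓝 (J.eval u)) := by
      intro u
      have h1 : Tendsto (fun y : ℝ => f (γ.X y + u * y ^ ((p : ℝ) / b), γ.ε * y) / y ^ E) (𝓝[>] 0)
          (𝓝 (J.eval u)) :=
        Tendsto.comp (g := fun z : ℝ × ℝ =>
          f (γ.X z.2 + z.1 * z.2 ^ ((p : ℝ) / b), γ.ε * z.2) / z.2 ^ E)
          (f := fun y : ℝ => (u, y)) (hlim u) (tendsto_const_prodMk u)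
      refine (h1.comp (tendsto_pow_zero_right (Nat.mul_pos hb0 hd))).congr' ?_
      filter_upwards [self_mem_nhdsWithin] with τ (hτ : (0 : ℝ) < τ)
      simp only [Function.comp]
      rw [pow_rpow_eq hτ.le, pow_rpow_eq hτ.le]
      congr 4
      rw [← rpow_natCast τ a]
      congr 1
      rw [ha]
      push_cast
      field_simp
    have hex2 : ∃ u : ℝ, Jc.eval (u : ℂ) ≠ 0 ∧ J.eval u ≠ 0 := by
      obtain ⟨u, hu⟩ := Infinite.exists_notMem_finset
        ((Jc.roots.toFinset.preimage (fun u : ℝ => (u : ℂ))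
          (Complex.ofReal_injective.injOn)) ∪ J.roots.toFinset)
      rw [Finset.mem_union, Finset.mem_preimage, Multiset.mem_toFinset, Multiset.mem_toFinset,
        mem_roots hJcne, mem_roots hJne, not_or] at hu
      exact ⟨u, hu.1, hu.2⟩
    have hlimc := fun u : ℝ => (Complex.continuous_ofReal.tendsto _).comp (hlim2 u)
    obtain ⟨u, hu1, hu2⟩ := hex2
    have hu2' : ((J.eval u : ℝ) : ℂ) ≠ 0 := mod_cast hu2
    -- the quotient of the two weights has a nonzero limit
    have h1 := (hlimc 0).div ((hlimc u).div (hcomp u) hu1) (div_ne_zero hu2' hu1)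
    rw [hJ0, ofReal_zero, zero_div] at h1
    have h2 := tendsto_nhds_unique (hcomp 0) (h1.congr' ?_)
    · simpa using h2
    filter_upwards [(hlim2 u).eventually_ne hu2, self_mem_nhdsWithin] with τ e1 (hτ : (0 : ℝ) < τ)
    have hf0 : ((f (γ.X (τ ^ (b * γ.d)) + u * τ ^ a, γ.ε * τ ^ (b * γ.d)) : ℝ) : ℂ) ≠ 0 := by
      exact_mod_cast fun h0 => e1 (by rw [h0, zero_div])
    have h3 : ((τ ^ (((b * γ.d : ℕ) : ℝ) * E) : ℝ) : ℂ) ≠ 0 := by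
      exact_mod_cast (rpow_pos_of_pos hτ _).ne'
    simp only [Function.comp, Pi.div_apply]
    rw [Complex.ofReal_div, Complex.ofReal_div, div_div_div_cancel_left' _ _ hf0, div_div_eq_mul_div,
      div_mul_cancel₀ _ h3]
  -- a Puiseux root of the quotient
  obtain ⟨R', hR'⟩ := (hG1an 0).exists_isTaylorSeq
  have hcoef := fun i => hR'.coeff_of_polynomial (J := Jc) (w₀ := 0)
    (fun w => by rw [hJc, zero_add]) i
  have hmult : 0 < Jc.rootMultiplicity 0 := (rootMultiplicity_pos hJcne).2 hJc0
  obtain ⟨N, hN, w, hw, hw0, hroot⟩ := hR'.exists_puiseux_root hmult (fun i hi => by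
      have := hcoef i
      rw [Polynomial.taylor_coeff_of_lt_rootMultiplicity hi] at this
      exact this)
    (by
      have := hcoef (Jc.rootMultiplicity 0)
      intro h0
      exact Polynomial.taylor_coeff_rootMultiplicity_ne_zero hJcne 0 (this.symm.trans h0))
  have hNb : 0 < N * b := Nat.mul_pos hN hb0
  have hNa : 0 < N * a := Nat.mul_pos hN ha0
  let ζ : ℝ → ℂ × ℂ := fun τ => (γ.xc ((τ : ℂ) ^ (N * b)) + w τ * (τ : ℂ) ^ (N * a),
    γ.ε * ((τ : ℂ) ^ (N * b)) ^ γ.d)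
  have hof : AnalyticAt ℝ (fun τ : ℝ => (τ : ℂ)) 0 := Complex.ofRealCLM.analyticAt 0
  have hζan : AnalyticAt ℝ ζ 0 := by
    have e1 : AnalyticAt ℂ (fun τ : ℂ => (γ.xc (τ ^ (N * b)) + w τ * τ ^ (N * a),
        (γ.ε : ℂ) * (τ ^ (N * b)) ^ γ.d)) 0 := by
      have e2 : AnalyticAt ℂ (fun τ : ℂ => γ.xc (τ ^ (N * b))) 0 := by
        refine AnalyticAt.fun_comp (g := γ.xc) (f := fun τ : ℂ => τ ^ (N * b)) ?_ (by fun_prop)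
        rw [zero_pow hNb.ne']
        exact γ.analyticAt_xc
      fun_prop
    have e3 : AnalyticAt ℝ (fun τ : ℂ => (γ.xc (τ ^ (N * b)) + w τ * τ ^ (N * a),
        (γ.ε : ℂ) * (τ ^ (N * b)) ^ γ.d)) ((0 : ℝ) : ℂ) := by
      rw [ofReal_zero]
      exact e1.restrictScalars
    exact AnalyticAt.fun_comp (f := fun τ : ℝ => (τ : ℂ)) e3 hof
  have hζ0 : ζ 0 = 0 := by simp [ζ, hNb.ne', hNa.ne', γ.xc_zero, hd.ne']
  refine ⟨ζ, ⟨⟨hζan, hζ0, ?_⟩, g, hg, ?_⟩, ?_⟩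
  · intro hev
    obtain ⟨τ, h1, h2⟩ := (hev.and self_mem_nhdsWithin).exists
    have hτ : (0 : ℝ) < τ := h2
    have := congrArg Prod.snd h1
    simp only [ζ, Prod.snd_zero, mul_eq_zero, Complex.ofReal_eq_zero] at this
    rcases this with h3 | h3
    · exact γ.ε_ne_zero h3
    · have h4 : (τ : ℂ) ≠ 0 := mod_cast hτ.ne'
      exact (pow_ne_zero _ (pow_ne_zero _ h4)) h3
  · have hτ0 : Tendsto (fun τ : ℝ => (τ : ℂ)) (𝓝[>] 0) (𝓝 0) := tendsto_ofReal_right.of_within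
    have hpt : Tendsto (fun τ : ℝ => (w τ, ((τ : ℂ) ^ N, PUnit.unit))) (𝓝[>] 0)
        (𝓝 ((0 : ℂ), (0 : ℂ × PUnit.{1}))) := by
      have e1 := hw.continuousAt.tendsto.comp hτ0
      rw [hw0] at e1
      have e2 := hτ0.pow N
      rw [zero_pow hN.ne'] at e2
      exact e1.prodMk_nhds (e2.prodMk_nhds tendsto_const_nhds)
    filter_upwards [hpt.eventually (hnewton 0), hτ0.eventually hroot] with τ e1 e2
    have e2' : newtonQuotient m a b c k A (R m) (w τ, ((τ : ℂ) ^ N, PUnit.unit)) = 0 := e2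
    rw [e2', mul_zero, arcGerm] at e1
    simp only [← pow_mul] at e1 ⊢
    simp only [ζ, ← pow_mul]
    exact e1
  · intro ε hε
    have hτt : Tendsto (fun s : ℝ => s ^ (1 / ((N * b : ℕ) : ℝ))) (𝓝[>] 0) (𝓝[>] 0) :=
      tendsto_root_zero_right hNb
    have hwb : ∀ᶠ s : ℝ in 𝓝[>] 0, ‖w ((s ^ (1 / ((N * b : ℕ) : ℝ)) : ℝ) : ℂ)‖ < 1 := by
      have e1 := (hw.continuousAt.tendsto.comp (tendsto_ofReal_right.of_within)).comp hτt
      rw [hw0] at e1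
      have := e1.norm
      rw [norm_zero] at this
      exact this.eventually (gt_mem_nhds one_pos)
    have hlt : ∀ᶠ s : ℝ in 𝓝[>] 0, s ^ (1 / ((N * b : ℕ) : ℝ)) < ε :=
      (hτt.of_within).eventually (gt_mem_nhds hε)
    refine IsBigO.of_bound 1 ?_
    filter_upwards [hwb, hlt, self_mem_nhdsWithin] with s e1 e2 (hs : (0 : ℝ) < s)
    rw [norm_of_nonneg infDist_nonneg, norm_of_nonneg (rpow_nonneg (pow_nonneg hs.le _) _), one_mul]
    set τ := s ^ (1 / ((N * b : ℕ) : ℝ)) with hτ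
    have hτpos : 0 < τ := rpow_pos_of_pos hs _
    have hτs : τ ^ (N * b) = s := root_pow hNb hs.le
    refine (Metric.infDist_le_dist_of_mem (mem_image_of_mem ζ
      (show τ ∈ Ico 0 ε from ⟨hτpos.le, e2⟩))).trans ?_
    have hτsc : (τ : ℂ) ^ (N * b) = s := by rw [← Complex.ofReal_pow, hτs]
    rw [dist_comm, Prod.dist_eq]
    simp only [ζ, RArc.toComplex, hτsc, γ.xc_ofReal, RArc.y_eq]
    refine max_le ?_ ?_
    · rw [dist_eq_norm, add_sub_cancel_left, norm_mul, norm_pow, norm_real, norm_of_nonneg hτpos.le]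
      have e4 : τ ^ (N * a) = (s ^ γ.d) ^ ((p : ℝ) / b) := by
        rw [hτ, ← rpow_natCast, ← rpow_mul hs.le, pow_rpow_eq hs.le]
        congr 1
        rw [hda]
        have : (N : ℝ) ≠ 0 := mod_cast hN.ne'
        push_cast
        field_simp
      rw [e4]
      have e5 : 0 ≤ (s ^ γ.d) ^ ((p : ℝ) / b) := rpow_nonneg (pow_nonneg hs.le _) _
      nlinarith
    · push_cast
      rw [dist_self]
      exact rpow_nonneg (pow_nonneg hs.le _) _

end HeightLower

section Height

theorem RegularX.one_le_fHeight {f : ℝ × ℝ → ℝ} (hf : RegularX f) (γ : RArc) : 1 ≤ fHeight f γ := by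
  obtain ⟨S, ν, l, m, H⟩ := hf.exists_isDots γ
  have hm : (0 : ℝ) < m := mod_cast H.pos
  have hex : ∃ r : ℕ, 0 < r ∧ ¬ IsStableAt f γ (((1 : ℕ) : ℝ) / r) := by
    by_cases h0 : 0 ∈ S
    · have hν : 0 < ν 0 := by
        obtain ⟨j, hj, hjν⟩ := H.exists_relCoeff 0 h0
        rw [← hjν]
        have hj0 : j ≠ 0 := by
          rintro rfl
          apply hj
          have h00 : f (0, 0) = 0 := hf.2.1
          simp [relCoeff, γ.x_zero, RArc.y_eq, γ.d_pos.ne', h00]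
        have := γ.d_pos
        positivity
      obtain ⟨r, hr⟩ := exists_nat_gt ((m : ℝ) / ν 0)
      have hr0 : 0 < r := by
        have : (0 : ℝ) < r := lt_trans (by positivity) hr
        exact_mod_cast this
      have hr' : (0 : ℝ) < r := mod_cast hr0
      refine ⟨r, hr0, fun hs => ?_⟩
      have h1 := ((H.isStableAt_iff (by positivity)).1 hs).2 m H.mem
      rw [H.zero, zero_add, Nat.cast_one, div_mul_eq_mul_div, one_mul, le_div_iff₀ hr'] at h1
      rw [div_lt_iff₀ hν] at hr
      linarith
    · exact ⟨1, one_pos, fun hs => h0 ((H.isStableAt_iff (by simp)).1 hs).1⟩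
  obtain ⟨r, hr, hst⟩ := hex
  obtain ⟨ζ, hζ, -⟩ := exists_zeroArc hf γ one_pos hr hst
  exact (γ.one_le_contactOrder hζ.1.2.1).trans (le_iSup₂_of_le ζ hζ le_rfl)

/-- The height of an arc is the infimum of the stable exponents. -/
theorem RegularX.le_fHeight_iff {f : ℝ × ℝ → ℝ} (hf : RegularX f) {γ : RArc} {h : ℝ} (hh : 1 < h) :
    ENNReal.ofReal h ≤ fHeight f γ ↔ HeightGE f γ h := by
  constructor
  · intro H k hk hkh hst
    obtain ⟨k', h1, h2⟩ := exists_between (max_lt hkh hh)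
    obtain ⟨k'', h3, h4⟩ := exists_between h2
    have hk1 : 1 < k' := (le_max_right _ _).trans_lt h1
    have h5 : ENNReal.ofReal k'' < fHeight f γ :=
      lt_of_lt_of_le ((ENNReal.ofReal_lt_ofReal_iff (by linarith)).2 h4) H
    rw [fHeight, lt_iSup_iff] at h5
    obtain ⟨ζ, h5⟩ := h5
    rw [lt_iSup_iff] at h5
    obtain ⟨⟨hζ, g, hg, hz⟩, h5⟩ := h5
    exact heightGE_of_near hf hg hζ.2.1 hz (hk1.trans h3) (RArc.near_of_lt h5) (by linarith) h3
      (hst.mono ((le_max_left _ _).trans h1.le))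
  · intro H
    refine le_of_forall_lt fun c hc => ?_
    have hctop : c ≠ ⊤ := ne_top_of_lt hc
    have hc' : c.toReal < h := by
      rw [← ENNReal.ofReal_toReal hctop] at hc
      exact (ENNReal.ofReal_lt_ofReal_iff (by linarith)).1 hc
    obtain ⟨q, h1, h2⟩ := exists_rat_btwn (max_lt hc' (lt_trans one_pos hh))
    have hq : (0 : ℝ) < q := (le_max_right _ _).trans_lt h1
    have hq' : 0 < q := mod_cast hq
    have hqeq : (q : ℝ) = ((q.num.toNat : ℕ) : ℝ) / (q.den : ℕ) := by
      have h3 : ((q.num.toNat : ℕ) : ℤ) = q.num := Int.toNat_of_nonneg (Rat.num_nonneg.2 hq'.le)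
      have h4 : ((q.num.toNat : ℕ) : ℝ) = (q.num : ℝ) := mod_cast h3
      rw [h4]
      exact Rat.cast_def q
    have hst := H q hq h2
    rw [hqeq] at hst
    have hnum : 0 < q.num := Rat.num_pos.2 hq'
    obtain ⟨ζ, hζ, hnear⟩ := exists_zeroArc hf γ (by omega) q.den_pos hst
    rw [← hqeq] at hnear
    refine lt_of_lt_of_le ?_ (hnear.le.trans (le_iSup₂_of_le ζ hζ le_rfl))
    rw [← ENNReal.ofReal_toReal hctop]
    exact (ENNReal.ofReal_lt_ofReal_iff hq).2 ((le_max_left _ _).trans_lt h1)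

end Height

/-! ### Relative Newton polygons in terms of vanishing orders on horns -/

section Polygon

/-- The union of the quadrants at finitely many dots. -/
def quadrants (S : Finset ℕ) (ν : ℕ → ℝ) : Set (ℝ × ℝ) := {p | ∃ i ∈ S, (i : ℝ) ≤ p.1 ∧ ν i ≤ p.2}

theorem IsDots.relNewtonPolygon_eq {f : ℝ × ℝ → ℝ} {γ : RArc} {S : Finset ℕ} {ν l : ℕ → ℝ} {m : ℕ}
    (H : IsDots f γ S ν l m) : relNewtonPolygon f γ = convexHull ℝ (quadrants S ν) := by
  rw [relNewtonPolygon]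
  congr 1
  ext p
  constructor
  · rintro ⟨i, j, h1, h2, h3⟩
    obtain ⟨i', h4, h5, h6⟩ := H.of_relCoeff i j h1
    exact ⟨i', h4, le_trans (by exact_mod_cast h5) h2, h6.trans h3⟩
  · rintro ⟨i, h1, h2, h3⟩
    obtain ⟨j, h4, h5⟩ := H.exists_relCoeff i h1
    exact ⟨i, j, h4, h2, h5 ▸ h3⟩

theorem forall_mem_convexHull_quadrants {S : Finset ℕ} {ν : ℕ → ℝ} {h e : ℝ} (hh : 0 < h) :
    (∀ p ∈ convexHull ℝ (quadrants S ν), e ≤ h * p.1 + p.2) ↔ ∀ i ∈ S, e ≤ ν i + h * i := by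
  constructor
  · intro H i hi
    have := H ((i : ℝ), ν i) (subset_convexHull ℝ _ ⟨i, hi, le_rfl, le_rfl⟩)
    linarith
  · intro H
    have hconv : Convex ℝ {p : ℝ × ℝ | e ≤ h * p.1 + p.2} := by
      refine convex_halfSpace_ge (𝕜 := ℝ) (f := fun p : ℝ × ℝ => h * p.1 + p.2) ?_ e
      exact ⟨fun x y => by simp only [Prod.fst_add, Prod.snd_add]; ring,
        fun c x => by simp only [Prod.smul_fst, Prod.smul_snd, smul_eq_mul]; ring⟩
    refine fun p hp => convexHull_min ?_ hconv hp
    rintro q ⟨i, hi, h1, h2⟩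
    have := H i hi
    show e ≤ h * q.1 + q.2
    nlinarith

/-- A point above all supporting lines of negative slope lies in the hull of the quadrants. -/
theorem mem_convexHull_quadrants {S : Finset ℕ} {ν : ℕ → ℝ} {x y : ℝ}
    (H : ∀ h > 0, ∃ i ∈ S, ν i + h * i ≤ y + h * x) :
    (x, y) ∈ convexHull ℝ (quadrants S ν) := by
  classical
  by_cases h0 : ∃ i ∈ S, (i : ℝ) ≤ x ∧ ν i ≤ y
  · obtain ⟨i, hi, h1, h2⟩ := h0
    exact subset_convexHull ℝ _ ⟨i, hi, h1, h2⟩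
  push Not at h0
  let α : ℕ → ℝ := fun i => (ν i - y) / (x - i)
  by_cases hcross : ∃ i ∈ S, ∃ k ∈ S, (i : ℝ) < x ∧ x < k ∧ α i ≤ α k
  · -- the segment between two dots passes below the point
    obtain ⟨i, hi, k, hk, h1, h2, h3⟩ := hcross
    have e1 : ν i = y + α i * (x - i) := by
      have : x - i ≠ 0 := (sub_pos.2 h1).ne'
      simp only [α]; field_simp; ring
    have e2 : ν k = y + α k * (x - k) := by
      have : x - k ≠ 0 := (sub_neg.2 h2).ne
      simp only [α]; field_simp; ring
    have hik : (0 : ℝ) < k - i := by linarith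
    set a := (k - x) / ((k : ℝ) - i) with ha
    set b := (x - i) / ((k : ℝ) - i) with hb
    have ha0 : 0 < a := div_pos (by linarith) hik
    have hb0 : 0 < b := div_pos (by linarith) hik
    have hab : a + b = 1 := by rw [ha, hb]; field_simp; ring
    have hx : a * i + b * k = x := by rw [ha, hb]; field_simp; ring
    have hy : a * ν i + b * ν k ≤ y := by
      rw [e1, e2]
      have h4 : a * (x - i) = b * (k - x) := by rw [ha, hb]; ring
      have h5 : 0 ≤ b * (k - x) := mul_nonneg hb0.le (by linarith)
      have h6 : a * (y + α i * (x - i)) + b * (y + α k * (x - k)) =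
          (a + b) * y + α i * (a * (x - i)) - α k * (b * (k - x)) := by ring
      rw [h6, h4, hab]
      nlinarith
    set t := (y - (a * ν i + b * ν k)) / b with ht
    have ht0 : 0 ≤ t := div_nonneg (by linarith) hb0.le
    have hp1 : ((i : ℝ), ν i) ∈ convexHull ℝ (quadrants S ν) :=
      subset_convexHull ℝ _ ⟨i, hi, le_rfl, le_rfl⟩
    have hp2 : ((k : ℝ), ν k + t) ∈ convexHull ℝ (quadrants S ν) :=
      subset_convexHull ℝ _ ⟨k, hk, le_rfl, by simp only; linarith⟩
    have := (convex_convexHull ℝ (quadrants S ν)) hp1 hp2 ha0.le hb0.le hab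
    have e3 : a • ((i : ℝ), ν i) + b • ((k : ℝ), ν k + t) = (x, y) := by
      ext
      · simpa using hx
      · simp only [Prod.snd_add, Prod.smul_snd, smul_eq_mul]
        rw [mul_add, ht, mul_div_cancel₀ _ hb0.ne']
        ring
    rwa [e3] at this
  · -- otherwise some supporting line separates
    exfalso
    push Not at hcross
    have hpos : ∀ i ∈ S, (i : ℝ) < x → 0 < α i := fun i hi h1 =>
      div_pos (sub_pos.2 (h0 i hi h1.le)) (sub_pos.2 h1)
    have hM : ∃ M : ℝ, 0 ≤ M ∧ (∀ k ∈ S, x < k → α k ≤ M) ∧ ∀ i ∈ S, (i : ℝ) < x → M < α i := by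
      obtain ⟨M, hM, hmax⟩ := (insert (0 : ℝ) ((S.filter fun k : ℕ => x < k).image α)).exists_max_image
        id ⟨0, Finset.mem_insert_self _ _⟩
      refine ⟨M, hmax 0 (Finset.mem_insert_self _ _), fun k hk h1 => hmax _
        (Finset.mem_insert_of_mem (Finset.mem_image_of_mem _ (mem_filter.2 ⟨hk, h1⟩))),
        fun i hi h1 => ?_⟩
      rcases Finset.mem_insert.1 hM with h2 | h2
      · rw [h2]; exact hpos i hi h1
      · obtain ⟨k, hk, rfl⟩ := Finset.mem_image.1 h2
        rw [mem_filter] at hk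
        exact hcross i hi k hk.1 h1 hk.2
    obtain ⟨M, hM0, hM1, hM2⟩ := hM
    have hh : ∃ h, M < h ∧ ∀ i ∈ S, (i : ℝ) < x → h < α i := by
      by_cases hA : (S.filter fun i : ℕ => (i : ℝ) < x).Nonempty
      · obtain ⟨i, hi, hmin⟩ := Finset.exists_min_image _ α hA
        rw [mem_filter] at hi
        obtain ⟨h, h1, h2⟩ := exists_between (hM2 i hi.1 hi.2)
        exact ⟨h, h1, fun k hk hk1 => h2.trans_le (hmin k (mem_filter.2 ⟨hk, hk1⟩))⟩
      · refine ⟨M + 1, by linarith, fun i hi h1 => absurd ?_ hA⟩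
        exact ⟨i, mem_filter.2 ⟨hi, h1⟩⟩
    obtain ⟨h, h1, h2⟩ := hh
    obtain ⟨i, hi, h3⟩ := H h (hM0.trans_lt h1)
    rcases lt_trichotomy (i : ℝ) x with h4 | h4 | h4
    · have h5 := h2 i hi h4
      rw [lt_div_iff₀ (sub_pos.2 h4)] at h5
      nlinarith
    · have := h0 i hi h4.le
      rw [h4] at h3
      linarith
    · have h5 := (hM1 i hi h4).trans_lt h1
      rw [div_lt_iff_of_neg (sub_neg.2 h4)] at h5
      nlinarith

/-- The relative Newton polygon and the vanishing orders on the horns determine each other. -/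
theorem relNewtonPolygon_eq_iff {f f' : ℝ × ℝ → ℝ} (hf : RegularX f) (hf' : RegularX f')
    (γ γ' : RArc) : relNewtonPolygon f γ = relNewtonPolygon f' γ' ↔
      ∀ h > 0, ∀ e, RelBound f γ h e ↔ RelBound f' γ' h e := by
  obtain ⟨S, ν, l, m, H⟩ := hf.exists_isDots γ
  obtain ⟨S', ν', l', m', H'⟩ := hf'.exists_isDots γ'
  rw [H.relNewtonPolygon_eq, H'.relNewtonPolygon_eq]
  constructor
  · intro heq h hh e
    rw [H.relBound_iff hh, H'.relBound_iff hh, ← forall_mem_convexHull_quadrants hh, heq,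
      forall_mem_convexHull_quadrants hh]
  · intro hb
    have key : ∀ {S S' : Finset ℕ} {ν ν' : ℕ → ℝ}, S'.Nonempty →
        (∀ h > 0, ∀ e : ℝ, (∀ i ∈ S', e ≤ ν' i + h * i) → ∀ i ∈ S, e ≤ ν i + h * i) →
        convexHull ℝ (quadrants S ν) ⊆ convexHull ℝ (quadrants S' ν') := by
      intro S S' ν ν' hne hb
      refine convexHull_min ?_ (convex_convexHull ℝ _)
      rintro ⟨x, y⟩ ⟨i, hi, h1, h2⟩
      refine mem_convexHull_quadrants fun h hh => ?_
      obtain ⟨k, hk, hmin⟩ := S'.exists_min_image (fun i => ν' i + h * i) hne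
      refine ⟨k, hk, (hb h hh _ hmin i hi).trans ?_⟩
      simp only at h1 h2
      gcongr
    refine Subset.antisymm (key ⟨_, H'.mem⟩ fun h hh e h1 => ?_)
      (key ⟨_, H.mem⟩ fun h hh e h1 => ?_)
    · exact (H.relBound_iff hh).1 ((hb h hh e).2 ((H'.relBound_iff hh).2 h1))
    · exact (H'.relBound_iff hh).1 ((hb h hh e).1 ((H.relBound_iff hh).2 h1))

end Polygon

/-! ### Polynomials and multiplicities of bars -/

section BarPolynomial

variable {f : ℝ × ℝ → ℝ} {γ μ : RArc} {h : ℝ}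

/-- The arc `x = γ (y) + u * |y| ^ (p / b)`. -/
theorem RArc.exists_add_rpow (γ : RArc) {p b : ℕ} (hb : 0 < b) (hpb : b ≤ p) (u : ℝ) :
    ∃ μ : RArc, μ.sgn = γ.sgn ∧ ∀ᶠ y in 𝓝[>] (0 : ℝ), μ.X y = γ.X y + u * y ^ ((p : ℝ) / b) := by
  classical
  set c : ℕ → ℝ := fun j => if j = p then u else 0 with hc
  have hser : ∀ s, ser c s = u * s ^ p := by
    intro s
    rw [ser, tsum_eq_single p]
    · simp [hc]
    · intro j hj; simp [hc, hj]
  have hconv : ConvSeq c := by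
    refine ⟨1, one_pos, ?_⟩
    refine summable_of_ne_finset_zero (s := {p}) fun j hj => ?_
    have : j ≠ p := by simpa using hj
    simp [hc, this]
  have h0 : ∀ j < b, c j = 0 := fun j hj => by
    have : j ≠ p := by omega
    simp [hc, this]
  refine ⟨γ.addSeries hb hconv h0, rfl, ?_⟩
  filter_upwards [γ.X_addSeries hb hconv h0, self_mem_nhdsWithin] with y hy hy0
  have hy0' : (0 : ℝ) ≤ y := le_of_lt hy0
  rw [hy, fracSer, hser, ← rpow_natCast, ← rpow_mul hy0']
  congr 3
  ring

theorem eq_of_tendsto_div {g : ℝ → ℝ} {e E a b : ℝ}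
    (h1 : Tendsto (fun y => g y / y ^ e) (𝓝[>] 0) (𝓝 a)) (ha : a ≠ 0)
    (h2 : Tendsto (fun y => g y / y ^ E) (𝓝[>] 0) (𝓝 b)) (hb : b ≠ 0) : e = E := by
  rcases lt_trichotomy e E with hlt | heq | hlt
  · exact absurd (tendsto_nhds_unique h1
      (tendsto_div_rpow_of_isBigO (isBigO_rpow_of_tendsto_div h2) hlt)) ha
  · exact heq
  · exact absurd (tendsto_nhds_unique h2
      (tendsto_div_rpow_of_isBigO (isBigO_rpow_of_tendsto_div h1) hlt)) hb

/-- `f` has the initial form `J` of weight `E` on the horns of exponent `h` around `γ`. -/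
def HasLim (f : ℝ × ℝ → ℝ) (γ : RArc) (h E : ℝ) (J : ℝ[X]) : Prop :=
  ∀ u : ℝ, Tendsto (fun z : ℝ × ℝ => f (γ.X z.2 + z.1 * z.2 ^ h, γ.ε * z.2) / z.2 ^ E)
    (𝓝 u ×ˢ 𝓝[>] 0) (𝓝 (J.eval u))

theorem HasLim.tendsto {E : ℝ} {J : ℝ[X]} (H : HasLim f γ h E J) (u : ℝ) :
    Tendsto (fun y : ℝ => f (γ.X y + u * y ^ h, γ.ε * y) / y ^ E) (𝓝[>] 0) (𝓝 (J.eval u)) :=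
  Tendsto.comp (g := fun z : ℝ × ℝ => f (γ.X z.2 + z.1 * z.2 ^ h, γ.ε * z.2) / z.2 ^ E)
    (f := fun y : ℝ => (u, y)) (H u) (tendsto_const_prodMk u)

theorem HasLim.unique {E E' : ℝ} {J J' : ℝ[X]} (H : HasLim f γ h E J) (hJ : J ≠ 0)
    (H' : HasLim f γ h E' J') (hJ' : J' ≠ 0) : E = E' ∧ J = J' := by
  obtain ⟨u, hu⟩ := Infinite.exists_notMem_finset (J.roots.toFinset ∪ J'.roots.toFinset)
  rw [Finset.mem_union, Multiset.mem_toFinset, Multiset.mem_toFinset, mem_roots hJ,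
    mem_roots hJ', not_or] at hu
  have hE := eq_of_tendsto_div (H.tendsto u) hu.1 (H'.tendsto u) hu.2
  subst hE
  exact ⟨rfl, Polynomial.funext fun v => tendsto_nhds_unique (H.tendsto v) (H'.tendsto v)⟩

theorem HasLim.shift {E u : ℝ} {J : ℝ[X]} (H : HasLim f γ h E J) (hs : γ.sgn = μ.sgn)
    (hμ : Tendsto (fun y => (μ.X y - γ.X y) / y ^ h) (𝓝[>] 0) (𝓝 u)) :
    HasLim f μ h E (taylor u J) := by
  intro v
  have := lim_shift (J := fun v => J.eval v) H hs hμ v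
  rwa [taylor_eval]

theorem HasLim.isStableAt_iff {E : ℝ} {J : ℝ[X]} (H : HasLim f γ h E J) (hJ : J ≠ 0)
    (hf : RegularX f) (hh : 0 < h) : IsStableAt f γ h ↔ J.eval 0 ≠ 0 := by
  obtain ⟨E', J', h1, -, h3, h4⟩ := hf.exists_initial γ hh
  obtain ⟨-, rfl⟩ := H.unique hJ h3 h1
  exact h4.symm

theorem HasLim.relBound_iff {E e : ℝ} {J : ℝ[X]} (H : HasLim f γ h E J) (hJ : J ≠ 0)
    (hf : RegularX f) (hh : 0 < h) : RelBound f γ h e ↔ e ≤ E := by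
  obtain ⟨E', J', h1, h2, h3, -⟩ := hf.exists_initial γ hh
  obtain ⟨rfl, -⟩ := H.unique hJ h3 h1
  exact h2 e

theorem fHeight_le_of_isStableAt (hf : RegularX f) (hh : 1 ≤ h) (hs : IsStableAt f γ h) :
    fHeight f γ ≤ ENNReal.ofReal h := by
  refine ENNReal.le_of_forall_one_lt (by simpa using hh) fun x hx hle => ?_
  by_contra hcon
  push Not at hcon
  have hlt := (ENNReal.ofReal_lt_ofReal_iff (by linarith)).1 hcon
  exact (hf.le_fHeight_iff hx).1 hle h (by linarith) hlt hs

theorem isStableAt_of_fHeight_le (hf : RegularX f) (hh : 1 ≤ h)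
    (hle : fHeight f γ ≤ ENNReal.ofReal h) : IsStableAt f γ h := by
  by_contra hcon
  obtain ⟨h', h1, h2⟩ := hf.exists_heightGE (by linarith) hcon
  have h3 := ((hf.le_fHeight_iff (by linarith)).2 h2).trans hle
  rw [ENNReal.ofReal_le_ofReal_iff (by linarith)] at h3
  linarith

theorem fHeight_eq_ofReal (hf : RegularX f) (hh : 1 ≤ h) (hs : IsStableAt f γ h)
    (hge : HeightGE f γ h) : fHeight f γ = ENNReal.ofReal h := by
  refine le_antisymm (fHeight_le_of_isStableAt hf hh hs) ?_
  rcases hh.eq_or_lt with h1 | h1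
  · rw [← h1, ENNReal.ofReal_one]; exact hf.one_le_fHeight γ
  · exact (hf.le_fHeight_iff h1).2 hge

/-- The values along an arc, with `y` as parameter. -/
theorem tendsto_arc_iff {e a : ℝ} :
    Tendsto (fun s => f (μ.x s, μ.y s) / |μ.y s| ^ e) (𝓝[>] (0 : ℝ)) (𝓝 a) ↔
      Tendsto (fun y => f (μ.X y, μ.ε * y) / y ^ e) (𝓝[>] (0 : ℝ)) (𝓝 a) := by
  constructor
  · intro H
    refine (H.comp (tendsto_root_zero_right μ.d_pos)).congr' ?_
    filter_upwards [self_mem_nhdsWithin] with y (hy0 : (0 : ℝ) < y)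
    simp only [Function.comp]
    rw [RArc.y_eq, root_pow μ.d_pos hy0.le, abs_mul, μ.abs_ε, one_mul, abs_of_pos hy0]
    rfl
  · intro H
    refine (H.comp (tendsto_pow_zero_right μ.d_pos)).congr' ?_
    filter_upwards [self_mem_nhdsWithin] with s (hs0 : (0 : ℝ) < s)
    simp only [Function.comp]
    rw [RArc.y_eq, abs_mul, μ.abs_ε, one_mul, abs_of_pos (pow_pos hs0 _), μ.X_pow hs0.le]

/-- The polynomial of a bar of finite height is, up to translation, the initial form of `f` on the
horns around any of its members. -/
theorem HasInitialForm.exists_hasLim (hf : RegularX f) {p b : ℕ} (hb : 0 < b) (hpb : b ≤ p)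
    (hheight : fHeight f γ = ENNReal.ofReal ((p : ℝ) / b)) {P : ℝ[X]} {e : ℝ}
    (HP : HasInitialForm f γ P e) :
    ∃ J : ℝ[X], J ≠ 0 ∧ J.natDegree = P.natDegree ∧ HasLim f γ ((p : ℝ) / b) e J := by
  set h : ℝ := (p : ℝ) / b with hh
  have hb' : (0 : ℝ) < b := mod_cast hb
  have hh1 : 1 ≤ h := by rw [hh, one_le_div hb']; exact_mod_cast hpb
  have hh0 : 0 < h := by linarith
  have hone : ∀ γ, 1 ≤ fHeight f γ := hf.one_le_fHeight
  obtain ⟨E, J, hJ, -, hlim, -⟩ := hf.exists_initial γ hh0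
  have H : HasLim f γ h E J := hlim
  set c := canonicalCoord f γ with hc
  have hcoord : ∀ μ : RArc, fHeight f μ = ENNReal.ofReal h → canonicalCoord f μ = μ.coeffAt h := by
    intro μ hμ
    rw [canonicalCoord, hμ, ENNReal.toReal_ofReal hh0.le]
  have key : ∀ u, J.eval u ≠ 0 → e = E ∧ P.eval (c + u) = J.eval u := by
    intro u hu
    obtain ⟨μ, hμs, hμX⟩ := γ.exists_add_rpow hb hpb u
    have hdiv : Tendsto (fun y => (μ.X y - γ.X y) / y ^ h) (𝓝[>] 0) (𝓝 u) := by
      refine tendsto_const_nhds.congr' ?_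
      filter_upwards [hμX, self_mem_nhdsWithin] with y h1 hy
      have : y ^ h ≠ 0 := (rpow_pos_of_pos hy _).ne'
      rw [h1, add_sub_cancel_left, mul_div_cancel_right₀ _ this]
    have hO := isBigO_rpow_of_tendsto_div hdiv
    have hlimμ := H.shift hμs.symm hdiv
    have htne : taylor u J ≠ 0 := by rw [Ne, taylor_eq_zero]; exact hJ
    have hst : IsStableAt f μ h := (hlimμ.isStableAt_iff htne hf hh0).2 (by
      rw [taylor_eval, zero_add]; exact hu)
    have hcon : ENNReal.ofReal h ≤ μ.contact γ := (RArc.le_contact_iff hμs).2 hO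
    have hμh : fHeight f μ = ENNReal.ofReal h := by
      refine le_antisymm (fHeight_le_of_isStableAt hf hh1 hst) ?_
      have := fHeight_ultra hone γ μ
      rw [hheight, RArc.contact_comm, min_eq_left hcon] at this
      exact this
    have hmem : μ ∈ bar f γ := mem_bar_iff.2 ⟨hμs.symm, by rw [hheight, hμh], by
      rw [hheight, RArc.contact_comm]; exact hcon⟩
    obtain ⟨h1, h2⟩ := HP μ hmem
    have hcμ : canonicalCoord f μ = c + u := by
      have := tendsto_nhds_unique (RArc.tendsto_sub_div hO) hdiv
      rw [hcoord μ hμh, hc, hcoord γ hheight]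
      linarith
    rw [hcμ] at h1 h2
    have h3 := tendsto_arc_iff.1 h2
    have h4 : Tendsto (fun y => f (μ.X y, μ.ε * y) / y ^ E) (𝓝[>] 0) (𝓝 (J.eval u)) := by
      have := hlimμ.tendsto 0
      rw [taylor_eval, zero_add] at this
      simpa using this
    have hE := eq_of_tendsto_div h3 h1 h4 hu
    subst hE
    exact ⟨rfl, tendsto_nhds_unique h3 h4⟩
  obtain ⟨u₀, hu₀⟩ := exists_eval_ne_zero hJ
  obtain ⟨rfl, -⟩ := key u₀ hu₀
  have hJP : J = taylor c P := by
    refine Polynomial.eq_of_infinite_eval_eq _ _ ?_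
    have : (J.roots.toFinset : Set ℝ)ᶜ ⊆ {x | J.eval x = (taylor c P).eval x} := by
      intro u hu
      have hu' : J.eval u ≠ 0 := by simpa [mem_roots hJ] using hu
      rw [mem_ofPred_eq, taylor_eval, add_comm u c, (key u hu').2]
    exact Infinite.mono this (Finset.finite_toSet _).infinite_compl
  exact ⟨J, hJ, by rw [hJP, natDegree_taylor], H⟩

theorem HasBarMult.exists_hasLim (hf : RegularX f) {p b n : ℕ} (hb : 0 < b) (hpb : b ≤ p)
    (hheight : fHeight f γ = ENNReal.ofReal ((p : ℝ) / b)) (H : HasBarMult f γ n) :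
    ∃ (e : ℝ) (J : ℝ[X]), J ≠ 0 ∧ J.natDegree = n ∧ HasLim f γ ((p : ℝ) / b) e J := by
  rcases H with ⟨-, P, e, hP, hn⟩ | ⟨htop, -⟩
  · obtain ⟨J, h1, h2, h3⟩ := hP.exists_hasLim hf hb hpb hheight
    exact ⟨e, J, h1, h2.trans hn, h3⟩
  · rw [hheight] at htop
    exact absurd htop ENNReal.ofReal_ne_top

/-- An initial form with nonzero constant term is the polynomial of a bar. -/
theorem HasLim.hasInitialForm (hf : RegularX f) (hh : 1 ≤ h) {E : ℝ} {J : ℝ[X]}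
    (H : HasLim f γ h E J) (hJ0 : J.eval 0 ≠ 0) (hge : HeightGE f γ h) :
    fHeight f γ = ENNReal.ofReal h ∧ HasInitialForm f γ (taylor (-γ.coeffAt h) J) E := by
  have hh0 : 0 < h := by linarith
  have hJ : J ≠ 0 := fun h0 => hJ0 (by simp [h0])
  have hheight := fHeight_eq_ofReal hf hh ((H.isStableAt_iff hJ hf hh0).2 hJ0) hge
  refine ⟨hheight, fun μ hμ => ?_⟩
  obtain ⟨hs, hμh, hcon⟩ := mem_bar_iff.1 hμ
  rw [hheight] at hμh hcon
  rw [RArc.contact_comm, RArc.le_contact_iff hs.symm] at hcon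
  have hdiv := RArc.tendsto_sub_div hcon
  have hlimμ := H.shift hs hdiv
  have hcoord : canonicalCoord f μ = μ.coeffAt h := by
    rw [canonicalCoord, ← hμh, ENNReal.toReal_ofReal hh0.le]
  have hval : (taylor (-γ.coeffAt h) J).eval (canonicalCoord f μ) =
      (taylor (μ.coeffAt h - γ.coeffAt h) J).eval 0 := by
    rw [taylor_eval, taylor_eval, hcoord, zero_add, sub_eq_add_neg]
  have htne : taylor (μ.coeffAt h - γ.coeffAt h) J ≠ 0 := by rw [Ne, taylor_eq_zero]; exact hJ
  rw [hval]
  refine ⟨(hlimμ.isStableAt_iff htne hf hh0).1 (isStableAt_of_fHeight_le hf hh hμh.ge), ?_⟩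
  rw [tendsto_arc_iff]
  have := hlimμ.tendsto 0
  simpa using this

theorem HasLim.isPolar (hf : RegularX f) (hh : 1 ≤ h) {E : ℝ} {J : ℝ[X]}
    (H : HasLim f γ h E J) (hJ0 : J.eval 0 ≠ 0) (hge : HeightGE f γ h)
    (hroots : ∃ z w : ℂ, z ≠ w ∧ aeval z J = 0 ∧ aeval w J = 0) :
    IsPolar f γ := by
  obtain ⟨h1, h2⟩ := H.hasInitialForm hf hh hJ0 hge
  obtain ⟨z, w, hzw, hz, hw⟩ := hroots
  have haev : ∀ z : ℂ, aeval (z + γ.coeffAt h) (taylor (-γ.coeffAt h) J) = aeval z J := by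
    intro z
    rw [Polynomial.taylor_apply, Polynomial.aeval_comp]
    simp
  refine Or.inl ⟨h1 ▸ ENNReal.ofReal_lt_top, _, E, h2, z + γ.coeffAt h, w + γ.coeffAt h,
    fun heq => hzw (add_right_cancel heq), ?_, ?_⟩
  · rw [haev, hz]
  · rw [haev, hw]

/-- A real polynomial of degree `p ≥ 2` with vanishing coefficient of degree `p - 1` which is not a
monomial has two distinct complex roots. -/
theorem exists_two_roots {J : ℝ[X]} {p i₀ : ℕ} (hdeg : J.natDegree = p) (h1 : J.coeff (p - 1) = 0)
    (hi₀ : i₀ < p) (h2 : J.coeff i₀ ≠ 0) :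
    ∃ z w : ℂ, z ≠ w ∧ aeval z J = 0 ∧ aeval w J = 0 := by
  set Jc : ℂ[X] := J.map (algebraMap ℝ ℂ) with hJc
  have hJne : J ≠ 0 := fun h0 => h2 (by simp [h0])
  have hJcne : Jc ≠ 0 := by rw [hJc, Ne, Polynomial.map_eq_zero]; exact hJne
  have hdegc : Jc.natDegree = p := by rw [hJc, Polynomial.natDegree_map, hdeg]
  have hsplit : Multiset.card Jc.roots = p := by
    rw [← hdegc]
    exact (IsAlgClosed.splits Jc).natDegree_eq_card_roots.symm
  have hpos : 0 < Multiset.card Jc.roots := by omega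
  obtain ⟨z, hz⟩ := Multiset.card_pos_iff_exists_mem.1 hpos
  have hlt : Jc.rootMultiplicity z < p := by
    refine Polynomial.rootMultiplicity_lt_of_coeff_eq_zero (i₀ := i₀) hdegc ?_ hi₀ ?_ z
    · rw [hJc, Polynomial.coeff_map, h1, map_zero]
    · rw [hJc, Polynomial.coeff_map]
      simpa using h2
  have hex : ∃ w ∈ Jc.roots, w ≠ z := by
    by_contra hcon
    push Not at hcon
    have h3 := Multiset.eq_replicate_card.2 hcon
    have h4 : Multiset.count z Jc.roots = p := by rw [h3, Multiset.count_replicate_self, hsplit]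
    rw [Polynomial.count_roots] at h4
    omega
  obtain ⟨w, hw, hwz⟩ := hex
  refine ⟨w, z, hwz, ?_, ?_⟩
  · have := (mem_roots hJcne).1 hw
    rwa [Polynomial.IsRoot.def, hJc, Polynomial.eval_map_algebraMap] at this
  · have := (mem_roots hJcne).1 hz
    rwa [Polynomial.IsRoot.def, hJc, Polynomial.eval_map_algebraMap] at this

end BarPolynomial

/-! ### Germs in the coordinate of an edge -/

section EdgeForm

variable {f : ℝ × ℝ → ℝ} {γ : RArc} {ε : ℝ} {D A C p : ℕ} {Λ : ℝ → ℝ} {g : ℝ × ℝ → ℝ} {θ : ℝ}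

/-- The coordinate `v (σ)` of an arc in the chart `x = Λ (σ) + v * σ ^ A`, `|y| = σ ^ D`. -/
def chartCoord (D A : ℕ) (Λ : ℝ → ℝ) (γ : RArc) (σ : ℝ) : ℝ := (γ.X (σ ^ D) - Λ σ) / σ ^ A

theorem chartCoord_mul {σ : ℝ} (hσ : 0 < σ) (x : ℝ) :
    Λ σ + (chartCoord D A Λ γ σ + x) * σ ^ A = γ.X (σ ^ D) + x * σ ^ A := by
  have : σ ^ A ≠ 0 := (pow_pos hσ A).ne'
  rw [chartCoord, add_mul, div_mul_cancel₀ _ this]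
  ring

theorem pow_rpow_div (hD : 0 < D) {σ : ℝ} (hσ : 0 < σ) (s : ℝ) : (σ ^ D) ^ (s / D) = σ ^ s := by
  have hD' : (D : ℝ) ≠ 0 := mod_cast hD.ne'
  rw [← rpow_natCast, ← rpow_mul hσ.le, mul_div_cancel₀ _ hD']

theorem rpow_natCast_add {σ : ℝ} (hσ : 0 < σ) (A : ℕ) (s : ℝ) :
    σ ^ ((A : ℝ) + s) = σ ^ A * σ ^ s := by
  rw [rpow_add hσ, rpow_natCast]

/-- Boundedness on horns, with `σ` as the parameter. -/
theorem relBound_iff_chart (hD : 0 < D) (θ' e : ℝ) :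
    RelBound f γ ((A + θ') / D) e ↔ ∀ K : ℝ, ∃ C₁ : ℝ, ∀ᶠ σ in 𝓝[>] (0 : ℝ), ∀ x : ℝ,
      |x| ≤ K * σ ^ θ' → |f (γ.X (σ ^ D) + x * σ ^ A, γ.ε * σ ^ D)| ≤ C₁ * σ ^ (D * e) := by
  constructor
  · intro H K
    obtain ⟨C₁, hC⟩ := H K
    refine ⟨C₁, ?_⟩
    filter_upwards [(tendsto_pow_zero_right hD).eventually hC, self_mem_nhdsWithin]
      with σ h1 (hσ' : (0 : ℝ) < σ) x hx
    have h2 := h1 (x * σ ^ A) (by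
      rw [pow_rpow_div hD hσ', rpow_natCast_add hσ', abs_mul, abs_of_pos (pow_pos hσ' A)]
      nlinarith [mul_le_mul_of_nonneg_right hx (pow_pos hσ' A).le])
    rwa [← rpow_natCast σ D, ← rpow_mul hσ'.le, rpow_natCast] at h2
  · intro H K
    obtain ⟨C₁, hC⟩ := H K
    refine ⟨C₁, ?_⟩
    filter_upwards [(tendsto_root_zero_right hD).eventually hC, self_mem_nhdsWithin]
      with y h1 (hy' : (0 : ℝ) < y) X hX
    set σ : ℝ := y ^ (1 / (D : ℝ))
    have hσ' : 0 < σ := rpow_pos_of_pos hy' _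
    have hyσ : y = σ ^ D := (root_pow hD hy'.le).symm
    have hA : 0 < σ ^ A := pow_pos hσ' A
    have h2 := h1 (X / σ ^ A) (by
      rw [abs_div, abs_of_pos hA, div_le_iff₀ hA]
      rw [hyσ, pow_rpow_div hD hσ', rpow_natCast_add hσ'] at hX
      linarith)
    rw [div_mul_cancel₀ _ hA.ne', ← hyσ] at h2
    rwa [hyσ, ← rpow_natCast σ D, ← rpow_mul hσ'.le, rpow_natCast, ← hyσ]

theorem eventually_near_coord {P : ℝ × ℝ → Prop} {ω θ' : ℝ} {v : ℝ → ℝ}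
    (hP : ∀ᶠ z in 𝓝 ω ×ˢ 𝓝[>] (0 : ℝ), P z) (hv : Tendsto v (𝓝[>] 0) (𝓝 ω)) (hθ : 0 < θ') (K : ℝ) :
    ∀ᶠ σ in 𝓝[>] (0 : ℝ), ∀ x : ℝ, |x| ≤ K * σ ^ θ' → P (v σ + x, σ) := by
  obtain ⟨U, hU, V, hV, h⟩ := eventually_prod_iff.1 hP
  obtain ⟨r, hr, hball⟩ := Metric.eventually_nhds_iff.1 hU
  have h1 : Tendsto (fun σ : ℝ => |v σ - ω| + K * σ ^ θ') (𝓝[>] 0) (𝓝 0) := by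
    have h2 : Tendsto (fun σ => |v σ - ω|) (𝓝[>] 0) (𝓝 0) := by simpa using (hv.sub_const ω).abs
    simpa using h2.add ((tendsto_rpow_nhds_zero hθ).const_mul K)
  filter_upwards [h1.eventually (gt_mem_nhds hr), hV] with σ h2 h3 x hx
  refine h (hball ?_) h3
  rw [Real.dist_eq]
  calc |v σ + x - ω| = |(v σ - ω) + x| := by ring_nf
    _ ≤ |v σ - ω| + |x| := abs_add_le _ _
    _ < r := by linarith

/-- The order of vanishing of `f` on the horns around `γ`, from bounds in the chart. -/
theorem relBound_iff_of_chart (hD : 0 < D) (hε : γ.ε = ε) {ω : ℝ}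
    (heq : ∀ᶠ z in 𝓝 ω ×ˢ 𝓝[>] (0 : ℝ), f (Λ z.2 + z.1 * z.2 ^ A, ε * z.2 ^ D) = z.2 ^ C * g z)
    (hv : Tendsto (chartCoord D A Λ γ) (𝓝[>] 0) (𝓝 ω)) {θ' M : ℝ} (hθ : 0 < θ')
    (hup : ∀ K : ℝ, ∃ C₁ : ℝ, ∀ᶠ σ in 𝓝[>] (0 : ℝ), ∀ x : ℝ, |x| ≤ K * σ ^ θ' →
      |g (chartCoord D A Λ γ σ + x, σ)| ≤ C₁ * σ ^ M)
    (hlo : ∃ K : ℝ, ∃ c > 0, ∀ᶠ σ in 𝓝[>] (0 : ℝ), ∃ x : ℝ, |x| ≤ K * σ ^ θ' ∧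
      c * σ ^ M ≤ |g (chartCoord D A Λ γ σ + x, σ)|) (e : ℝ) :
    RelBound f γ ((A + θ') / D) e ↔ D * e ≤ C + M := by
  have key : ∀ K : ℝ, ∀ᶠ σ in 𝓝[>] (0 : ℝ), ∀ x : ℝ, |x| ≤ K * σ ^ θ' →
      |f (γ.X (σ ^ D) + x * σ ^ A, γ.ε * σ ^ D)| =
        σ ^ C * |g (chartCoord D A Λ γ σ + x, σ)| := by
    intro K
    filter_upwards [eventually_near_coord heq hv hθ K, self_mem_nhdsWithin]
      with σ h1 (hσ' : (0 : ℝ) < σ) x hx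
    have h2 := h1 x hx
    rw [chartCoord_mul hσ'] at h2
    rw [hε, h2, abs_mul, abs_of_pos (pow_pos hσ' C)]
  rw [relBound_iff_chart hD]
  constructor
  · intro H
    obtain ⟨K, c, hc, hlo⟩ := hlo
    obtain ⟨C₁, hC⟩ := H K
    by_contra hcon
    push Not at hcon
    refine not_isBigO_rpow hcon ?_
    refine IsBigO.of_bound (C₁ / c) ?_
    filter_upwards [key K, hC, hlo, self_mem_nhdsWithin] with σ h1 h2 h3 (hσ' : (0 : ℝ) < σ)
    obtain ⟨x, hx, h4⟩ := h3
    have h5 := h2 x hx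
    rw [h1 x hx] at h5
    rw [norm_of_nonneg (rpow_nonneg hσ'.le _),
      norm_of_nonneg (rpow_nonneg hσ'.le _), rpow_natCast_add hσ', div_mul_eq_mul_div,
      le_div_iff₀ hc]
    nlinarith [mul_le_mul_of_nonneg_left h4 (pow_pos hσ' C).le]
  · intro hle K
    obtain ⟨C₁, hC⟩ := hup K
    refine ⟨|C₁|, ?_⟩
    filter_upwards [key K, hC, self_mem_nhdsWithin,
      eventually_lt_one_right] with σ h1 h2 (hσ' : (0 : ℝ) < σ) hσ1 x hx
    rw [h1 x hx]
    calc σ ^ C * |g (chartCoord D A Λ γ σ + x, σ)| ≤ σ ^ C * (|C₁| * σ ^ M) := by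
          refine mul_le_mul_of_nonneg_left ((h2 x hx).trans ?_) (pow_pos hσ' C).le
          exact mul_le_mul_of_nonneg_right (le_abs_self _) (rpow_nonneg hσ'.le _)
      _ = |C₁| * σ ^ ((C : ℝ) + M) := by rw [rpow_natCast_add hσ']; ring
      _ ≤ |C₁| * σ ^ (D * e) := by
          refine mul_le_mul_of_nonneg_left ?_ (abs_nonneg _)
          exact rpow_le_rpow_of_exponent_ge hσ' hσ1.le hle

theorem isStableAt_of_relBound_iff (hD : 0 < D) {κ M : ℝ}
    (H : ∀ θ' ≥ κ, ∀ e, RelBound f γ ((A + θ') / D) e ↔ D * e ≤ C + M) :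
    IsStableAt f γ ((A + κ) / D) := by
  intro h' hh' e he
  have hD' : (0 : ℝ) < D := mod_cast hD
  rw [H κ le_rfl]
  rw [ge_iff_le, div_le_iff₀ hD'] at hh'
  have h1 := H (h' * D - A) (by linarith) e
  rw [show (A + (h' * D - A)) / (D : ℝ) = h' by field_simp; ring] at h1
  exact h1.1 he

/-- If the arc does not run into the zero `v = 0` of the restriction of `f` to the exceptional
line, then its height is at most `A / D`. -/
theorem not_heightGE_of_chart (hD : 0 < D) (hε : γ.ε = ε) {ω G₀ h : ℝ}
    (heq : ∀ᶠ z in 𝓝 ω ×ˢ 𝓝[>] (0 : ℝ), f (Λ z.2 + z.1 * z.2 ^ A, ε * z.2 ^ D) = z.2 ^ C * g z)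
    (hv : Tendsto (chartCoord D A Λ γ) (𝓝[>] 0) (𝓝 ω))
    (hg : Tendsto g (𝓝 ω ×ˢ 𝓝[>] 0) (𝓝 G₀)) (hG : G₀ ≠ 0) (hh : (A : ℝ) / D < h) :
    ¬ HeightGE f γ h := by
  have hD' : (0 : ℝ) < D := mod_cast hD
  intro H
  have hup : ∀ᶠ z in 𝓝 ω ×ˢ 𝓝[>] (0 : ℝ), |g z| < |G₀| + 1 :=
    hg.abs.eventually (gt_mem_nhds (lt_add_one _))
  have hlo : ∀ᶠ z in 𝓝 ω ×ˢ 𝓝[>] (0 : ℝ), |G₀| / 2 < |g z| :=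
    hg.abs.eventually (lt_mem_nhds (half_lt_self (abs_pos.2 hG)))
  have key : ∀ θ' > 0, ∀ e, RelBound f γ ((A + θ') / D) e ↔ D * e ≤ C + 0 := by
    intro θ' hθ' e
    refine relBound_iff_of_chart hD hε heq hv hθ' (fun K => ⟨|G₀| + 1, ?_⟩)
      ⟨0, |G₀| / 2, by positivity, ?_⟩ e
    · filter_upwards [eventually_near_coord hup hv hθ' K] with σ h1 x hx
      rw [rpow_zero, mul_one]
      exact (h1 x hx).le
    · filter_upwards [eventually_near_coord hlo hv hθ' 0] with σ h1
      exact ⟨0, by simp, by rw [rpow_zero, mul_one]; exact (h1 0 (by simp)).le⟩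
  have hκ : 0 < (h * D - A) / 2 := by
    rw [div_lt_iff₀ hD'] at hh
    linarith
  refine H _ ?_ ?_ (isStableAt_of_relBound_iff hD (κ := (h * D - A) / 2)
    fun θ' h1 => key θ' (hκ.trans_le h1))
  · positivity
  · rw [div_lt_iff₀ hD']
    linarith

/-- In the chart `x = Λ (σ) + v * σ ^ A`, `|y| = σ ^ D`, the germ `f` is `σ ^ C * g (v, σ)`, where
`g` behaves like a polynomial of degree `p` in `v` that is quasi-homogeneous of weight `p * θ` for
`v` of weight `θ`. -/
structure EdgeForm (f : ℝ × ℝ → ℝ) (ε : ℝ) (D A C p : ℕ) (Λ : ℝ → ℝ) (g : ℝ × ℝ → ℝ) (θ : ℝ) :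
    Prop where
  D_pos : 0 < D
  pos : 0 < θ
  eq : ∀ᶠ z in 𝓝 (0 : ℝ) ×ˢ 𝓝[>] (0 : ℝ), f (Λ z.2 + z.1 * z.2 ^ A, ε * z.2 ^ D) = z.2 ^ C * g z
  upper : ∃ C₁ : ℝ, ∀ᶠ z in 𝓝 (0 : ℝ) ×ˢ 𝓝[>] (0 : ℝ), |g z| ≤ C₁ * (|z.1| + z.2 ^ θ) ^ p
  lower : ∃ K : ℝ, ∃ c > 0, ∀ᶠ z in 𝓝 (0 : ℝ) ×ˢ 𝓝[>] (0 : ℝ),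
    K * z.2 ^ θ ≤ |z.1| → c * |z.1| ^ p ≤ |g z|

namespace EdgeForm

theorem upper_coord (H : EdgeForm f ε D A C p Λ g θ)
    (hv : Tendsto (chartCoord D A Λ γ) (𝓝[>] 0) (𝓝 0)) {κ θ' : ℝ} (hκ : κ ≤ θ) (hκ' : κ ≤ θ')
    (hθ' : 0 < θ') (hO : chartCoord D A Λ γ =O[𝓝[>] 0] fun σ => σ ^ κ) (K : ℝ) :
    ∃ C₁ : ℝ, ∀ᶠ σ in 𝓝[>] (0 : ℝ), ∀ x : ℝ, |x| ≤ K * σ ^ θ' →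
      |g (chartCoord D A Λ γ σ + x, σ)| ≤ C₁ * σ ^ (p * κ) := by
  obtain ⟨C₁, hC⟩ := H.upper
  obtain ⟨c, hc⟩ := hO.bound
  refine ⟨|C₁| * (c + |K| + 1) ^ p, ?_⟩
  filter_upwards [eventually_near_coord hC hv hθ' K, hc, self_mem_nhdsWithin,
    eventually_lt_one_right] with
    σ h1 h2 hσ hσ1 x hx
  have hσ' : (0 : ℝ) < σ := hσ
  have hp : ∀ s : ℝ, 0 < σ ^ s := fun s => rpow_pos_of_pos hσ' _
  rw [norm_eq_abs, norm_of_nonneg (hp κ).le] at h2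
  have h3 : σ ^ θ ≤ σ ^ κ := rpow_le_rpow_of_exponent_ge hσ' hσ1.le hκ
  have h4 : |x| ≤ |K| * σ ^ κ := by
    refine hx.trans ((mul_le_mul_of_nonneg_right (le_abs_self K) (hp _).le).trans ?_)
    exact mul_le_mul_of_nonneg_left (rpow_le_rpow_of_exponent_ge hσ' hσ1.le hκ') (abs_nonneg _)
  have h5 : |chartCoord D A Λ γ σ + x| + σ ^ θ ≤ (c + |K| + 1) * σ ^ κ := by
    have := abs_add_le (chartCoord D A Λ γ σ) x
    nlinarith
  calc |g (chartCoord D A Λ γ σ + x, σ)| ≤ |C₁| * (|chartCoord D A Λ γ σ + x| + σ ^ θ) ^ p :=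
        (h1 x hx).trans (mul_le_mul_of_nonneg_right (le_abs_self _)
          (pow_nonneg (add_nonneg (abs_nonneg _) (hp _).le) _))
    _ ≤ |C₁| * ((c + |K| + 1) * σ ^ κ) ^ p := by
        refine mul_le_mul_of_nonneg_left (pow_le_pow_left₀ ?_ h5 _) (abs_nonneg _)
        exact add_nonneg (abs_nonneg _) (hp _).le
    _ = |C₁| * (c + |K| + 1) ^ p * σ ^ (p * κ) := by
        rw [mul_pow, mul_comm (p : ℝ) κ, rpow_mul hσ'.le, rpow_natCast]; ring

/-- On horns that are at least as wide as the distance to the centre of the chart, `f` behaves like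
`σ ^ C * v ^ p`. -/
theorem relBound_iff (H : EdgeForm f ε D A C p Λ g θ) (hε : γ.ε = ε)
    (hv : Tendsto (chartCoord D A Λ γ) (𝓝[>] 0) (𝓝 0)) {θ' : ℝ} (h0 : 0 < θ') (hle : θ' ≤ θ)
    (hO : chartCoord D A Λ γ =O[𝓝[>] 0] fun σ => σ ^ θ') (e : ℝ) :
    RelBound f γ ((A + θ') / D) e ↔ D * e ≤ C + p * θ' := by
  refine relBound_iff_of_chart H.D_pos hε H.eq hv h0 (H.upper_coord hv hle le_rfl h0 hO) ?_ e
  obtain ⟨K, c, hc, hlow⟩ := H.lower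
  obtain ⟨k, hk⟩ := hO.bound
  have hK1 : 0 < |K| + 1 := by positivity
  refine ⟨|K| + 1 + k, c * (|K| + 1) ^ p, by positivity, ?_⟩
  filter_upwards [eventually_near_coord hlow hv h0 (|K| + 1 + k), hk, self_mem_nhdsWithin,
    eventually_lt_one_right] with
    σ h1 h2 hσ hσ1
  have hσ' : (0 : ℝ) < σ := hσ
  have hp : ∀ s : ℝ, 0 < σ ^ s := fun s => rpow_pos_of_pos hσ' _
  rw [norm_eq_abs, norm_of_nonneg (hp _).le] at h2
  -- the horn contains the point with coordinate `(|K| + 1) * σ ^ θ'`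
  have hx : |(|K| + 1) * σ ^ θ' - chartCoord D A Λ γ σ| ≤ (|K| + 1 + k) * σ ^ θ' := by
    refine (abs_sub _ _).trans ?_
    rw [abs_of_pos (mul_pos hK1 (hp _))]
    linarith
  refine ⟨_, hx, ?_⟩
  have h3 := h1 _ hx
  simp only [add_sub_cancel] at h3 ⊢
  rw [abs_of_pos (mul_pos hK1 (hp _))] at h3
  have h4 : σ ^ θ ≤ σ ^ θ' := rpow_le_rpow_of_exponent_ge hσ' hσ1.le hle
  have h5 := h3 (by nlinarith [le_abs_self K, hp θ, hp θ', abs_nonneg K])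
  refine le_of_eq_of_le ?_ h5
  rw [mul_pow, mul_comm (p : ℝ) θ', rpow_mul hσ'.le, rpow_natCast]
  ring

/-- The vanishing order on all horns, if `f` has the expected size `σ ^ C * v ^ p` on the arc. -/
theorem relBound_iff_min (H : EdgeForm f ε D A C p Λ g θ) (hε : γ.ε = ε)
    (hv : Tendsto (chartCoord D A Λ γ) (𝓝[>] 0) (𝓝 0)) {κ θ' : ℝ} (hκ : κ ≤ θ) (h0 : 0 < θ')
    (hO : chartCoord D A Λ γ =O[𝓝[>] 0] fun σ => σ ^ κ)
    (hlow : ∃ c > 0, ∀ᶠ σ in 𝓝[>] (0 : ℝ), c * σ ^ (p * κ) ≤ |g (chartCoord D A Λ γ σ, σ)|)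
    (e : ℝ) : RelBound f γ ((A + θ') / D) e ↔ D * e ≤ C + p * min κ θ' := by
  rcases le_total κ θ' with h1 | h1
  · rw [min_eq_left h1]
    refine relBound_iff_of_chart H.D_pos hε H.eq hv h0 (H.upper_coord hv hκ h1 h0 hO) ?_ e
    obtain ⟨c, hc, h2⟩ := hlow
    refine ⟨0, c, hc, h2.mono fun σ hσ => ⟨0, by simp, ?_⟩⟩
    rwa [add_zero]
  · rw [min_eq_right h1]
    exact H.relBound_iff hε hv h0 (h1.trans hκ) (hO.trans (isBigO_rpow_rpow h1)) e

theorem isStableAt (H : EdgeForm f ε D A C p Λ g θ) (hε : γ.ε = ε)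
    (hv : Tendsto (chartCoord D A Λ γ) (𝓝[>] 0) (𝓝 0)) {κ : ℝ} (hκ : κ ≤ θ) (h0 : 0 < κ)
    (hO : chartCoord D A Λ γ =O[𝓝[>] 0] fun σ => σ ^ κ)
    (hlow : ∃ c > 0, ∀ᶠ σ in 𝓝[>] (0 : ℝ), c * σ ^ (p * κ) ≤ |g (chartCoord D A Λ γ σ, σ)|) :
    IsStableAt f γ ((A + κ) / D) :=
  isStableAt_of_relBound_iff H.D_pos fun θ' hθ' e => by
    rw [H.relBound_iff_min hε hv hκ (h0.trans_le hθ') hO hlow e, min_eq_left hθ']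

theorem lower_coord (H : EdgeForm f ε D A C p Λ g θ)
    (hv : Tendsto (chartCoord D A Λ γ) (𝓝[>] 0) (𝓝 0)) {κ c : ℝ} (hκ : κ < θ)
    (hc : Tendsto (fun σ => chartCoord D A Λ γ σ / σ ^ κ) (𝓝[>] 0) (𝓝 c)) (hc0 : c ≠ 0) :
    ∃ c > 0, ∀ᶠ σ in 𝓝[>] (0 : ℝ), c * σ ^ (p * κ) ≤ |g (chartCoord D A Λ γ σ, σ)| := by
  obtain ⟨K, c₁, hc₁, hlow⟩ := H.lower
  have hcpos : 0 < |c| / 2 := by positivity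
  refine ⟨c₁ * (|c| / 2) ^ p, by positivity, ?_⟩
  have h1 := hc.abs.eventually (lt_mem_nhds (half_lt_self (abs_pos.2 hc0)))
  have h2 : ∀ᶠ σ : ℝ in 𝓝[>] 0, K * σ ^ (θ - κ) < |c| / 2 := by
    have := (tendsto_rpow_nhds_zero (sub_pos.2 hκ)).const_mul K
    rw [mul_zero] at this
    exact this.eventually (gt_mem_nhds hcpos)
  have h3 := eventually_near_coord hlow hv one_pos 0
  filter_upwards [h1, h2, h3, self_mem_nhdsWithin] with σ h1 h2 h3 (hσ' : (0 : ℝ) < σ)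
  have hp : 0 < σ ^ κ := rpow_pos_of_pos hσ' _
  rw [abs_div, abs_of_pos hp, lt_div_iff₀ hp] at h1
  have h4 := h3 0 (by simp)
  rw [add_zero] at h4
  have h5 := h4 (by
    rw [rpow_sub hσ', mul_div_assoc', div_lt_iff₀ hp] at h2
    exact (h2.trans h1).le)
  refine le_trans ?_ h5
  rw [mul_comm (p : ℝ) κ, rpow_mul hσ'.le, rpow_natCast, mul_assoc, ← mul_pow]
  exact mul_le_mul_of_nonneg_left (pow_le_pow_left₀ (mul_pos hcpos hp).le h1.le _) hc₁.le

theorem lower_coord_of_lim {w J : ℝ}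
    (hlim : Tendsto (fun z : ℝ × ℝ => g (z.1 * z.2 ^ θ, z.2) / z.2 ^ (p * θ)) (𝓝 w ×ˢ 𝓝[>] 0)
      (𝓝 J)) (hJ : J ≠ 0)
    (hw : Tendsto (fun σ => chartCoord D A Λ γ σ / σ ^ θ) (𝓝[>] 0) (𝓝 w)) :
    ∃ c > 0, ∀ᶠ σ in 𝓝[>] (0 : ℝ), c * σ ^ (p * θ) ≤ |g (chartCoord D A Λ γ σ, σ)| := by
  refine ⟨|J| / 2, by positivity, ?_⟩
  have h1 := Tendsto.comp (g := fun z : ℝ × ℝ => g (z.1 * z.2 ^ θ, z.2) / z.2 ^ (p * θ))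
    (f := fun σ => (chartCoord D A Λ γ σ / σ ^ θ, σ)) hlim (hw.prodMk tendsto_id)
  filter_upwards [h1.abs.eventually (lt_mem_nhds (half_lt_self (abs_pos.2 hJ))),
    self_mem_nhdsWithin] with σ h2 (hσ' : (0 : ℝ) < σ)
  simp only [Function.comp] at h2
  rw [div_mul_cancel₀ _ (rpow_pos_of_pos hσ' _).ne', abs_div,
    abs_of_pos (rpow_pos_of_pos hσ' _), lt_div_iff₀ (rpow_pos_of_pos hσ' _)] at h2
  exact h2.le

end EdgeForm

/-- The coordinate of an arc vanishes or has an order. -/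
theorem chartCoord_dichotomy (hD : 0 < D) (hΛ : AnalyticAt ℝ Λ 0) (A : ℕ) (γ : RArc) :
    (∀ᶠ σ in 𝓝[>] (0 : ℝ), chartCoord D A Λ γ σ = 0) ∨
      ∃ κ c : ℝ, c ≠ 0 ∧ Tendsto (fun σ => chartCoord D A Λ γ σ / σ ^ κ) (𝓝[>] 0) (𝓝 c) := by
  have hd := γ.d_pos
  have han : AnalyticAt ℝ (fun τ : ℝ => γ.x (τ ^ D) - Λ (τ ^ γ.d)) 0 := by
    refine AnalyticAt.fun_sub ?_ ?_
    · refine AnalyticAt.fun_comp (g := γ.x) (f := fun τ : ℝ => τ ^ D) ?_ (by fun_prop)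
      rw [zero_pow hD.ne']; exact γ.analyticAt_x
    · refine AnalyticAt.fun_comp (g := Λ) (f := fun τ : ℝ => τ ^ γ.d) ?_ (by fun_prop)
      rwa [zero_pow hd.ne']
  have hnum : ∀ σ : ℝ, 0 < σ → γ.X (σ ^ D) - Λ σ =
      (fun τ : ℝ => γ.x (τ ^ D) - Λ (τ ^ γ.d)) (σ ^ (1 / (γ.d : ℝ))) := by
    intro σ hσ
    have h1 : 0 ≤ σ ^ (1 / (γ.d : ℝ)) := rpow_nonneg hσ.le _
    simp only
    rw [root_pow hd hσ.le, ← γ.X_pow (pow_nonneg h1 _), ← pow_mul, mul_comm D, pow_mul,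
      root_pow hd hσ.le]
  rcases AnalyticAt.taylorSeq_dichotomy han with ⟨h0, -⟩ | ⟨n, u, hu, hu0, he, -⟩
  · left
    have h1 := (tendsto_root_zero_right hd).eventually (h0.within)
    filter_upwards [h1, self_mem_nhdsWithin] with σ h2 hσ
    rw [chartCoord, hnum σ hσ]
    simp only at h2 ⊢
    rw [h2, zero_div]
  · right
    refine ⟨n / γ.d - A, u 0, hu0, ?_⟩
    have h1 := (tendsto_root_zero_right hd).eventually (he.within)
    have h2 := (hu.continuousAt.tendsto.within).comp (tendsto_root_zero_right hd)
    refine h2.congr' ?_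
    filter_upwards [h1, self_mem_nhdsWithin] with σ h3 (hσ' : (0 : ℝ) < σ)
    rw [chartCoord, hnum σ hσ']
    simp only at h3 ⊢
    rw [h3, rpow_sub hσ', rpow_natCast, ← rpow_natCast, ← rpow_mul hσ'.le, one_div_mul_eq_div]
    simp only [Function.comp]
    field_simp

theorem pos_of_tendsto_div_rpow {v : ℝ → ℝ} {κ c : ℝ} (hv : Tendsto v (𝓝[>] 0) (𝓝 0))
    (hc : Tendsto (fun σ => v σ / σ ^ κ) (𝓝[>] 0) (𝓝 c)) (hc0 : c ≠ 0) : 0 < κ := by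
  by_contra hcon
  push Not at hcon
  rcases hcon.eq_or_lt with h0 | h0
  · rw [h0] at hc
    simp only [rpow_zero, div_one] at hc
    exact hc0 (tendsto_nhds_unique hc hv)
  · have h1 := hv.mul (tendsto_rpow_nhds_zero (neg_pos.2 h0))
    refine hc0 (tendsto_nhds_unique hc ?_)
    rw [mul_zero] at h1
    refine h1.congr' ?_
    filter_upwards [self_mem_nhdsWithin] with σ (hσ' : (0 : ℝ) < σ)
    rw [Real.rpow_neg hσ'.le, div_eq_mul_inv]

namespace EdgeForm

/-- An arc whose height is at least `h` comes close to the centre of the chart. -/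
theorem coord_isBigO (H : EdgeForm f ε D A C p Λ g θ) (hΛ : AnalyticAt ℝ Λ 0) (hε : γ.ε = ε)
    (hv : Tendsto (chartCoord D A Λ γ) (𝓝[>] 0) (𝓝 0)) {h : ℝ} (hh : HeightGE f γ h)
    (hle : h ≤ (A + θ) / D) : chartCoord D A Λ γ =O[𝓝[>] 0] fun σ => σ ^ (D * h - A) := by
  have hD : (0 : ℝ) < D := mod_cast H.D_pos
  rw [le_div_iff₀ hD] at hle
  rcases chartCoord_dichotomy H.D_pos hΛ A γ with h0 | ⟨κ, c, hc0, hc⟩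
  · exact (isBigO_zero _ _).congr' (h0.mono fun σ hσ => hσ.symm) EventuallyEq.rfl
  · have hO := isBigO_rpow_of_tendsto_div hc
    have hκ := pos_of_tendsto_div_rpow hv hc hc0
    rcases le_or_gt (D * h - A) κ with h1 | h1
    · exact hO.trans (isBigO_rpow_rpow h1)
    · exfalso
      refine hh ((A + κ) / D) (by positivity) ?_ (H.isStableAt hε hv (by linarith) hκ hO
        (H.lower_coord hv (by linarith) hc hc0))
      rw [div_lt_iff₀ hD]
      linarith

/-- An arc whose height exceeds the weight of the edge runs into a root of the edge polynomial. -/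
theorem exists_root (H : EdgeForm f ε D A C p Λ g θ) (hΛ : AnalyticAt ℝ Λ 0) (hε : γ.ε = ε)
    (hv : Tendsto (chartCoord D A Λ γ) (𝓝[>] 0) (𝓝 0)) {J : ℝ → ℝ}
    (hlim : ∀ w, Tendsto (fun z : ℝ × ℝ => g (z.1 * z.2 ^ θ, z.2) / z.2 ^ (p * θ))
      (𝓝 w ×ˢ 𝓝[>] 0) (𝓝 (J w))) {h : ℝ} (hh : HeightGE f γ h) (hlt : (A + θ) / D < h) :
    ∃ w, J w = 0 ∧ Tendsto (fun σ => chartCoord D A Λ γ σ / σ ^ θ) (𝓝[>] 0) (𝓝 w) := by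
  have hD : (0 : ℝ) < D := mod_cast H.D_pos
  have hO := H.coord_isBigO hΛ hε hv (hh.mono hlt.le) le_rfl
  rw [mul_div_cancel₀ _ hD.ne', add_sub_cancel_left] at hO
  have hex : ∃ w, Tendsto (fun σ => chartCoord D A Λ γ σ / σ ^ θ) (𝓝[>] 0) (𝓝 w) := by
    rcases chartCoord_dichotomy H.D_pos hΛ A γ with h0 | ⟨κ, c, hc0, hc⟩
    · refine ⟨0, tendsto_const_nhds.congr' (h0.mono fun σ hσ => ?_)⟩
      simp only [hσ, zero_div]
    · have hO' := isBigO_rpow_of_tendsto_div hc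
      rcases lt_trichotomy κ θ with h1 | rfl | h1
      · exact absurd (tendsto_nhds_unique hc (tendsto_div_rpow_of_isBigO hO h1)) hc0
      · exact ⟨c, hc⟩
      · exact ⟨0, tendsto_div_rpow_of_isBigO hO' h1⟩
  obtain ⟨w, hw⟩ := hex
  refine ⟨w, ?_, hw⟩
  by_contra hJ
  have h0 : 0 < ((A : ℝ) + θ) / D := by have := H.pos; positivity
  exact hh _ h0 hlt (H.isStableAt hε hv le_rfl H.pos hO (lower_coord_of_lim (hlim w) hJ hw))

end EdgeForm

/-- A Taylor expansion with coefficients of the right order gives an edge form. -/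
theorem EdgeForm.of_expand (hD : 0 < D) (hθ : 0 < θ) (heq : ∀ᶠ z in 𝓝 (0 : ℝ) ×ˢ 𝓝[>] (0 : ℝ),
      f (Λ z.2 + z.1 * z.2 ^ A, ε * z.2 ^ D) = z.2 ^ C * g z)
    {a : ℕ → ℝ → ℝ} {S : ℝ × ℝ → ℝ} {S₀ : ℝ}
    (hexp : ∀ᶠ z in 𝓝 (0 : ℝ) ×ˢ 𝓝[>] (0 : ℝ),
      g z = ∑ i ∈ Finset.range p, z.1 ^ i * a i z.2 + z.1 ^ p * S z)
    (ha : ∀ i < p, a i =O[𝓝[>] 0] fun σ => σ ^ (((p - i : ℕ) : ℝ) * θ))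
    (hS : Tendsto S (𝓝 0 ×ˢ 𝓝[>] 0) (𝓝 S₀)) (hS0 : S₀ ≠ 0) : EdgeForm f ε D A C p Λ g θ := by
  have hex : ∃ c : ℝ, 0 ≤ c ∧ ∀ᶠ σ in 𝓝[>] (0 : ℝ), ∀ i < p,
      |a i σ| ≤ c * (σ ^ θ) ^ (p - i) := by
    have h1 : ∀ i, ∃ c : ℝ, i < p → ∀ᶠ σ in 𝓝[>] (0 : ℝ), |a i σ| ≤ c * (σ ^ θ) ^ (p - i) := by
      intro i
      by_cases hi : i < p
      · obtain ⟨c, hc⟩ := (ha i hi).bound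
        refine ⟨c, fun _ => ?_⟩
        filter_upwards [hc, self_mem_nhdsWithin] with σ h1 (hσ' : (0 : ℝ) < σ)
        rwa [norm_eq_abs, norm_of_nonneg (rpow_nonneg hσ'.le _), mul_comm _ θ,
          rpow_mul hσ'.le, rpow_natCast] at h1
      · exact ⟨0, fun h => absurd h hi⟩
    choose c hc using h1
    refine ⟨∑ i ∈ Finset.range p, |c i|, Finset.sum_nonneg fun _ _ => abs_nonneg _, ?_⟩
    have h2 : ∀ᶠ σ in 𝓝[>] (0 : ℝ), ∀ i ∈ Finset.range p, |a i σ| ≤ c i * (σ ^ θ) ^ (p - i) :=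
      (Finset.eventually_all _).2 fun i hi => hc i (Finset.mem_range.1 hi)
    filter_upwards [h2, self_mem_nhdsWithin] with σ h3 (hσ' : (0 : ℝ) < σ) i hi
    refine (h3 i (Finset.mem_range.2 hi)).trans (mul_le_mul_of_nonneg_right ?_
      (pow_nonneg (rpow_nonneg hσ'.le _) _))
    exact (le_abs_self _).trans (Finset.single_le_sum (f := fun i => |c i|)
      (fun _ _ => abs_nonneg _) (Finset.mem_range.2 hi))
  obtain ⟨c, hc0, hc⟩ := hex
  have hc' : ∀ᶠ z : ℝ × ℝ in 𝓝 (0 : ℝ) ×ˢ 𝓝[>] (0 : ℝ), ∀ i < p,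
      |a i z.2| ≤ c * (z.2 ^ θ) ^ (p - i) := tendsto_snd.eventually hc
  have hpos : ∀ᶠ z : ℝ × ℝ in 𝓝 (0 : ℝ) ×ˢ 𝓝[>] (0 : ℝ), 0 < z.2 :=
    tendsto_snd.eventually self_mem_nhdsWithin
  refine ⟨hD, hθ, heq, ⟨p * c + (|S₀| + 1), ?_⟩, 4 * p * c / |S₀| + 2, |S₀| / 4, by positivity, ?_⟩
  · filter_upwards [hexp, hc', hpos, hS.abs.eventually (gt_mem_nhds (lt_add_one _))] with
      z h1 h2 h3 h4
    have hρ : 0 < z.2 ^ θ := rpow_pos_of_pos h3 _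
    set ρ := z.2 ^ θ
    have hw : |z.1| ≤ |z.1| + ρ := by linarith
    have hw' : ρ ≤ |z.1| + ρ := by linarith [abs_nonneg z.1]
    have hw0 : 0 ≤ |z.1| + ρ := by linarith [abs_nonneg z.1]
    rw [h1, add_mul]
    refine (abs_add_le _ _).trans (add_le_add ?_ ?_)
    · refine (Finset.abs_sum_le_sum_abs _ _).trans ?_
      rw [mul_assoc]
      refine (Finset.sum_le_card_nsmul _ _ (c * (|z.1| + ρ) ^ p) fun i hi => ?_).trans
        (by rw [Finset.card_range, nsmul_eq_mul])
      have hi' := Finset.mem_range.1 hi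
      rw [abs_mul, abs_pow]
      calc |z.1| ^ i * |a i z.2| ≤ (|z.1| + ρ) ^ i * (c * (|z.1| + ρ) ^ (p - i)) := by
            refine mul_le_mul (pow_le_pow_left₀ (abs_nonneg _) hw _) ((h2 i hi').trans ?_)
              (abs_nonneg _) (pow_nonneg hw0 _)
            exact mul_le_mul_of_nonneg_left (pow_le_pow_left₀ hρ.le hw' _) hc0
        _ = c * (|z.1| + ρ) ^ p := by rw [mul_left_comm, ← pow_add, Nat.add_sub_cancel' hi'.le]
    · rw [abs_mul, abs_pow, mul_comm (|S₀| + 1)]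
      exact mul_le_mul (pow_le_pow_left₀ (abs_nonneg _) hw _) h4.le (abs_nonneg _)
        (pow_nonneg hw0 _)
  · filter_upwards [hexp, hc', hpos,
      hS.abs.eventually (lt_mem_nhds (half_lt_self (abs_pos.2 hS0)))] with z h1 h2 h3 h4 h5
    set ρ := z.2 ^ θ
    have hs : 0 < |S₀| := abs_pos.2 hS0
    have hK : 0 ≤ 4 * p * c / |S₀| := by positivity
    set B : ℝ := 4 * p * c / |S₀| + 2 with hB
    have hv0 : 0 ≤ |z.1| := abs_nonneg _
    -- the lower order terms are small compared with `|v| ^ p`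
    have hterm : ∀ i ∈ Finset.range p, |z.1 ^ i * a i z.2| * B ≤ c * |z.1| ^ p := by
      intro i hi
      have hi' := Finset.mem_range.1 hi
      obtain ⟨j, hj⟩ : ∃ j, p - i = j + 1 := ⟨p - i - 1, by omega⟩
      have h6 : ρ ≤ |z.1| := by nlinarith
      calc |z.1 ^ i * a i z.2| * B ≤ |z.1| ^ i * (c * ρ ^ (p - i)) * B := by
            rw [abs_mul, abs_pow]
            have := h2 i hi'
            gcongr
        _ = c * (|z.1| ^ i * ρ ^ j * (B * ρ)) := by rw [hj, pow_succ]; ring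
        _ ≤ c * (|z.1| ^ i * |z.1| ^ j * |z.1|) := by gcongr
        _ = c * |z.1| ^ p := by
            rw [mul_assoc (|z.1| ^ i), ← pow_succ, ← pow_add, ← hj, Nat.add_sub_cancel' hi'.le]
    have hsum : |∑ i ∈ Finset.range p, z.1 ^ i * a i z.2| ≤ |S₀| / 4 * |z.1| ^ p := by
      have h7 : |∑ i ∈ Finset.range p, z.1 ^ i * a i z.2| * B ≤ p * (c * |z.1| ^ p) := by
        calc |∑ i ∈ Finset.range p, z.1 ^ i * a i z.2| * B
            ≤ (∑ i ∈ Finset.range p, |z.1 ^ i * a i z.2|) * B :=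
              mul_le_mul_of_nonneg_right (Finset.abs_sum_le_sum_abs _ _) (by linarith)
          _ ≤ p * (c * |z.1| ^ p) := by
              rw [Finset.sum_mul]
              refine (Finset.sum_le_card_nsmul _ _ _ hterm).trans
                (by rw [Finset.card_range, nsmul_eq_mul])
      have h8 : |S₀| / 4 * B = p * c + |S₀| / 2 := by
        rw [hB]
        field_simp
        ring
      have h9 : 0 ≤ |z.1| ^ p := pow_nonneg hv0 _
      refine le_of_mul_le_mul_right (h7.trans ?_) (by linarith : (0 : ℝ) < B)
      calc (p : ℝ) * (c * |z.1| ^ p) ≤ (p * c + |S₀| / 2) * |z.1| ^ p := by nlinarith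
        _ = |S₀| / 4 * |z.1| ^ p * B := by rw [← h8]; ring
    rw [h1]
    have h9 : |S₀| / 2 * |z.1| ^ p ≤ |z.1 ^ p * S z| := by
      rw [abs_mul, abs_pow, mul_comm]
      exact mul_le_mul_of_nonneg_left h4.le (pow_nonneg hv0 _)
    have := abs_sub_abs_le_abs_sub (z.1 ^ p * S z) (-∑ i ∈ Finset.range p, z.1 ^ i * a i z.2)
    rw [abs_neg, sub_neg_eq_add, add_comm (z.1 ^ p * S z)] at this
    linarith

end EdgeForm

/-! ### Power series with parameters -/

section Parameters

/-- Power series `Λ (·, t)` of order at least `D`, depending analytically on `t`, are the series of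
an analytic family of arcs. -/
theorem exists_isAnalyticFamily_X_eq (s : ℤˣ) {D : ℕ} (hD : 0 < D) {Λ : ℝ × ℝ → ℝ} {δ : ℝ}
    (hΛ : ∀ t ∈ Ioo (-δ) δ, AnalyticAt ℝ Λ (0, t))
    (hO : ∀ t ∈ Ioo (-δ) δ, (Λ ⟨·, t⟩) =O[𝓝[>] 0] fun σ : ℝ => σ ^ (D : ℝ)) :
    ∃ L : ℝ → RArc, IsAnalyticFamily δ L ∧ ∀ t ∈ Ioo (-δ) δ, (L t).sgn = s ∧
      ∀ᶠ σ in 𝓝[>] (0 : ℝ), (L t).X (σ ^ D) = Λ (σ, t) := by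
  classical
  let c : ℝ → ℕ → ℝ := fun t j => if t ∈ Ioo (-δ) δ then taylorSeq (Λ ⟨·, t⟩) j else 0
  have hcin : ∀ t ∈ Ioo (-δ) δ, c t = taylorSeq fun σ => Λ (σ, t) := fun t ht => by
    ext j; simp only [c, if_pos ht]
  have hconv : ∀ t, ConvSeq (c t) := by
    intro t
    by_cases ht : t ∈ Ioo (-δ) δ
    · rw [hcin t ht]; exact (analyticAt_slice (hΛ t ht)).convSeq
    · have : c t = fun _ => 0 := by ext j; simp only [c, if_neg ht]
      rw [this]
      exact ⟨1, one_pos, by simp⟩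
  have hser : ∀ t ∈ Ioo (-δ) δ, ∀ᶠ σ in 𝓝[>] (0 : ℝ), ser (c t) σ = Λ (σ, t) := by
    intro t ht
    rw [hcin t ht]
    filter_upwards [(analyticAt_slice (hΛ t ht)).eventuallyEq_ser.within] with σ hσ
    exact hσ.symm
  have hzero : ∀ t, ∀ j < D, c t j = 0 := by
    intro t j hj
    by_cases ht : t ∈ Ioo (-δ) δ
    · exact (hconv t).coeff_eq_zero_of_isBigO
        ((hO t ht).congr' ((hser t ht).mono fun σ h => h.symm) EventuallyEq.rfl) j
        (by exact_mod_cast hj)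
    · simp only [c, if_neg ht]
  let L : ℝ → RArc := fun t => ⟨s, D, hD, c t, hzero t, hconv t⟩
  refine ⟨L, ⟨fun t _ => ⟨rfl, rfl⟩, fun j t ht => ?_⟩, fun t ht => ⟨rfl, ?_⟩⟩
  · refine (analyticAt_taylorSeq_slice (hΛ t ht) j).congr ?_
    filter_upwards [isOpen_Ioo.mem_nhds ht] with t ht
    simp only [L, hcin t ht]
  · filter_upwards [hser t ht, self_mem_nhdsWithin] with σ h1 hσ
    rw [← h1]
    exact (L t).X_pow (le_of_lt hσ)

theorem IsContFamily.mono {δ δ' : ℝ} {Γ : ℝ → RArc} (h : IsContFamily δ Γ) (hle : δ' ≤ δ) :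
    IsContFamily δ' Γ := by
  have hs : Ioo (-δ') δ' ⊆ Ioo (-δ) δ := Ioo_subset_Ioo (neg_le_neg hle) hle
  exact ⟨fun t ht => h.1 t (hs ht), fun j => (h.2 j).mono hs⟩

theorem IsAnalyticFamily.isContFamily {δ : ℝ} {Γ : ℝ → RArc} (h : IsAnalyticFamily δ Γ) :
    IsContFamily δ Γ :=
  ⟨h.1, fun j => (h.2 j).continuousOn⟩

theorem IsContFamily.continuousOn_coeffAt {δ : ℝ} {Γ : ℝ → RArc} (h : IsContFamily δ Γ) (e : ℝ) :
    ContinuousOn (fun t => (Γ t).coeffAt e) (Ioo (-δ) δ) := by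
  refine ContinuousOn.congr (f := fun t => if ((⌊e * (Γ 0).d⌋₊ : ℕ) : ℝ) = e * (Γ 0).d then
    (Γ t).coeff ⌊e * (Γ 0).d⌋₊ else 0) ?_ fun t ht => ?_
  · split_ifs
    · exact h.2 _
    · exact continuousOn_const
  · simp only [RArc.coeffAt, (h.1 t ht).2]

/-- An analytic function of `(σ, t)` whose slices vanish to order `κ` at `σ = 0` is divisible by
`σ ^ k`, `k < κ + 1`. -/
theorem AnalyticAt.exists_eq_pow_mul_of_isBigO {α : ℝ × ℝ → ℝ} (hα : AnalyticAt ℝ α 0) {κ : ℝ}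
    (hO : ∀ᶠ t in 𝓝 (0 : ℝ), (fun σ => α (σ, t)) =O[𝓝[>] 0] fun σ : ℝ => σ ^ κ) {k : ℕ}
    (hk : (k : ℝ) < κ + 1) :
    ∃ β : ℝ × ℝ → ℝ, AnalyticAt ℝ β 0 ∧ ∀ᶠ x in 𝓝 (0 : ℝ × ℝ), α x = x.1 ^ k * β x := by
  have hα' : AnalyticAt ℝ α ((0 : ℝ), (0 : ℝ)) := hα
  obtain ⟨T, hT⟩ := hα'.exists_isTaylorSeq
  have h0 : ∀ j < k, ∀ᶠ t in 𝓝 (0 : ℝ), T j (0, t) = 0 := by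
    intro j hj
    have hj' : (j : ℝ) < κ := by
      have : (j : ℝ) + 1 ≤ k := mod_cast hj
      linarith
    have han : ∀ᶠ t in 𝓝 (0 : ℝ), AnalyticAt ℝ α (0, t) :=
      (eventually_nhds_slice hα'.eventually_analyticAt).mono fun t ht => ht.self_of_nhds
    filter_upwards [hO, hT.iteratedDeriv_eq j, han] with t h1 h2 h3
    have h4 := analyticAt_slice h3
    have h5 := h4.convSeq.coeff_eq_zero_of_isBigO (h1.congr'
      (h4.eventuallyEq_ser.within) EventuallyEq.rfl) j hj'
    rw [taylorSeq, h2] at h5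
    field_simp at h5
    exact h5
  refine ⟨T k, hT.analyticAt k, ?_⟩
  have h1 : ∀ᶠ t in 𝓝 (0 : ℝ), ∀ j ∈ Finset.range k, T j (0, t) = 0 :=
    (Finset.eventually_all _).2 fun j hj => h0 j (Finset.mem_range.1 hj)
  have h2 : ∀ᶠ x in 𝓝 ((0 : ℝ), (0 : ℝ)), ∀ j ∈ Finset.range k, T j (0, x.2) = 0 :=
    (continuous_snd.tendsto ((0 : ℝ), (0 : ℝ))).eventually h1
  have h3 := hT.expand k
  filter_upwards [h2, h3] with x h4 h5
  rw [h5, sum_eq_zero fun j hj => by rw [h4 j hj, mul_zero], zero_add]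

end Parameters

section EdgePoly

/-- The polynomial `∑ i ≤ p, c i * X ^ i`. -/
def edgePoly (p : ℕ) (c : ℕ → ℝ) : ℝ[X] := ∑ i ∈ Finset.range (p + 1), monomial i (c i)

theorem eval_edgePoly (p : ℕ) (c : ℕ → ℝ) (w : ℝ) :
    (edgePoly p c).eval w = ∑ i ∈ Finset.range p, w ^ i * c i + w ^ p * c p := by
  rw [edgePoly, eval_finsetSum, sum_range_succ]
  simp [Polynomial.eval_monomial, mul_comm]

theorem coeff_edgePoly {p : ℕ} (c : ℕ → ℝ) {i : ℕ} (hi : i ≤ p) : (edgePoly p c).coeff i = c i := by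
  rw [edgePoly, finsetSum_coeff]
  simp only [coeff_monomial]
  rw [Finset.sum_ite_eq' (Finset.range (p + 1)) i c, if_pos (Finset.mem_range.2 (by omega))]

theorem natDegree_edgePoly_le (p : ℕ) (c : ℕ → ℝ) : (edgePoly p c).natDegree ≤ p := by
  refine Polynomial.natDegree_sum_le_of_forall_le _ _ fun i hi => ?_
  exact (Polynomial.natDegree_monomial_le _).trans (by have := Finset.mem_range.1 hi; omega)

theorem natDegree_edgePoly {p : ℕ} {c : ℕ → ℝ} (hc : c p ≠ 0) : (edgePoly p c).natDegree = p := by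
  refine le_antisymm (natDegree_edgePoly_le p c) (Polynomial.le_natDegree_of_ne_zero ?_)
  rwa [coeff_edgePoly c le_rfl]

variable {f : ℝ × ℝ → ℝ} {γ : RArc} {D A C p : ℕ} {Λ : ℝ → ℝ} {g : ℝ × ℝ → ℝ} {θ : ℝ}

/-- The quasi-homogeneous initial form of a Taylor expansion. -/
theorem tendsto_edgePoly (hθ : 0 < θ) {a : ℕ → ℝ → ℝ} {S : ℝ × ℝ → ℝ} {c : ℕ → ℝ}
    (hexp : ∀ᶠ z in 𝓝 (0 : ℝ) ×ˢ 𝓝[>] (0 : ℝ),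
      g z = ∑ i ∈ Finset.range p, z.1 ^ i * a i z.2 + z.1 ^ p * S z)
    (ha : ∀ i < p, Tendsto (fun σ => a i σ / σ ^ (((p - i : ℕ) : ℝ) * θ)) (𝓝[>] 0) (𝓝 (c i)))
    (hS : Tendsto S (𝓝 0 ×ˢ 𝓝[>] 0) (𝓝 (c p))) (w : ℝ) :
    Tendsto (fun z : ℝ × ℝ => g (z.1 * z.2 ^ θ, z.2) / z.2 ^ (p * θ)) (𝓝 w ×ˢ 𝓝[>] 0)
      (𝓝 ((edgePoly p c).eval w)) := by
  have hmap : Tendsto (fun z : ℝ × ℝ => (z.1 * z.2 ^ θ, z.2)) (𝓝 w ×ˢ 𝓝[>] 0) (𝓝 0 ×ˢ 𝓝[>] 0) := by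
    have h1 : Tendsto (fun z : ℝ × ℝ => z.1 * z.2 ^ θ) (𝓝 w ×ˢ 𝓝[>] 0) (𝓝 (w * 0)) :=
      tendsto_fst.mul ((tendsto_rpow_nhds_zero hθ).comp tendsto_snd)
    rw [mul_zero] at h1
    exact h1.prodMk tendsto_snd
  rw [eval_edgePoly]
  have hsum : Tendsto (fun z : ℝ × ℝ => ∑ i ∈ Finset.range p,
      z.1 ^ i * (a i z.2 / z.2 ^ (((p - i : ℕ) : ℝ) * θ)) + z.1 ^ p * S (z.1 * z.2 ^ θ, z.2))
      (𝓝 w ×ˢ 𝓝[>] 0) (𝓝 (∑ i ∈ Finset.range p, w ^ i * c i + w ^ p * c p)) := by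
    refine Tendsto.add (tendsto_finsetSum _ fun i hi => ?_) ?_
    · exact (tendsto_fst.pow i).mul ((ha i (Finset.mem_range.1 hi)).comp tendsto_snd)
    · exact (tendsto_fst.pow p).mul (hS.comp hmap)
  refine hsum.congr' ?_
  have hpos : ∀ᶠ z : ℝ × ℝ in 𝓝 w ×ˢ 𝓝[>] (0 : ℝ), 0 < z.2 :=
    tendsto_snd.eventually self_mem_nhdsWithin
  filter_upwards [hmap.eventually hexp, hpos] with z h1 h2
  have hr : ∀ s : ℝ, 0 < z.2 ^ s := fun s => rpow_pos_of_pos h2 _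
  have hpw : ∀ k : ℕ, z.2 ^ ((k : ℝ) * θ) = (z.2 ^ θ) ^ k := fun k => by
    rw [mul_comm, rpow_mul h2.le, rpow_natCast]
  rw [h1, add_div, Finset.sum_div]
  congr 1
  · refine sum_congr rfl fun i hi => ?_
    have hi' := Finset.mem_range.1 hi
    obtain ⟨j, hj⟩ : ∃ j, p = i + j := ⟨p - i, by omega⟩
    rw [hpw, hpw, mul_pow, hj, pow_add, Nat.add_sub_cancel_left]
    have := (hr θ).ne'
    field_simp
  · rw [hpw, mul_pow]
    have := (hr θ).ne'
    field_simp

/-- The coefficients `b i` of `∑ i < p, b i * X ^ i + X ^ p * T` are bounded by the values at the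
points `X = k * σ ^ θ`. -/
theorem isBigO_coeff_of_values {b T φ : ℕ → ℝ → ℝ} (hφ : ∀ k : ℕ, ∀ᶠ σ in 𝓝[>] (0 : ℝ), φ k σ =
      ∑ i ∈ Finset.range p, (k * σ ^ θ) ^ i * b i σ + (k * σ ^ θ) ^ p * T k σ)
    (hT : ∀ k, T k =O[𝓝[>] 0] fun _ => (1 : ℝ))
    (hO : ∀ k, φ k =O[𝓝[>] 0] fun σ => σ ^ ((p : ℝ) * θ)) :
    ∀ i < p, b i =O[𝓝[>] 0] fun σ => σ ^ (((p - i : ℕ) : ℝ) * θ) := by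
  intro i hi
  have hpw : ∀ σ : ℝ, 0 < σ → ∀ k : ℕ, (σ ^ θ) ^ k = σ ^ ((k : ℝ) * θ) := fun σ hσ k => by
    rw [mul_comm, rpow_mul hσ.le, rpow_natCast]
  have h1 : (fun σ => b i σ * σ ^ ((i : ℝ) * θ)) =O[𝓝[>] 0] fun σ => σ ^ ((p : ℝ) * θ) := by
    refine coeff_isBigO (n := p) (c := fun i σ => b i σ * σ ^ ((i : ℝ) * θ)) (fun k _ => ?_) i hi
    have h3 : (fun σ : ℝ => (k : ℝ) ^ p * T k σ * σ ^ ((p : ℝ) * θ)) =O[𝓝[>] 0]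
        fun σ => σ ^ ((p : ℝ) * θ) := by
      simpa using ((hT k).const_mul_left ((k : ℝ) ^ p)).mul
        (isBigO_refl (fun σ : ℝ => σ ^ ((p : ℝ) * θ)) (𝓝[>] 0))
    refine ((hO k).sub h3).congr' ?_ EventuallyEq.rfl
    filter_upwards [hφ k, self_mem_nhdsWithin] with σ h1 hσ
    rw [h1, mul_pow, hpw σ hσ, sub_eq_iff_eq_add]
    congr 1
    · refine sum_congr rfl fun j _ => ?_
      rw [mul_pow, hpw σ hσ]
      ring
    · ring
  obtain ⟨K, hK⟩ := h1.bound
  refine IsBigO.of_bound K ?_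
  filter_upwards [hK, self_mem_nhdsWithin] with σ h2 (hσ' : (0 : ℝ) < σ)
  have hr : ∀ s : ℝ, 0 < σ ^ s := fun s => rpow_pos_of_pos hσ' _
  rw [norm_of_nonneg (hr _).le] at h2 ⊢
  rw [norm_mul, norm_of_nonneg (hr _).le] at h2
  have h3 : σ ^ ((p : ℝ) * θ) = σ ^ (((p - i : ℕ) : ℝ) * θ) * σ ^ ((i : ℝ) * θ) := by
    rw [← rpow_add hσ', ← add_mul, Nat.cast_sub hi.le, sub_add_cancel]
  rw [h3, ← mul_assoc] at h2
  exact le_of_mul_le_mul_right h2 (hr _)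

/-- If a function of the form `∑ i < p, b i * X ^ i + X ^ p * (β + o(1))`, restricted to
`X = k * σ ^ θ`, has an initial form in `k` which is a polynomial of degree `p`, then its order is at
least that of `X ^ p`. -/
theorem le_of_tendsto_polynomial {b T φ : ℕ → ℝ → ℝ} {β E : ℝ} (hp : 0 < p)
    {J : ℝ[X]} (hJ : J.natDegree = p)
    (hφ : ∀ k : ℕ, ∀ᶠ σ in 𝓝[>] (0 : ℝ), φ k σ =
      ∑ i ∈ Finset.range p, (k * σ ^ θ) ^ i * b i σ + (k * σ ^ θ) ^ p * T k σ)
    (hT : ∀ k, Tendsto (T k) (𝓝[>] 0) (𝓝 β))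
    (hlim : ∀ k : ℕ, Tendsto (fun σ => φ k σ / σ ^ E) (𝓝[>] 0) (𝓝 (J.eval (k : ℝ)))) :
    p * θ ≤ E := by
  have hpw : ∀ σ : ℝ, 0 < σ → ∀ k : ℕ, (σ ^ θ) ^ k = σ ^ ((k : ℝ) * θ) := fun σ hσ k => by
    rw [mul_comm, rpow_mul hσ.le, rpow_natCast]
  set c : ℕ → ℝ → ℝ := fun i σ => b i σ * σ ^ ((i : ℝ) * θ) with hc
  have hsum : ∀ k : ℕ, ∀ᶠ σ in 𝓝[>] (0 : ℝ), ∑ j ∈ Finset.range p, c j σ * (k : ℝ) ^ j =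
      φ k σ - (k : ℝ) ^ p * T k σ * σ ^ (p * θ) := by
    intro k
    filter_upwards [hφ k, self_mem_nhdsWithin] with σ h1 hσ
    rw [h1, mul_pow, hpw σ hσ, eq_sub_iff_add_eq]
    congr 1
    · refine sum_congr rfl fun j _ => ?_
      rw [mul_pow, hpw σ hσ, hc]
      ring
    · ring
  by_contra hcon
  push Not at hcon
  -- the terms of degree `p` are negligible, so the limit has degree less than `p`
  have h1 : ∀ k : ℕ, Tendsto (fun σ => ∑ j ∈ Finset.range p, c j σ / σ ^ E * (k : ℝ) ^ j)
      (𝓝[>] 0) (𝓝 (J.eval (k : ℝ))) := by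
    intro k
    have h2 := (hlim k).sub (((hT k).const_mul ((k : ℝ) ^ p)).mul
      (tendsto_rpow_nhds_zero (sub_pos.2 hcon)))
    rw [mul_zero, sub_zero] at h2
    refine h2.congr' ?_
    filter_upwards [hsum k, self_mem_nhdsWithin] with σ h3 (hσ' : (0 : ℝ) < σ)
    have h4 : ∑ j ∈ Finset.range p, c j σ / σ ^ E * (k : ℝ) ^ j =
        (∑ j ∈ Finset.range p, c j σ * (k : ℝ) ^ j) / σ ^ E := by
      rw [Finset.sum_div]
      exact sum_congr rfl fun j _ => by ring
    rw [h4, h3, rpow_sub hσ']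
    ring
  obtain ⟨M, hM⟩ := exists_coeff_eq_sum_values (𝕜 := ℝ) p
  have h2 : ∀ i < p, Tendsto (fun σ => c i σ / σ ^ E) (𝓝[>] 0)
      (𝓝 (∑ k ∈ Finset.range p, M i k * J.eval (k : ℝ))) := by
    intro i hi
    refine (tendsto_finsetSum (Finset.range p) fun k _ => (h1 k).const_mul (M i k)).congr
      fun σ => ?_
    exact (hM (fun j => c j σ / σ ^ E) i hi).symm
  set q : ℕ → ℝ := fun i => ∑ k ∈ Finset.range p, M i k * J.eval (k : ℝ)
  have h3 : ∀ k : ℕ, (edgePoly (p - 1) q).eval (k : ℝ) = J.eval (k : ℝ) := by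
    intro k
    refine tendsto_nhds_unique ?_ (h1 k)
    have : (edgePoly (p - 1) q).eval (k : ℝ) = ∑ j ∈ Finset.range p, q j * (k : ℝ) ^ j := by
      obtain ⟨p', rfl⟩ : ∃ p', p = p' + 1 := ⟨p - 1, by omega⟩
      rw [eval_edgePoly, Nat.add_sub_cancel, sum_range_succ]
      simp only [mul_comm]
    rw [this]
    exact tendsto_finsetSum _ fun j hj => (h2 j (Finset.mem_range.1 hj)).mul_const _
  have h4 : edgePoly (p - 1) q = J := by
    refine Polynomial.eq_of_infinite_eval_eq _ _ (Infinite.mono (s := range fun k : ℕ => (k : ℝ))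
      ?_ (infinite_range_of_injective Nat.cast_injective))
    rintro _ ⟨k, rfl⟩
    exact h3 k
  have h5 := natDegree_edgePoly_le (p - 1) q
  rw [h4, hJ] at h5
  omega

/-- An arc in the centre of an edge form has at least the height of the edge. -/
theorem EdgeForm.heightGE {ε : ℝ} (H : EdgeForm f ε D A C p Λ g θ) (hp : 0 < p) (hε : γ.ε = ε)
    (hv : Tendsto (chartCoord D A Λ γ) (𝓝[>] 0) (𝓝 0))
    (hO : chartCoord D A Λ γ =O[𝓝[>] 0] fun σ => σ ^ θ) : HeightGE f γ ((A + θ) / D) := by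
  intro h' h0 hlt hst
  have hD : (0 : ℝ) < D := mod_cast H.D_pos
  have hp' : (0 : ℝ) < p := mod_cast hp
  have hθ := H.pos
  rw [lt_div_iff₀ hD] at hlt
  set θ' : ℝ := max (h' * D - A) (θ / 2)
  have h1 : θ' < θ := max_lt (by linarith) (by linarith)
  have h2 : 0 < θ' := lt_of_lt_of_le (by linarith) (le_max_right _ _)
  have h3 : h' ≤ (A + θ') / D := by
    rw [le_div_iff₀ hD]
    linarith [le_max_left (h' * D - A) (θ / 2)]
  have h4 := hst.mono h3 ((A + θ) / D) (by gcongr) ((C + p * θ) / D)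
    ((H.relBound_iff hε hv hθ le_rfl hO _).2 (by rw [mul_div_cancel₀ _ hD.ne']))
  rw [H.relBound_iff hε hv h2 h1.le (hO.trans (isBigO_rpow_rpow h1.le)),
    mul_div_cancel₀ _ hD.ne'] at h4
  nlinarith

end EdgePoly

/-! ### Charts of the deformation -/

section Chart

/-- The arc lies in the half plane of the chart and its coordinate tends to `0`. -/
def InChart (s : ℤˣ) (D A : ℕ) (Λ : ℝ → ℝ) (γ : RArc) : Prop :=
  γ.sgn = s ∧ Tendsto (chartCoord D A Λ γ) (𝓝[>] 0) (𝓝 0)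

/-- A chart `x = Λ (σ, t) + v * σ ^ A`, `|y| = σ ^ D` of the deformation `F`, in which `F` becomes
`σ ^ C * G (v, (σ, t))` with `G` of order `p` in `v` at the origin and without term of degree
`p - 1`. The `R i (0, (σ, t))` are the Taylor coefficients of `G` with respect to `v`. By `track`,
deformations of constant height of the arcs of the chart stay close to it. -/
structure Chart (F : ℝ × ℝ × ℝ → ℝ) (s : ℤˣ) (D A C p : ℕ) (Λ : ℝ × ℝ → ℝ) (G : ℝ × (ℝ × ℝ) → ℝ)
    (R : ℕ → ℝ × (ℝ × ℝ) → ℝ) : Prop where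
  D_pos : 0 < D
  p_pos : 0 < p
  analytic : AnalyticAt ℝ Λ 0
  taylor : IsTaylorSeq G (0 : ℝ × ℝ) R
  eq : ∀ᶠ z in 𝓝 ((0 : ℝ), (0 : ℝ × ℝ)),
    F (Λ z.2 + z.1 * z.2.1 ^ A, ((s : ℤ) : ℝ) * z.2.1 ^ D, z.2.2) = z.2.1 ^ C * G z
  low : ∀ i < p, R i (0, 0) = 0
  top : R p (0, 0) ≠ 0
  norm : ∀ᶠ x in 𝓝 (0 : ℝ × ℝ), R (p - 1) (0, x) = 0
  bound : ∀ᶠ t in 𝓝 (0 : ℝ), (∀ i < p, R i (0, (0, t)) = 0) →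
    (Λ ⟨·, t⟩) =O[𝓝[>] 0] fun σ : ℝ => σ ^ (D : ℝ)
  ord : ∀ i < p, (fun σ => R i (0, (σ, 0))) =O[𝓝[>] 0]
    fun σ : ℝ => σ ^ ((((p - i) * (D - A) : ℕ)) : ℝ)
  track : ∀ δ > 0, ∀ Γ, IsContFamily δ Γ → InChart s D A (Λ ⟨·, 0⟩) (Γ 0) →
    (∃ H : ℝ≥0∞, ENNReal.ofReal ((A : ℝ) / D) < H ∧
      ∀ t ∈ Ioo (-δ) δ, H ≤ fHeight (slice F t) (Γ t)) →
    ∃ ω : ℝ → ℝ, Tendsto ω (𝓝 0) (𝓝 0) ∧ ∀ᶠ t in 𝓝 (0 : ℝ),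
      Tendsto (chartCoord D A (Λ ⟨·, t⟩) (Γ t)) (𝓝[>] 0) (𝓝 (ω t))

theorem eventually_nhds_point {P : ℝ × (ℝ × ℝ) → Prop} (h : ∀ᶠ z in 𝓝 ((0 : ℝ), (0 : ℝ × ℝ)), P z) :
    ∀ᶠ q in 𝓝 (0 : ℝ × ℝ), ∀ᶠ z in 𝓝 (q.1, ((0 : ℝ), q.2)), P z := by
  have h2 := eventually_eventually_nhds.2 h
  have : Tendsto (fun q : ℝ × ℝ => (q.1, ((0 : ℝ), q.2))) (𝓝 0) (𝓝 ((0 : ℝ), (0 : ℝ × ℝ))) := by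
    have : Continuous (fun q : ℝ × ℝ => (q.1, ((0 : ℝ), q.2))) := by fun_prop
    exact this.tendsto _
  exact this.eventually h2

theorem tendsto_slice_point (q : ℝ × ℝ) :
    Tendsto (fun z : ℝ × ℝ => (z.1, (z.2, q.2))) (𝓝 q.1 ×ˢ 𝓝[>] 0) (𝓝 (q.1, ((0 : ℝ), q.2))) := by
  refine tendsto_fst.prodMk_nhds ((tendsto_snd.of_within).prodMk_nhds tendsto_const_nhds)

theorem tendsto_zero_prodMk {ω : ℝ → ℝ} (hω : Tendsto ω (𝓝 0) (𝓝 0)) :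
    Tendsto (fun t : ℝ => (ω t, t)) (𝓝 0) (𝓝 (0 : ℝ × ℝ)) :=
  hω.prodMk_nhds tendsto_id

/-- A property of the germ at the origin holds along curves through points near the origin of the
exceptional line. -/
theorem eventually_nhds_right {P : ℝ × (ℝ × ℝ) → Prop} (h : ∀ᶠ z in 𝓝 ((0 : ℝ), (0 : ℝ × ℝ)), P z) :
    ∀ᶠ q in 𝓝 (0 : ℝ × ℝ), ∀ᶠ z in 𝓝 q.1 ×ˢ 𝓝[>] (0 : ℝ), P (z.1, (z.2, q.2)) := by
  filter_upwards [eventually_nhds_point h] with q hq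
  exact (tendsto_slice_point q).eventually hq

theorem eventually_zero_prodMk {P : ℝ × ℝ → Prop} (h : ∀ᶠ q in 𝓝 (0 : ℝ × ℝ), P q) :
    ∀ᶠ t in 𝓝 (0 : ℝ), P (0, t) :=
  (tendsto_zero_prodMk (ω := fun _ => 0) tendsto_const_nhds).eventually h

variable {F : ℝ × ℝ × ℝ → ℝ} {s : ℤˣ} {D A C p : ℕ} {Λ : ℝ × ℝ → ℝ} {G : ℝ × (ℝ × ℝ) → ℝ}
  {R : ℕ → ℝ × (ℝ × ℝ) → ℝ}

namespace Chart

theorem eventually_analyticAt (H : Chart F s D A C p Λ G R) :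
    ∀ᶠ t in 𝓝 (0 : ℝ), AnalyticAt ℝ Λ (0, t) :=
  eventually_zero_prodMk H.analytic.eventually_analyticAt

theorem eventually_eq (H : Chart F s D A C p Λ G R) : ∀ᶠ q in 𝓝 (0 : ℝ × ℝ),
    ∀ᶠ z in 𝓝 q.1 ×ˢ 𝓝[>] (0 : ℝ), slice F q.2 (Λ (z.2, q.2) + z.1 * z.2 ^ A,
      ((s : ℤ) : ℝ) * z.2 ^ D) = z.2 ^ C * G (z.1, (z.2, q.2)) :=
  eventually_nhds_right H.eq

theorem eventually_expand (H : Chart F s D A C p Λ G R) : ∀ᶠ t in 𝓝 (0 : ℝ),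
    ∀ᶠ z in 𝓝 (0 : ℝ) ×ˢ 𝓝[>] (0 : ℝ), G (z.1, (z.2, t)) =
      ∑ i ∈ Finset.range p, z.1 ^ i * R i (0, (z.2, t)) + z.1 ^ p * R p (z.1, (z.2, t)) :=
  eventually_zero_prodMk (eventually_nhds_right (H.taylor.expand p))

theorem eventually_tendsto_of_analyticAt {Q : ℝ × (ℝ × ℝ) → ℝ}
    (hQ : AnalyticAt ℝ Q ((0 : ℝ), (0 : ℝ × ℝ))) : ∀ᶠ q in 𝓝 (0 : ℝ × ℝ),
      Tendsto (fun z : ℝ × ℝ => Q (z.1, (z.2, q.2))) (𝓝 q.1 ×ˢ 𝓝[>] 0) (𝓝 (Q (q.1, (0, q.2)))) := by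
  filter_upwards [eventually_nhds_point hQ.eventually_analyticAt] with q hq
  exact hq.self_of_nhds.continuousAt.tendsto.comp (tendsto_slice_point q)

theorem eventually_ne_of_analyticAt {Q : ℝ × (ℝ × ℝ) → ℝ}
    (hQ : AnalyticAt ℝ Q ((0 : ℝ), (0 : ℝ × ℝ))) (h0 : Q (0, 0) ≠ 0) :
    ∀ᶠ q in 𝓝 (0 : ℝ × ℝ), Q (q.1, (0, q.2)) ≠ 0 :=
  (eventually_nhds_point (hQ.continuousAt.eventually_ne h0)).mono fun _ h => h.self_of_nhds

/-- The edge form of a slice, from bounds of the Taylor coefficients. -/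
theorem edgeForm (H : Chart F s D A C p Λ G R) : ∀ᶠ t in 𝓝 (0 : ℝ), ∀ θ > 0,
    (∀ i < p, (fun σ => R i (0, (σ, t))) =O[𝓝[>] 0] fun σ => σ ^ (((p - i : ℕ) : ℝ) * θ)) →
    EdgeForm (slice F t) ((s : ℤ) : ℝ) D A C p (Λ ⟨·, t⟩) (fun z => G (z.1, (z.2, t))) θ := by
  filter_upwards [eventually_zero_prodMk H.eventually_eq, H.eventually_expand,
    eventually_zero_prodMk (eventually_tendsto_of_analyticAt (H.taylor.analyticAt p)),
    eventually_zero_prodMk (eventually_ne_of_analyticAt (H.taylor.analyticAt p) H.top)]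
    with t h1 h2 h3 h4 θ hθ ha
  exact EdgeForm.of_expand H.D_pos hθ h1 (a := fun i σ => R i (0, (σ, t)))
    (S := fun z => R p (z.1, (z.2, t))) h2 ha h3 h4

/-- An arc whose coordinate has a small nonzero limit has height at most `A / D`. -/
theorem coord_eq_zero (H : Chart F s D A C p Λ G R) : ∀ᶠ q in 𝓝 (0 : ℝ × ℝ),
    (∀ i < p, R i (0, (0, q.2)) = 0) → ∀ (γ : RArc) (h : ℝ), γ.sgn = s →
    Tendsto (chartCoord D A (fun σ => Λ (σ, q.2)) γ) (𝓝[>] 0) (𝓝 q.1) → (A : ℝ) / D < h →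
    HeightGE (slice F q.2) γ h → q.1 = 0 := by
  have hG : AnalyticAt ℝ G ((0 : ℝ), (0 : ℝ × ℝ)) := H.taylor.zero ▸ H.taylor.analyticAt 0
  filter_upwards [H.eventually_eq, eventually_tendsto_of_analyticAt hG,
    eventually_nhds_point (H.taylor.expand p),
    eventually_ne_of_analyticAt (H.taylor.analyticAt p) H.top] with q h1 h2 h3 h4 h5 γ h hs hv hh hge
  by_contra hne
  have h6 := h3.self_of_nhds
  rw [sum_eq_zero fun i hi => by rw [h5 i (Finset.mem_range.1 hi), mul_zero], zero_add] at h6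
  refine not_heightGE_of_chart H.D_pos (ε := ((s : ℤ) : ℝ)) (by rw [RArc.ε, hs]) h1 hv h2 ?_ hh hge
  rw [h6]
  exact mul_ne_zero (pow_ne_zero _ hne) h4

theorem tendsto_moving {v : ℝ → ℝ} {ω t θ : ℝ} (hv : Tendsto v (𝓝[>] 0) (𝓝 ω)) (hθ : 0 < θ)
    (k : ℝ) : Tendsto (fun σ : ℝ => (k * σ ^ θ, (v σ, (σ, t)))) (𝓝[>] 0)
      (𝓝 ((0 : ℝ), (ω, ((0 : ℝ), t)))) := by
  have h1 : Tendsto (fun σ : ℝ => k * σ ^ θ) (𝓝[>] 0) (𝓝 (k * 0)) :=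
    (tendsto_rpow_nhds_zero hθ).const_mul k
  rw [mul_zero] at h1
  exact h1.prodMk_nhds (hv.prodMk_nhds ((tendsto_id.of_within).prodMk_nhds tendsto_const_nhds))

/-- If the germ has, on the horns of exponent `(A + θ) / D` around an arc near the chart, an initial
form of the full degree `p`, then the Taylor coefficients have the order prescribed by an edge of
weight `θ`. The missing term of degree `p - 1` forces the arc to the centre of the chart. -/
theorem coeff_isBigO_of_hasLim (H : Chart F s D A C p Λ G R) : ∀ᶠ q in 𝓝 (0 : ℝ × ℝ),
    RegularX (slice F q.2) → ∀ γ : RArc, γ.sgn = s →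
    Tendsto (chartCoord D A (fun σ => Λ (σ, q.2)) γ) (𝓝[>] 0) (𝓝 q.1) →
    ∀ θ > 0, ∀ (E : ℝ) (J : ℝ[X]), J.natDegree = p →
    HasLim (slice F q.2) γ ((A + θ) / D) E J →
    ∀ i < p, (fun σ => R i (0, (σ, q.2))) =O[𝓝[>] 0] fun σ => σ ^ (((p - i : ℕ) : ℝ) * θ) := by
  obtain ⟨B, hB, hB0, hBQ⟩ := H.taylor.exists_moving
  obtain ⟨Q, hQ, hQ0, hQB⟩ := hBQ (p - 1)
  have hp := H.p_pos
  have hQne : Q (0, 0) ≠ 0 := by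
    rw [hQ0, Nat.sub_add_cancel hp]
    exact mul_ne_zero (by positivity) H.top
  have hpt : Tendsto (fun q : ℝ × ℝ => ((0 : ℝ), (q.1, ((0 : ℝ), q.2)))) (𝓝 0)
      (𝓝 ((0 : ℝ), ((0 : ℝ), (0 : ℝ × ℝ)))) := by
    have : Continuous (fun q : ℝ × ℝ => ((0 : ℝ), (q.1, ((0 : ℝ), q.2)))) := by fun_prop
    exact this.tendsto _
  have hD : (0 : ℝ) < D := mod_cast H.D_pos
  have hnorm : ∀ᶠ z in 𝓝 ((0 : ℝ), (0 : ℝ × ℝ)), R (p - 1) (0, z.2) = 0 :=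
    (continuous_snd.tendsto ((0 : ℝ), (0 : ℝ × ℝ))).eventually H.norm
  have hB0' : ∀ᶠ z in 𝓝 ((0 : ℝ), (0 : ℝ × ℝ)), B (p - 1) (0, (0, z.2)) = R (p - 1) (0, z.2) :=
    (continuous_snd.tendsto ((0 : ℝ), (0 : ℝ × ℝ))).eventually (hB0 (p - 1))
  have hRp := eventually_zero_prodMk (eventually_tendsto_of_analyticAt (H.taylor.analyticAt p))
  have hsnd : Tendsto (fun q : ℝ × ℝ => q.2) (𝓝 0) (𝓝 0) := continuous_snd.tendsto _
  filter_upwards [H.eventually_eq, hpt.eventually (eventually_eventually_nhds.2 (hB.expand p)),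
    hpt.eventually (hB.analyticAt p).eventually_analyticAt,
    eventually_nhds_right hQB, eventually_nhds_right hnorm, eventually_nhds_right hB0',
    eventually_tendsto_of_analyticAt hQ, eventually_ne_of_analyticAt hQ hQne,
    hsnd.eventually H.eventually_expand, hsnd.eventually hRp] with
    q h1 h2 h3 h5 h6 h7 h8 h9 h10 h11 hreg γ hs hv θ hθ E J hJ hlim
  set v := chartCoord D A (fun σ => Λ (σ, q.2)) γ with hvdef
  have hε : γ.ε = ((s : ℤ) : ℝ) := by rw [RArc.ε, hs]
  have hJ0 : J ≠ 0 := by rintro rfl; simp at hJ; omega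
  have hh : 0 < (A + θ) / D := by positivity
  set b : ℕ → ℝ → ℝ := fun i σ => B i (0, (v σ, (σ, q.2))) with hb
  have hexp : ∀ k : ℕ, ∀ᶠ σ in 𝓝[>] (0 : ℝ), G (v σ + k * σ ^ θ, (σ, q.2)) =
      ∑ i ∈ Finset.range p, (k * σ ^ θ) ^ i * b i σ +
        (k * σ ^ θ) ^ p * B p (k * σ ^ θ, (v σ, (σ, q.2))) := fun k =>
    (tendsto_moving hv hθ k).eventually h2
  have hT : ∀ k : ℕ, Tendsto (fun σ => B p (k * σ ^ θ, (v σ, (σ, q.2)))) (𝓝[>] 0)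
      (𝓝 (B p (0, (q.1, (0, q.2))))) := fun k =>
    h3.continuousAt.tendsto.comp (tendsto_moving hv hθ k)
  have hval : ∀ k : ℕ, Tendsto (fun σ => G (v σ + k * σ ^ θ, (σ, q.2)) / σ ^ (D * E - C)) (𝓝[>] 0)
      (𝓝 (J.eval (k : ℝ))) := by
    intro k
    refine ((hlim.tendsto k).comp (tendsto_pow_zero_right H.D_pos)).congr' ?_
    filter_upwards [eventually_near_coord h1 hv hθ k, self_mem_nhdsWithin]
      with σ e1 (hσ' : (0 : ℝ) < σ)
    have e2 := e1 (k * σ ^ θ) (by rw [abs_of_nonneg (by positivity)])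
    rw [hvdef, chartCoord_mul (Λ := fun σ => Λ (σ, q.2)) hσ', ← hvdef] at e2
    simp only [Function.comp]
    rw [pow_rpow_div H.D_pos hσ', rpow_natCast_add hσ',
      show (k : ℝ) * (σ ^ A * σ ^ θ) = k * σ ^ θ * σ ^ A by ring, hε, e2,
      rpow_sub hσ', ← rpow_natCast σ D, ← rpow_mul hσ'.le, rpow_natCast]
    have := (pow_pos hσ' C).ne'
    have := (rpow_pos_of_pos hσ' (D * E)).ne'
    field_simp
  have hE := le_of_tendsto_polynomial hp hJ hexp hT hval
  have hbO := isBigO_coeff_of_values hexp (fun k => (hT k).isBigO_one ℝ)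
    (fun k => (isBigO_rpow_of_tendsto_div (hval k)).trans (isBigO_rpow_rpow hE)) (p - 1) (by omega)
  -- the coefficient of degree `p - 1` is the coordinate times a unit
  have hvO : v =O[𝓝[>] 0] fun σ => σ ^ θ := by
    have e0 : Tendsto (fun σ : ℝ => (v σ, σ)) (𝓝[>] 0) (𝓝 q.1 ×ˢ 𝓝[>] 0) := hv.prodMk tendsto_id
    have e1 : ∀ᶠ σ in 𝓝[>] (0 : ℝ), b (p - 1) σ = v σ * Q (v σ, (σ, q.2)) := by
      filter_upwards [e0.eventually h5, e0.eventually h6, e0.eventually h7] with σ a1 a2 a3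
      rw [hb]
      simp only
      rw [a1, a3, a2, zero_add]
    have e2 : Tendsto (fun σ => Q (v σ, (σ, q.2))) (𝓝[>] 0) (𝓝 (Q (q.1, (0, q.2)))) := h8.comp e0
    have e3 : (fun σ => (Q (v σ, (σ, q.2)))⁻¹) =O[𝓝[>] 0] fun _ => (1 : ℝ) :=
      (e2.inv₀ h9).isBigO_one ℝ
    have e4 := hbO.mul e3
    simp only [mul_one] at e4
    have e5 : ((p - (p - 1) : ℕ) : ℝ) * θ = θ := by rw [show p - (p - 1) = 1 by omega]; simp
    rw [e5] at e4
    refine e4.congr' ?_ EventuallyEq.rfl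
    filter_upwards [e1, e2.eventually_ne h9] with σ a1 a2
    rw [a1, mul_assoc, mul_inv_cancel₀ a2, mul_one]
  have hrel : RelBound (slice F q.2) γ ((A + θ) / D) ((C + p * θ) / D) :=
    (hlim.relBound_iff hJ0 hreg hh).2 (by rw [div_le_iff₀ hD]; linarith)
  rw [relBound_iff_chart H.D_pos] at hrel
  obtain ⟨c, hc⟩ := hvO.bound
  have hline : ∀ k : ℕ, Tendsto (fun σ : ℝ => ((k : ℝ) * σ ^ θ, σ)) (𝓝[>] 0)
      (𝓝 0 ×ˢ 𝓝[>] 0) := fun k => by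
    refine Tendsto.prodMk ?_ tendsto_id
    simpa using (tendsto_rpow_nhds_zero hθ).const_mul (k : ℝ)
  refine isBigO_coeff_of_values (b := fun i σ => R i (0, (σ, q.2)))
    (T := fun k σ => R p (k * σ ^ θ, (σ, q.2))) (φ := fun k σ => G (k * σ ^ θ, (σ, q.2)))
    (fun k => ?_) (fun k => ?_) (fun k => ?_)
  · exact (hline k).eventually h10
  · exact (h11.comp (hline k)).isBigO_one ℝ
  · obtain ⟨C₁, hC⟩ := hrel (k + c)
    refine IsBigO.of_bound C₁ ?_
    filter_upwards [hC, hc, eventually_near_coord h1 hv hθ (k + c), self_mem_nhdsWithin] with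
      σ e1 e2 e3 hσ
    have hσ' : (0 : ℝ) < σ := hσ
    have hr : ∀ s : ℝ, 0 < σ ^ s := fun s => rpow_pos_of_pos hσ' _
    rw [norm_of_nonneg (hr θ).le, norm_eq_abs] at e2
    have e4 : |k * σ ^ θ - v σ| ≤ (k + c) * σ ^ θ := by
      refine (abs_sub _ _).trans ?_
      rw [abs_of_nonneg (by positivity), add_mul]
      linarith
    have e5 := e1 _ e4
    have e6 := e3 _ e4
    rw [hvdef, chartCoord_mul (Λ := fun σ => Λ (σ, q.2)) hσ', ← hvdef, add_sub_cancel] at e6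
    rw [hε, e6, abs_mul, abs_of_pos (pow_pos hσ' C), mul_div_cancel₀ _ hD.ne',
      rpow_natCast_add hσ'] at e5
    rw [norm_of_nonneg (hr _).le, norm_eq_abs]
    have := pow_pos hσ' C
    refine le_of_mul_le_mul_left ?_ this
    linarith

end Chart

end Chart

/-! ### The first Newton edge in a chart -/

section FirstEdge

/-- The initial form of `f` around an arc of the edge. -/
theorem EdgeForm.hasLim {f : ℝ × ℝ → ℝ} {γ : RArc} {ε : ℝ} {D A C p : ℕ} {Λ : ℝ → ℝ}
    {g : ℝ × ℝ → ℝ} {θ u : ℝ} (H : EdgeForm f ε D A C p Λ g θ) {J : ℝ[X]}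
    (hlim : ∀ w, Tendsto (fun z : ℝ × ℝ => g (z.1 * z.2 ^ θ, z.2) / z.2 ^ (p * θ))
      (𝓝 w ×ˢ 𝓝[>] 0) (𝓝 (J.eval w))) (hε : γ.ε = ε)
    (hv : Tendsto (fun σ => chartCoord D A Λ γ σ / σ ^ θ) (𝓝[>] 0) (𝓝 u)) :
    HasLim f γ ((A + θ) / D) ((C + p * θ) / D) (Polynomial.taylor u J) := by
  intro w
  have hv0 : Tendsto (fun z : ℝ × ℝ => (chartCoord D A Λ γ z.2 / z.2 ^ θ + z.1) * z.2 ^ θ)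
      (𝓝 w ×ˢ 𝓝[>] 0) (𝓝 0) := by
    have := ((hv.comp tendsto_snd).add tendsto_fst).mul ((tendsto_rpow_nhds_zero H.pos).comp
        (tendsto_snd (f := 𝓝 w) (g := 𝓝[>] (0 : ℝ))))
    rwa [mul_zero] at this
  have h1 : ∀ᶠ z : ℝ × ℝ in 𝓝 w ×ˢ 𝓝[>] (0 : ℝ),
      f (Λ z.2 + (chartCoord D A Λ γ z.2 / z.2 ^ θ + z.1) * z.2 ^ θ * z.2 ^ A, ε * z.2 ^ D) =
        z.2 ^ C * g ((chartCoord D A Λ γ z.2 / z.2 ^ θ + z.1) * z.2 ^ θ, z.2) :=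
    (hv0.prodMk tendsto_snd).eventually H.eq
  have h2 : Tendsto (fun z : ℝ × ℝ => f (γ.X (z.2 ^ D) + z.1 * (z.2 ^ D) ^ ((A + θ) / D),
      γ.ε * z.2 ^ D) / (z.2 ^ D) ^ ((C + p * θ) / D)) (𝓝 w ×ˢ 𝓝[>] 0)
      (𝓝 ((Polynomial.taylor u J).eval w)) := by
    rw [taylor_eval, add_comm w u]
    have h3 := Tendsto.comp (g := fun z : ℝ × ℝ => g (z.1 * z.2 ^ θ, z.2) / z.2 ^ (p * θ))
      (f := fun z : ℝ × ℝ => (chartCoord D A Λ γ z.2 / z.2 ^ θ + z.1, z.2)) (hlim (u + w))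
      (((hv.comp tendsto_snd).add tendsto_fst).prodMk (tendsto_snd (f := 𝓝 w) (g := 𝓝[>] (0 : ℝ))))
    refine h3.congr' ?_
    have hpos : ∀ᶠ z : ℝ × ℝ in 𝓝 w ×ˢ 𝓝[>] (0 : ℝ), 0 < z.2 :=
      tendsto_snd.eventually self_mem_nhdsWithin
    filter_upwards [h1, hpos] with z h4 hz
    have h5 : (chartCoord D A Λ γ z.2 / z.2 ^ θ + z.1) * z.2 ^ θ =
        chartCoord D A Λ γ z.2 + z.1 * z.2 ^ θ := by field_simp
    simp only [Function.comp]
    rw [h5, chartCoord_mul hz] at h4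
    rw [pow_rpow_div H.D_pos hz, pow_rpow_div H.D_pos hz, rpow_natCast_add hz,
      show z.1 * (z.2 ^ A * z.2 ^ θ) = z.1 * z.2 ^ θ * z.2 ^ A by ring, hε, h4,
      rpow_natCast_add hz, h5]
    have := (pow_pos hz C).ne'
    field_simp
  refine (h2.comp (tendsto_fst.prodMk ((tendsto_root_zero_right H.D_pos).comp
    tendsto_snd))).congr' ?_
  have hpos : ∀ᶠ z : ℝ × ℝ in 𝓝 w ×ˢ 𝓝[>] (0 : ℝ), 0 < z.2 :=
    tendsto_snd.eventually self_mem_nhdsWithin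
  filter_upwards [hpos] with z hz
  simp only [Function.comp]
  rw [root_pow H.D_pos hz.le]

/-- The limit of a coefficient for the weight `a / b` of a line through `(p, 0)`: it is nonzero only
if the dot of the coefficient is on the line. -/
theorem tendsto_div_rpow_edge {r β : ℝ → ℝ} {p a b k i : ℕ} (hb : 0 < b) (hi : i ≤ p)
    (hβ : ContinuousAt β 0) (hr : ∀ᶠ σ in 𝓝 (0 : ℝ), r σ = σ ^ k * β σ)
    (h : a * p ≤ b * k + a * i) :
    Tendsto (fun σ => r σ / σ ^ (((p - i : ℕ) : ℝ) * ((a : ℝ) / b))) (𝓝[>] 0)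
      (𝓝 (if b * k + a * i = a * p then β 0 else 0)) := by
  have hb' : (0 : ℝ) < b := mod_cast hb
  have hκ : (k : ℝ) - ((p - i : ℕ) : ℝ) * ((a : ℝ) / b) =
      (((b * k + a * i : ℕ) : ℝ) - ((a * p : ℕ) : ℝ)) / b := by
    rw [Nat.cast_sub hi]
    push_cast
    field_simp
    ring
  have h4 : Tendsto (fun σ : ℝ => σ ^ ((k : ℝ) - ((p - i : ℕ) : ℝ) * ((a : ℝ) / b)) * β σ)
      (𝓝[>] 0) (𝓝 (if b * k + a * i = a * p then β 0 else 0)) := by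
    rw [hκ]
    split_ifs with h6
    · simpa [h6] using hβ.tendsto.within (s := Ioi 0)
    · have h7 : ((a * p : ℕ) : ℝ) < ((b * k + a * i : ℕ) : ℝ) := mod_cast h.lt_of_ne' h6
      simpa using (tendsto_rpow_nhds_zero (div_pos (sub_pos.2 h7) hb')).mul hβ.tendsto.within
  refine h4.congr' ?_
  filter_upwards [hr.within, self_mem_nhdsWithin] with σ h5 (hσ' : (0 : ℝ) < σ)
  rw [h5, rpow_sub hσ', rpow_natCast]
  ring

/-- The Newton edge of weight `a / b` of the Taylor coefficients `R i (0, (σ, t))`, `i < p`: they are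
`σ ^ k i * β i (σ, t)`, and the dots `(i, k i)` lie on or above the line through `(p, 0)` of that
weight, one with `β i 0 ≠ 0` being on the line. -/
structure IsEdge (R : ℕ → ℝ × (ℝ × ℝ) → ℝ) (p a b : ℕ) (k : ℕ → ℕ) (β : ℕ → ℝ × ℝ → ℝ) : Prop where
  a_pos : 0 < a
  b_pos : 0 < b
  analytic : ∀ i < p, AnalyticAt ℝ (β i) 0
  eq : ∀ i < p, ∀ᶠ x in 𝓝 (0 : ℝ × ℝ), R i (0, x) = x.1 ^ k i * β i x
  le : ∀ i < p, a * p ≤ b * k i + a * i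
  exists_ne : ∃ i < p, b * k i + a * i = a * p ∧ β i 0 ≠ 0

variable {F : ℝ × ℝ × ℝ → ℝ} {s : ℤˣ} {D A C p : ℕ} {Λ : ℝ × ℝ → ℝ} {G : ℝ × (ℝ × ℝ) → ℝ}
  {R : ℕ → ℝ × (ℝ × ℝ) → ℝ}

namespace Chart

theorem eventually_bound (H : Chart F s D A C p Λ G R)
    (hz : ∀ᶠ t in 𝓝 (0 : ℝ), ∀ i < p, R i (0, (0, t)) = 0) :
    ∀ᶠ t in 𝓝 (0 : ℝ), AnalyticAt ℝ Λ (0, t) ∧ (Λ ⟨·, t⟩) =O[𝓝[>] 0] fun σ : ℝ => σ ^ (D : ℝ) := by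
  filter_upwards [H.eventually_analyticAt, H.bound, hz] with t h1 h2 h3 using ⟨h1, h2 h3⟩

/-- The centre of a chart as a family of arcs. -/
theorem exists_center (H : Chart F s D A C p Λ G R)
    (hz : ∀ᶠ t in 𝓝 (0 : ℝ), ∀ i < p, R i (0, (0, t)) = 0) :
    ∃ δ₀ > 0, ∀ δ ≤ δ₀, ∃ L : ℝ → RArc, IsAnalyticFamily δ L ∧ ∀ t ∈ Ioo (-δ) δ, (L t).sgn = s ∧
      ∀ᶠ σ in 𝓝[>] (0 : ℝ), (L t).X (σ ^ D) = Λ (σ, t) := by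
  obtain ⟨r, hr, h⟩ := Metric.eventually_nhds_iff.1 (H.eventually_bound hz)
  have h' : ∀ δ ≤ r, ∀ t ∈ Ioo (-δ) δ, _ := fun δ hδ t ht =>
    h (y := t) (by rw [Real.dist_eq, sub_zero]; exact (abs_lt.2 ht).trans_le hδ)
  exact ⟨r, hr, fun δ hδ => exists_isAnalyticFamily_X_eq s H.D_pos (fun t ht => (h' δ hδ t ht).1)
    fun t ht => (h' δ hδ t ht).2⟩

theorem exists_center_zero (H : Chart F s D A C p Λ G R) : ∃ L : RArc, L.sgn = s ∧
    ∀ᶠ σ in 𝓝[>] (0 : ℝ), L.X (σ ^ D) = Λ (σ, 0) := by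
  obtain ⟨L, -, hL⟩ := exists_isAnalyticFamily_X_eq s H.D_pos (δ := 1)
    (Λ := fun x => Λ (x.1, 0)) (fun t _ => AnalyticAt.fun_comp (g := Λ)
      (f := fun x : ℝ × ℝ => (x.1, (0 : ℝ))) H.analytic (by fun_prop))
    fun t _ => H.bound.self_of_nhds H.low
  exact ⟨L 0, hL 0 (by simp)⟩

theorem analyticAt_coeff_zero (H : Chart F s D A C p Λ G R) (i : ℕ) :
    AnalyticAt ℝ (fun σ : ℝ => R i (0, (σ, 0))) 0 :=
  AnalyticAt.fun_comp (g := R i) (f := fun σ : ℝ => ((0 : ℝ), (σ, (0 : ℝ))))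
    (H.taylor.analyticAt i) (by fun_prop)

/-- The coordinates of two arcs in a chart differ by the difference of the arcs. -/
theorem _root_.chartCoord_sub (D A : ℕ) (Λ : ℝ → ℝ) (γ μ : RArc) (σ : ℝ) :
    chartCoord D A Λ γ σ - chartCoord D A Λ μ σ = (γ.X (σ ^ D) - μ.X (σ ^ D)) / σ ^ A := by
  rw [chartCoord, chartCoord, ← sub_div]
  congr 1
  ring

theorem _root_.isBigO_chartCoord_sub {D : ℕ} (hD : 0 < D) (A : ℕ) (Λ : ℝ → ℝ) {γ μ : RArc} {θ : ℝ} :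
    (fun y => γ.X y - μ.X y) =O[𝓝[>] 0] (fun y => y ^ ((A + θ) / D)) ↔
    (fun σ => chartCoord D A Λ γ σ - chartCoord D A Λ μ σ) =O[𝓝[>] 0] fun σ => σ ^ θ := by
  simp only [chartCoord_sub]
  constructor
  · intro hO
    obtain ⟨c, hc⟩ := (hO.comp_tendsto (tendsto_pow_zero_right hD)).bound
    refine IsBigO.of_bound c ?_
    filter_upwards [hc, self_mem_nhdsWithin] with σ h1 (hσ' : (0 : ℝ) < σ)
    simp only [Function.comp] at h1
    rw [pow_rpow_div hD hσ', rpow_natCast_add hσ', norm_mul,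
      norm_of_nonneg (pow_pos hσ' A).le] at h1
    rw [norm_div, norm_of_nonneg (pow_pos hσ' A).le, div_le_iff₀ (pow_pos hσ' A)]
    linarith
  · intro hO
    obtain ⟨c, hc⟩ := (hO.comp_tendsto (tendsto_root_zero_right hD)).bound
    refine IsBigO.of_bound c ?_
    filter_upwards [hc, self_mem_nhdsWithin] with y h1 (hy' : (0 : ℝ) < y)
    have hσ' : 0 < y ^ (1 / (D : ℝ)) := rpow_pos_of_pos hy' _
    simp only [Function.comp] at h1
    rw [root_pow hD hy'.le, norm_div, norm_of_nonneg (pow_pos hσ' A).le,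
      div_le_iff₀ (pow_pos hσ' A)] at h1
    have h2 := pow_rpow_div hD hσ' (A + θ)
    rw [root_pow hD hy'.le, rpow_natCast_add hσ'] at h2
    rw [h2, norm_mul, norm_of_nonneg (pow_pos hσ' A).le]
    linarith

/-- An edge at `t = 0` with the exponents of the coefficients is an edge for small `t`, because an
arc of the edge that is not on a root of the edge polynomial is polar. -/
theorem isBigO_of_edge (H : Chart F s D A C p Λ G R)
    (hreg : ∀ᶠ t in 𝓝 (0 : ℝ), RegularX (slice F t))
    (hpolar : ∀ γ : RArc, IsPolar (slice F 0) γ → HasStableBarDeformation F γ)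
    {a b : ℕ} {k : ℕ → ℕ} {β : ℕ → ℝ → ℝ} (ha : 0 < a) (hb : 0 < b)
    (hβ : ∀ i < p, AnalyticAt ℝ (β i) 0 ∧
      (∀ᶠ σ in 𝓝 (0 : ℝ), R i (0, (σ, 0)) = σ ^ k i * β i σ) ∧ a * p ≤ b * k i + a * i)
    {i₀ : ℕ} (hi₀ : i₀ < p) (hk₀ : b * k i₀ + a * i₀ = a * p) (hβ₀ : β i₀ 0 ≠ 0) :
    b * D ≤ b * A + a ∧ ∀ᶠ t in 𝓝 (0 : ℝ), ∀ i < p, (fun σ => R i (0, (σ, t))) =O[𝓝[>] 0]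
      fun σ => σ ^ (((p - i : ℕ) : ℝ) * ((a : ℝ) / b)) := by
  have hp := H.p_pos
  have hb' : (0 : ℝ) < b := mod_cast hb
  have ha' : (0 : ℝ) < a := mod_cast ha
  have hD' : (0 : ℝ) < D := mod_cast H.D_pos
  set θ : ℝ := (a : ℝ) / b with hθdef
  have hθ : 0 < θ := by positivity
  have hbθ : b * θ = a := by rw [hθdef]; field_simp
  -- the limits of the coefficients
  set c : ℕ → ℝ := fun i => if i < p then (if b * k i + a * i = a * p then β i 0 else 0) else
    R p (0, (0, 0)) with hc
  have hlimc : ∀ i < p, Tendsto (fun σ => R i (0, (σ, 0)) / σ ^ (((p - i : ℕ) : ℝ) * θ)) (𝓝[>] 0)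
      (𝓝 (c i)) := fun i hi => by
    obtain ⟨h1, h2, h3⟩ := hβ i hi
    simpa only [hc, if_pos hi] using tendsto_div_rpow_edge hb hi.le h1.continuousAt h2 h3
  have hcp : c p = R p (0, (0, 0)) := by simp [hc]
  have hcp0 : c p ≠ 0 := hcp ▸ H.top
  have hci₀ : c i₀ ≠ 0 := by simp [hc, hi₀, hk₀, hβ₀]
  have hc1 : c (p - 1) = 0 := by
    refine tendsto_nhds_unique (hlimc (p - 1) (by omega)) (tendsto_const_nhds.congr' ?_)
    have h1 : Tendsto (fun σ : ℝ => ((σ, (0 : ℝ)) : ℝ × ℝ)) (𝓝[>] 0) (𝓝 (0, 0)) :=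
      (tendsto_id.of_within).prodMk_nhds tendsto_const_nhds
    filter_upwards [h1.eventually H.norm] with σ h2
    rw [h2, zero_div]
  set J := edgePoly p c with hJdef
  have hJdeg : J.natDegree = p := natDegree_edgePoly hcp0
  have hJ0 : J ≠ 0 := by rintro h0; rw [h0] at hJdeg; simp at hJdeg; omega
  obtain ⟨u, hu⟩ := exists_eval_ne_zero hJ0
  -- the edge is steep enough
  have hDle : b * D ≤ b * A + a := by
    by_contra hcon
    push Not at hcon
    have h1 := (H.ord i₀ hi₀).trans (isBigO_rpow_rpow (κ' := (((p - i₀) * (D - A) : ℕ) : ℝ)) le_rfl)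
    refine hci₀ (tendsto_nhds_unique (hlimc i₀ hi₀) (tendsto_div_rpow_of_isBigO h1 ?_))
    push_cast
    have h2 : A ≤ D := by
      by_contra h; push Not at h
      have := Nat.mul_le_mul_left b h.le
      omega
    rw [Nat.cast_sub h2]
    have h3 : ((b * A + a : ℕ) : ℝ) < ((b * D : ℕ) : ℝ) := mod_cast hcon
    push_cast at h3
    have h4 : θ < (D : ℝ) - A := by rw [hθdef, div_lt_iff₀ hb']; linarith
    have h5 : (0 : ℝ) < ((p - i₀ : ℕ) : ℝ) := by
      have : 0 < p - i₀ := by omega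
      exact_mod_cast this
    exact mul_lt_mul_of_pos_left h4 h5
  refine ⟨hDle, ?_⟩
  have reg0 := hreg.self_of_nhds
  have hone := reg0.one_le_fHeight
  have hOα : ∀ i < p, (fun σ => R i (0, (σ, 0))) =O[𝓝[>] 0]
      fun σ => σ ^ (((p - i : ℕ) : ℝ) * θ) := fun i hi => isBigO_rpow_of_tendsto_div (hlimc i hi)
  have hedge := H.edgeForm.self_of_nhds θ hθ hOα
  have hlim := tendsto_edgePoly (c := c) hθ (a := fun i σ => R i (0, (σ, 0)))
    (S := fun z => R p (z.1, (z.2, 0))) H.eventually_expand.self_of_nhds hlimc (by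
      rw [hcp]
      exact (eventually_tendsto_of_analyticAt (H.taylor.analyticAt p)).self_of_nhds)
  obtain ⟨L, hLs, hLX⟩ := H.exists_center_zero
  have hbD : 0 < b * D := Nat.mul_pos hb H.D_pos
  obtain ⟨γ, hγs, hγX⟩ := L.exists_add_rpow hbD hDle u
  have hexpo : ((b * A + a : ℕ) : ℝ) / (b * D : ℕ) = (A + θ) / D := by
    push_cast
    rw [← hbθ]
    field_simp
  rw [hLs] at hγs
  have hγε : γ.ε = ((s : ℤ) : ℝ) := by rw [RArc.ε, hγs]
  have hvγ : ∀ᶠ σ in 𝓝[>] (0 : ℝ), chartCoord D A (Λ ⟨·, 0⟩) γ σ = u * σ ^ θ := by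
    filter_upwards [hLX, (tendsto_pow_zero_right H.D_pos).eventually hγX, self_mem_nhdsWithin] with
      σ h1 h2 hσ
    have hσ' : (0 : ℝ) < σ := hσ
    have := (pow_pos hσ' A).ne'
    rw [chartCoord, h2, h1, hexpo, pow_rpow_div H.D_pos hσ', rpow_natCast_add hσ']
    field_simp
    ring
  have hvγdiv : Tendsto (fun σ => chartCoord D A (Λ ⟨·, 0⟩) γ σ / σ ^ θ) (𝓝[>] 0) (𝓝 u) := by
    refine tendsto_const_nhds.congr' ?_
    filter_upwards [hvγ, self_mem_nhdsWithin] with σ h1 (hσ' : (0 : ℝ) < σ)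
    rw [h1, mul_div_cancel_right₀ _ (rpow_pos_of_pos hσ' _).ne']
  have hvγO := isBigO_rpow_of_tendsto_div hvγdiv
  have hvγ0 : Tendsto (chartCoord D A (Λ ⟨·, 0⟩) γ) (𝓝[>] 0) (𝓝 0) :=
    hvγO.trans_tendsto (tendsto_rpow_nhds_zero hθ)
  set h : ℝ := (A + θ) / D with hh
  have hh1 : 1 ≤ h := by
    rw [hh, le_div_iff₀ hD', one_mul]
    have : ((b * D : ℕ) : ℝ) ≤ ((b * A + a : ℕ) : ℝ) := mod_cast hDle
    push_cast at this
    refine le_of_mul_le_mul_left ?_ hb'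
    rw [mul_add, hbθ]
    exact this
  have hlimγ := hedge.hasLim hlim hγε hvγdiv
  have hgeγ := hedge.heightGE hp hγε hvγ0 hvγO
  have hval0 : (Polynomial.taylor u J).eval 0 ≠ 0 := by rwa [taylor_eval, zero_add]
  have htJ : Polynomial.taylor u J ≠ 0 := by rw [Ne, taylor_eq_zero]; exact hJ0
  have hheight := (hlimγ.hasInitialForm reg0 hh1 hval0 hgeγ).1
  have hpol : IsPolar (slice F 0) γ := by
    refine hlimγ.isPolar reg0 hh1 hval0 hgeγ ?_
    obtain ⟨z, w, hzw, hz, hw⟩ := exists_two_roots hJdeg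
      ((coeff_edgePoly c (by omega)).trans hc1) hi₀
      (by rw [hJdef, coeff_edgePoly c hi₀.le]; exact hci₀)
    have haev : ∀ z : ℂ, aeval (z - u) (Polynomial.taylor u J) = aeval z J := by
      intro z
      rw [Polynomial.taylor_apply, Polynomial.aeval_comp]
      simp
    exact ⟨z - u, w - u, fun heq => hzw (sub_left_injective heq), by rw [haev, hz],
      by rw [haev, hw]⟩
  obtain ⟨δ, hδ, μ, hμ, Γ, ⟨hΓ, hΓμ⟩, hΓh, n, hΓn⟩ := hpolar γ hpol
  have h0δ : (0 : ℝ) ∈ Ioo (-δ) δ := ⟨by linarith, hδ⟩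
  have hΓ0 : Γ 0 ∈ bar (slice F 0) γ := bar_trans hμ (mem_bar_of_mem_fArc hone hΓμ)
  obtain ⟨hs0, hh0, hcon⟩ := mem_bar_iff.1 hΓ0
  rw [hheight, RArc.contact_comm, RArc.le_contact_iff hs0.symm] at hcon
  have hv0O := (isBigO_chartCoord_sub H.D_pos A (Λ ⟨·, 0⟩)).1 hcon
  have hv0O' : chartCoord D A (Λ ⟨·, 0⟩) (Γ 0) =O[𝓝[>] 0] fun σ => σ ^ θ := by
    simpa using hv0O.add hvγO
  have hin : InChart s D A (Λ ⟨·, 0⟩) (Γ 0) := ⟨hs0.symm.trans hγs, hv0O'.trans_tendsto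
      (tendsto_rpow_nhds_zero hθ)⟩
  have hheights : ∀ t ∈ Ioo (-δ) δ, fHeight (slice F t) (Γ t) =
      ENNReal.ofReal (((b * A + a : ℕ) : ℝ) / (b * D : ℕ)) := fun t ht => by
    rw [hΓh t ht, hheight, hexpo]
  have hnp : n = p := by
    obtain ⟨e, J₁, h1, h2, h3⟩ := (hΓn 0 h0δ).exists_hasLim reg0 hbD hDle (hheights 0 h0δ)
    rw [hexpo] at h3
    have h4 := hlimγ.shift hs0 (RArc.tendsto_sub_div hcon)
    have h5 := h3.unique h1 h4 (by rw [Ne, taylor_eq_zero]; exact htJ)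
    rw [← h2, h5.2, natDegree_taylor, natDegree_taylor, hJdeg]
  obtain ⟨ω, hω, hωt⟩ := H.track δ hδ Γ hΓ hin ⟨ENNReal.ofReal h, by
    refine (ENNReal.ofReal_lt_ofReal_iff (by linarith)).2 ?_
    rw [hh]
    gcongr
    linarith, fun t ht => by rw [hheights t ht, hexpo]⟩
  filter_upwards [hωt, (tendsto_zero_prodMk hω).eventually H.coeff_isBigO_of_hasLim, hreg,
    Ioo_mem_nhds h0δ.1 h0δ.2] with t h1 h2 h3 ht
  obtain ⟨e, J₁, -, h5, h6⟩ := (hΓn t ht).exists_hasLim h3 hbD hDle (hheights t ht)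
  rw [hexpo] at h6
  exact h2 h3 (Γ t) ((hΓ.1 t ht).1.trans hin.1) h1 θ hθ e J₁ (h5.trans hnp) h6

end Chart

end FirstEdge

/-! ### Multiple roots -/

section Leaf

variable {F : ℝ × ℝ × ℝ → ℝ} {s : ℤˣ} {D A C p : ℕ} {Λ : ℝ × ℝ → ℝ} {G : ℝ × (ℝ × ℝ) → ℝ}
  {R : ℕ → ℝ × (ℝ × ℝ) → ℝ}

namespace Chart

/-- The derivatives with respect to `x` in the coordinates of a chart. -/
theorem eventually_iteratedDeriv (H : Chart F s D A C p Λ G R) {B : ℕ → ℝ × (ℝ × (ℝ × ℝ)) → ℝ}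
    (hB : IsTaylorSeq (fun z : ℝ × (ℝ × (ℝ × ℝ)) => G (z.2.1 + z.1, z.2.2))
      ((0 : ℝ), (0 : ℝ × ℝ)) B) (n : ℕ) :
    ∀ᶠ x in 𝓝 ((0 : ℝ), (0 : ℝ × ℝ)), 0 < x.2.1 →
      iteratedDeriv n (fun X => F (X, ((s : ℤ) : ℝ) * x.2.1 ^ D, x.2.2)) (Λ x.2 + x.1 * x.2.1 ^ A) =
        n.factorial * (x.2.1 ^ C * B n (0, x) / (x.2.1 ^ A) ^ n) := by
  have h1 := eventually_nhds_slice' (hB.expand (n + 1))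
  have h2 := (eventually_nhds_slice (hB.analyticAt (n + 1)).eventually_analyticAt).mono
    fun x hx => hx.self_of_nhds
  have h3 := eventually_eventually_nhds.2 H.eq
  filter_upwards [h1, h2, h3] with x e1 e2 e3 hσ
  set σ := x.2.1 with hσdef
  have hdiv : Tendsto (fun Y : ℝ => Y / σ ^ A) (𝓝 0) (𝓝 0) := by
    have : Continuous fun Y : ℝ => Y / σ ^ A := by fun_prop
    simpa using this.tendsto 0
  have hshift : Tendsto (fun Y : ℝ => (x.1 + Y / σ ^ A, x.2)) (𝓝 0) (𝓝 x) := by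
    have : Tendsto (fun Y : ℝ => (x.1 + Y / σ ^ A, x.2)) (𝓝 0) (𝓝 (x.1 + 0, x.2)) :=
      (hdiv.const_add x.1).prodMk_nhds tendsto_const_nhds
    rwa [add_zero] at this
  have hS : AnalyticAt ℝ (fun Y : ℝ => σ ^ C / (σ ^ A) ^ (n + 1) * B (n + 1) (Y / σ ^ A, x)) 0 := by
    refine AnalyticAt.fun_mul analyticAt_const (AnalyticAt.fun_comp (g := B (n + 1))
      (f := fun Y : ℝ => (Y / σ ^ A, x)) ?_ ?_)
    · simpa using e2
    · exact (analyticAt_id.div_const).prod analyticAt_const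
  have h4 := congrFun (iteratedDeriv_comp_const_add n
    (fun X => F (X, ((s : ℤ) : ℝ) * σ ^ D, x.2.2)) (Λ x.2 + x.1 * σ ^ A)) 0
  simp only [add_zero] at h4
  rw [← h4]
  refine iteratedDeriv_of_expand (b := fun i => σ ^ C * B i (0, x) / (σ ^ A) ^ i) hS ?_
    (Nat.lt_succ_self n)
  filter_upwards [hdiv.eventually e1, hshift.eventually e3] with Y e4 e5
  have e6 : Λ x.2 + (x.1 + Y / σ ^ A) * σ ^ A = Λ x.2 + x.1 * σ ^ A + Y := by
    field_simp
    ring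
  rw [e6] at e5
  rw [e5, e4, ← hσdef, mul_add, Finset.mul_sum]
  congr 1
  · refine sum_congr rfl fun i _ => ?_
    rw [div_pow]
    field_simp
  · rw [div_pow]
    field_simp

/-- The vanishing of the derivatives along an arc, in the coordinates of a chart. -/
theorem xDerivVanishes_iff (H : Chart F s D A C p Λ G R) {B : ℕ → ℝ × (ℝ × (ℝ × ℝ)) → ℝ}
    (hB : IsTaylorSeq (fun z : ℝ × (ℝ × (ℝ × ℝ)) => G (z.2.1 + z.1, z.2.2))
      ((0 : ℝ), (0 : ℝ × ℝ)) B) (n : ℕ) :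
    ∀ᶠ q in 𝓝 (0 : ℝ × ℝ), ∀ γ : RArc, γ.sgn = s →
      Tendsto (chartCoord D A (fun σ => Λ (σ, q.2)) γ) (𝓝[>] 0) (𝓝 q.1) →
      (XDerivVanishes (slice F q.2) γ n ↔ ∀ᶠ σ in 𝓝[>] (0 : ℝ),
        B n (0, (chartCoord D A (fun σ => Λ (σ, q.2)) γ σ, (σ, q.2))) = 0) := by
  filter_upwards [eventually_nhds_right (H.eventually_iteratedDeriv hB n)] with q hq γ hs hv
  have hε : γ.ε = ((s : ℤ) : ℝ) := by rw [RArc.ε, hs]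
  have h1 : ∀ᶠ σ in 𝓝[>] (0 : ℝ),
      (iteratedDeriv n (fun X => slice F q.2 (X, γ.ε * σ ^ D)) (γ.X (σ ^ D)) = 0 ↔
        B n (0, (chartCoord D A (fun σ => Λ (σ, q.2)) γ σ, (σ, q.2))) = 0) := by
    filter_upwards [(hv.prodMk tendsto_id).eventually hq, self_mem_nhdsWithin]
      with σ h1 (hσ' : (0 : ℝ) < σ)
    have h2 := h1 hσ'
    have h3 := chartCoord_mul (D := D) (A := A) (Λ := fun σ => Λ (σ, q.2)) (γ := γ) hσ' 0
    simp only [add_zero, zero_mul, id_eq] at h2 h3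
    rw [h3] at h2
    simp only [slice, hε]
    rw [h2]
    have e1 := (pow_pos hσ' C).ne'
    have e3 : (n.factorial : ℝ) ≠ 0 := mod_cast n.factorial_ne_zero
    simp [e1, e3, hσ'.ne']
  rw [← eventually_congr h1]
  constructor
  · intro hX
    have := ((tendsto_root_zero_right γ.d_pos).comp (tendsto_pow_zero_right H.D_pos)).eventually hX
    filter_upwards [this, self_mem_nhdsWithin] with σ h2 (hσ' : (0 : ℝ) < σ)
    simp only [Function.comp] at h2
    rw [RArc.y_eq, root_pow γ.d_pos (pow_pos hσ' D).le] at h2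
    exact h2
  · intro hX
    have := ((tendsto_root_zero_right H.D_pos).comp (tendsto_pow_zero_right γ.d_pos)).eventually hX
    rw [XDerivVanishes]
    filter_upwards [this, self_mem_nhdsWithin] with τ h2 (hτ' : (0 : ℝ) < τ)
    simp only [Function.comp] at h2
    rw [root_pow H.D_pos (pow_pos hτ' _).le, RArc.X_pow γ hτ'.le] at h2
    exact h2

/-- If the centre of the chart is a root of multiplicity `p` at `t = 0`, then so it is for small
`t`, because this root is polar. -/
theorem eventually_zero_of_root (H : Chart F s D A C p Λ G R) (hp2 : 2 ≤ p)
    (hreg : ∀ᶠ t in 𝓝 (0 : ℝ), RegularX (slice F t))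
    (hpolar : ∀ γ : RArc, IsPolar (slice F 0) γ → HasStableBarDeformation F γ)
    (hzero : ∀ i < p, ∀ᶠ σ in 𝓝 (0 : ℝ), R i (0, (σ, 0)) = 0) :
    ∀ᶠ t in 𝓝 (0 : ℝ), ∀ i < p, ∀ᶠ σ in 𝓝[>] (0 : ℝ), R i (0, (σ, t)) = 0 := by
  have hp := H.p_pos
  have reg0 := hreg.self_of_nhds
  have hone := reg0.one_le_fHeight
  obtain ⟨B, hB, hB0, hBQ⟩ := H.taylor.exists_moving
  obtain ⟨Q, hQ, hQ0, hQB⟩ := hBQ (p - 1)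
  have hQne : Q (0, 0) ≠ 0 := by
    rw [hQ0, Nat.sub_add_cancel hp]
    exact mul_ne_zero (by positivity) H.top
  obtain ⟨γ, hLs, hLX⟩ := H.exists_center_zero
  have hγε : γ.ε = ((s : ℤ) : ℝ) := by rw [RArc.ε, hLs]
  have hvγ : ∀ᶠ σ in 𝓝[>] (0 : ℝ), chartCoord D A (Λ ⟨·, 0⟩) γ σ = 0 := by
    filter_upwards [hLX] with σ h1
    rw [chartCoord, h1, sub_self, zero_div]
  have hvγ0 : Tendsto (chartCoord D A (Λ ⟨·, 0⟩) γ) (𝓝[>] 0) (𝓝 0) :=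
    tendsto_const_nhds.congr' (hvγ.mono fun σ h => h.symm)
  have hD' : (0 : ℝ) < D := mod_cast H.D_pos
  have hgeγ : ∀ h : ℝ, HeightGE (slice F 0) γ h := by
    intro h
    set θ := max (h * D - A) 1
    have hθ1 : 0 < θ := lt_of_lt_of_le one_pos (le_max_right _ _)
    have hedge := H.edgeForm.self_of_nhds θ hθ1 fun i hi =>
      (isBigO_zero _ _).congr' (((hzero i hi).within).mono fun σ h => h.symm) EventuallyEq.rfl
    refine (hedge.heightGE hp hγε hvγ0 ((isBigO_zero _ _).congr'
      (hvγ.mono fun σ h => h.symm) EventuallyEq.rfl)).mono ?_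
    rw [le_div_iff₀ hD']
    linarith [le_max_left (h * D - A) 1]
  have hheight : fHeight (slice F 0) γ = ⊤ := by
    rw [eq_top_iff]
    exact ENNReal.le_of_forall_one_lt (hone γ) fun x hx _ => (reg0.le_fHeight_iff hx).2 (hgeγ x)
  have hR0 : ∀ n, ∀ᶠ σ in 𝓝[>] (0 : ℝ), B n (0, (0, (σ, 0))) = R n (0, (σ, 0)) := fun n => by
    have h1 : Tendsto (fun σ : ℝ => ((σ, (0 : ℝ)) : ℝ × ℝ)) (𝓝[>] 0) (𝓝 (0, 0)) :=
      (tendsto_id.of_within).prodMk_nhds tendsto_const_nhds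
    exact h1.eventually (hB0 n)
  have htop : ∀ᶠ σ in 𝓝[>] (0 : ℝ), R p (0, (σ, 0)) ≠ 0 :=
    ((H.analyticAt_coeff_zero p).continuousAt.eventually_ne H.top).within
  -- arcs with vanishing coordinate at `t = 0` have multiplicity `p`
  have hmult : ∀ μ : RArc, μ.sgn = s → (∀ᶠ σ in 𝓝[>] (0 : ℝ), chartCoord D A (Λ ⟨·, 0⟩) μ σ = 0) →
      (∀ i < p, XDerivVanishes (slice F 0) μ i) ∧ ¬ XDerivVanishes (slice F 0) μ p := by
    intro μ hs hv
    have hv0 : Tendsto (chartCoord D A (Λ ⟨·, 0⟩) μ) (𝓝[>] 0) (𝓝 0) :=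
      tendsto_const_nhds.congr' (hv.mono fun σ h => h.symm)
    have hiff : ∀ n, XDerivVanishes (slice F 0) μ n ↔
        ∀ᶠ σ in 𝓝[>] (0 : ℝ), R n (0, (σ, 0)) = 0 := by
      intro n
      refine ((H.xDerivVanishes_iff hB n).self_of_nhds μ hs hv0).trans (eventually_congr ?_)
      filter_upwards [hv, hR0 n] with σ h1 h2
      have h1' : chartCoord D A (fun σ => Λ (σ, (0 : ℝ × ℝ).2)) μ σ = 0 := h1
      rw [h1']
      exact ⟨fun h => h2.symm.trans h, fun h => Eq.trans h2 h⟩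
    refine ⟨fun i hi => (hiff i).2 ((hzero i hi).within), fun hcon => ?_⟩
    obtain ⟨σ, h1, h2⟩ := (((hiff p).1 hcon).and htop).exists
    exact h2 h1
  have hpol : IsPolar (slice F 0) γ := Or.inr ⟨hheight, p, hp2, Or.inr ⟨hheight, hmult γ hLs hvγ⟩⟩
  obtain ⟨δ, hδ, μ, hμ, Γ, ⟨hΓ, hΓμ⟩, hΓh, n, hΓn⟩ := hpolar γ hpol
  have h0δ : (0 : ℝ) ∈ Ioo (-δ) δ := ⟨by linarith, hδ⟩
  have hΓ0 : Γ 0 ∈ bar (slice F 0) γ := bar_trans hμ (mem_bar_of_mem_fArc hone hΓμ)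
  obtain ⟨hs0, hh0, hcon⟩ := mem_bar_iff.1 hΓ0
  rw [hheight, top_le_iff, RArc.contact_comm] at hcon
  have hO : ∀ θ : ℝ, chartCoord D A (Λ ⟨·, 0⟩) (Γ 0) =O[𝓝[>] 0] fun σ => σ ^ θ := by
    intro θ
    have h1 := (isBigO_chartCoord_sub H.D_pos A (Λ ⟨·, 0⟩) (θ := θ)).1
      ((RArc.le_contact_iff hs0.symm).1 (hcon ▸ le_top))
    refine h1.congr' ?_ EventuallyEq.rfl
    filter_upwards [hvγ] with σ h2
    rw [h2, sub_zero]
  have hv0 : ∀ᶠ σ in 𝓝[>] (0 : ℝ), chartCoord D A (Λ ⟨·, 0⟩) (Γ 0) σ = 0 := by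
    rcases chartCoord_dichotomy H.D_pos (analyticAt_slice H.analytic) A (Γ 0) with
      h1 | ⟨κ, c, hc, hκ⟩
    · exact h1
    · exact absurd (tendsto_nhds_unique hκ
        (tendsto_div_rpow_of_isBigO (hO (κ + 1)) (lt_add_one κ))) hc
  have hin : InChart s D A (Λ ⟨·, 0⟩) (Γ 0) :=
    ⟨hs0.symm.trans hLs, tendsto_const_nhds.congr' (hv0.mono fun σ h => h.symm)⟩
  have hX : ∀ t ∈ Ioo (-δ) δ, (∀ i < n, XDerivVanishes (slice F t) (Γ t) i) ∧
      ¬ XDerivVanishes (slice F t) (Γ t) n := by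
    intro t ht
    rcases hΓn t ht with ⟨h1, -⟩ | ⟨-, h2⟩
    · rw [hΓh t ht, hheight] at h1
      exact absurd h1 (lt_irrefl _)
    · exact h2
  have hnp : p ≤ n := by
    by_contra hlt
    push Not at hlt
    exact (hX 0 h0δ).2 ((hmult (Γ 0) hin.1 hv0).1 n hlt)
  obtain ⟨ω, hω, hωt⟩ := H.track δ hδ Γ hΓ hin ⟨⊤, ENNReal.ofReal_lt_top, fun t ht => by
    rw [hΓh t ht, hheight]⟩
  have hallX : ∀ᶠ q in 𝓝 (0 : ℝ × ℝ), ∀ i ∈ Finset.range p, ∀ γ : RArc, γ.sgn = s →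
      Tendsto (chartCoord D A (fun σ => Λ (σ, q.2)) γ) (𝓝[>] 0) (𝓝 q.1) →
      (XDerivVanishes (slice F q.2) γ i ↔ ∀ᶠ σ in 𝓝[>] (0 : ℝ),
        B i (0, (chartCoord D A (fun σ => Λ (σ, q.2)) γ σ, (σ, q.2))) = 0) :=
    (Finset.eventually_all _).2 fun i _ => H.xDerivVanishes_iff hB i
  have hnorm : ∀ᶠ t in 𝓝 (0 : ℝ), ∀ᶠ σ in 𝓝[>] (0 : ℝ), R (p - 1) (0, (σ, t)) = 0 := by
    filter_upwards [eventually_nhds_slice' (a := (0 : ℝ)) (x₀ := (0 : ℝ)) H.norm] with t ht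
    exact ht.within
  have hB0t : ∀ᶠ t in 𝓝 (0 : ℝ), ∀ i ∈ Finset.range p, ∀ᶠ σ in 𝓝[>] (0 : ℝ),
      B i (0, (0, (σ, t))) = R i (0, (σ, t)) := by
    refine (Finset.eventually_all _).2 fun i _ => ?_
    filter_upwards [eventually_nhds_slice' (a := (0 : ℝ)) (x₀ := (0 : ℝ)) (hB0 i)] with t ht
    exact ht.within
  filter_upwards [hωt, (tendsto_zero_prodMk hω).eventually hallX, Ioo_mem_nhds h0δ.1 h0δ.2,
    (tendsto_zero_prodMk hω).eventually (eventually_nhds_right hQB),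
    (tendsto_zero_prodMk hω).eventually (eventually_tendsto_of_analyticAt hQ),
    (tendsto_zero_prodMk hω).eventually (eventually_ne_of_analyticAt hQ hQne), hnorm, hB0t] with
    t h1 h2 ht h3 h4 h5 h6 h7 i hi
  have hst : (Γ t).sgn = s := (hΓ.1 t ht).1.trans hin.1
  have hBi : ∀ i < p, ∀ᶠ σ in 𝓝[>] (0 : ℝ),
      B i (0, (chartCoord D A (Λ ⟨·, t⟩) (Γ t) σ, (σ, t))) = 0 := fun i hi =>
    (h2 i (Finset.mem_range.2 hi) (Γ t) hst h1).1 ((hX t ht).1 i (hi.trans_le hnp))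
  have hmap := h1.prodMk (tendsto_id (x := 𝓝[>] (0 : ℝ)))
  -- the coefficient of degree `p - 1` is the coordinate times a unit
  have hvt : ∀ᶠ σ in 𝓝[>] (0 : ℝ), chartCoord D A (Λ ⟨·, t⟩) (Γ t) σ = 0 := by
    filter_upwards [hBi (p - 1) (by omega), hmap.eventually h3, (h4.comp hmap).eventually_ne h5, h6,
      h7 (p - 1) (Finset.mem_range.2 (by omega))] with σ e1 e2 e3 e4 e5
    simp only [Function.comp, id_eq] at e2 e3
    rw [e1, e5, e4, zero_add] at e2
    exact (mul_eq_zero.1 e2.symm).resolve_right e3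
  filter_upwards [hBi i hi, hvt, h7 i (Finset.mem_range.2 hi)] with σ e1 e2 e3
  rw [e2] at e1
  exact e3.symm.trans e1

/-- In a chart, either the centre is a root of multiplicity `p` for all small `t`, or there is a
Newton edge common to all small `t`. -/
theorem dichotomy (H : Chart F s D A C p Λ G R) (hreg : ∀ᶠ t in 𝓝 (0 : ℝ), RegularX (slice F t))
    (hpolar : ∀ γ : RArc, IsPolar (slice F 0) γ → HasStableBarDeformation F γ) :
    (∀ᶠ t in 𝓝 (0 : ℝ), ∀ i < p, ∀ᶠ σ in 𝓝[>] (0 : ℝ), R i (0, (σ, t)) = 0) ∨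
      ∃ (a b : ℕ) (k : ℕ → ℕ) (β : ℕ → ℝ × ℝ → ℝ), IsEdge R p a b k β ∧ b * D ≤ b * A + a := by
  have hp := H.p_pos
  rcases (show p = 1 ∨ 2 ≤ p by omega) with rfl | hp2
  · left
    filter_upwards [eventually_nhds_slice' (a := (0 : ℝ)) (x₀ := (0 : ℝ)) H.norm] with t ht i hi
    obtain rfl : i = 1 - 1 := by omega
    exact ht.within
  by_cases hne : ∃ i < p, ¬ ∀ᶠ σ in 𝓝 (0 : ℝ), R i (0, (σ, 0)) = 0
  swap
  · push Not at hne
    exact Or.inl (H.eventually_zero_of_root hp2 hreg hpolar hne)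
  right
  obtain ⟨a, b, k, β, hb, hβ, i₀, hi₀, hk₀, hβ₀, hak⟩ :=
    exists_newton_edge (fun i _ => H.analyticAt_coeff_zero i) hne
  have ha : 0 < a := by
    rw [hak]
    by_contra hcon
    have hk : k i₀ = 0 := by omega
    have h1 := (hβ i₀ hi₀).2.1.self_of_nhds
    rw [hk, pow_zero, one_mul] at h1
    exact hβ₀ (h1.symm.trans (H.low i₀ hi₀))
  obtain ⟨hle, hO⟩ := H.isBigO_of_edge hreg hpolar ha hb hβ hi₀ hk₀ hβ₀
  have hb' : (0 : ℝ) < b := mod_cast hb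
  set θ : ℝ := (a : ℝ) / b with hθ
  have hbθ : b * θ = a := by rw [hθ]; field_simp
  have hex : ∀ i, ∃ β' : ℝ × ℝ → ℝ, i < p → AnalyticAt ℝ β' 0 ∧ ∀ᶠ x in 𝓝 (0 : ℝ × ℝ),
      R i (0, x) = x.1 ^ ⌈((p - i : ℕ) : ℝ) * θ⌉₊ * β' x := by
    intro i
    by_cases hi : i < p
    · obtain ⟨β', h1, h2⟩ := (H.taylor.analyticAt_coeff i).exists_eq_pow_mul_of_isBigO
        (hO.mono fun t ht => ht i hi) (k := ⌈((p - i : ℕ) : ℝ) * θ⌉₊)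
        (Nat.ceil_lt_add_one (by positivity))
      exact ⟨β', fun _ => ⟨h1, h2⟩⟩
    · exact ⟨0, fun h => absurd h hi⟩
  choose β' hβ' using hex
  have hk : ⌈((p - i₀ : ℕ) : ℝ) * θ⌉₊ = k i₀ := by
    have : ((p - i₀ : ℕ) : ℝ) * θ = k i₀ := by
      have h1 : ((b * k i₀ + a * i₀ : ℕ) : ℝ) = ((a * p : ℕ) : ℝ) := mod_cast hk₀
      push_cast at h1
      rw [Nat.cast_sub hi₀.le]
      refine mul_left_cancel₀ hb'.ne' ?_
      rw [mul_left_comm, hbθ]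
      linarith
    rw [this, Nat.ceil_natCast]
  refine ⟨a, b, fun i => ⌈((p - i : ℕ) : ℝ) * θ⌉₊, β', ⟨ha, hb, fun i hi => (hβ' i hi).1,
    fun i hi => (hβ' i hi).2, fun i hi => ?_, i₀, hi₀, by simp only [hk]; exact hk₀, ?_⟩, hle⟩
  · have h1 := Nat.le_ceil (((p - i : ℕ) : ℝ) * θ)
    have h2 : ((a * p : ℕ) : ℝ) ≤ ((b * ⌈((p - i : ℕ) : ℝ) * θ⌉₊ + a * i : ℕ) : ℝ) := by
      push_cast
      have h3 := mul_le_mul_of_nonneg_left h1 hb'.le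
      rw [mul_left_comm, hbθ, Nat.cast_sub hi.le] at h3
      rw [Nat.cast_sub hi.le]
      linarith
    exact_mod_cast h2
  · have h1 : Tendsto (fun σ : ℝ => ((σ, (0 : ℝ)) : ℝ × ℝ)) (𝓝[>] 0) (𝓝 0) :=
      (tendsto_id.of_within).prodMk_nhds tendsto_const_nhds
    have h2 := ((hβ' i₀ hi₀).1.continuousAt.tendsto).comp h1
    have h3 := (hβ i₀ hi₀).1.continuousAt.tendsto.within (s := Ioi 0)
    have h4 : β' i₀ 0 = β i₀ 0 := by
      refine tendsto_nhds_unique h2 (h3.congr' ?_)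
      filter_upwards [h1.eventually (hβ' i₀ hi₀).2, ((hβ i₀ hi₀).2.1).within, self_mem_nhdsWithin]
          with σ e1 e2 (hσ' : (0 : ℝ) < σ)
      rw [hk, e2] at e1
      exact mul_left_cancel₀ (pow_pos hσ' _).ne' e1
    rwa [h4]

end Chart

end Leaf

/-! ### The charts at the roots of an edge -/

section Child

variable {F : ℝ × ℝ × ℝ → ℝ} {s : ℤˣ} {D A C p : ℕ} {Λ : ℝ × ℝ → ℝ} {G : ℝ × (ℝ × ℝ) → ℝ}
  {R : ℕ → ℝ × (ℝ × ℝ) → ℝ} {a b : ℕ} {k : ℕ → ℕ} {β : ℕ → ℝ × ℝ → ℝ}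

/-- The coefficients of the edge polynomial at time `t`. -/
def edgeCoeff (R : ℕ → ℝ × (ℝ × ℝ) → ℝ) (p a b : ℕ) (k : ℕ → ℕ) (β : ℕ → ℝ × ℝ → ℝ) (t : ℝ)
    (i : ℕ) : ℝ :=
  if i < p then (if b * k i + a * i = a * p then β i (0, t) else 0) else R p (0, (0, t))

theorem edgeCoeff_top (t : ℝ) : edgeCoeff R p a b k β t p = R p (0, (0, t)) := by simp [edgeCoeff]

namespace IsEdge

variable (hE : IsEdge R p a b k β)

include hE

theorem k_pos {i : ℕ} (hi : i < p) : 0 < k i := by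
  by_contra hcon
  have h1 := hE.le i hi
  have h2 : k i = 0 := by omega
  rw [h2, mul_zero, zero_add] at h1
  have h3 := Nat.le_of_mul_le_mul_left h1 hE.a_pos
  omega

theorem theta_pos : (0 : ℝ) < (a : ℝ) / b := by
  have h1 : (0 : ℝ) < a := mod_cast hE.a_pos
  have h2 : (0 : ℝ) < b := mod_cast hE.b_pos
  positivity

theorem b_mul_theta : (b : ℝ) * ((a : ℝ) / b) = a := by
  have h2 : (0 : ℝ) < b := mod_cast hE.b_pos
  field_simp

theorem continuousAt_edgeCoeff (hR : AnalyticAt ℝ (R p) ((0 : ℝ), (0 : ℝ × ℝ))) (i : ℕ) :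
    ContinuousAt (fun t => edgeCoeff R p a b k β t i) 0 := by
  unfold edgeCoeff
  by_cases hi : i < p
  · simp only [if_pos hi]
    split_ifs
    · exact ContinuousAt.comp (g := β i) (f := fun t : ℝ => ((0 : ℝ), t))
        (hE.analytic i hi).continuousAt (by fun_prop)
    · exact continuousAt_const
  · simp only [if_neg hi]
    exact ContinuousAt.comp (g := R p) (f := fun t : ℝ => ((0 : ℝ), ((0 : ℝ), t)))
      hR.continuousAt (by fun_prop)

theorem newtonQuotient_eq (w t : ℝ) : newtonQuotient p a b (a * p) k β (R p) (w, (0, t)) =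
    (edgePoly p (edgeCoeff R p a b k β t)).eval w := by
  rw [newtonQuotient_zero hE.b_pos hE.a_pos hE.le le_rfl, eval_edgePoly, edgeCoeff_top, if_pos rfl]
  congr 1
  refine sum_congr rfl fun i hi => ?_
  rw [edgeCoeff, if_pos (Finset.mem_range.1 hi)]

/-- The limits of the coefficients for weight `a / b`. -/
theorem tendsto_coeff {i : ℕ} (hi : i < p) : ∀ᶠ t in 𝓝 (0 : ℝ),
    Tendsto (fun σ => R i (0, (σ, t)) / σ ^ (((p - i : ℕ) : ℝ) * ((a : ℝ) / b))) (𝓝[>] 0)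
      (𝓝 (edgeCoeff R p a b k β t i)) := by
  filter_upwards [eventually_zero_prodMk (hE.analytic i hi).eventually_analyticAt,
    eventually_nhds_slice' (a := (0 : ℝ)) (x₀ := (0 : ℝ)) (hE.eq i hi)] with t h2 h3
  rw [edgeCoeff, if_pos hi]
  exact tendsto_div_rpow_edge hE.b_pos hi.le (analyticAt_slice h2).continuousAt h3 (hE.le i hi)

end IsEdge

/-- The slices have the edge form, with the edge polynomial as initial form. -/
theorem Chart.eventually_edgeForm (H : Chart F s D A C p Λ G R) (hE : IsEdge R p a b k β) :
    ∀ᶠ t in 𝓝 (0 : ℝ), EdgeForm (slice F t) ((s : ℤ) : ℝ) D A C p (Λ ⟨·, t⟩)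
        (fun z => G (z.1, (z.2, t))) ((a : ℝ) / b) ∧
      (∀ w, Tendsto (fun z : ℝ × ℝ => G (z.1 * z.2 ^ ((a : ℝ) / b), (z.2, t)) /
        z.2 ^ (p * ((a : ℝ) / b))) (𝓝 w ×ˢ 𝓝[>] 0)
          (𝓝 ((edgePoly p (edgeCoeff R p a b k β t)).eval w))) ∧ ∀ i < p, R i (0, (0, t)) = 0 := by
  have hall : ∀ᶠ t in 𝓝 (0 : ℝ), ∀ i ∈ Finset.range p,
      Tendsto (fun σ => R i (0, (σ, t)) / σ ^ (((p - i : ℕ) : ℝ) * ((a : ℝ) / b))) (𝓝[>] 0)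
        (𝓝 (edgeCoeff R p a b k β t i)) :=
    (Finset.eventually_all _).2 fun i hi => hE.tendsto_coeff (Finset.mem_range.1 hi)
  have hzero : ∀ᶠ t in 𝓝 (0 : ℝ), ∀ i ∈ Finset.range p, R i (0, (0, t)) = 0 := by
    refine (Finset.eventually_all _).2 fun i hi => ?_
    filter_upwards [eventually_zero_prodMk (hE.eq i (Finset.mem_range.1 hi))] with t ht
    rw [ht, zero_pow (hE.k_pos (Finset.mem_range.1 hi)).ne', zero_mul]
  filter_upwards [hall, hzero, H.edgeForm, H.eventually_expand,
    eventually_zero_prodMk (eventually_tendsto_of_analyticAt (H.taylor.analyticAt p))] with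
    t h1 h2 h3 h4 h5
  refine ⟨h3 _ hE.theta_pos fun i hi =>
    isBigO_rpow_of_tendsto_div (h1 i (Finset.mem_range.2 hi)), fun w => ?_,
    fun i hi => h2 i (Finset.mem_range.2 hi)⟩
  exact tendsto_edgePoly (p := p) (g := fun z => G (z.1, (z.2, t))) hE.theta_pos
    (a := fun i σ => R i (0, (σ, t)))
    (S := fun z => R p (z.1, (z.2, t))) h4 (fun i hi => h1 i (Finset.mem_range.2 hi))
    (by rw [edgeCoeff_top]; exact h5) w

/-- The weighted limit of the coordinate of an arc is a difference of coefficients. -/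
theorem tendsto_chartCoord_div {Λ : ℝ → ℝ} {γ L : RArc} (hD : 0 < D) {θ : ℝ}
    (hL : ∀ᶠ σ in 𝓝[>] (0 : ℝ), L.X (σ ^ D) = Λ σ)
    (hO : chartCoord D A Λ γ =O[𝓝[>] 0] fun σ => σ ^ θ) :
    Tendsto (fun σ => chartCoord D A Λ γ σ / σ ^ θ) (𝓝[>] 0)
      (𝓝 (γ.coeffAt ((A + θ) / D) - L.coeffAt ((A + θ) / D))) := by
  have hv : ∀ᶠ σ in 𝓝[>] (0 : ℝ), chartCoord D A Λ L σ = 0 := by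
    filter_upwards [hL] with σ h1
    rw [chartCoord, h1, sub_self, zero_div]
  have h1 : (fun y => γ.X y - L.X y) =O[𝓝[>] 0] fun y => y ^ ((A + θ) / D) := by
    rw [isBigO_chartCoord_sub hD A Λ]
    refine hO.congr' ?_ EventuallyEq.rfl
    filter_upwards [hv] with σ h2
    rw [h2, sub_zero]
  refine ((RArc.tendsto_sub_div h1).comp (tendsto_pow_zero_right hD)).congr' ?_
  filter_upwards [hL, self_mem_nhdsWithin] with σ h2 (hσ' : (0 : ℝ) < σ)
  simp only [Function.comp]
  rw [chartCoord, h2, pow_rpow_div hD hσ', rpow_natCast_add hσ', div_div]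

/-- The coordinate in the chart with centre `Λ (τ ^ b) + ψ (τ) * τ ^ (b * A + a)`. -/
theorem tendsto_chartCoord_child {Λ ψ : ℝ → ℝ} (γ : RArc) (hb : 0 < b) {ψ₀ ω : ℝ}
    (hψ : Tendsto ψ (𝓝[>] 0) (𝓝 ψ₀)) :
    Tendsto (chartCoord (b * D) (b * A + a) (fun τ => Λ (τ ^ b) + ψ τ * τ ^ (b * A + a)) γ)
      (𝓝[>] 0) (𝓝 ω) ↔
    Tendsto (fun σ => chartCoord D A Λ γ σ / σ ^ ((a : ℝ) / b)) (𝓝[>] 0) (𝓝 (ψ₀ + ω)) := by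
  have key : ∀ τ : ℝ, 0 < τ →
      chartCoord (b * D) (b * A + a) (fun τ => Λ (τ ^ b) + ψ τ * τ ^ (b * A + a)) γ τ + ψ τ =
        chartCoord D A Λ γ (τ ^ b) / (τ ^ b) ^ ((a : ℝ) / b) := by
    intro τ hτ
    rw [pow_rpow_div hb hτ, rpow_natCast, chartCoord, chartCoord]
    rw [pow_add, ← pow_mul, ← pow_mul]
    field_simp
    ring
  constructor
  · intro hT
    have h1 := (hψ.add hT).comp (tendsto_root_zero_right hb)
    refine h1.congr' ?_
    filter_upwards [self_mem_nhdsWithin] with σ (hσ' : (0 : ℝ) < σ)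
    have h2 := key (σ ^ (1 / (b : ℝ))) (rpow_pos_of_pos hσ' _)
    rw [root_pow hb hσ'.le] at h2
    simp only [Function.comp]
    rw [add_comm, h2]
  · intro hT
    have h1 := (hT.comp (tendsto_pow_zero_right hb)).sub hψ
    rw [add_sub_cancel_left] at h1
    refine h1.congr' ?_
    filter_upwards [self_mem_nhdsWithin] with τ hτ
    simp only [Function.comp]
    rw [← key τ hτ, add_sub_cancel_right]

theorem eventually_tendsto_add_slice {φ : ℝ × ℝ → ℝ} (hφ : AnalyticAt ℝ φ 0) (u : ℝ) :
    ∀ᶠ t in 𝓝 (0 : ℝ), Tendsto (fun τ => u + φ (τ, t)) (𝓝[>] 0) (𝓝 (u + φ (0, t))) := by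
  filter_upwards [eventually_zero_prodMk hφ.eventually_analyticAt] with t ht
  exact ((analyticAt_slice ht).continuousAt.tendsto.within).const_add u

/-- Arcs of large height which start in the chart at a root of the edge polynomial stay in that
chart: the weighted limit of the coordinate is a root of the edge polynomial which depends
continuously on `t`. -/
theorem Chart.track_child (H : Chart F s D A C p Λ G R) (hE : IsEdge R p a b k β)
    (hle : b * D ≤ b * A + a) (hreg : ∀ᶠ t in 𝓝 (0 : ℝ), RegularX (slice F t)) {u : ℝ}
    {φ : ℝ × ℝ → ℝ} (hφ : AnalyticAt ℝ φ 0) (hφ0 : φ 0 = 0) :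
    ∀ δ > 0, ∀ Γ, IsContFamily δ Γ → InChart s (b * D) (b * A + a)
        (fun τ => Λ (τ ^ b, 0) + (u + φ (τ, 0)) * τ ^ (b * A + a)) (Γ 0) →
      (∃ h : ℝ≥0∞, ENNReal.ofReal (((b * A + a : ℕ) : ℝ) / (b * D : ℕ)) < h ∧
        ∀ t ∈ Ioo (-δ) δ, h ≤ fHeight (slice F t) (Γ t)) →
      ∃ ω : ℝ → ℝ, Tendsto ω (𝓝 0) (𝓝 0) ∧ ∀ᶠ t in 𝓝 (0 : ℝ),
        Tendsto (chartCoord (b * D) (b * A + a)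
          (fun τ => Λ (τ ^ b, t) + (u + φ (τ, t)) * τ ^ (b * A + a)) (Γ t)) (𝓝[>] 0)
          (𝓝 (ω t)) := by
  have ha := hE.a_pos
  have hb := hE.b_pos
  have hb' : (0 : ℝ) < b := mod_cast hb
  have hD' : (0 : ℝ) < D := mod_cast H.D_pos
  set θ : ℝ := (a : ℝ) / b with hθdef
  have hθ : 0 < θ := hE.theta_pos
  have hφt := eventually_tendsto_add_slice hφ u
  have hA'D' : ((b * A + a : ℕ) : ℝ) / (b * D : ℕ) = (A + θ) / D := by
    push_cast
    rw [← hE.b_mul_theta, ← hθdef]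
    field_simp
  intro δ hδ Γ hΓ hin hex
  obtain ⟨h, hh, hΓh⟩ := hex
  have hs0 := hin.1
  have hv0 := hin.2
  rw [hA'D'] at hh
  have hu0 := (tendsto_chartCoord_child (D := D) (A := A) (a := a) (ω := 0)
    (Λ := fun σ => Λ (σ, 0)) (ψ := fun τ => u + φ (τ, 0)) (Γ 0) hb hφt.self_of_nhds).1 hv0
  have hφ0' : φ (0, 0) = 0 := hφ0
  rw [hφ0', add_zero, add_zero] at hu0
  have hv0' : Tendsto (chartCoord D A (Λ ⟨·, 0⟩) (Γ 0)) (𝓝[>] 0) (𝓝 0) :=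
    (isBigO_rpow_of_tendsto_div hu0).trans_tendsto (tendsto_rpow_nhds_zero hθ)
  have hlt : (A : ℝ) / D < (A + θ) / D := by gcongr; linarith
  have h1le : 1 ≤ (A + θ) / D := by
    rw [← hA'D', one_le_div (by exact_mod_cast Nat.mul_pos hb H.D_pos)]
    exact_mod_cast hle
  obtain ⟨ω, hω, hωt⟩ := H.track δ hδ Γ hΓ ⟨hs0, hv0'⟩ ⟨h, lt_of_le_of_lt
    (ENNReal.ofReal_le_ofReal hlt.le) hh, hΓh⟩
  obtain ⟨h', hh1, hh2⟩ : ∃ h' : ℝ, (A + θ) / D < h' ∧ ENNReal.ofReal h' ≤ h := by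
    obtain ⟨q, h1, h2⟩ := ENNReal.lt_iff_exists_nnreal_btwn.1 hh
    refine ⟨q, ?_, by simpa using h2.le⟩
    rw [← ENNReal.ofReal_coe_nnreal] at h1
    exact (ENNReal.ofReal_lt_ofReal_iff'.1 h1).1
  obtain ⟨δ₁, hδ₁, hcenter⟩ := H.exists_center ((H.eventually_edgeForm hE).mono fun t h => h.2.2)
  obtain ⟨L, hL, hLX⟩ := hcenter (min δ δ₁) (min_le_right _ _)
  have h0δ' : (0 : ℝ) ∈ Ioo (-min δ δ₁) (min δ δ₁) :=
    ⟨neg_neg_of_pos (lt_min hδ hδ₁), lt_min hδ hδ₁⟩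
  set W : ℝ → ℝ := fun t => (Γ t).coeffAt ((A + θ) / D) - (L t).coeffAt ((A + θ) / D)
  have hWt : ∀ᶠ t in 𝓝 (0 : ℝ), Tendsto (fun σ =>
      chartCoord D A (Λ ⟨·, t⟩) (Γ t) σ / σ ^ θ) (𝓝[>] 0) (𝓝 (W t)) := by
    filter_upwards [hωt, (tendsto_zero_prodMk hω).eventually H.coord_eq_zero, hreg,
      H.eventually_edgeForm hE, Ioo_mem_nhds h0δ'.1 h0δ'.2, H.eventually_analyticAt] with
      t e1 e2 e3 e4 ht e5
    have htδ : t ∈ Ioo (-δ) δ := ⟨lt_of_le_of_lt (neg_le_neg (min_le_left _ _)) ht.1,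
      ht.2.trans_le (min_le_left _ _)⟩
    have hge : HeightGE (slice F t) (Γ t) h' :=
      (e3.le_fHeight_iff (h1le.trans_lt hh1)).1 (hh2.trans (hΓh t htδ))
    have hst := (hΓ.1 t htδ).1.trans hs0
    have hω0 : ω t = 0 := e2 e4.2.2 (Γ t) h' hst e1 (hlt.trans hh1) hge
    rw [hω0] at e1
    obtain ⟨w, -, hw⟩ := e4.1.exists_root (analyticAt_slice e5) (by rw [RArc.ε, hst]) e1 e4.2.1
      hge hh1
    exact tendsto_chartCoord_div H.D_pos (hLX t ht).2 (isBigO_rpow_of_tendsto_div hw)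
  have hWc : ContinuousAt W 0 := by
    have h1 := ((hΓ.mono (min_le_left δ δ₁)).continuousOn_coeffAt ((A + θ) / D)).continuousAt
      (Ioo_mem_nhds h0δ'.1 h0δ'.2)
    have h2 := (hL.isContFamily.continuousOn_coeffAt ((A + θ) / D)).continuousAt
      (Ioo_mem_nhds h0δ'.1 h0δ'.2)
    exact h1.sub h2
  have hW0 : W 0 = u := tendsto_nhds_unique hWt.self_of_nhds hu0
  have hφc : Tendsto (fun t : ℝ => φ (0, t)) (𝓝 0) (𝓝 0) := by
    have := hφ.continuousAt.tendsto.comp (tendsto_zero_prodMk (ω := fun _ => 0) tendsto_const_nhds)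
    rwa [hφ0] at this
  refine ⟨fun t => W t - (u + φ (0, t)), ?_, ?_⟩
  · have := hWc.tendsto.sub (hφc.const_add u)
    rwa [hW0, add_zero, sub_self] at this
  · filter_upwards [hWt, hφt] with t h1 h2
    rw [tendsto_chartCoord_child (Λ := fun σ => Λ (σ, t)) (ψ := fun τ => u + φ (τ, t)) (Γ t) hb h2,
      add_sub_cancel]
    exact h1

/-- At a root `u` of the edge polynomial at `t = 0` there is a chart of smaller multiplicity. -/
theorem Chart.exists_child (H : Chart F s D A C p Λ G R) (hE : IsEdge R p a b k β)
    (hle : b * D ≤ b * A + a) (hreg : ∀ᶠ t in 𝓝 (0 : ℝ), RegularX (slice F t)) {u : ℝ}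
    (hu : (edgePoly p (edgeCoeff R p a b k β 0)).eval u = 0) :
    ∃ (m : ℕ) (φ : ℝ × ℝ → ℝ) (G' : ℝ × (ℝ × ℝ) → ℝ) (R' : ℕ → ℝ × (ℝ × ℝ) → ℝ), m < p ∧
      AnalyticAt ℝ φ 0 ∧ φ 0 = 0 ∧
      (∀ v t, G' (v, (0, t)) = (edgePoly p (edgeCoeff R p a b k β t)).eval (u + (v + φ (0, t)))) ∧
      Chart F s (b * D) (b * A + a) (b * C + a * p) m
        (fun x => Λ (x.1 ^ b, x.2) + (u + φ x) * x.1 ^ (b * A + a)) G' R' := by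
  have ha := hE.a_pos
  have hb := hE.b_pos
  have hb' : (0 : ℝ) < b := mod_cast hb
  have hD' : (0 : ℝ) < D := mod_cast H.D_pos
  have hp := H.p_pos
  set θ : ℝ := (a : ℝ) / b
  set J := edgePoly p (edgeCoeff R p a b k β 0) with hJdef
  have htop : edgeCoeff R p a b k β 0 p ≠ 0 := by rw [edgeCoeff_top]; exact H.top
  have hJdeg : J.natDegree = p := natDegree_edgePoly htop
  have hJ0 : J ≠ 0 := by rintro h0; rw [h0] at hJdeg; simp at hJdeg; omega
  have hcoeff1 : J.coeff (p - 1) = 0 := by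
    rw [hJdef, coeff_edgePoly _ (by omega)]
    have h1 := (hE.tendsto_coeff (i := p - 1) (by omega)).self_of_nhds
    refine tendsto_nhds_unique h1 (tendsto_const_nhds.congr' ?_)
    have h1 : Tendsto (fun σ : ℝ => ((σ, (0 : ℝ)) : ℝ × ℝ)) (𝓝[>] 0) (𝓝 (0, 0)) :=
      (tendsto_id.of_within).prodMk_nhds tendsto_const_nhds
    filter_upwards [h1.eventually H.norm] with σ h2
    rw [h2, zero_div]
  obtain ⟨i₀, hi₀, hk₀, hβ₀⟩ := hE.exists_ne
  have hmlt : J.rootMultiplicity u < p :=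
    Polynomial.rootMultiplicity_lt_of_coeff_eq_zero hJdeg hcoeff1 hi₀ (by
      rw [hJdef, coeff_edgePoly _ hi₀.le, edgeCoeff, if_pos hi₀, if_pos hk₀]; exact hβ₀) u
  set m := J.rootMultiplicity u
  have hmpos : 0 < m := (rootMultiplicity_pos hJ0).2 hu
  set NQ := newtonQuotient p a b (a * p) k β (R p)
  have hNQan : ∀ w₀, AnalyticAt ℝ NQ (w₀, ((0 : ℝ), (0 : ℝ))) := fun w₀ =>
    analyticAt_newtonQuotient_of hE.analytic (H.taylor.analyticAt p) ha hb
  have hG₁ : AnalyticAt ℝ (fun z : ℝ × (ℝ × ℝ) => NQ (u + z.1, z.2)) ((0 : ℝ), (0 : ℝ × ℝ)) := by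
    refine AnalyticAt.fun_comp (g := NQ) (f := fun z : ℝ × (ℝ × ℝ) => (u + z.1, z.2)) ?_
      (by fun_prop)
    have h1 := hNQan u
    rwa [show (u, ((0 : ℝ), (0 : ℝ))) = (u + (0 : ℝ), (0 : ℝ × ℝ)) by simp] at h1
  obtain ⟨R₁, hR₁⟩ := hG₁.exists_isTaylorSeq
  have hcoef : ∀ i, R₁ i (0, 0) = (Polynomial.taylor u J).coeff i := fun i =>
    hR₁.coeff_of_polynomial (J := J) (w₀ := u) (fun w => hE.newtonQuotient_eq (u + w) 0) i
  obtain ⟨φ, hφ, hφ0, R', hR', hlow', htop', hnorm'⟩ := hR₁.exists_normalize hmpos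
    (fun i hi => (hcoef i).trans (Polynomial.taylor_coeff_of_lt_rootMultiplicity hi))
    (by rw [hcoef]; exact Polynomial.taylor_coeff_rootMultiplicity_ne_zero hJ0 u)
  have hφt := eventually_tendsto_add_slice hφ u
  refine ⟨m, φ, fun z => NQ (u + (z.1 + φ z.2), z.2), R', hmlt, hφ, hφ0,
    fun v t => hE.newtonQuotient_eq _ t, Nat.mul_pos hb H.D_pos, hmpos, ?_, hR', ?_, hlow', htop',
    hnorm', ?_, ?_, ?_⟩
  · have h1 : AnalyticAt ℝ (fun x : ℝ × ℝ => Λ (x.1 ^ b, x.2)) 0 := by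
      refine AnalyticAt.fun_comp (g := Λ) (f := fun x : ℝ × ℝ => (x.1 ^ b, x.2)) ?_ (by fun_prop)
      have h1 := H.analytic
      rwa [show (0 : ℝ × ℝ) = (((0 : ℝ × ℝ).1) ^ b, (0 : ℝ × ℝ).2) by simp [hb.ne', Prod.zero_eq_mk]] at h1
    exact h1.fun_add ((analyticAt_const.fun_add hφ).fun_mul (by fun_prop))
  · have hw : Tendsto (fun z : ℝ × (ℝ × ℝ) => (u + (z.1 + φ z.2), z.2)) (𝓝 ((0 : ℝ), (0 : ℝ × ℝ)))
        (𝓝 (u, (0 : ℝ × ℝ))) := by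
      have h1 : Tendsto (fun z : ℝ × (ℝ × ℝ) => φ z.2) (𝓝 ((0 : ℝ), (0 : ℝ × ℝ))) (𝓝 0) := by
        have h := hφ.continuousAt.tendsto
        rw [hφ0] at h
        exact h.comp (continuous_snd.tendsto ((0 : ℝ), (0 : ℝ × ℝ)))
      have h2 := ((continuous_fst.tendsto ((0 : ℝ), (0 : ℝ × ℝ))).add h1).const_add u
      simp only [add_zero] at h2
      exact h2.prodMk_nhds (continuous_snd.tendsto ((0 : ℝ), (0 : ℝ × ℝ)))
    have hmap : Tendsto (fun z : ℝ × (ℝ × ℝ) => (z.1 * z.2.1 ^ a, (z.2.1 ^ b, z.2.2)))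
        (𝓝 (u, (0 : ℝ × ℝ))) (𝓝 ((0 : ℝ), (0 : ℝ × ℝ))) := by
      have : Continuous fun z : ℝ × (ℝ × ℝ) => (z.1 * z.2.1 ^ a, (z.2.1 ^ b, z.2.2)) := by fun_prop
      exact this.tendsto' _ _ (by simp [ha.ne', hb.ne'])
    filter_upwards [hw.eventually (H.taylor.newton_eq hE.eq ha hb hE.le le_rfl u),
      (hmap.comp hw).eventually H.eq] with z h1 h2
    simp only [Function.comp] at h1 h2
    rw [h1] at h2
    have e1 : Λ (z.2.1 ^ b, z.2.2) + (u + φ z.2) * z.2.1 ^ (b * A + a) + z.1 * z.2.1 ^ (b * A + a) =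
        Λ (z.2.1 ^ b, z.2.2) + (u + (z.1 + φ z.2)) * z.2.1 ^ a * (z.2.1 ^ b) ^ A := by
      rw [← pow_mul, pow_add]; ring
    rw [e1, pow_mul z.2.1 b D, h2, ← pow_mul, ← mul_assoc, ← pow_add]
  · filter_upwards [H.eventually_bound ((H.eventually_edgeForm hE).mono fun t h => h.2.2), hφt] with
      t h1 h2 _
    replace h1 := h1.2
    have h3 : (fun τ : ℝ => Λ (τ ^ b, t)) =O[𝓝[>] 0] fun τ : ℝ => τ ^ (((b * D : ℕ)) : ℝ) := by
      refine (h1.comp_tendsto (tendsto_pow_zero_right hb)).congr' EventuallyEq.rfl ?_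
      filter_upwards with τ
      simp only [Function.comp]
      rw [rpow_natCast, rpow_natCast, pow_mul]
    refine h3.add ?_
    have h4 : (fun τ : ℝ => τ ^ (b * A + a)) =O[𝓝[>] 0] fun τ : ℝ => τ ^ (((b * D : ℕ)) : ℝ) := by
      have := isBigO_rpow_rpow (κ := ((b * A + a : ℕ) : ℝ)) (κ' := ((b * D : ℕ) : ℝ))
        (by exact_mod_cast hle)
      simpa only [rpow_natCast] using this
    simpa using (h2.isBigO_one ℝ).mul h4
  · intro i hi
    have h1 : b * D - (b * A + a) = 0 := by omega
    have h2 : AnalyticAt ℝ (fun τ : ℝ => R' i (0, (τ, 0))) 0 :=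
      AnalyticAt.fun_comp (g := R' i) (f := fun σ : ℝ => ((0 : ℝ), (σ, (0 : ℝ))))
        (hR'.analyticAt i) (by fun_prop)
    rw [h1, mul_zero, Nat.cast_zero]
    simp only [rpow_zero]
    exact (h2.continuousAt.tendsto.within).isBigO_one ℝ
  · exact H.track_child hE hle hreg hφ hφ0

end Child

/-! ### Equisingularity in a chart -/

section Equisingular

variable {F : ℝ × ℝ × ℝ → ℝ} {s : ℤˣ} {D A C p : ℕ} {Λ : ℝ × ℝ → ℝ} {G : ℝ × (ℝ × ℝ) → ℝ}
  {R : ℕ → ℝ × (ℝ × ℝ) → ℝ} {a b : ℕ} {k : ℕ → ℕ} {β : ℕ → ℝ × ℝ → ℝ}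

theorem eventually_forall_Ioo {P : ℝ → Prop} (h : ∀ᶠ t in 𝓝 (0 : ℝ), P t) :
    ∀ᶠ δ in 𝓝[>] (0 : ℝ), ∀ t ∈ Ioo (-δ) δ, P t := by
  obtain ⟨r, hr, h1⟩ := Metric.eventually_nhds_iff.1 h
  filter_upwards [nhdsWithin_le_nhds (gt_mem_nhds hr)] with δ hδ t ht
  exact h1 (by rw [Real.dist_eq, sub_zero]; exact (abs_lt.2 ht).trans hδ)

/-- Over `|t| < δ`, the arc `γ` is a member of an analytic family of arcs of the chart whose relative
Newton polygon is constant, as far as it is seen by the chart. -/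
abbrev HasEquisingularFamily (F : ℝ × ℝ × ℝ → ℝ) (s : ℤˣ) (D A : ℕ) (Λ : ℝ × ℝ → ℝ) (δ : ℝ)
    (γ : RArc) : Prop :=
  ∃ Γ, IsAnalyticFamily δ Γ ∧ (∀ᶠ y in 𝓝[>] (0 : ℝ), (Γ 0).X y = γ.X y) ∧
    ∀ t ∈ Ioo (-δ) δ, InChart s D A (Λ ⟨·, t⟩) (Γ t) ∧ ∀ h, (A : ℝ) / D < h → ∀ e,
      (RelBound (slice F t) (Γ t) h e ↔ RelBound (slice F 0) (Γ 0) h e)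

/-- The conclusion of the theorem, over `|t| < δ`, for the arcs of one chart: they deform, and the
contact of two deformed arcs, as far as it is below their heights, is constant. -/
structure EquisingularOn (F : ℝ × ℝ × ℝ → ℝ) (s : ℤˣ) (D A : ℕ) (Λ : ℝ × ℝ → ℝ) (δ : ℝ) :
    Prop where
  exists_family : ∀ γ, InChart s D A (Λ ⟨·, 0⟩) γ → HasEquisingularFamily F s D A Λ δ γ
  contact : ∀ h : ℝ, ∀ δ' ≤ δ, ∀ Γ H, IsContFamily δ' Γ → IsContFamily δ' H →
    (∀ t ∈ Ioo (-δ') δ', InChart s D A (Λ ⟨·, t⟩) (Γ t) ∧ HeightGE (slice F t) (Γ t) h) →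
    (∀ t ∈ Ioo (-δ') δ', InChart s D A (Λ ⟨·, t⟩) (H t) ∧ HeightGE (slice F t) (H t) h) →
    (∀ t ∈ Ioo (-δ') δ', (fun y => (Γ t).X y - (H t).X y) =O[𝓝[>] 0] fun y => y ^ h) ∨
    ∀ t ∈ Ioo (-δ') δ', ¬ (fun y => (Γ t).X y - (H t).X y) =O[𝓝[>] 0] fun y => y ^ h

/-- An arc is deformed by moving it along with a centre. -/
theorem exists_isAnalyticFamily_chartCoord_eq {γ : RArc} (hs : γ.sgn = s) (hD : 0 < D) (A : ℕ)
    {δ : ℝ} (hδ : 0 < δ) (hΛ : ∀ t ∈ Ioo (-δ) δ, AnalyticAt ℝ Λ (0, t) ∧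
      (Λ ⟨·, t⟩) =O[𝓝[>] 0] fun σ : ℝ => σ ^ (D : ℝ)) :
    ∃ Γ, IsAnalyticFamily δ Γ ∧ (∀ᶠ y in 𝓝[>] (0 : ℝ), (Γ 0).X y = γ.X y) ∧
      ∀ t ∈ Ioo (-δ) δ, (Γ t).sgn = s ∧ chartCoord D A (Λ ⟨·, t⟩) (Γ t) =ᶠ[𝓝[>] 0]
        chartCoord D A (Λ ⟨·, 0⟩) γ := by
  have h0 : (0 : ℝ) ∈ Ioo (-δ) δ := ⟨by linarith, hδ⟩
  obtain ⟨Γ, hΓ, h1⟩ := exists_isAnalyticFamily γ hD hδ (fun t ht => (hΛ t ht).1)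
    fun t ht => (hΛ t ht).2.sub (hΛ 0 h0).2
  refine ⟨Γ, hΓ, ?_, fun t ht => ⟨(h1 t ht).1.trans hs, ?_⟩⟩
  · filter_upwards [(h1 0 h0).2] with y hy
    rw [hy, sub_self, add_zero]
  · filter_upwards [(tendsto_pow_zero_right hD).eventually (h1 t ht).2, self_mem_nhdsWithin] with
      σ h2 hσ
    have hσ' : (0 : ℝ) < σ := hσ
    rw [chartCoord, chartCoord, h2, pow_root hD hσ'.le]
    ring

theorem mul_sub_pos (hD : 0 < D) {h : ℝ} (hh : (A : ℝ) / D < h) :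
    0 < (D : ℝ) * h - A ∧ (A + ((D : ℝ) * h - A)) / D = h := by
  have hD' : (0 : ℝ) < D := mod_cast hD
  rw [div_lt_iff₀ hD'] at hh
  exact ⟨by linarith, by field_simp; ring⟩

theorem add_mul_sub_div (hD : 0 < D) (h : ℝ) : ((A : ℝ) + ((D : ℝ) * h - A)) / D = h := by
  have hD' : (0 : ℝ) < D := mod_cast hD
  field_simp
  ring

/-- Arcs of large height in a slice agree up to the height. -/
theorem EdgeForm.isBigO_sub {f : ℝ × ℝ → ℝ} {Λ : ℝ → ℝ} {g : ℝ × ℝ → ℝ} {γ μ : RArc} {θ h : ℝ}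
    (H : EdgeForm f ((s : ℤ) : ℝ) D A C p Λ g θ) (hΛ : AnalyticAt ℝ Λ 0)
    (hγ : InChart s D A Λ γ ∧ HeightGE f γ h) (hμ : InChart s D A Λ μ ∧ HeightGE f μ h)
    (hle : h ≤ (A + θ) / D) : (fun y => γ.X y - μ.X y) =O[𝓝[>] 0] fun y => y ^ h := by
  have key : ∀ ν : RArc, InChart s D A Λ ν ∧ HeightGE f ν h →
      chartCoord D A Λ ν =O[𝓝[>] 0] fun σ => σ ^ (D * h - A) := fun ν hν =>
    H.coord_isBigO hΛ (by rw [RArc.ε, hν.1.1]) hν.1.2 hν.2 hle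
  have h1 := (isBigO_chartCoord_sub H.D_pos A Λ).2 ((key γ hγ).sub (key μ hμ))
  rwa [add_mul_sub_div H.D_pos] at h1

/-- If the coefficients below the top one vanish, the centre is the only zero set. -/
theorem Chart.equisingularOn_of_eq_zero (H : Chart F s D A C p Λ G R)
    (hz : ∀ᶠ t in 𝓝 (0 : ℝ), ∀ i < p, ∀ᶠ σ in 𝓝[>] (0 : ℝ), R i (0, (σ, t)) = 0)
    (hz0 : ∀ᶠ t in 𝓝 (0 : ℝ), ∀ i < p, R i (0, (0, t)) = 0) :
    ∀ᶠ δ in 𝓝[>] (0 : ℝ), EquisingularOn F s D A Λ δ := by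
  have hform : ∀ᶠ t in 𝓝 (0 : ℝ), ∀ θ > 0, EdgeForm (slice F t) ((s : ℤ) : ℝ) D A C p
      (Λ ⟨·, t⟩) (fun z => G (z.1, (z.2, t))) θ := by
    filter_upwards [H.edgeForm, hz] with t h1 h2 θ hθ
    exact h1 θ hθ fun i hi => EventuallyEq.trans_isBigO (h2 i hi) (isBigO_zero _ _)
  filter_upwards [eventually_forall_Ioo (hform.and (H.eventually_bound hz0)),
    self_mem_nhdsWithin] with δ hall hδ
  have h0 : (0 : ℝ) ∈ Ioo (-δ) δ := ⟨neg_neg_of_pos hδ, hδ⟩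
  constructor
  · rintro γ ⟨hs, hv⟩
    obtain ⟨Γ, hΓ, hΓ0, hΓt⟩ := exists_isAnalyticFamily_chartCoord_eq hs H.D_pos A hδ
      fun t ht => (hall t ht).2
    have hin : ∀ t ∈ Ioo (-δ) δ, InChart s D A (Λ ⟨·, t⟩) (Γ t) := fun t ht =>
      ⟨(hΓt t ht).1, hv.congr' (hΓt t ht).2.symm⟩
    refine ⟨Γ, hΓ, hΓ0, fun t ht => ⟨hin t ht, fun h hh e => ?_⟩⟩
    obtain ⟨hpos, hdiv⟩ := mul_sub_pos H.D_pos hh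
    suffices ∃ N : Prop, ∀ t ∈ Ioo (-δ) δ, (RelBound (slice F t) (Γ t) h e ↔ N) by
      obtain ⟨N, hN⟩ := this
      exact (hN t ht).trans (hN 0 h0).symm
    rcases chartCoord_dichotomy H.D_pos (analyticAt_slice (hall 0 h0).2.1) A γ with
      h1 | ⟨κ, c, hc0, hc⟩
    · refine ⟨(D : ℝ) * e ≤ C + p * (D * h - A), fun t ht => ?_⟩
      have := ((hall t ht).1 _ hpos).relBound_iff (by rw [RArc.ε, (hin t ht).1]) (hin t ht).2 hpos
        le_rfl (((hΓt t ht).2.trans h1).trans_isBigO (isBigO_zero _ _)) e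
      rwa [hdiv] at this
    · have hκ := pos_of_tendsto_div_rpow hv hc hc0
      refine ⟨(D : ℝ) * e ≤ C + p * min κ (D * h - A), fun t ht => ?_⟩
      have hc' : Tendsto (fun σ => chartCoord D A (Λ ⟨·, t⟩) (Γ t) σ / σ ^ κ) (𝓝[>] 0)
          (𝓝 c) := hc.congr' ((hΓt t ht).2.symm.div EventuallyEq.rfl)
      have hH := (hall t ht).1 (κ + 1) (by linarith)
      have := hH.relBound_iff_min (by rw [RArc.ε, (hin t ht).1]) (hin t ht).2 (κ := κ) (by linarith)
        hpos (isBigO_rpow_of_tendsto_div hc')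
        (hH.lower_coord (hin t ht).2 (by linarith) hc' hc0) e
      rwa [hdiv] at this
  · refine fun h δ' hδ' Γ Γ' _ _ hΓ hΓ' => Or.inl fun t ht => ?_
    have ht' : t ∈ Ioo (-δ) δ := ⟨(neg_le_neg hδ').trans_lt ht.1, ht.2.trans_le hδ'⟩
    refine ((hall t ht').1 (max 1 (D * h - A)) (by positivity)).isBigO_sub
      (analyticAt_slice (hall t ht').2.1) (hΓ t ht) (hΓ' t ht) ?_
    have hD' : (0 : ℝ) < D := mod_cast H.D_pos
    rw [le_div_iff₀ hD']
    linarith [le_max_right (1 : ℝ) (D * h - A)]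

/-- If the coefficients below the top one vanish on the exceptional line, then zeros of `G` on that
line near the origin are at `v = 0`. -/
theorem IsTaylorSeq.eventually_eq_zero_of_zero (hG : IsTaylorSeq G (0 : ℝ × ℝ) R) (hp : 0 < p)
    (htop : R p (0, 0) ≠ 0) : ∀ᶠ q in 𝓝 (0 : ℝ × ℝ),
      (∀ i < p, R i (0, (0, q.2)) = 0) → G (q.1, (0, q.2)) = 0 → q.1 = 0 := by
  filter_upwards [eventually_nhds_point (hG.expand p),
    Chart.eventually_ne_of_analyticAt (hG.analyticAt p) htop] with q h1 h3 h2 h4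
  rw [h1.self_of_nhds, sum_eq_zero (fun i hi => by rw [h2 i (Finset.mem_range.1 hi), mul_zero]),
    zero_add] at h4
  exact (pow_eq_zero_iff hp.ne').1 ((mul_eq_zero.1 h4).resolve_right h3)

/-- The roots of a polynomial whose coefficients are continuous at `0` and whose leading coefficient
does not vanish stay close to the roots at `0`. -/
theorem eventually_edgePoly_ne_zero {c : ℝ → ℕ → ℝ} (hp : 0 < p)
    (hc : ∀ i, ContinuousAt (fun t => c t i) 0) (htop : c 0 p ≠ 0) {U : Set ℝ} (hU : IsOpen U)
    (hroot : ∀ w, (edgePoly p (c 0)).eval w = 0 → w ∈ U) :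
    ∀ᶠ t in 𝓝 (0 : ℝ), ∀ w, (edgePoly p (c t)).eval w = 0 → w ∈ U := by
  set B : ℝ → ℝ := fun t => (∑ i ∈ Finset.range p, |c t i|) / |c t p| with hB
  have hBc : ContinuousAt B 0 := by
    refine ContinuousAt.div ?_ (hc p).abs (abs_ne_zero.2 htop)
    exact tendsto_finsetSum _ fun i _ => (hc i).abs
  set K := max 1 (B 0 + 1)
  have hcpt : ∀ᶠ t in 𝓝 (0 : ℝ), ∀ w ∈ Icc (-K) K \ U, (edgePoly p (c t)).eval w ≠ 0 := by
    refine eventually_forall_of_isCompact (p := fun z : ℝ × ℝ => (edgePoly p (c z.2)).eval z.1 ≠ 0)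
      (isCompact_Icc.diff hU) fun w hw => ?_
    have hne : (edgePoly p (c 0)).eval w ≠ 0 := fun h => hw.2 (hroot w h)
    rw [← nhds_prod_eq]
    refine ContinuousAt.eventually_ne (g := fun z : ℝ × ℝ => (edgePoly p (c z.2)).eval z.1) ?_ hne
    have hc2 : ∀ i, ContinuousAt (fun z : ℝ × ℝ => c z.2 i) (w, 0) := fun i =>
      ContinuousAt.comp (g := fun t => c t i) (f := fun z : ℝ × ℝ => z.2) (hc i) continuousAt_snd
    simp only [eval_edgePoly]
    exact (tendsto_finsetSum _ fun i _ => (continuousAt_fst.pow i).mul (hc2 i)).add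
      ((continuousAt_fst.pow p).mul (hc2 p))
  filter_upwards [hcpt, hBc.eventually_lt continuousAt_const (show B 0 < B 0 + 1 by linarith),
    (hc p).eventually_ne htop] with t h1 h2 h3 w hw
  by_contra hwU
  refine h1 w ⟨abs_le.1 ?_, hwU⟩ hw
  rcases le_or_gt |w| 1 with h4 | h4
  · exact h4.trans (le_max_left _ _)
  refine le_trans ?_ (h2.le.trans (le_max_right _ _))
  rw [hB, le_div_iff₀ (abs_pos.2 h3)]
  obtain ⟨n, rfl⟩ : ∃ n, p = n + 1 := ⟨p - 1, by omega⟩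
  rw [eval_edgePoly] at hw
  have h5 : |w| ^ (n + 1) * |c t (n + 1)| ≤ |w| ^ n * ∑ i ∈ Finset.range (n + 1), |c t i| := by
    rw [← abs_pow, ← abs_mul, eq_neg_of_add_eq_zero_right hw, abs_neg, Finset.mul_sum]
    refine (Finset.abs_sum_le_sum_abs _ _).trans (Finset.sum_le_sum fun i hi => ?_)
    rw [abs_mul, abs_pow]
    exact mul_le_mul_of_nonneg_right (pow_le_pow_right₀ h4.le (Finset.mem_range_succ_iff.1 hi))
      (abs_nonneg _)
  rw [pow_succ, mul_assoc] at h5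
  exact le_of_mul_le_mul_left h5 (by positivity)

end Equisingular

/-! ### Equisingularity along an edge -/

section Branch

variable {F : ℝ × ℝ × ℝ → ℝ} {s : ℤˣ} {D A C p : ℕ} {Λ : ℝ × ℝ → ℝ} {G : ℝ × (ℝ × ℝ) → ℝ}
  {R : ℕ → ℝ × (ℝ × ℝ) → ℝ} {a b : ℕ} {k : ℕ → ℕ} {β : ℕ → ℝ × ℝ → ℝ}
  {J : ℝ → ℝ → ℝ} {S : Finset ℝ} {φ : ℝ → ℝ × ℝ → ℝ} {r δ : ℝ}

/-- The centre of the chart at the root `u` of an edge, moved by `φ`. -/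
def childCenter (A a b : ℕ) (Λ : ℝ × ℝ → ℝ) (u : ℝ) (φ : ℝ × ℝ → ℝ) (x : ℝ × ℝ) : ℝ :=
  Λ (x.1 ^ b, x.2) + (u + φ x) * x.1 ^ (b * A + a)

/-- Over `|t| < δ`, the germ has a chart with an edge of weight `a / b` and initial forms `J t`,
whose roots at `t = 0` are in `S` and whose roots at `t` are among the `u + φ u (0, t)`, `u ∈ S`;
these stay in disjoint intervals, and the deformation is equisingular in the charts at the roots. -/
structure EdgeTracking (F : ℝ × ℝ × ℝ → ℝ) (s : ℤˣ) (D A C p : ℕ) (Λ : ℝ × ℝ → ℝ)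
    (G : ℝ × (ℝ × ℝ) → ℝ) (a b : ℕ) (J : ℝ → ℝ → ℝ) (S : Finset ℝ) (φ : ℝ → ℝ × ℝ → ℝ) (r δ : ℝ) :
    Prop where
  pos : 0 < δ
  b_pos : 0 < b
  analytic : ∀ t ∈ Ioo (-δ) δ, AnalyticAt ℝ Λ (0, t) ∧
    (Λ ⟨·, t⟩) =O[𝓝[>] 0] fun σ : ℝ => σ ^ (D : ℝ)
  edgeForm : ∀ t ∈ Ioo (-δ) δ, EdgeForm (slice F t) ((s : ℤ) : ℝ) D A C p (Λ ⟨·, t⟩)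
    (fun z => G (z.1, (z.2, t))) ((a : ℝ) / b)
  lim : ∀ t ∈ Ioo (-δ) δ, ∀ w, Tendsto (fun z : ℝ × ℝ => G (z.1 * z.2 ^ ((a : ℝ) / b), (z.2, t)) /
    z.2 ^ (p * ((a : ℝ) / b))) (𝓝 w ×ˢ 𝓝[>] 0) (𝓝 (J t w))
  root : ∀ t ∈ Ioo (-δ) δ, ∀ w, J t w = 0 → ∃ u ∈ S, |w - u| < r
  eq_zero : ∀ t ∈ Ioo (-δ) δ, ∀ u ∈ S, ∀ v, |v| < r + r → J t (u + (v + φ u (0, t))) = 0 → v = 0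
  abs_lt : ∀ t ∈ Ioo (-δ) δ, ∀ u ∈ S, |φ u (0, t)| < r
  separated : ∀ u ∈ S, ∀ u' ∈ S, u ≠ u' → r + r ≤ |u - u'|
  zero : ∀ u ∈ S, φ u (0, 0) = 0
  tendsto : ∀ t ∈ Ioo (-δ) δ, ∀ u ∈ S,
    Tendsto (fun τ => u + φ u (τ, t)) (𝓝[>] 0) (𝓝 (u + φ u (0, t)))
  child_analytic : ∀ t ∈ Ioo (-δ) δ, ∀ u ∈ S, AnalyticAt ℝ (childCenter A a b Λ u (φ u)) (0, t) ∧
    (fun σ => childCenter A a b Λ u (φ u) (σ, t)) =O[𝓝[>] 0] fun σ : ℝ => σ ^ ((b * D : ℕ) : ℝ)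
  child : ∀ u ∈ S, EquisingularOn F s (b * D) (b * A + a) (childCenter A a b Λ u (φ u)) δ

namespace EdgeTracking

variable (H : EdgeTracking F s D A C p Λ G a b J S φ r δ)

include H

theorem zero_mem : (0 : ℝ) ∈ Ioo (-δ) δ := ⟨neg_neg_of_pos H.pos, H.pos⟩

theorem D_pos : 0 < D := (H.edgeForm 0 H.zero_mem).D_pos

theorem theta_pos : (0 : ℝ) < (a : ℝ) / b := (H.edgeForm 0 H.zero_mem).pos

theorem child_div : ((b * A + a : ℕ) : ℝ) / (b * D : ℕ) = (A + (a : ℝ) / b) / D := by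
  have hb' : (0 : ℝ) < b := mod_cast H.b_pos
  push_cast
  field_simp

theorem tendsto_child_iff {t : ℝ} (ht : t ∈ Ioo (-δ) δ) {u : ℝ} (hu : u ∈ S) (γ : RArc) {ω : ℝ} :
    Tendsto (chartCoord (b * D) (b * A + a) (fun τ => childCenter A a b Λ u (φ u) (τ, t)) γ)
      (𝓝[>] 0) (𝓝 ω) ↔
    Tendsto (fun σ => chartCoord D A (Λ ⟨·, t⟩) γ σ / σ ^ ((a : ℝ) / b)) (𝓝[>] 0)
      (𝓝 (u + φ u (0, t) + ω)) :=
  tendsto_chartCoord_child (Λ := fun σ => Λ (σ, t)) (ψ := fun τ => u + φ u (τ, t)) γ H.b_pos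
    (H.tendsto t ht u hu)

theorem inChart_of_tendsto {t w : ℝ} {γ : RArc} (hs : γ.sgn = s)
    (hw : Tendsto (fun σ => chartCoord D A (Λ ⟨·, t⟩) γ σ / σ ^ ((a : ℝ) / b)) (𝓝[>] 0)
      (𝓝 w)) : InChart s D A (Λ ⟨·, t⟩) γ :=
  ⟨hs, (isBigO_rpow_of_tendsto_div hw).trans_tendsto (tendsto_rpow_nhds_zero H.theta_pos)⟩

/-- The relative Newton polygon of an arc whose weighted coordinate does not tend to a root. -/
theorem relBound_iff_of_lim {t w : ℝ} (ht : t ∈ Ioo (-δ) δ) {γ : RArc} (hs : γ.sgn = s)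
    (hw : Tendsto (fun σ => chartCoord D A (Λ ⟨·, t⟩) γ σ / σ ^ ((a : ℝ) / b)) (𝓝[>] 0)
      (𝓝 w)) (hJ : J t w ≠ 0) {h : ℝ} (hh : (A : ℝ) / D < h) (e : ℝ) :
    RelBound (slice F t) γ h e ↔ (D : ℝ) * e ≤ C + p * min ((a : ℝ) / b) (D * h - A) := by
  obtain ⟨hpos, hdiv⟩ := mul_sub_pos H.D_pos hh
  have := (H.edgeForm t ht).relBound_iff_min (γ := γ) (by rw [RArc.ε, hs])
    (H.inChart_of_tendsto hs hw).2 le_rfl hpos (isBigO_rpow_of_tendsto_div hw)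
    (EdgeForm.lower_coord_of_lim (g := fun z => G (z.1, (z.2, t))) (H.lim t ht w) hJ hw) e
  rwa [hdiv] at this

theorem exists_family_of_tendsto_root {γ : RArc} (hs : γ.sgn = s) {u : ℝ} (hu : u ∈ S)
    (hw : Tendsto (fun σ => chartCoord D A (Λ ⟨·, 0⟩) γ σ / σ ^ ((a : ℝ) / b)) (𝓝[>] 0)
      (𝓝 u)) : HasEquisingularFamily F s D A Λ δ γ := by
  have hin : InChart s (b * D) (b * A + a) (fun τ => childCenter A a b Λ u (φ u) (τ, 0)) γ := by
    refine ⟨hs, (H.tendsto_child_iff H.zero_mem hu γ).2 ?_⟩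
    rwa [H.zero u hu, add_zero, add_zero]
  obtain ⟨Γ, hΓ, hΓ0, hΓt⟩ := (H.child u hu).exists_family γ hin
  have hwt : ∀ t ∈ Ioo (-δ) δ, Tendsto (fun σ => chartCoord D A (Λ ⟨·, t⟩) (Γ t) σ /
      σ ^ ((a : ℝ) / b)) (𝓝[>] 0) (𝓝 (u + φ u (0, t) + 0)) := fun t ht =>
    (H.tendsto_child_iff ht hu (Γ t)).1 (hΓt t ht).1.2
  refine ⟨Γ, hΓ, hΓ0, fun t ht => ⟨H.inChart_of_tendsto (hΓt t ht).1.1 (hwt t ht),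
    fun h hh e => ?_⟩⟩
  obtain ⟨hpos, hdiv⟩ := mul_sub_pos H.D_pos hh
  rcases lt_or_ge (((b * A + a : ℕ) : ℝ) / (b * D : ℕ)) h with h1 | h1
  · exact (hΓt t ht).2 h h1 e
  have hle : (D : ℝ) * h - A ≤ (a : ℝ) / b := by
    have hD' : (0 : ℝ) < D := mod_cast H.D_pos
    rw [H.child_div, le_div_iff₀ hD'] at h1
    linarith
  have key : ∀ t ∈ Ioo (-δ) δ, (RelBound (slice F t) (Γ t) h e ↔
      (D : ℝ) * e ≤ C + p * (D * h - A)) := fun t ht => by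
    have := (H.edgeForm t ht).relBound_iff (γ := Γ t) (by rw [RArc.ε, (hΓt t ht).1.1])
      (H.inChart_of_tendsto (hΓt t ht).1.1 (hwt t ht)).2 hpos hle
      ((isBigO_rpow_of_tendsto_div (hwt t ht)).trans (isBigO_rpow_rpow hle)) e
    rwa [hdiv] at this
  exact (key t ht).trans (key 0 H.zero_mem).symm

theorem exists_family {γ : RArc} (hγ : InChart s D A (Λ ⟨·, 0⟩) γ) :
    HasEquisingularFamily F s D A Λ δ γ := by
  set θ : ℝ := (a : ℝ) / b
  have hdich : (∃ κ < θ, ∃ c, c ≠ 0 ∧ Tendsto (fun σ => chartCoord D A (Λ ⟨·, 0⟩) γ σ /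
      σ ^ κ) (𝓝[>] 0) (𝓝 c)) ∨ ∃ w, Tendsto (fun σ => chartCoord D A (Λ ⟨·, 0⟩) γ σ /
      σ ^ θ) (𝓝[>] 0) (𝓝 w) := by
    rcases chartCoord_dichotomy H.D_pos (analyticAt_slice (H.analytic 0 H.zero_mem).1) A γ with
      h1 | ⟨κ, c, hc0, hc⟩
    · refine Or.inr ⟨0, tendsto_const_nhds.congr' ?_⟩
      filter_upwards [h1] with σ h2
      rw [h2, zero_div]
    rcases lt_trichotomy κ θ with h1 | h1 | h1
    · exact Or.inl ⟨κ, h1, c, hc0, hc⟩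
    · exact Or.inr ⟨c, h1 ▸ hc⟩
    · exact Or.inr ⟨0, tendsto_div_rpow_of_isBigO (isBigO_rpow_of_tendsto_div hc) h1⟩
  rcases hdich with ⟨κ, hκ, c, hc0, hc⟩ | ⟨w, hw⟩
  · obtain ⟨Γ, hΓ, hΓ0, hΓt⟩ := exists_isAnalyticFamily_chartCoord_eq hγ.1 H.D_pos A H.pos H.analytic
    have hin : ∀ t ∈ Ioo (-δ) δ, InChart s D A (Λ ⟨·, t⟩) (Γ t) := fun t ht =>
      ⟨(hΓt t ht).1, hγ.2.congr' (hΓt t ht).2.symm⟩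
    refine ⟨Γ, hΓ, hΓ0, fun t ht => ⟨hin t ht, fun h hh e => ?_⟩⟩
    obtain ⟨hpos, hdiv⟩ := mul_sub_pos H.D_pos hh
    have key : ∀ t ∈ Ioo (-δ) δ, (RelBound (slice F t) (Γ t) h e ↔
        (D : ℝ) * e ≤ C + p * min κ (D * h - A)) := fun t ht => by
      have hc' : Tendsto (fun σ => chartCoord D A (Λ ⟨·, t⟩) (Γ t) σ / σ ^ κ) (𝓝[>] 0)
          (𝓝 c) := hc.congr' ((hΓt t ht).2.symm.div EventuallyEq.rfl)
      have := (H.edgeForm t ht).relBound_iff_min (by rw [RArc.ε, (hin t ht).1]) (hin t ht).2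
        hκ.le hpos (isBigO_rpow_of_tendsto_div hc')
        ((H.edgeForm t ht).lower_coord (hin t ht).2 hκ hc' hc0) e
      rwa [hdiv] at this
    exact (key t ht).trans (key 0 H.zero_mem).symm
  by_cases hnear : ∃ u ∈ S, |w - u| < r
  · obtain ⟨u, hu, hwu⟩ := hnear
    rcases eq_or_ne w u with rfl | hne
    · exact H.exists_family_of_tendsto_root hγ.1 hu hw
    -- The arc is moved along with the nearby root, so that its limit does not become a root.
    obtain ⟨Γ, hΓ, hΓ0, hΓt⟩ := exists_isAnalyticFamily_chartCoord_eq hγ.1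
      (Nat.mul_pos H.b_pos H.D_pos) (b * A + a) H.pos fun t ht => H.child_analytic t ht u hu
    have h0 := (H.tendsto_child_iff H.zero_mem hu γ (ω := w - u)).2 (by
      rwa [H.zero u hu, add_zero, add_sub_cancel])
    have hwt : ∀ t ∈ Ioo (-δ) δ, Tendsto (fun σ => chartCoord D A (Λ ⟨·, t⟩) (Γ t) σ /
        σ ^ θ) (𝓝[>] 0) (𝓝 (u + φ u (0, t) + (w - u))) := fun t ht =>
      (H.tendsto_child_iff ht hu (Γ t)).1 (h0.congr' (hΓt t ht).2.symm)
    have hJ : ∀ t ∈ Ioo (-δ) δ, J t (u + φ u (0, t) + (w - u)) ≠ 0 := fun t ht hJ0 => by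
      refine sub_ne_zero.2 hne (H.eq_zero t ht u hu _ (by linarith [abs_nonneg (w - u)]) ?_)
      rwa [add_comm (w - u), ← add_assoc]
    exact ⟨Γ, hΓ, hΓ0, fun t ht => ⟨H.inChart_of_tendsto (hΓt t ht).1 (hwt t ht), fun h hh e =>
      (H.relBound_iff_of_lim ht (hΓt t ht).1 (hwt t ht) (hJ t ht) hh e).trans
      (H.relBound_iff_of_lim H.zero_mem (hΓt 0 H.zero_mem).1 (hwt 0 H.zero_mem) (hJ 0 H.zero_mem)
        hh e).symm⟩⟩
  · obtain ⟨Γ, hΓ, hΓ0, hΓt⟩ := exists_isAnalyticFamily_chartCoord_eq hγ.1 H.D_pos A H.pos H.analytic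
    have hwt : ∀ t ∈ Ioo (-δ) δ, Tendsto (fun σ => chartCoord D A (Λ ⟨·, t⟩) (Γ t) σ /
        σ ^ θ) (𝓝[>] 0) (𝓝 w) := fun t ht =>
      hw.congr' ((hΓt t ht).2.symm.div EventuallyEq.rfl)
    have hJ : ∀ t ∈ Ioo (-δ) δ, J t w ≠ 0 := fun t ht hJ0 => hnear (H.root t ht w hJ0)
    exact ⟨Γ, hΓ, hΓ0, fun t ht => ⟨H.inChart_of_tendsto (hΓt t ht).1 (hwt t ht), fun h hh e =>
      (H.relBound_iff_of_lim ht (hΓt t ht).1 (hwt t ht) (hJ t ht) hh e).trans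
      (H.relBound_iff_of_lim H.zero_mem (hΓt 0 H.zero_mem).1 (hwt 0 H.zero_mem) (hJ 0 H.zero_mem)
        hh e).symm⟩⟩

/-- Arcs of height beyond the edge follow one root of the edge. -/
theorem exists_tendsto_root {L : ℝ → RArc} (hL : IsContFamily δ L) (hLX : ∀ t ∈ Ioo (-δ) δ,
      ∀ᶠ σ in 𝓝[>] (0 : ℝ), (L t).X (σ ^ D) = Λ (σ, t)) {h δ' : ℝ} (hδ : 0 < δ') (hδ' : δ' ≤ δ)
    {Γ : ℝ → RArc} (hΓ : IsContFamily δ' Γ) (hin : ∀ t ∈ Ioo (-δ') δ',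
      InChart s D A (Λ ⟨·, t⟩) (Γ t) ∧ HeightGE (slice F t) (Γ t) h)
    (hh : (A + (a : ℝ) / b) / D < h) : ∃ u ∈ S, ∀ t ∈ Ioo (-δ') δ',
      Tendsto (fun σ => chartCoord D A (Λ ⟨·, t⟩) (Γ t) σ / σ ^ ((a : ℝ) / b)) (𝓝[>] 0)
        (𝓝 (u + φ u (0, t))) := by
  have hsub : Ioo (-δ') δ' ⊆ Ioo (-δ) δ := Ioo_subset_Ioo (neg_le_neg hδ') hδ'
  set W : ℝ → ℝ := fun t => (Γ t).coeffAt ((A + (a : ℝ) / b) / D) -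
    (L t).coeffAt ((A + (a : ℝ) / b) / D) with hW
  have hWt : ∀ t ∈ Ioo (-δ') δ', J t (W t) = 0 ∧ Tendsto (fun σ =>
      chartCoord D A (Λ ⟨·, t⟩) (Γ t) σ / σ ^ ((a : ℝ) / b)) (𝓝[>] 0) (𝓝 (W t)) := by
    intro t ht
    obtain ⟨w, hJw, hw⟩ := (H.edgeForm t (hsub ht)).exists_root
      (analyticAt_slice (H.analytic t (hsub ht)).1) (by rw [RArc.ε, (hin t ht).1.1]) (hin t ht).1.2
      (H.lim t (hsub ht)) (hin t ht).2 hh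
    have := tendsto_chartCoord_div H.D_pos (hLX t (hsub ht)) (isBigO_rpow_of_tendsto_div hw)
    obtain rfl := tendsto_nhds_unique hw this
    exact ⟨hJw, hw⟩
  have hWc : ContinuousOn W (Ioo (-δ') δ') :=
    (hΓ.continuousOn_coeffAt _).sub ((hL.continuousOn_coeffAt _).mono hsub)
  have h0 : (0 : ℝ) ∈ Ioo (-δ') δ' := ⟨neg_neg_of_pos hδ, hδ⟩
  obtain ⟨u, hu, hWu⟩ := H.root 0 (hsub h0) _ (hWt 0 h0).1
  have himg : W '' Ioo (-δ') δ' ⊆ ball u r := by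
    refine (isPreconnected_Ioo.image W hWc).subset_left_of_subset_union Metric.isOpen_ball
      (isOpen_biUnion (s := {x | x ∈ S ∧ u ≠ x}) (f := fun x => ball x r)
        fun x _ => Metric.isOpen_ball) ?_ ?_ ⟨W 0, ⟨0, h0, rfl⟩, hWu⟩
    · rw [disjoint_iUnion₂_right]
      exact fun x hx => Metric.ball_disjoint_ball (H.separated u hu x hx.1 hx.2)
    · rintro _ ⟨t, ht, rfl⟩
      obtain ⟨x, hx, hWx⟩ := H.root t (hsub ht) _ (hWt t ht).1
      by_cases hux : u = x
      · exact Or.inl (hux ▸ hWx)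
      · exact Or.inr (mem_iUnion₂.2 ⟨x, ⟨hx, hux⟩, hWx⟩)
  refine ⟨u, hu, fun t ht => ?_⟩
  have h1 : |W t - u| < r := himg ⟨t, ht, rfl⟩
  have h2 := H.eq_zero t (hsub ht) u hu (W t - u - φ u (0, t))
    ((abs_sub _ _).trans_lt (add_lt_add h1 (H.abs_lt t (hsub ht) u hu)))
    (by rw [sub_add_cancel, add_sub_cancel]; exact (hWt t ht).1)
  have h3 : W t = u + φ u (0, t) := by linarith
  rw [← h3]
  exact (hWt t ht).2

theorem equisingularOn {L : ℝ → RArc} (hL : IsContFamily δ L) (hLX : ∀ t ∈ Ioo (-δ) δ,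
      ∀ᶠ σ in 𝓝[>] (0 : ℝ), (L t).X (σ ^ D) = Λ (σ, t)) : EquisingularOn F s D A Λ δ := by
  refine ⟨fun γ hγ => H.exists_family hγ, fun h δ' hδ' Γ Γ' hΓ hΓ' hin hin' => ?_⟩
  have hsub : Ioo (-δ') δ' ⊆ Ioo (-δ) δ := Ioo_subset_Ioo (neg_le_neg hδ') hδ'
  rcases le_or_gt δ' 0 with hδ | hδ
  · exact Or.inl fun t ht => by linarith [ht.1, ht.2]
  rcases le_or_gt h ((A + (a : ℝ) / b) / D) with hh | hh
  · exact Or.inl fun t ht => (H.edgeForm t (hsub ht)).isBigO_sub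
      (analyticAt_slice (H.analytic t (hsub ht)).1) (hin t ht) (hin' t ht) hh
  obtain ⟨u, hu, hw⟩ := H.exists_tendsto_root hL hLX hδ hδ' hΓ hin hh
  obtain ⟨u', hu', hw'⟩ := H.exists_tendsto_root hL hLX hδ hδ' hΓ' hin' hh
  rcases eq_or_ne u u' with rfl | hne
  · have key : ∀ Γ : ℝ → RArc, (∀ t ∈ Ioo (-δ') δ',
        InChart s D A (Λ ⟨·, t⟩) (Γ t) ∧ HeightGE (slice F t) (Γ t) h) →
        (∀ t ∈ Ioo (-δ') δ', Tendsto (fun σ => chartCoord D A (Λ ⟨·, t⟩) (Γ t) σ /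
          σ ^ ((a : ℝ) / b)) (𝓝[>] 0) (𝓝 (u + φ u (0, t)))) → ∀ t ∈ Ioo (-δ') δ',
        InChart s (b * D) (b * A + a) (fun σ => childCenter A a b Λ u (φ u) (σ, t)) (Γ t) ∧
          HeightGE (slice F t) (Γ t) h := fun Γ h1 h2 t ht =>
      ⟨⟨(h1 t ht).1.1, (H.tendsto_child_iff (hsub ht) hu (Γ t)).2 (by
        rw [add_zero]; exact h2 t ht)⟩, (h1 t ht).2⟩
    exact (H.child u hu).contact h δ' hδ' Γ Γ' hΓ hΓ' (key Γ hin hw) (key Γ' hin' hw')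
  · refine Or.inr fun t ht hO => ?_
    have hlt : (a : ℝ) / b < D * h - A := by
      have hD' : (0 : ℝ) < D := mod_cast H.D_pos
      rw [div_lt_iff₀ hD'] at hh
      linarith
    rw [← add_mul_sub_div (A := A) H.D_pos h, isBigO_chartCoord_sub H.D_pos A fun σ => Λ (σ, t)] at hO
    have h1 := tendsto_div_rpow_of_isBigO hO hlt
    have h2 := tendsto_nhds_unique (((hw t ht).sub (hw' t ht)).congr fun σ => (sub_div _ _ _).symm) h1
    have h3 : u - u' = φ u' (0, t) - φ u (0, t) := by linarith
    have h4 := H.separated u hu u' hu' hne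
    rw [h3] at h4
    exact absurd ((abs_sub _ _).trans_lt (add_lt_add (H.abs_lt t (hsub ht) u' hu')
      (H.abs_lt t (hsub ht) u hu))) (not_lt.2 h4)

end EdgeTracking

end Branch

/-! ### Equisingularity in every chart -/

section Induction

variable {F : ℝ × ℝ × ℝ → ℝ} {s : ℤˣ} {D A C p : ℕ} {Λ : ℝ × ℝ → ℝ} {G : ℝ × (ℝ × ℝ) → ℝ}
  {R : ℕ → ℝ × (ℝ × ℝ) → ℝ} {a b : ℕ} {k : ℕ → ℕ} {β : ℕ → ℝ × ℝ → ℝ}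

theorem eventually_forall_abs_lt {P : ℝ × ℝ → Prop} (h : ∀ᶠ q in 𝓝 (0 : ℝ × ℝ), P q) :
    ∀ᶠ r in 𝓝 (0 : ℝ), ∀ᶠ t in 𝓝 (0 : ℝ), ∀ v : ℝ, |v| < r + r → P (v, t) := by
  obtain ⟨ε, hε, h1⟩ := Metric.eventually_nhds_iff.1 h
  filter_upwards [gt_mem_nhds (half_pos hε)] with r hr
  filter_upwards [Metric.ball_mem_nhds (0 : ℝ) hε] with t ht v hv
  refine h1 ?_
  rw [Prod.dist_eq]
  exact max_lt (by simpa [Real.dist_eq] using hv.trans (by linarith)) ht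

/-- A deformation that is equisingular in the charts at the roots of an edge is equisingular. -/
theorem Chart.equisingularOn_of_edge (H : Chart F s D A C p Λ G R) (hE : IsEdge R p a b k β)
    (hchild : ∀ u, (edgePoly p (edgeCoeff R p a b k β 0)).eval u = 0 → ∃ φ : ℝ × ℝ → ℝ,
      AnalyticAt ℝ φ 0 ∧ φ 0 = 0 ∧
      (∀ᶠ q in 𝓝 (0 : ℝ × ℝ), (edgePoly p (edgeCoeff R p a b k β q.2)).eval
        (u + (q.1 + φ (0, q.2))) = 0 → q.1 = 0) ∧
      (∀ᶠ δ in 𝓝[>] (0 : ℝ), EquisingularOn F s (b * D) (b * A + a) (childCenter A a b Λ u φ) δ) ∧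
      ∀ᶠ t in 𝓝 (0 : ℝ), AnalyticAt ℝ (childCenter A a b Λ u φ) (0, t) ∧
        (fun σ => childCenter A a b Λ u φ (σ, t)) =O[𝓝[>] 0] fun σ : ℝ => σ ^ ((b * D : ℕ) : ℝ)) :
    ∀ᶠ δ in 𝓝[>] (0 : ℝ), EquisingularOn F s D A Λ δ := by
  set J : ℝ → ℝ → ℝ := fun t w => (edgePoly p (edgeCoeff R p a b k β t)).eval w
  have htop : edgeCoeff R p a b k β 0 p ≠ 0 := by rw [edgeCoeff_top]; exact H.top
  have hJ0 : edgePoly p (edgeCoeff R p a b k β 0) ≠ 0 := fun h0 => by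
    have := natDegree_edgePoly htop
    rw [h0, Polynomial.natDegree_zero] at this
    exact H.p_pos.ne this
  set S := (edgePoly p (edgeCoeff R p a b k β 0)).roots.toFinset with hS
  have hmem : ∀ u, u ∈ S ↔ J 0 u = 0 := fun u => by
    rw [hS, Multiset.mem_toFinset, mem_roots hJ0, Polynomial.IsRoot.def]
  have hchild' : ∀ u ∈ S, _ := fun u hu => hchild u ((hmem u).1 hu)
  choose! φ hφ hφ0 hφz hφE hφc using hchild'
  obtain ⟨r, ⟨hsep, hz⟩, hr⟩ : ∃ r : ℝ, ((∀ u ∈ S, ∀ u' ∈ S, u ≠ u' → r + r ≤ |u - u'|) ∧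
      ∀ u ∈ S, ∀ᶠ t in 𝓝 (0 : ℝ), ∀ v : ℝ, |v| < r + r →
        J t (u + (v + φ u (0, t))) = 0 → v = 0) ∧ 0 < r := by
    have h1 : ∀ᶠ r in 𝓝 (0 : ℝ), ∀ u ∈ S, ∀ u' ∈ S, u ≠ u' → r + r ≤ |u - u'| := by
      refine (Finset.eventually_all _).2 fun u _ => (Finset.eventually_all _).2 fun u' _ => ?_
      by_cases hne : u = u'
      · exact Eventually.of_forall fun r h => absurd hne h
      have h2 : Tendsto (fun r : ℝ => r + r) (𝓝 0) (𝓝 0) :=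
        (continuous_id.add continuous_id).tendsto' 0 0 (by simp)
      filter_upwards [h2.eventually (eventually_le_nhds (abs_pos.2 (sub_ne_zero.2 hne)))] with
        r h3 _ using h3
    have h2 := (Finset.eventually_all S).2 fun u hu => eventually_forall_abs_lt (hφz u hu)
    exact (((h1.and h2).within).and (self_mem_nhdsWithin (s := Ioi (0 : ℝ)))).exists
  have hU : IsOpen (⋃ u ∈ S, ball u r) := isOpen_biUnion fun _ _ => Metric.isOpen_ball
  have hroot := eventually_edgePoly_ne_zero H.p_pos
    (hE.continuousAt_edgeCoeff (H.taylor.analyticAt p)) htop hU fun w hw =>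
      mem_iUnion₂.2 ⟨w, (hmem w).2 hw, Metric.mem_ball_self hr⟩
  have hlt : ∀ u ∈ S, ∀ᶠ t in 𝓝 (0 : ℝ), |φ u (0, t)| < r := fun u hu => by
    have h1 := (hφ u hu).continuousAt.tendsto
    rw [hφ0 u hu] at h1
    filter_upwards [eventually_zero_prodMk (h1.eventually (Metric.ball_mem_nhds 0 hr))] with t ht
    simpa [Real.dist_eq] using ht
  have hφt := (Finset.eventually_all S).2 fun u hu => eventually_tendsto_add_slice (hφ u hu) u
  have hz0 := (H.eventually_edgeForm hE).mono fun t h => h.2.2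
  obtain ⟨δ₀, hδ₀, hcenter⟩ := H.exists_center hz0
  filter_upwards [eventually_forall_Ioo (H.eventually_bound hz0),
    eventually_forall_Ioo (H.eventually_edgeForm hE), eventually_forall_Ioo hroot,
    eventually_forall_Ioo ((Finset.eventually_all S).2 hz),
    eventually_forall_Ioo ((Finset.eventually_all S).2 hlt), eventually_forall_Ioo hφt,
    eventually_forall_Ioo ((Finset.eventually_all S).2 hφc), (Finset.eventually_all S).2 hφE,
    self_mem_nhdsWithin, nhdsWithin_le_nhds (gt_mem_nhds hδ₀)] with
    δ h1 h2 h3 h4 h5 h6 h7 h8 hδ hδ'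
  obtain ⟨L, hL, hLX⟩ := hcenter δ hδ'.le
  refine EdgeTracking.equisingularOn (C := C) (p := p) (G := G) (a := a) (b := b) (J := J) (S := S)
    (φ := φ) (r := r) ⟨hδ, hE.b_pos, h1, fun t ht => (h2 t ht).1, fun t ht => (h2 t ht).2.1,
      fun t ht w hw => ?_, h4, h5, hsep, fun u hu => hφ0 u hu, h6, h7, h8⟩ hL.isContFamily
      fun t ht => (hLX t ht).2
  obtain ⟨u, hu, hwu⟩ := mem_iUnion₂.1 (h3 t ht w hw)
  exact ⟨u, hu, hwu⟩

/-- By induction on the multiplicity, the deformation is equisingular in every chart. -/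
theorem Chart.equisingularOn (hreg : ∀ᶠ t in 𝓝 (0 : ℝ), RegularX (slice F t))
    (hpolar : ∀ γ : RArc, IsPolar (slice F 0) γ → HasStableBarDeformation F γ)
    (H : Chart F s D A C p Λ G R) :
    (∀ᶠ t in 𝓝 (0 : ℝ), ∀ i < p, R i (0, (0, t)) = 0) ∧
      ∀ᶠ δ in 𝓝[>] (0 : ℝ), EquisingularOn F s D A Λ δ := by
  induction p using Nat.strong_induction_on generalizing D A C Λ G R with
  | _ p ih =>
    rcases H.dichotomy hreg hpolar with hz | ⟨a, b, k, β, hE, hle⟩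
    · suffices hz0 : ∀ᶠ t in 𝓝 (0 : ℝ), ∀ i < p, R i (0, (0, t)) = 0 from
        ⟨hz0, H.equisingularOn_of_eq_zero hz hz0⟩
      have hc := (Finset.eventually_all (Finset.range p)).2 fun i _ =>
        eventually_zero_prodMk (eventually_tendsto_of_analyticAt (H.taylor.analyticAt i))
      filter_upwards [hz, hc] with t h1 h2 i hi
      have h3 := (h2 i (Finset.mem_range.2 hi)).comp (tendsto_const_nhds.prodMk
        (tendsto_id (x := 𝓝[>] (0 : ℝ))) : Tendsto (fun σ : ℝ => ((0 : ℝ), σ)) _ _)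
      refine tendsto_nhds_unique h3 (tendsto_const_nhds.congr' ?_)
      filter_upwards [h1 i hi] with σ h4 using h4.symm
    · refine ⟨(H.eventually_edgeForm hE).mono fun t h => h.2.2,
        H.equisingularOn_of_edge hE fun u hu => ?_⟩
      obtain ⟨m, φ, G', R', hm, hφ, hφ0, hG', H'⟩ := H.exists_child hE hle hreg hu
      obtain ⟨h1, h2⟩ := ih m hm H'
      refine ⟨φ, hφ, hφ0, ?_, h2, H'.eventually_bound h1⟩
      filter_upwards [H'.taylor.eventually_eq_zero_of_zero H'.p_pos H'.top,
        (continuous_snd.tendsto (0 : ℝ × ℝ)).eventually h1] with q hq h3 h4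
      exact hq h3 ((hG' _ _).trans h4)

end Induction

/-! ### The charts at the origin -/

section Root

variable {F : ℝ × ℝ × ℝ → ℝ}

/-- A germ whose derivatives of order less than `m` vanish is `O (‖·‖ ^ m)`. -/
theorem isBigO_norm_pow {f : ℝ × ℝ → ℝ} (hf : AnalyticAt ℝ f 0) {m : ℕ}
    (hm : ∀ k < m, iteratedFDeriv ℝ k f 0 = 0) : f =O[𝓝 0] fun z => ‖z‖ ^ m := by
  obtain ⟨P, r, hP⟩ := hf
  refine (hP.hasFPowerSeriesAt.isBigO_sub_partialSum_pow m).congr_left fun y => ?_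
  rw [FormalMultilinearSeries.partialSum, sum_eq_zero fun k hk => ?_, zero_add, sub_zero]
  have h1 := hP.factorial_smul y k
  rw [hm k (Finset.mem_range.1 hk)] at h1
  exact (smul_eq_zero.1 h1).resolve_left k.factorial_ne_zero

theorem eventually_regularX (hF : AnalyticAt ℝ F 0) (hF0 : ∀ᶠ t in 𝓝 (0 : ℝ), F (0, 0, t) = 0)
    (hreg : MiniRegular (slice F 0)) : ∀ᶠ t in 𝓝 (0 : ℝ), RegularX (slice F t) := by
  obtain ⟨m, -, hm⟩ := hreg
  obtain ⟨R, hR⟩ := AnalyticAt.exists_isTaylorSeq (E := ℝ × ℝ) (x₀ := 0) hF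
  have h1 := hR.iteratedDeriv_eq m
  have h2 : R m (0, 0) ≠ 0 := fun h => hm (h1.self_of_nhds.trans (by rw [h, mul_zero]))
  have han : ∀ᶠ t in 𝓝 (0 : ℝ), AnalyticAt ℝ F (0, 0, t) :=
    ((show Continuous fun t : ℝ => ((0 : ℝ), (0 : ℝ), t) by fun_prop).tendsto' 0 0 rfl).eventually
      hF.eventually_analyticAt
  filter_upwards [hF0, han, eventually_zero_prodMk h1,
    eventually_zero_prodMk (Chart.eventually_ne_of_analyticAt (hR.analyticAt m) h2)] with t h3 h4 h5 h6
  refine ⟨AnalyticAt.fun_comp (g := F) (f := fun p : ℝ × ℝ => (p.1, p.2, t)) h4 (by fun_prop), h3, m,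
    ?_⟩
  rw [show (fun x => slice F t (x, 0)) = fun v => F (v, (0, t)) from rfl, h5]
  exact mul_ne_zero (by positivity) h6

/-- The coordinates at the origin, with the coefficient below the top one removed, are a chart. -/
theorem exists_chart (hF : AnalyticAt ℝ F 0) (hF0 : ∀ᶠ t in 𝓝 (0 : ℝ), F (0, 0, t) = 0)
    (hreg : MiniRegular (slice F 0)) (s : ℤˣ) : ∃ p Λ G R, Chart F s 1 0 0 p Λ G R := by
  obtain ⟨m, hm, hmne⟩ := hreg
  set G : ℝ × (ℝ × ℝ) → ℝ := fun z => F (z.1, ((s : ℤ) : ℝ) * z.2.1, z.2.2) with hGdef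
  have hG : AnalyticAt ℝ G ((0 : ℝ), (0 : ℝ × ℝ)) := by
    refine AnalyticAt.fun_comp (g := F) (f := fun z : ℝ × (ℝ × ℝ) =>
      (z.1, ((s : ℤ) : ℝ) * z.2.1, z.2.2)) ?_ (by fun_prop)
    rwa [show ((0 : ℝ), ((s : ℤ) : ℝ) * (0 : ℝ × ℝ).1, (0 : ℝ × ℝ).2) = 0 by simp]
  obtain ⟨R, hR⟩ := hG.exists_isTaylorSeq
  have hcoef : ∀ i, iteratedDeriv i (fun x => slice F 0 (x, 0)) 0 = i.factorial * R i (0, 0) := by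
    intro i
    refine Eq.trans ?_ (hR.iteratedDeriv_eq i).self_of_nhds
    simp [hGdef, slice]
  classical
  have hex : ∃ i, R i (0, 0) ≠ 0 := ⟨m, fun h => hmne (by rw [hcoef, h, mul_zero])⟩
  set p := Nat.find hex
  have hpm : p ≤ m := Nat.find_min' hex fun h => hmne (by rw [hcoef, h, mul_zero])
  have hp0 : 0 < p := by
    refine (Nat.find_pos hex).2 (not_not.2 ?_)
    rw [hR.zero]
    simpa [hGdef] using hF0.self_of_nhds
  obtain ⟨φ, hφ, hφ0, R', hR', hlow, htop, hnorm⟩ := hR.exists_normalize hp0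
    (fun i hi => not_not.1 (Nat.find_min hex hi)) (Nat.find_spec hex)
  have hφt : ∀ᶠ t in 𝓝 (0 : ℝ), Tendsto (fun σ => φ (σ, t)) (𝓝[>] 0) (𝓝 (φ (0, t))) := by
    filter_upwards [eventually_zero_prodMk hφ.eventually_analyticAt] with t ht
    exact (analyticAt_slice ht).continuousAt.tendsto.within
  have hφc : Tendsto (fun t : ℝ => -φ (0, t)) (𝓝 0) (𝓝 0) := by
    have := (hφ.continuousAt.tendsto.comp
      (tendsto_zero_prodMk (ω := fun _ => 0) tendsto_const_nhds)).neg
    rwa [hφ0, neg_zero] at this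
  have hlin : ∀ {ψ : ℝ → ℝ}, AnalyticAt ℝ ψ 0 → ψ 0 = 0 → ψ =O[𝓝[>] 0] fun σ => σ := by
    intro ψ h1 h2
    have := h1.differentiableAt.isBigO_sub
    simp only [h2, sub_zero] at this
    exact this.mono nhdsWithin_le_nhds
  refine ⟨p, φ, _, R', one_pos, hp0, hφ, hR', ?_, hlow, htop, hnorm, ?_, ?_, ?_⟩
  · exact Eventually.of_forall fun z => by simp [hGdef, add_comm]
  · -- the common zero at the origin forces the centre through the origin
    filter_upwards [(tendsto_zero_prodMk hφc).eventually (hR'.eventually_eq_zero_of_zero hp0 htop),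
      hF0, eventually_zero_prodMk hφ.eventually_analyticAt] with t h1 h2 h3 h4
    have h5 := h1 h4 (by simpa [hGdef] using h2)
    simpa using hlin (analyticAt_slice h3) (neg_eq_zero.1 h5)
  · have hline : ∀ k : ℕ, Tendsto (fun σ : ℝ => (k * σ ^ (1 : ℝ), (σ, (0 : ℝ)))) (𝓝[>] 0)
        (𝓝 ((0 : ℝ), (0 : ℝ × ℝ))) := fun k => by
      simp only [rpow_one]
      exact ((show Continuous fun σ : ℝ => (k * σ, (σ, (0 : ℝ))) by fun_prop).tendsto' 0 _
        (by simp)).within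
    have hf0 := isBigO_norm_pow (f := slice F 0) (AnalyticAt.fun_comp (g := F)
      (f := fun z : ℝ × ℝ => (z.1, z.2, (0 : ℝ))) hF (by fun_prop)) hm
    have hpt : ∀ k : ℕ, (fun σ : ℝ => (k * σ + φ (σ, 0), ((s : ℤ) : ℝ) * σ)) =O[𝓝[>] 0]
        fun σ : ℝ => σ := fun k =>
      (((isBigO_refl _ _).const_mul_left _).add (hlin (analyticAt_slice hφ) hφ0)).prod_left
        ((isBigO_refl _ _).const_mul_left _)
    have hval : ∀ k : ℕ, (fun σ : ℝ => G (k * σ ^ (1 : ℝ) + φ (σ, 0), (σ, 0))) =O[𝓝[>] 0]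
        fun σ => σ ^ ((p : ℝ) * 1) := fun k => by
      have h1 := (hf0.comp_tendsto ((hpt k).trans_tendsto
        (tendsto_id.of_within))).trans ((hpt k).norm_left.pow m)
      have h2 := isBigO_rpow_rpow (κ := (m : ℝ)) (κ' := (p : ℝ) * 1) (by simpa using hpm)
      simp only [rpow_natCast] at h2
      simp only [rpow_one]
      exact h1.trans h2
    intro i hi
    simpa using isBigO_coeff_of_values (b := fun i σ => R' i (0, (σ, 0)))
      (fun k => (hline k).eventually (hR'.expand p))
      (fun k => ((hR'.analyticAt p).continuousAt.tendsto.comp (hline k)).isBigO_one ℝ) hval i hi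
  · intro δ hδ Γ hΓ hin _
    refine ⟨_, hφc, ?_⟩
    filter_upwards [hφt] with t ht
    have := (Γ t).X_tendsto.sub ht
    rw [zero_sub] at this
    refine this.congr fun σ => ?_
    simp [chartCoord]

end Root

/-! ### Heights, bars and contact orders along the deformation -/

section Deformation

variable {F : ℝ × ℝ × ℝ → ℝ} {δ : ℝ}

/-- Over `|t| < δ`, the deformation is equisingular in a chart that contains all arcs of the half
plane of sign `s`. -/
abbrev EquisingularAll (F : ℝ × ℝ × ℝ → ℝ) (δ : ℝ) (s : ℤˣ) : Prop :=
  ∃ Λ, EquisingularOn F s 1 0 Λ δ ∧ ∀ t ∈ Ioo (-δ) δ, ∀ γ : RArc, γ.sgn = s →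
    InChart s 1 0 (Λ ⟨·, t⟩) γ

theorem eventually_equisingular (hF : AnalyticAt ℝ F 0) (hF0 : ∀ᶠ t in 𝓝 (0 : ℝ), F (0, 0, t) = 0)
    (hreg : MiniRegular (slice F 0))
    (hpolar : ∀ γ : RArc, IsPolar (slice F 0) γ → HasStableBarDeformation F γ) (s : ℤˣ) :
    ∀ᶠ δ in 𝓝[>] (0 : ℝ), EquisingularAll F δ s := by
  obtain ⟨p, Λ, G, R, H⟩ := exists_chart hF hF0 hreg s
  obtain ⟨h1, h2⟩ := H.equisingularOn (eventually_regularX hF hF0 hreg) hpolar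
  filter_upwards [h2, eventually_forall_Ioo (H.eventually_bound h1)] with δ h3 h4
  refine ⟨Λ, h3, fun t ht γ hs => ⟨hs, ?_⟩⟩
  have h5 : Tendsto (Λ ⟨·, t⟩) (𝓝[>] 0) (𝓝 0) := (h4 t ht).2.trans_tendsto
      (tendsto_rpow_nhds_zero (by simp))
  have h6 := γ.X_tendsto.sub h5
  rw [sub_zero] at h6
  exact h6.congr fun σ => by simp [chartCoord]

/-- The relative Newton polygon determines the height. -/
theorem fHeight_eq_of_relNewtonPolygon_eq {f f' : ℝ × ℝ → ℝ} (hf : RegularX f) (hf' : RegularX f')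
    {γ γ' : RArc} (h : relNewtonPolygon f γ = relNewtonPolygon f' γ') :
    fHeight f γ = fHeight f' γ' := by
  rw [relNewtonPolygon_eq_iff hf hf'] at h
  refine ENNReal.eq_of_forall_one_lt (hf.one_le_fHeight γ) (hf'.one_le_fHeight γ') fun x hx => ?_
  rw [hf.le_fHeight_iff hx, hf'.le_fHeight_iff hx]
  refine forall₂_congr fun k hk => imp_congr_right fun _ => not_congr ?_
  refine forall₂_congr fun k' hk' => forall_congr' fun e => ?_
  rw [h k hk, h k' (hk.trans_le hk')]

theorem contact_eq_top_of_X_eq {γ μ : RArc} (hs : γ.sgn = μ.sgn)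
    (h : ∀ᶠ y in 𝓝[>] (0 : ℝ), γ.X y = μ.X y) : γ.contact μ = ⊤ :=
  eq_top_iff.2 <| ENNReal.le_of_forall_one_lt (γ.one_le_contact μ) fun _ _ _ =>
    (RArc.le_contact_iff hs).2 <|
      EventuallyEq.trans_isBigO (h.mono fun _ => sub_eq_zero_of_eq) (isBigO_zero _ _)

theorem mem_fArc_of_contact_eq_top {f : ℝ × ℝ → ℝ} (hf : RegularX f) {γ μ : RArc}
    (h : γ.contact μ = ⊤) : μ ∈ fArc f γ := by
  have h1 := fHeight_ultra hf.one_le_fHeight γ μ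
  have h2 := fHeight_ultra hf.one_le_fHeight μ γ
  rw [h, min_eq_left le_top] at h1
  rw [RArc.contact_comm, h, min_eq_left le_top] at h2
  exact ⟨le_antisymm h1 h2, Or.inr h⟩

theorem KeepsPolygon.fHeight_eq (hR : ∀ t ∈ Ioo (-δ) δ, RegularX (slice F t)) {δ' : ℝ} (hδ' : δ' ≤ δ)
    {γ : RArc} {Γ : ℝ → RArc} (h : KeepsPolygon F δ' γ Γ) : ∀ t ∈ Ioo (-δ') δ',
      fHeight (slice F t) (Γ t) = fHeight (slice F 0) γ := fun t ht =>
  fHeight_eq_of_relNewtonPolygon_eq (hR t ⟨(neg_le_neg hδ').trans_lt ht.1, ht.2.trans_le hδ'⟩)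
    (hR 0 ⟨by linarith [ht.1, ht.2], by linarith [ht.1, ht.2]⟩) (h t ht)

/-- The contact order of two deformed arcs is constant, as far as it is below their heights. -/
theorem ofReal_le_contact_iff (hR : ∀ t ∈ Ioo (-δ) δ, RegularX (slice F t))
    (hE : ∀ s : ℤˣ, EquisingularAll F δ s) {δ' : ℝ} (hδ' : δ' ≤ δ) {γ γ' : RArc} {Γ Γ' : ℝ → RArc}
    (hΓ : IsContFamily δ' Γ) (hΓ' : IsContFamily δ' Γ') (hK : KeepsPolygon F δ' γ Γ) (hK' : KeepsPolygon F δ' γ' Γ') {x : ℝ}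
    (hx : 1 < x) (hγ : ENNReal.ofReal x ≤ fHeight (slice F 0) γ)
    (hγ' : ENNReal.ofReal x ≤ fHeight (slice F 0) γ') {t : ℝ} (ht : t ∈ Ioo (-δ') δ') :
    ENNReal.ofReal x ≤ (Γ t).contact (Γ' t) ↔ ENNReal.ofReal x ≤ (Γ 0).contact (Γ' 0) := by
  have h0 : (0 : ℝ) ∈ Ioo (-δ') δ' := ⟨by linarith [ht.1, ht.2], by linarith [ht.1, ht.2]⟩
  have hsub : Ioo (-δ') δ' ⊆ Ioo (-δ) δ := Ioo_subset_Ioo (neg_le_neg hδ') hδ'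
  by_cases hs : (Γ 0).sgn = (Γ' 0).sgn
  swap
  · have hst : (Γ t).sgn ≠ (Γ' t).sgn := by rwa [(hΓ.1 t ht).1, (hΓ'.1 t ht).1]
    rw [RArc.contact_of_sgn_ne hs, RArc.contact_of_sgn_ne hst]
  obtain ⟨Λ, hΛ, hin⟩ := hE (Γ 0).sgn
  have hst : ∀ t ∈ Ioo (-δ') δ', (Γ t).sgn = (Γ' t).sgn := fun t ht => by
    rw [(hΓ.1 t ht).1, (hΓ'.1 t ht).1, hs]
  rw [RArc.le_contact_iff (hst t ht), RArc.le_contact_iff hs]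
  have hge : ∀ (γ : RArc) (Γ : ℝ → RArc), KeepsPolygon F δ' γ Γ →
      ENNReal.ofReal x ≤ fHeight (slice F 0) γ → ∀ t ∈ Ioo (-δ') δ',
        HeightGE (slice F t) (Γ t) x := fun γ Γ h1 h2 t ht =>
    ((hR t (hsub ht)).le_fHeight_iff hx).1 (h2.trans_eq (h1.fHeight_eq hR hδ' t ht).symm)
  rcases hΛ.contact x δ' hδ' Γ Γ' hΓ hΓ'
    (fun t ht => ⟨hin t (hsub ht) _ (hΓ.1 t ht).1, hge γ Γ hK hγ t ht⟩)
    (fun t ht => ⟨hin t (hsub ht) _ ((hΓ'.1 t ht).1.trans hs.symm), hge γ' Γ' hK' hγ' t ht⟩) with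
    h | h
  · exact ⟨fun _ => h 0 h0, fun _ => h t ht⟩
  · exact ⟨fun h1 => absurd h1 (h t ht), fun h1 => absurd h1 (h 0 h0)⟩

/-- The bars of two deformed arcs agree for one `t` if and only if they agree at `t = 0`. -/
theorem mem_bar_deformation_iff (hR : ∀ t ∈ Ioo (-δ) δ, RegularX (slice F t))
    (hE : ∀ s : ℤˣ, EquisingularAll F δ s) {δ' : ℝ} (hδ' : δ' ≤ δ) {γ γ' : RArc} {Γ Γ' : ℝ → RArc}
    (hΓ : IsContFamily δ' Γ) (hΓ' : IsContFamily δ' Γ') (hK : KeepsPolygon F δ' γ Γ) (hK' : KeepsPolygon F δ' γ' Γ')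
    {t : ℝ} (ht : t ∈ Ioo (-δ') δ') :
    Γ' t ∈ bar (slice F t) (Γ t) ↔ Γ' 0 ∈ bar (slice F 0) (Γ 0) := by
  have h0 : (0 : ℝ) ∈ Ioo (-δ') δ' := ⟨by linarith [ht.1, ht.2], by linarith [ht.1, ht.2]⟩
  rw [mem_bar_iff, mem_bar_iff, (hΓ.1 t ht).1, (hΓ'.1 t ht).1, hK.fHeight_eq hR hδ' t ht,
    hK'.fHeight_eq hR hδ' t ht, hK.fHeight_eq hR hδ' 0 h0, hK'.fHeight_eq hR hδ' 0 h0]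
  refine and_congr_right fun _ => and_congr_right fun hh => ?_
  have key : ∀ x : ℝ, 1 < x → ENNReal.ofReal x ≤ fHeight (slice F 0) γ →
      (ENNReal.ofReal x ≤ (Γ t).contact (Γ' t) ↔ ENNReal.ofReal x ≤ (Γ 0).contact (Γ' 0)) :=
    fun x hx h1 => ofReal_le_contact_iff hR hE hδ' hΓ hΓ' hK hK' hx h1 (hh ▸ h1) ht
  exact ⟨fun h => ENNReal.le_of_forall_one_lt (RArc.one_le_contact _ _) fun x hx h1 =>
      (key x hx h1).1 (h1.trans h),
    fun h => ENNReal.le_of_forall_one_lt (RArc.one_le_contact _ _) fun x hx h1 =>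
      (key x hx h1).2 (h1.trans h)⟩

theorem IsAnalyticFamily.truncate {Γ : ℝ → RArc} (h : IsAnalyticFamily δ Γ) (H : ℝ → ℝ≥0∞)
    {H₀ : ℝ≥0∞} (hH : ∀ t ∈ Ioo (-δ) δ, H t = H₀) :
    IsAnalyticFamily δ fun t => (Γ t).truncate (H t) := by
  refine ⟨h.1, fun j => ?_⟩
  refine AnalyticOnNhd.congr isOpen_Ioo (f := fun t =>
    if ENNReal.ofReal ((j : ℝ) / (Γ 0).d) < H₀ then (Γ t).coeff j else 0) ?_ fun t ht => ?_
  · split_ifs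
    exacts [h.2 j, analyticOnNhd_const]
  · simp only [RArc.truncate, (h.1 t ht).2, hH t ht]

end Deformation

end

theorem mainTheorem5 (F : ℝ × ℝ × ℝ → ℝ) (hF : AnalyticAt ℝ F 0)
    (hF0 : ∀ᶠ t in 𝓝 (0 : ℝ), F (0, 0, t) = 0)
    (hreg : MiniRegular (slice F 0))
    (hpolar : ∀ γ : RArc, IsPolar (slice F 0) γ → HasStableBarDeformation F γ) :
    ∃ δ > (0 : ℝ),
      -- existence of an analytic deformation with constant relative Newton polygon
      (∀ γ : RArc, ∃ Γ : ℝ → RArc, IsAnalyticDeformation F δ γ Γ ∧ KeepsPolygon F δ γ Γ) ∧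
      -- the canonical representations of the bars are deformed analytically, and the deformations
      -- of the bar and of its canonical representation are unique
      (∀ (γ : RArc) (Γ : ℝ → RArc), IsAnalyticDeformation F δ γ Γ → KeepsPolygon F δ γ Γ →
        (IsAnalyticFamily δ (fun t => canonicalRep (slice F t) (Γ t)) ∧
          (canonicalRep (slice F 0) (Γ 0)).SameSeries (canonicalRep (slice F 0) γ)) ∧
        ∀ η ∈ bar (slice F 0) γ, ∀ δ' : ℝ, 0 < δ' → δ' ≤ δ → ∀ H : ℝ → RArc,
          IsContDeformation F δ' η H → KeepsPolygon F δ' γ H →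
          ∀ t ∈ Ioo (-δ') δ', bar (slice F t) (H t) = bar (slice F t) (Γ t) ∧
            (canonicalRep (slice F t) (H t)).SameSeries (canonicalRep (slice F t) (Γ t))) ∧
      -- contact orders of deformed bars are constant
      (∀ (γ γ' : RArc) (Γ Γ' : ℝ → RArc),
        IsAnalyticDeformation F δ γ Γ → KeepsPolygon F δ γ Γ →
        IsAnalyticDeformation F δ γ' Γ' → KeepsPolygon F δ γ' Γ' →
        ∀ t ∈ Ioo (-δ) δ,
          barContact (bar (slice F t) (Γ t)) (bar (slice F t) (Γ' t)) =
            barContact (bar (slice F 0) γ) (bar (slice F 0) γ')) := by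
  have hE := fun s => eventually_equisingular hF hF0 hreg hpolar s
  obtain ⟨δ, ⟨⟨hE₁, hE₂⟩, hR⟩, hδ⟩ := (((hE 1).and (hE (-1))).and
    (eventually_forall_Ioo (eventually_regularX hF hF0 hreg)) |>.and
      (self_mem_nhdsWithin (s := Ioi (0 : ℝ)))).exists
  have hE : ∀ s : ℤˣ, EquisingularAll F δ s := fun s => by
    rcases Int.units_eq_one_or s with rfl | rfl
    exacts [hE₁, hE₂]
  have h0 : (0 : ℝ) ∈ Ioo (-δ) δ := ⟨neg_neg_of_pos hδ, hδ⟩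
  have hone := (hR 0 h0).one_le_fHeight
  refine ⟨δ, hδ, fun γ => ?_, fun γ Γ hΓ hK => ⟨⟨?_, ?_⟩, fun η hη δ' hδ₀ hδ' H hH hKH t ht => ?_⟩,
    fun γ γ' Γ Γ' hΓ hK hΓ' hK' t ht => ?_⟩
  · obtain ⟨Λ, hΛ, hin⟩ := hE γ.sgn
    obtain ⟨Γ, hΓ, hΓ0, hΓt⟩ := hΛ.exists_family γ (hin 0 h0 γ rfl)
    have hs : (Γ 0).sgn = γ.sgn := (hΓt 0 h0).1.1
    have hO : ∀ h : ℝ, (fun y => (Γ 0).X y - γ.X y) =O[𝓝[>] 0] fun y => y ^ h := fun h =>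
      EventuallyEq.trans_isBigO (hΓ0.mono fun _ => sub_eq_zero_of_eq) (Asymptotics.isBigO_zero _ _)
    refine ⟨Γ, ⟨hΓ, mem_fArc_of_contact_eq_top (hR 0 h0)
      (contact_eq_top_of_X_eq hs.symm (hΓ0.mono fun _ => Eq.symm))⟩, fun t ht => ?_⟩
    refine (relNewtonPolygon_eq_iff (hR t ht) (hR 0 h0) _ _).2 fun h hh e => ?_
    refine ((hΓt t ht).2 h (by simpa using hh) e).trans ⟨fun h1 => h1.congr_arc hs (hO h),
      fun h1 => h1.congr_arc hs.symm ?_⟩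
    exact ((hO h).neg_left).congr_left fun y => neg_sub _ _
  · exact hΓ.1.truncate _ (hK.fHeight_eq hR le_rfl)
  · exact sameSeries_canonicalRep (mem_bar_of_mem_fArc hone hΓ.2)
  · have hsub : Ioo (-δ') δ' ⊆ Ioo (-δ) δ := Ioo_subset_Ioo (neg_le_neg hδ') hδ'
    have h1 : H 0 ∈ bar (slice F 0) (Γ 0) := bar_trans (bar_symm (mem_bar_of_mem_fArc hone hΓ.2))
      (bar_trans hη (mem_bar_of_mem_fArc hone hH.2))
    have h2 := (mem_bar_deformation_iff hR hE hδ' (hΓ.1.isContFamily.mono hδ') hH.1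
      (fun t ht => hK t (hsub ht)) hKH ht).2 h1
    exact ⟨bar_eq_of_mem h2, sameSeries_canonicalRep h2⟩
  · rw [← bar_eq_of_mem (mem_bar_of_mem_fArc hone hΓ.2), ← bar_eq_of_mem (mem_bar_of_mem_fArc hone hΓ'.2)]
    have hiff := mem_bar_deformation_iff hR hE le_rfl hΓ.1.isContFamily hΓ'.1.isContFamily hK hK' ht
    by_cases hmem : Γ' 0 ∈ bar (slice F 0) (Γ 0)
    · rw [bar_eq_of_mem hmem, bar_eq_of_mem (hiff.2 hmem), barContact, barContact, if_pos rfl,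
        if_pos rfl]
    have hmem' := fun h => hmem (hiff.1 h)
    rw [barContact_of_notMem hone hmem, barContact_of_notMem (hR t ht).one_le_fHeight hmem']
    have hle := contact_le_of_notMem_bar hone hmem
    have hle' := contact_le_of_notMem_bar (hR t ht).one_le_fHeight hmem'
    rw [hK.fHeight_eq hR le_rfl 0 h0, hK'.fHeight_eq hR le_rfl 0 h0] at hle
    rw [hK.fHeight_eq hR le_rfl t ht, hK'.fHeight_eq hR le_rfl t ht] at hle'
    have key := fun x hx h1 => ofReal_le_contact_iff hR hE le_rfl hΓ.1.isContFamily
      hΓ'.1.isContFamily hK hK' (x := x) hx (le_min_iff.1 h1).1 (le_min_iff.1 h1).2 ht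
    exact ENNReal.eq_of_forall_one_lt (RArc.one_le_contact _ _) (RArc.one_le_contact _ _) fun x hx =>
      ⟨fun h => (key x hx (h.trans hle')).1 h, fun h => (key x hx (h.trans hle)).2 h⟩
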